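/- **Setting.** Let $d\ge 1$, $1<p<\infty$, and let $\Omega\subset\mathbb R^d$ be open, bounded, connected and nonempty with Lipschitz boundary; $\Omega^c=\mathbb R^d\setminus\Omega$. Put $K_{d,p}=\frac1{|\mathbb S^{d-1}|}\int_{\mathbb S^{d-1}}|w_d|^p\,d\sigma(w)$ and $\mu=1/K_{d,p}$. Let $\nu_\varepsilon:\mathbb R^d\setminus\{0\}\to[0,\infty)$, $0<\varepsilon<1$, be measurable radial kernels with $$\int_{\mathbb R^d}(1\wedge|h|^p)\,\nu_\varepsilon(h)\,dh=1,\qquad \lim_{\varepsilon\to0}\int_{|h|>\delta}\nu_\varepsilon(h)\,dh=0\quad\text{for all }\delta>0 .$$ If $d=1$, assume moreover that there are $c_0,\theta_0\in(0,1)$ such that $\int_{\mathbb R}(1\wedge|h|^p)\inf_{\theta_0\le\theta\le1}\nu_\varepsilon(\theta h)\,dh\ge c_0$ for all $\varepsilon\in(0,1)$. **Forms and spaces.** For measurable $S\subset\mathbb R^d\times\mathbb R^d$ let $$\mathcal E^\varepsilon_S(u,v)=\iint_S|u(x)-u(y)|^{p-2}(u(x)-u(y))(v(x)-v(y))\,\nu_\varepsilon(x-y)\,dy\,dx,$$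 and let $\mathcal E^\varepsilon$, $\mathcal E^\varepsilon_\Omega$, $\mathcal E^\varepsilon_{cr}$ be the forms with $S=(\Omega^c\times\Omega^c)^c$, $\Omega\times\Omega$, $\Omega\times\Omega^c$ respectively. Put $\|u\|^p_{W^p_{\nu_\varepsilon}(\Omega)}=\|u\|^p_{L^p(\Omega)}+\mathcal E^\varepsilon_\Omega(u,u)$ and $\|u\|^p_{W^p_{\nu_\varepsilon}(\Omega|\mathbb R^d)}=\|u\|^p_{L^p(\Omega)}+\mathcal E^\varepsilon(u,u)$. The space $W^p_{\nu_\varepsilon}(\Omega|\mathbb R^d)$ consists of the measurable $u:\mathbb R^d\to\mathbb R$ for which the second quantity is finite. The space $T^p_{\nu_\varepsilon}(\Omega^c)$ consists of the restrictions $\mathrm{Tr}\,u=u|_{\Omega^c}$ of such functions, with the quotient seminorm. Let $\gamma_0$ be the trace operator on $W^{1,p}(\Omega)$, and $W^{1-1/p,p}(\partial\Omega)=\gamma_0(W^{1,p}(\Omega))$ with the quotient norm. Put $\mathcal E^0(u,v)=\int_\Omega|\nabla u|^{p-2}\nabla u\cdot\nabla v\,dx$. A prime denotes the space of bounded linear functionals.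 **Data.** Let $f_\varepsilon\in(W^p_{\nu_\varepsilon}(\Omega|\mathbb R^d))'$ and $g_\varepsilon\in(T^p_{\nu_\varepsilon}(\Omega^c))'$, $0<\varepsilon<1$, converge asymptotically weakly to $f\in(W^{1,p}(\Omega))'$ and $g\in(W^{1-1/p,p}(\partial\Omega))'$. This means that $\sup_{0<\varepsilon<1}\|f_\varepsilon\|<\infty$ and $\sup_{0<\varepsilon<1}\|g_\varepsilon\|<\infty$ in the respective dual norms, and that for every $v\in W^{1,p}(\mathbb R^d)$ and every family $v_\varepsilon\in W^p_{\nu_\varepsilon}(\Omega|\mathbb R^d)$ with $\sup_{0<\varepsilon<1}\|v_\varepsilon\|_{W^p_{\nu_\varepsilon}(\Omega|\mathbb R^d)}<\infty$ and $v_\varepsilon|_\Omega\to v|_\Omega$ in $L^p(\Omega)$ as $\varepsilon\to0$, $$\langle f_\varepsilon,v_\varepsilon\rangle\to\langle f,v|_\Omega\rangle,\qquad \langle g_\varepsilon,\mathrm{Tr}\,v_\varepsilon\rangle\to\langle g,\gamma_0(v|_\Omega)\rangle .$$ **Solutions.** Let $w_\varepsilon\in W^p_{\nu_\varepsilon}(\Omega|\mathbb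 R^d)$ be a weak solution of the nonlocal Neumann problem $\mu L_\varepsilon w_\varepsilon=f_\varepsilon$ in $\Omega$, $\mu\mathcal N_\varepsilon w_\varepsilon=g_\varepsilon$ on $\Omega^c$, where $L_\varepsilon u(x)=2\,\mathrm{p.v.}\!\int_{\mathbb R^d}|u(x)-u(y)|^{p-2}(u(x)-u(y))\nu_\varepsilon(x-y)\,dy$ and $\mathcal N_\varepsilon u(x)=2\int_\Omega|u(x)-u(y)|^{p-2}(u(x)-u(y))\nu_\varepsilon(x-y)\,dy$; that is, $$\mu\,\mathcal E^\varepsilon(w_\varepsilon,v)=\langle f_\varepsilon,v\rangle+\langle g_\varepsilon,\mathrm{Tr}\,v\rangle\quad\text{for all }v\in W^p_{\nu_\varepsilon}(\Omega|\mathbb R^d)\text{ with }\int_\Omega v\,dx=0 .$$ Let $w\in W^{1,p}(\Omega)$ be a weak solution of $-\Delta_pw=f$ in $\Omega$, $|\nabla w|^{p-2}\nabla w\cdot n=g$ on $\partial\Omega$; that is, $\mathcal E^0(w,v)=\langle f,v\rangle+\langle g,\gamma_0v\rangle$ for all $v\in W^{1,p}(\Omega)$ with $\int_\Omega v\,dx=0$.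 (In particular, solutions that satisfy these identities for all $v$ in the respective space are covered.) **Theorem.** Put $u_\varepsilon=w_\varepsilon-\frac1{|\Omega|}\int_\Omega w_\varepsilon\,dx$ and $u=w-\frac1{|\Omega|}\int_\Omega w\,dx$. Then, for every $\overline u\in W^{1,p}(\mathbb R^d)$ with $\overline u=u$ a.e. on $\Omega$, $$\lim_{\varepsilon\to0}\|u_\varepsilon-u\|_{W^p_{\nu_\varepsilon}(\Omega)}=\lim_{\varepsilon\to0}\|u_\varepsilon-\overline u\|_{W^p_{\nu_\varepsilon}(\Omega|\mathbb R^d)}=\lim_{\varepsilon\to0}\mathcal E^\varepsilon_{cr}(u_\varepsilon,u_\varepsilon)=0 .$$ The first and the third limit do not involve $\overline u$. -/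

import Mathlib

open MeasureTheory Set Filter Topology
open scoped ContDiff ENNReal

noncomputable section

namespace NonlocalNeumann

/-- The Euclidean space `ℝᵈ`. -/
abbrev E (d : ℕ) : Type := EuclideanSpace ℝ (Fin d)

/-! ### Domains -/

/-- `Ω` has a Lipschitz boundary: near each boundary point there are a unit vector `e` and a
Lipschitz function `γ` of the component orthogonal to `e` such that `Ω` is locally the set of points
lying above the graph of `γ` in direction `e`. -/
def HasLipschitzBoundary {d : ℕ} (Ω : Set (E d)) : Prop :=
  ∀ x ∈ frontier Ω, ∃ r : ℝ, 0 < r ∧ ∃ e : E d, ‖e‖ = 1 ∧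
    ∃ (γ : E d → ℝ) (L : NNReal), LipschitzWith L γ ∧
      ∀ y ∈ Metric.ball x r, (y ∈ Ω ↔ γ (y - inner ℝ y e • e) < inner ℝ y e)

/-! ### Kernels -/

/-- A radial `p`-Lévy kernel on `ℝᵈ`; its value at the origin plays no role. -/
structure RadialLevyKernel (d : ℕ) (p : ℝ) where
  toFun : E d → ℝ
  measurable_toFun : Measurable toFun
  nonneg : ∀ h, 0 ≤ toFun h
  radial : ∀ h k : E d, ‖h‖ = ‖k‖ → toFun h = toFun k
  integrable : Integrable (fun h => min 1 (‖h‖ ^ p) * toFun h)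

instance {d : ℕ} {p : ℝ} : CoeFun (RadialLevyKernel d p) (fun _ => E d → ℝ) :=
  ⟨RadialLevyKernel.toFun⟩

/-- `(ν ε)`, `0 < ε < 1`, is a `p`-Lévy approximation of the unity. -/
def IsLevyApproxUnity {d : ℕ} {p : ℝ} (ν : ℝ → RadialLevyKernel d p) : Prop :=
  (∀ ε ∈ Ioo (0 : ℝ) 1, ∫ h, min 1 (‖h‖ ^ p) * ν ε h = 1) ∧
  ∀ δ : ℝ, 0 < δ → Tendsto (fun ε => ∫ h in {h : E d | δ < ‖h‖}, ν ε h) (𝓝[>] 0) (𝓝 0)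

/-- The additional condition on the kernels that is imposed in dimension one. -/
def OneDimCondition {d : ℕ} {p : ℝ} (ν : ℝ → RadialLevyKernel d p) : Prop :=
  ∃ c₀ ∈ Ioo (0 : ℝ) 1, ∃ θ₀ ∈ Ioo (0 : ℝ) 1, ∀ ε ∈ Ioo (0 : ℝ) 1,
    ENNReal.ofReal c₀ ≤
      ∫⁻ h, ENNReal.ofReal (min 1 (‖h‖ ^ p)) * ⨅ θ ∈ Icc θ₀ 1, ENNReal.ofReal (ν ε (θ • h))

/-- `K_{d,p}`: the average of `|w₁|ᵖ` over the unit sphere (by symmetry the choice of the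
coordinate is irrelevant). -/
def K (d : ℕ) [NeZero d] (p : ℝ) : ℝ :=
  ⨍ w : Metric.sphere (0 : E d) 1, |(w : E d) 0| ^ p ∂((volume : Measure (E d)).toSphere)

/-! ### Nonlocal forms and spaces -/

/-- `(Ωᶜ × Ωᶜ)ᶜ`. -/
def hullRegion {d : ℕ} (Ω : Set (E d)) : Set (E d × E d) := (Ωᶜ ×ˢ Ωᶜ)ᶜ

/-- `∬_S |u(x) - u(y)|ᵖ ν(x - y) dy dx` as an element of `[0, ∞]`. -/
def energy {d : ℕ} {p : ℝ} (S : Set (E d × E d)) (ν : RadialLevyKernel d p) (u : E d → ℝ) : ℝ≥0∞ :=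
  ∫⁻ z in S, ENNReal.ofReal (|u z.1 - u z.2| ^ p * ν (z.1 - z.2))

/-- `∬_S |u(x) - u(y)|ᵖ⁻² (u(x) - u(y)) (v(x) - v(y)) ν(x - y) dy dx`. -/
def form {d : ℕ} {p : ℝ} (S : Set (E d × E d)) (ν : RadialLevyKernel d p) (u v : E d → ℝ) : ℝ :=
  ∫ z in S, |u z.1 - u z.2| ^ (p - 2) * (u z.1 - u z.2) * (v z.1 - v z.2) * ν (z.1 - z.2)

/-- `(‖u‖ᵖ_{Lᵖ(Ω)} + ∬_S |u(x) - u(y)|ᵖ ν(x - y) dy dx)^{1/p}` as an element of `[0, ∞]`. -/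
def nlNorm {d : ℕ} {p : ℝ} (Ω : Set (E d)) (S : Set (E d × E d)) (ν : RadialLevyKernel d p)
    (u : E d → ℝ) : ℝ≥0∞ :=
  ((∫⁻ x in Ω, ENNReal.ofReal (|u x| ^ p)) + energy S ν u) ^ (1 / p)

/-- The norm of `W^p_ν(Ω)`. -/
def regionalNorm {d : ℕ} {p : ℝ} (Ω : Set (E d)) (ν : RadialLevyKernel d p) (u : E d → ℝ) : ℝ≥0∞ :=
  nlNorm Ω (Ω ×ˢ Ω) ν u

/-- The (semi)norm of `W^p_ν(Ω|ℝᵈ)`. -/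
def hullNorm {d : ℕ} {p : ℝ} (Ω : Set (E d)) (ν : RadialLevyKernel d p) (u : E d → ℝ) : ℝ≥0∞ :=
  nlNorm Ω (hullRegion Ω) ν u

/-- The boundary crossing energy `ℰ_cr(u, u)`. -/
def crossEnergy {d : ℕ} {p : ℝ} (Ω : Set (E d)) (ν : RadialLevyKernel d p) (u : E d → ℝ) : ℝ≥0∞ :=
  energy (Ω ×ˢ Ωᶜ) ν u

theorem energy_add_lt_top {d : ℕ} {p : ℝ} (hp : 1 < p) (S : Set (E d × E d))
    (ν : RadialLevyKernel d p) {u v : E d → ℝ} (hum : AEMeasurable u)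
    (hu : energy S ν u < ⊤) (hv : energy S ν v < ⊤) :
    energy S ν (u + v) < ⊤ := by
  have hp0 : 0 ≤ p := by linarith
  have key : ∀ z : E d × E d,
      ENNReal.ofReal (|(u + v) z.1 - (u + v) z.2| ^ p * ν (z.1 - z.2)) ≤
        ENNReal.ofReal (2 ^ (p - 1)) *
          (ENNReal.ofReal (|u z.1 - u z.2| ^ p * ν (z.1 - z.2)) +
            ENNReal.ofReal (|v z.1 - v z.2| ^ p * ν (z.1 - z.2))) := by
    intro z
    have hν := ν.nonneg (z.1 - z.2)
    rw [← ENNReal.ofReal_add (by positivity) (by positivity), ← ENNReal.ofReal_mul (by positivity)]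
    apply ENNReal.ofReal_le_ofReal
    have h1 : |(u + v) z.1 - (u + v) z.2| ≤ |u z.1 - u z.2| + |v z.1 - v z.2| := by
      have : (u + v) z.1 - (u + v) z.2 = (u z.1 - u z.2) + (v z.1 - v z.2) := by
        simp only [Pi.add_apply]; ring
      rw [this]; exact abs_add_le _ _
    have h2 := Real.rpow_le_rpow (abs_nonneg _) h1 hp0
    have h3 : (|u z.1 - u z.2| + |v z.1 - v z.2|) ^ p ≤
        2 ^ (p - 1) * (|u z.1 - u z.2| ^ p + |v z.1 - v z.2| ^ p) :=
      mod_cast NNReal.rpow_add_le_mul_rpow_add_rpow ⟨_, abs_nonneg (u z.1 - u z.2)⟩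
        ⟨_, abs_nonneg (v z.1 - v z.2)⟩ hp.le
    calc _ ≤ (2 ^ (p - 1) * (|u z.1 - u z.2| ^ p + |v z.1 - v z.2| ^ p)) * ν (z.1 - z.2) :=
          mul_le_mul_of_nonneg_right (h2.trans h3) hν
      _ = _ := by ring
  have hmeas : AEMeasurable
      (fun z : E d × E d => ENNReal.ofReal (|u z.1 - u z.2| ^ p * ν (z.1 - z.2)))
      (volume.restrict S) := by
    have h1 : AEMeasurable (fun z : E d × E d => u z.1) volume :=
      hum.comp_quasiMeasurePreserving Measure.quasiMeasurePreserving_fst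
    have h2 : AEMeasurable (fun z : E d × E d => u z.2) volume :=
      hum.comp_quasiMeasurePreserving Measure.quasiMeasurePreserving_snd
    have h3 : Measurable (fun z : E d × E d => ν (z.1 - z.2)) :=
      ν.measurable_toFun.comp (measurable_fst.sub measurable_snd)
    have h4 : AEMeasurable (fun z : E d × E d => |u z.1 - u z.2|) volume := by
      exact (h1.sub h2).norm
    exact (((h4.pow_const p).mul h3.aemeasurable).ennreal_ofReal).restrict
  calc energy S ν (u + v) ≤ ∫⁻ z in S, ENNReal.ofReal (2 ^ (p - 1)) *
          (ENNReal.ofReal (|u z.1 - u z.2| ^ p * ν (z.1 - z.2)) +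
            ENNReal.ofReal (|v z.1 - v z.2| ^ p * ν (z.1 - z.2))) := lintegral_mono key
    _ = ENNReal.ofReal (2 ^ (p - 1)) * (energy S ν u + energy S ν v) := by
        rw [lintegral_const_mul' _ _ ENNReal.ofReal_ne_top, lintegral_add_left' hmeas]; rfl
    _ < ⊤ := ENNReal.mul_lt_top ENNReal.ofReal_lt_top (ENNReal.add_lt_top.2 ⟨hu, hv⟩)

theorem energy_smul {d : ℕ} {p : ℝ} (S : Set (E d × E d))
    (ν : RadialLevyKernel d p) (c : ℝ) (u : E d → ℝ) :
    energy S ν (c • u) = ENNReal.ofReal (|c| ^ p) * energy S ν u := by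
  unfold energy
  rw [← lintegral_const_mul' _ _ ENNReal.ofReal_ne_top]
  congr 1
  ext z
  rw [← ENNReal.ofReal_mul (by positivity)]
  congr 1
  simp only [Pi.smul_apply, smul_eq_mul, ← mul_sub, abs_mul]
  rw [Real.mul_rpow (abs_nonneg _) (abs_nonneg _)]
  ring

/-- `W^p_ν(Ω|ℝᵈ)` for `1 < p < ∞`: measurable functions on `ℝᵈ` that are `Lᵖ` on `Ω` and have finite
energy over `(Ωᶜ × Ωᶜ)ᶜ`. -/
def WHull {d : ℕ} {p : ℝ} (hp : 1 < p) (Ω : Set (E d)) (ν : RadialLevyKernel d p) :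
    Submodule ℝ (E d → ℝ) where
  carrier := {u | AEMeasurable u ∧ MemLp u (ENNReal.ofReal p) (volume.restrict Ω) ∧
    energy (hullRegion Ω) ν u < ⊤}
  zero_mem' := by
    refine ⟨aemeasurable_const, MemLp.zero, ?_⟩
    have hp0 : p ≠ 0 := by linarith
    simp [energy, Real.zero_rpow hp0]
  add_mem' := fun hu hv => ⟨hu.1.add hv.1, hu.2.1.add hv.2.1,
    energy_add_lt_top hp _ ν hu.1 hu.2.2 hv.2.2⟩
  smul_mem' := fun c u hu => ⟨AEMeasurable.const_smul (μ := volume) hu.1 c,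
    hu.2.1.const_smul c, by
    rw [energy_smul]; exact ENNReal.mul_lt_top ENNReal.ofReal_lt_top hu.2.2⟩

/-- Restriction of functions on `ℝᵈ` to `Ωᶜ`. -/
def restrictCompl {d : ℕ} (Ω : Set (E d)) : (E d → ℝ) →ₗ[ℝ] (↥(Ωᶜ) → ℝ) :=
  LinearMap.funLeft ℝ ℝ Subtype.val

/-- The nonlocal trace space `T^p_ν(Ωᶜ)`: restrictions to `Ωᶜ` of the elements of `W^p_ν(Ω|ℝᵈ)`. -/
def TSpace {d : ℕ} {p : ℝ} (hp : 1 < p) (Ω : Set (E d)) (ν : RadialLevyKernel d p) :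
    Submodule ℝ (↥(Ωᶜ) → ℝ) :=
  (WHull hp Ω ν).map (restrictCompl Ω)

/-- The nonlocal trace operator `Tr u = u|_{Ωᶜ}`. -/
def Tr {d : ℕ} {p : ℝ} (hp : 1 < p) (Ω : Set (E d)) (ν : RadialLevyKernel d p) :
    WHull hp Ω ν →ₗ[ℝ] TSpace hp Ω ν :=
  (restrictCompl Ω).submoduleMap (WHull hp Ω ν)

/-- The quotient (semi)norm of `T^p_ν(Ωᶜ)`. -/
def tNorm {d : ℕ} {p : ℝ} (hp : 1 < p) (Ω : Set (E d)) (ν : RadialLevyKernel d p)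
    (v : TSpace hp Ω ν) : ℝ≥0∞ :=
  ⨅ (u : WHull hp Ω ν) (_ : Tr hp Ω ν u = v), hullNorm Ω ν u

/-! ### Sobolev spaces -/

/-- `G` is a weak gradient of `u` on `Ω`. -/
structure IsWeakGrad {d : ℕ} (Ω : Set (E d)) (u : E d → ℝ) (G : E d → E d) : Prop where
  locallyIntegrableOn_fun : LocallyIntegrableOn u Ω
  locallyIntegrableOn_grad : LocallyIntegrableOn G Ω
  integral_eq : ∀ φ : E d → ℝ, ContDiff ℝ ∞ φ → HasCompactSupport φ → tsupport φ ⊆ Ω →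
    ∀ e : E d, ∫ x in Ω, u x * fderiv ℝ φ x e = - ∫ x in Ω, inner ℝ (G x) e * φ x

theorem integrableOn_mul_test {d : ℕ} {Ω : Set (E d)} {u φ : E d → ℝ}
    (hu : LocallyIntegrableOn u Ω) (hφ : Continuous φ)
    (hc : HasCompactSupport φ) (hs : tsupport φ ⊆ Ω) :
    IntegrableOn (fun x => u x * φ x) Ω := by
  have h1 : IntegrableOn (fun x => u x * φ x) (tsupport φ) :=
    (hu.integrableOn_compact_subset hs hc).mul_continuousOn hφ.continuousOn hc
  have h2 : Integrable (fun x => u x * φ x) := by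
    refine (integrableOn_iff_integrable_of_support_subset ?_).1 h1
    intro x hx
    refine subset_tsupport φ ?_
    rw [Function.mem_support] at hx ⊢
    exact fun h => hx (by simp [h])
  exact h2.integrableOn

theorem IsWeakGrad.add {d : ℕ} {Ω : Set (E d)} {u v : E d → ℝ} {G H : E d → E d}
    (hu : IsWeakGrad Ω u G) (hv : IsWeakGrad Ω v H) : IsWeakGrad Ω (u + v) (G + H) := by
  refine ⟨hu.1.add hv.1, hu.2.add hv.2, fun φ hφ hc hs e => ?_⟩
  have hd : Continuous (fun x => fderiv ℝ φ x e) :=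
    (hφ.continuous_fderiv (by simp)).clm_apply continuous_const
  have hdc : HasCompactSupport (fun x => fderiv ℝ φ x e) := hc.fderiv_apply (𝕜 := ℝ) e
  have hds : tsupport (fun x => fderiv ℝ φ x e) ⊆ Ω :=
    (tsupport_fderiv_apply_subset ℝ e).trans hs
  have hG : LocallyIntegrableOn (fun x => inner ℝ (G x) e) Ω := fun x hx => by
    obtain ⟨s, hs, h⟩ := hu.2 x hx
    exact ⟨s, hs, h.inner_const e⟩
  have hH : LocallyIntegrableOn (fun x => inner ℝ (H x) e) Ω := fun x hx => by
    obtain ⟨s, hs, h⟩ := hv.2 x hx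
    exact ⟨s, hs, h.inner_const e⟩
  have e1 := integral_add (integrableOn_mul_test hu.1 hd hdc hds)
    (integrableOn_mul_test hv.1 hd hdc hds)
  have e2 := integral_add (integrableOn_mul_test hG hφ.continuous hc hs)
    (integrableOn_mul_test hH hφ.continuous hc hs)
  simp only [Pi.add_apply, add_mul, inner_add_left]
  rw [e1, e2, hu.3 φ hφ hc hs e, hv.3 φ hφ hc hs e, neg_add]

theorem IsWeakGrad.smul {d : ℕ} {Ω : Set (E d)} {u : E d → ℝ} {G : E d → E d}
    (hu : IsWeakGrad Ω u G) (c : ℝ) : IsWeakGrad Ω (c • u) (c • G) := by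
  refine ⟨hu.1.smul c, hu.2.smul c, fun φ hφ hc hs e => ?_⟩
  simp only [Pi.smul_apply, smul_eq_mul, mul_assoc, real_inner_smul_left, integral_const_mul]
  rw [hu.3 φ hφ hc hs e, mul_neg]

theorem IsWeakGrad.zero {d : ℕ} (Ω : Set (E d)) : IsWeakGrad Ω (0 : E d → ℝ) 0 :=
  ⟨locallyIntegrableOn_zero, locallyIntegrableOn_zero, fun φ _ _ _ e => by simp⟩

theorem IsWeakGrad.of_univ {d : ℕ} {u : E d → ℝ} {G : E d → E d} (Ω : Set (E d))
    (hu : IsWeakGrad univ u G) : IsWeakGrad Ω u G := by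
  refine ⟨hu.1.mono_set (subset_univ _), hu.2.mono_set (subset_univ _), fun φ hφ hc hs e => ?_⟩
  have h := hu.3 φ hφ hc (subset_univ _) e
  rw [setIntegral_univ, setIntegral_univ] at h
  rw [setIntegral_eq_integral_of_forall_compl_eq_zero,
    setIntegral_eq_integral_of_forall_compl_eq_zero, h]
  · intro x hx
    rw [image_eq_zero_of_notMem_tsupport (fun h => hx (hs h)), mul_zero]
  · intro x hx
    rw [image_eq_zero_of_notMem_tsupport
      (fun h => hx (hs (tsupport_fderiv_apply_subset ℝ e h)) : x ∉ tsupport (fderiv ℝ φ · e)),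
      mul_zero]

open Classical in
/-- The weak gradient of `u` on `Ω` (unique up to null sets on an open set `Ω`; it is `0` when there
is no weak gradient). -/
def weakGrad {d : ℕ} (Ω : Set (E d)) (u : E d → ℝ) : E d → E d :=
  if h : ∃ G, IsWeakGrad Ω u G then h.choose else 0

/-- The Sobolev space `W^{1,p}(Ω)`; only the values on `Ω` are relevant. -/
def W1p {d : ℕ} (p : ℝ) (Ω : Set (E d)) : Submodule ℝ (E d → ℝ) where
  carrier := {u | MemLp u (ENNReal.ofReal p) (volume.restrict Ω) ∧
    ∃ G, IsWeakGrad Ω u G ∧ MemLp G (ENNReal.ofReal p) (volume.restrict Ω)}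
  zero_mem' := ⟨MemLp.zero, 0, IsWeakGrad.zero Ω, MemLp.zero⟩
  add_mem' := fun ⟨hu, G, hG, hG2⟩ ⟨hv, H, hH, hH2⟩ =>
    ⟨hu.add hv, G + H, hG.add hH, hG2.add hH2⟩
  smul_mem' := fun c _ ⟨hu, G, hG, hG2⟩ =>
    ⟨hu.const_smul c, c • G, hG.smul c, hG2.const_smul c⟩

/-- Restriction `W^{1,p}(ℝᵈ) → W^{1,p}(Ω)`. -/
def resW1p {d : ℕ} {p : ℝ} (Ω : Set (E d)) (v : W1p p (univ : Set (E d))) : W1p p Ω :=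
  ⟨v, v.2.1.mono_measure (Measure.restrict_mono_set _ (subset_univ _)), by
    obtain ⟨G, hG, hG2⟩ := v.2.2
    exact ⟨G, hG.of_univ Ω, hG2.mono_measure (Measure.restrict_mono_set _ (subset_univ _))⟩⟩

/-- The norm `(‖u‖ᵖ_{Lᵖ(Ω)} + K_{d,p} ‖∇u‖ᵖ_{Lᵖ(Ω)})^{1/p}` of `W^{1,p}(Ω)`. -/
def sobolevNorm {d : ℕ} [NeZero d] (p : ℝ) (Ω : Set (E d)) (u : E d → ℝ) : ℝ≥0∞ :=
  ((∫⁻ x in Ω, ENNReal.ofReal (|u x| ^ p)) +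
    ENNReal.ofReal (K d p) * ∫⁻ x in Ω, ENNReal.ofReal (‖weakGrad Ω u x‖ ^ p)) ^ (1 / p)

/-- `ℰ⁰(u, v) = ∫_Ω |∇u|ᵖ⁻² ∇u · ∇v`. -/
def localForm {d : ℕ} (p : ℝ) (Ω : Set (E d)) (u v : E d → ℝ) : ℝ :=
  ∫ x in Ω, ‖weakGrad Ω u x‖ ^ (p - 2) * inner ℝ (weakGrad Ω u x) (weakGrad Ω v x)

/-! ### Local traces -/

/-- Surface measure on `∂Ω`: the normalized `(d-1)`-dimensional Hausdorff measure. -/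
def surf {d : ℕ} (Ω : Set (E d)) : Measure (E d) :=
  (Measure.euclideanHausdorffMeasure (d - 1)).restrict (frontier Ω)

/-- `t ∈ Lᵖ(∂Ω)` is the trace of `u ∈ W^{1,p}(Ω)`: some `C¹` functions `φ n` converge to `u` in
`W^{1,p}(Ω)`, and their restrictions to `∂Ω` converge to `t` in `Lᵖ(∂Ω)`. -/
def HasTrace {d : ℕ} {p : ℝ} {Ω : Set (E d)} (u : E d → ℝ)
    (t : Lp ℝ (ENNReal.ofReal p) (surf Ω)) : Prop :=
  ∃ G : E d → E d, IsWeakGrad Ω u G ∧ ∃ φ : ℕ → E d → ℝ, (∀ n, ContDiff ℝ 1 (φ n)) ∧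
    Tendsto (fun n => eLpNorm (fun x => φ n x - u x) (ENNReal.ofReal p) (volume.restrict Ω)) atTop (𝓝 0) ∧
    Tendsto (fun n => eLpNorm (fun x => gradient (φ n) x - G x) (ENNReal.ofReal p) (volume.restrict Ω))
      atTop (𝓝 0) ∧
    Tendsto (fun n => eLpNorm (fun x => φ n x - t x) (ENNReal.ofReal p) (surf Ω)) atTop (𝓝 0)

theorem HasTrace.zero {d : ℕ} {p : ℝ} {Ω : Set (E d)} :
    HasTrace (0 : E d → ℝ) (0 : Lp ℝ (ENNReal.ofReal p) (surf Ω)) := by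
  refine ⟨0, IsWeakGrad.zero Ω, fun _ _ => 0, fun _ => contDiff_const, by simp, ?_, ?_⟩
  · have : gradient (fun _ : E d => (0 : ℝ)) = fun _ => 0 := by ext x; simp [gradient]
    simp [this]
  · refine tendsto_const_nhds.congr fun _ => (eLpNorm_eq_zero_of_ae_zero ?_).symm
    filter_upwards [Lp.coeFn_zero ℝ (ENNReal.ofReal p) (surf Ω)] with x hx
    simp only [zero_sub, Pi.zero_apply, neg_eq_zero]
    exact hx

theorem tendsto_eLpNorm_add {α F : Type*} [MeasurableSpace α] [NormedAddCommGroup F]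
    {μ : Measure α} {q : ℝ≥0∞} (hq : 1 ≤ q) {a b c : ℕ → α → F}
    (ha : ∀ n, AEStronglyMeasurable (a n) μ) (hb : ∀ n, AEStronglyMeasurable (b n) μ)
    (ha0 : Tendsto (fun n => eLpNorm (a n) q μ) atTop (𝓝 0))
    (hb0 : Tendsto (fun n => eLpNorm (b n) q μ) atTop (𝓝 0))
    (hc : ∀ n, c n =ᵐ[μ] a n + b n) :
    Tendsto (fun n => eLpNorm (c n) q μ) atTop (𝓝 0) := by
  refine tendsto_of_tendsto_of_tendsto_of_le_of_le tendsto_const_nhds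
    (by simpa using ha0.add hb0) (fun _ => zero_le) fun n => ?_
  dsimp only
  rw [eLpNorm_congr_ae (hc n)]
  exact eLpNorm_add_le (ha n) (hb n) hq

theorem tendsto_eLpNorm_smul {α F : Type*} [MeasurableSpace α] [NormedAddCommGroup F]
    [NormedSpace ℝ F] {μ : Measure α} {q : ℝ≥0∞} {a b : ℕ → α → F} (k : ℝ)
    (ha0 : Tendsto (fun n => eLpNorm (a n) q μ) atTop (𝓝 0))
    (hb : ∀ n, b n =ᵐ[μ] k • a n) :
    Tendsto (fun n => eLpNorm (b n) q μ) atTop (𝓝 0) := by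
  have h : (fun n => eLpNorm (b n) q μ) = fun n => ‖k‖ₑ * eLpNorm (a n) q μ := by
    funext n
    rw [eLpNorm_congr_ae (hb n), eLpNorm_const_smul]
  rw [h]
  simpa using ENNReal.Tendsto.const_mul ha0 (Or.inr enorm_ne_top)

theorem continuous_gradient {d : ℕ} {χ : E d → ℝ} (h : ContDiff ℝ 1 χ) :
    Continuous (gradient χ) :=
  (InnerProductSpace.toDual ℝ (E d)).symm.continuous.comp (h.continuous_fderiv (by simp))

theorem HasTrace.add {d : ℕ} {p : ℝ} (hp : 1 < p) {Ω : Set (E d)} {u v : E d → ℝ}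
    {s t : Lp ℝ (ENNReal.ofReal p) (surf Ω)} (hu : HasTrace u s)
    (hum : MemLp u (ENNReal.ofReal p) (volume.restrict Ω))
    (hvm : MemLp v (ENNReal.ofReal p) (volume.restrict Ω)) (hv : HasTrace v t) :
    HasTrace (u + v) (s + t) := by
  have hp1 : 1 ≤ ENNReal.ofReal p := by simpa using hp.le
  obtain ⟨G, hG, φ, hφ, a1, a2, a3⟩ := hu
  obtain ⟨H, hH, ψ, hψ, b1, b2, b3⟩ := hv
  refine ⟨G + H, hG.add hH, fun n x => φ n x + ψ n x, fun n => (hφ n).add (hψ n), ?_, ?_, ?_⟩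
  · refine tendsto_eLpNorm_add hp1 (fun n => (hφ n).continuous.aestronglyMeasurable.sub hum.1)
      (fun n => (hψ n).continuous.aestronglyMeasurable.sub hvm.1) a1 b1
      fun n => Eventually.of_forall fun x => ?_
    simp only [Pi.add_apply, Pi.sub_apply]
    ring
  · refine tendsto_eLpNorm_add hp1
      (fun n => (continuous_gradient (hφ n)).aestronglyMeasurable.sub hG.2.aestronglyMeasurable)
      (fun n => (continuous_gradient (hψ n)).aestronglyMeasurable.sub hH.2.aestronglyMeasurable)
      a2 b2 fun n => Eventually.of_forall fun x => ?_
    have h1 := ((hφ n).differentiable (by simp) x)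
    have h2 := ((hψ n).differentiable (by simp) x)
    simp only [Pi.add_apply, Pi.sub_apply, gradient]
    rw [show (fun x => φ n x + ψ n x) = φ n + ψ n from rfl, fderiv_add h1 h2, map_add]
    abel
  · refine tendsto_eLpNorm_add hp1
      (fun n => (hφ n).continuous.aestronglyMeasurable.sub (Lp.aestronglyMeasurable s))
      (fun n => (hψ n).continuous.aestronglyMeasurable.sub (Lp.aestronglyMeasurable t)) a3 b3
      fun n => ?_
    filter_upwards [Lp.coeFn_add s t] with x hx
    simp only [hx, Pi.add_apply, Pi.sub_apply]
    ring

theorem HasTrace.smul {d : ℕ} {p : ℝ} {Ω : Set (E d)} {u : E d → ℝ}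
    {t : Lp ℝ (ENNReal.ofReal p) (surf Ω)} (hu : HasTrace u t) (c : ℝ) :
    HasTrace (c • u) (c • t) := by
  obtain ⟨G, hG, φ, hφ, a1, a2, a3⟩ := hu
  refine ⟨c • G, hG.smul c, fun n x => c * φ n x, fun n => contDiff_const.mul (hφ n), ?_, ?_, ?_⟩
  · refine tendsto_eLpNorm_smul c a1 fun n => Eventually.of_forall fun x => ?_
    simp only [Pi.smul_apply, smul_eq_mul]
    ring
  · refine tendsto_eLpNorm_smul c a2 fun n => Eventually.of_forall fun x => ?_
    have h1 := ((hφ n).differentiable (by simp) x)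
    simp only [Pi.smul_apply, gradient]
    rw [show (fun x => c * φ n x) = c • φ n from rfl, fderiv_const_smul h1, map_smul, smul_sub]
  · refine tendsto_eLpNorm_smul c a3 fun n => ?_
    filter_upwards [Lp.coeFn_smul c t] with x hx
    simp only [Pi.smul_apply, smul_eq_mul, hx]
    ring

/-- The local trace space `W^{1-1/p,p}(∂Ω)`: all traces of functions in `W^{1,p}(Ω)`. -/
def TraceSpace {d : ℕ} {p : ℝ} (hp : 1 < p) (Ω : Set (E d)) :
    Submodule ℝ (Lp ℝ (ENNReal.ofReal p) (surf Ω)) where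
  carrier := {t | ∃ u ∈ W1p p Ω, HasTrace u t}
  zero_mem' := ⟨0, Submodule.zero_mem _, HasTrace.zero⟩
  add_mem' := fun ⟨u, hu, hu2⟩ ⟨v, hv, hv2⟩ =>
    ⟨u + v, Submodule.add_mem _ hu hv, hu2.add hp hu.1 hv.1 hv2⟩
  smul_mem' := fun c _ ⟨u, hu, hu2⟩ => ⟨c • u, Submodule.smul_mem _ c hu, hu2.smul c⟩

open Classical in
/-- The trace operator `γ₀ : W^{1,p}(Ω) → W^{1-1/p,p}(∂Ω)`. (On a bounded Lipschitz domain every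
`u ∈ W^{1,p}(Ω)` has exactly one trace.) -/
def trace {d : ℕ} {p : ℝ} (hp : 1 < p) (Ω : Set (E d)) (u : W1p p Ω) : TraceSpace hp Ω :=
  if h : ∃ t : Lp ℝ (ENNReal.ofReal p) (surf Ω), HasTrace u t then
    ⟨h.choose, u, u.2, h.choose_spec⟩ else 0

/-- The quotient norm of `W^{1-1/p,p}(∂Ω)`. -/
def traceNorm {d : ℕ} [NeZero d] {p : ℝ} (hp : 1 < p) (Ω : Set (E d)) (t : TraceSpace hp Ω) :
    ℝ≥0∞ :=
  ⨅ (u : W1p p Ω) (_ : HasTrace (u : E d → ℝ) (t : Lp ℝ (ENNReal.ofReal p) (surf Ω))),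
    sobolevNorm p Ω u

/-! ### Asymptotic weak convergence of the data -/

/-- `F` is a bounded linear functional for the (semi)norm `N`. -/
def IsBddFunctional {V : Type*} [AddCommGroup V] [Module ℝ V] (N : V → ℝ≥0∞) (F : V →ₗ[ℝ] ℝ) :
    Prop :=
  ∃ C : ℝ, ∀ v, |F v| ≤ C * (N v).toReal

/-- `f ε ∈ (W^p_{ν_ε}(Ω|ℝᵈ))'`, `0 < ε < 1`, converges asymptotically weakly to
`f₀ ∈ (W^{1,p}(Ω))'` as `ε → 0`. -/
structure AsympWeakConv {d : ℕ} [NeZero d] {p : ℝ} (hp : 1 < p) (Ω : Set (E d))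
    (ν : ℝ → RadialLevyKernel d p) (f : ∀ ε : ℝ, WHull hp Ω (ν ε) →ₗ[ℝ] ℝ)
    (f₀ : W1p p Ω →ₗ[ℝ] ℝ) : Prop where
  /-- the limit belongs to `(W^{1,p}(Ω))'` -/
  limit_bdd : IsBddFunctional (fun v : W1p p Ω => sobolevNorm p Ω v) f₀
  /-- the dual norms of `f ε` are bounded uniformly in `ε` -/
  bdd : ∃ C : ℝ, ∀ ε ∈ Ioo (0 : ℝ) 1, ∀ v : WHull hp Ω (ν ε),
    |f ε v| ≤ C * (hullNorm Ω (ν ε) v).toReal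
  /-- `⟨f ε, v ε⟩ → ⟨f₀, v₀⟩` whenever `v ε → v₀` in `Lᵖ(Ω)` along an asymptotically bounded
  family -/
  tendsto : ∀ (v₀ : W1p p (univ : Set (E d))) (v : ∀ ε : ℝ, WHull hp Ω (ν ε)),
    (∃ M : ℝ, ∀ ε ∈ Ioo (0 : ℝ) 1, (hullNorm Ω (ν ε) (v ε)).toReal ≤ M) →
    Tendsto (fun ε => eLpNorm (fun x => (v ε : E d → ℝ) x - (v₀ : E d → ℝ) x) (ENNReal.ofReal p)
      (volume.restrict Ω))
      (𝓝[>] 0) (𝓝 0) →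
    Tendsto (fun ε => f ε (v ε)) (𝓝[>] 0) (𝓝 (f₀ (resW1p Ω v₀)))

/-- `g ε ∈ (T^p_{ν_ε}(Ωᶜ))'`, `0 < ε < 1`, converges asymptotically weakly to
`g₀ ∈ (W^{1-1/p,p}(∂Ω))'` as `ε → 0`. -/
structure AsympWeakConvTrace {d : ℕ} [NeZero d] {p : ℝ} (hp : 1 < p) (Ω : Set (E d))
    (ν : ℝ → RadialLevyKernel d p) (g : ∀ ε : ℝ, TSpace hp Ω (ν ε) →ₗ[ℝ] ℝ)
    (g₀ : TraceSpace hp Ω →ₗ[ℝ] ℝ) : Prop where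
  /-- the limit belongs to `(W^{1-1/p,p}(∂Ω))'` -/
  limit_bdd : IsBddFunctional (traceNorm hp Ω) g₀
  /-- the dual norms of `g ε` are bounded uniformly in `ε` -/
  bdd : ∃ C : ℝ, ∀ ε ∈ Ioo (0 : ℝ) 1, ∀ v : TSpace hp Ω (ν ε),
    |g ε v| ≤ C * (tNorm hp Ω (ν ε) v).toReal
  /-- `⟨g ε, Tr (v ε)⟩ → ⟨g₀, γ₀ v₀⟩` whenever `v ε → v₀` in `Lᵖ(Ω)` along an asymptotically
  bounded family -/
  tendsto : ∀ (v₀ : W1p p (univ : Set (E d))) (v : ∀ ε : ℝ, WHull hp Ω (ν ε)),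
    (∃ M : ℝ, ∀ ε ∈ Ioo (0 : ℝ) 1, (hullNorm Ω (ν ε) (v ε)).toReal ≤ M) →
    Tendsto (fun ε => eLpNorm (fun x => (v ε : E d → ℝ) x - (v₀ : E d → ℝ) x) (ENNReal.ofReal p)
      (volume.restrict Ω))
      (𝓝[>] 0) (𝓝 0) →
    Tendsto (fun ε => g ε (Tr hp Ω (ν ε) (v ε))) (𝓝[>] 0) (𝓝 (g₀ (trace hp Ω (resW1p Ω v₀))))

/-! ### Weak solutions -/

/-- `w ∈ W^p_ν(Ω|ℝᵈ)` is a weak solution of the nonlocal Neumann problem `μ L w = f` in `Ω`,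
`μ 𝒩 w = g` on `Ωᶜ`, where `μ = 1 / K_{d,p}`. The test functions have mean zero on `Ω`, so no
compatibility condition is imposed on the data; a solution that satisfies the identity for all test
functions is in particular a solution here. -/
def IsWeakSolNonlocal {d : ℕ} [NeZero d] {p : ℝ} (hp : 1 < p) (Ω : Set (E d))
    (ν : RadialLevyKernel d p) (f : WHull hp Ω ν →ₗ[ℝ] ℝ) (g : TSpace hp Ω ν →ₗ[ℝ] ℝ)
    (w : WHull hp Ω ν) : Prop :=
  ∀ v : WHull hp Ω ν, ∫ x in Ω, (v : E d → ℝ) x = 0 →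
    (K d p)⁻¹ * form (hullRegion Ω) ν w v = f v + g (Tr hp Ω ν v)

/-- `w ∈ W^{1,p}(Ω)` is a weak solution of the Neumann problem `-Δ_p w = f` in `Ω`,
`|∇w|ᵖ⁻² ∇w · n = g` on `∂Ω` (again with test functions of mean zero). -/
def IsWeakSolLocal {d : ℕ} {p : ℝ} (hp : 1 < p) (Ω : Set (E d))
    (f : W1p p Ω →ₗ[ℝ] ℝ) (g : TraceSpace hp Ω →ₗ[ℝ] ℝ) (w : W1p p Ω) : Prop :=
  ∀ v : W1p p Ω, ∫ x in Ω, (v : E d → ℝ) x = 0 →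
    localForm p Ω w v = f v + g (trace hp Ω v)

/-- `w - (1/|Ω|) ∫_Ω w`. -/
def subMean {d : ℕ} (Ω : Set (E d)) (w : E d → ℝ) : E d → ℝ :=
  fun x => w x - ⨍ y in Ω, w y

end NonlocalNeumann

end

open NonlocalNeumann

/-!
The proof compares minimizers. With `Ū` a Sobolev extension of the mean-free local solution `u`, and
`E^ε` the energy over `(Ωᶜ × Ωᶜ)ᶜ`, strict convexity in the quantitative form
`exists_energy_sub_le_excess` bounds `E^ε(u_ε - Ū)`, up to an arbitrarily small multiple of
`E^ε(u_ε) + E^ε(Ū)`, by the excess of `E^ε(Ū)` over the tangent of `E^ε` at `u_ε`. By the nonlocal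
equation this excess is `E^ε(Ū) - E^ε(u_ε) + p K ⟨f_ε + g_ε, u_ε - Ū⟩`. Its limit superior is
nonpositive for four reasons, in which `V` denotes a subsequential limit of `u_ε` in `Lᵖ(Ω)`:

* `E^ε(Ū) → K ∫_Ω |∇u|ᵖ` (`tendsto_energy_hull`);
* `V` exists and belongs to `W^{1,p}` (`exists_subseq_sobolev_limit`), the `u_ε` being bounded by
  the Poincaré inequality (`exists_poincare`, `exists_solution_bound`);
* `K ∫_Ω |∇V|ᵖ ≤ liminf E^ε(u_ε)` (`lintegral_grad_le_of_frequently`);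
* the data converge to `⟨f + g, V - Ū⟩`, and `u` minimizes the local functional, so that
  `∫_Ω |∇u|ᵖ + p ⟨f + g, V - Ū⟩ ≤ ∫_Ω |∇V|ᵖ` (`local_energy_le`).

No property of traces enters: the hypothesis on the boundary data is applied to `V - Ū` itself. The
limits in the theorem follow from `E^ε(u_ε - Ū) → 0` by the Poincaré inequality, and because the
energy of `Ū` across `∂Ω` vanishes in the limit (`tendsto_energy_cross`).

Nonlocal energies are cut into slices `shiftInt`, `∫_{x ∈ A, x + h ∈ B} |u(x + h) - u(x)|ᵖ dx`, over
which the kernel averages. The slices satisfy triangle inequalities along paths, and for Sobolev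
functions they are `∫ |∇u · h|ᵖ + o(|h|ᵖ)`, by the fundamental theorem along segments
(`ae_shift_eq_integral`); this gives the limits of energies of a fixed function. Lower
semicontinuity holds because `N` steps of length `|h|` reach a fixed distance, at which the
`Lᵖ`-distance of `u_ε` and `V` is negligible (`shiftInt_rpow_le_of_near`).

Compactness passes through the ball energies `ballInt`,
`∬_{A × A, |x - y| < r} |u(x) - u(y)|ᵖ dx dy`. Averaging over two-step paths shows that the energy over
`Ω × ℝᵈ` controls an average of the rescaled ball energies over small scales, so that one scale is
good (`exists_small_scale`). In dimension at least two the steps are `h` and its reflection, whose sum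
has a fixed direction and a length with a density that is bounded below
(`lintegral_radial_reflection_le`, `lintegral_radial_marginal_ge`); in dimension one the kernel may be
too irregular for this, and the steps are taken in an annulus, on which the additional condition
bounds the kernel from below. A ball energy survives extension across the Lipschitz boundary by folding
maps (`exists_extension`), and on `ℝᵈ` its bound at one scale yields Lipschitz bounds for translations
at all larger scales (`exists_shiftInt_le_of_ballInt`). Hence the extensions are asymptotically
equicontinuous in `Lᵖ`, and a limit has translations that are Lipschitz in `Lᵖ`, which characterizes
`W^{1,p}(ℝᵈ)` (`exists_isWeakGrad_of_shiftInt_le`). The Poincaré inequality follows by contradiction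
from compactness and lower semicontinuity.
-/

noncomputable section

namespace NonlocalNeumann

/-! ### Slices of the nonlocal energies -/

section Slices

variable {d : ℕ} {F : Type*} [NormedAddCommGroup F]

/-- The slice at `h` of the `p`-energy of `u` over `A × B`, that is
`∫_{x ∈ A, x + h ∈ B} |u(x + h) - u(x)|ᵖ dx`. -/
def shiftInt (p : ℝ) (A B : Set (E d)) (u : E d → F) (h : E d) : ℝ≥0∞ :=
  ∫⁻ x in {x | x ∈ A ∧ x + h ∈ B}, ‖u (x + h) - u x‖ₑ ^ p

theorem measurableSet_slice {A B : Set (E d)} (hA : MeasurableSet A) (hB : MeasurableSet B)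
    (h : E d) : MeasurableSet {x | x ∈ A ∧ x + h ∈ B} :=
  hA.inter (hB.preimage (measurable_id.add_const h))

theorem ofReal_abs_rpow {p : ℝ} (hp : 0 ≤ p) (a : ℝ) :
    ENNReal.ofReal (|a| ^ p) = ‖a‖ₑ ^ p := by
  rw [Real.enorm_eq_ofReal_abs, ENNReal.ofReal_rpow_of_nonneg (abs_nonneg _) hp]

theorem quasiMeasurePreserving_add_const (h : E d) :
    Measure.QuasiMeasurePreserving (fun x : E d => x + h) volume volume :=
  (measurePreserving_add_right volume h).quasiMeasurePreserving

theorem ae_add_const {P : E d → Prop} (hP : ∀ᵐ x, P x) (h : E d) : ∀ᵐ x, P (x + h) :=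
  (quasiMeasurePreserving_add_const h).tendsto_ae hP

theorem aemeasurable_shift [MeasurableSpace F] [BorelSpace F] {u : E d → F} (hu : AEMeasurable u)
    (h : E d) : AEMeasurable (fun x => u (x + h)) :=
  hu.comp_quasiMeasurePreserving (quasiMeasurePreserving_add_const h)

theorem shiftInt_mono (p : ℝ) {A B A' B' : Set (E d)} (hA : A ⊆ A') (hB : B ⊆ B') (u : E d → F)
    (h : E d) : shiftInt p A B u h ≤ shiftInt p A' B' u h :=
  lintegral_mono_set fun _ hx => ⟨hA hx.1, hB hx.2⟩

theorem shiftInt_congr (p : ℝ) {A B : Set (E d)} (hA : MeasurableSet A) (hB : MeasurableSet B)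
    {u v : E d → F} (h1 : ∀ᵐ x, x ∈ A → u x = v x) (h2 : ∀ᵐ x, x ∈ B → u x = v x) (h : E d) :
    shiftInt p A B u h = shiftInt p A B v h := by
  refine setLIntegral_congr_fun_ae (measurableSet_slice hA hB h) ?_
  filter_upwards [h1, ae_add_const h2 h] with x hx hx' hxs
  rw [hx hxs.1, hx' hxs.2]

theorem shiftInt_neg (p : ℝ) {A B : Set (E d)} (hA : MeasurableSet A) (hB : MeasurableSet B)
    (u : E d → F) (h : E d) :
    shiftInt p A B u (-h) = shiftInt p B A u h := by
  unfold shiftInt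
  rw [← lintegral_indicator (measurableSet_slice hA hB _),
    ← lintegral_indicator (measurableSet_slice hB hA _), ← lintegral_add_right_eq_self _ h]
  refine lintegral_congr fun x => ?_
  by_cases hx : x ∈ B ∧ x + h ∈ A
  · rw [indicator_of_mem (by simpa [and_comm] using hx), indicator_of_mem (by exact hx)]
    simp [← enorm_neg (u (x + h) - u x)]
  · rw [indicator_of_notMem (by simpa [and_comm] using hx), indicator_of_notMem (by exact hx)]

/-- The triangle inequality for slices along a two-step path. -/
theorem shiftInt_add_le [MeasurableSpace F] [BorelSpace F] [SecondCountableTopology F]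
    {p : ℝ} (hp : 1 ≤ p) {A B C : Set (E d)} (hA : MeasurableSet A)
    (hC : MeasurableSet C) {u : E d → F} (hu : AEMeasurable u) (h k : E d)
    (hABC : ∀ x ∈ A, x + h + k ∈ C → x + h ∈ B) :
    shiftInt p A C u (h + k) ≤ 2 ^ (p - 1) * (shiftInt p A B u h + shiftInt p B C u k) := by
  have hp0 : 0 ≤ p := by linarith
  unfold shiftInt
  set T := {x | x ∈ A ∧ x + (h + k) ∈ C} with hT
  have hTm : MeasurableSet T := measurableSet_slice hA hC _
  calc ∫⁻ x in T, ‖u (x + (h + k)) - u x‖ₑ ^ p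
      ≤ ∫⁻ x in T, 2 ^ (p - 1) * (‖u (x + h) - u x‖ₑ ^ p + ‖u (x + h + k) - u (x + h)‖ₑ ^ p) := by
        refine lintegral_mono fun x => ?_
        refine le_trans (ENNReal.rpow_le_rpow ?_ hp0) (ENNReal.rpow_add_le_mul_rpow_add_rpow _ _ hp)
        have e : u (x + (h + k)) - u x = (u (x + h) - u x) + (u (x + h + k) - u (x + h)) := by
          rw [add_assoc]; abel
        rw [e]
        exact enorm_add_le _ _
    _ = 2 ^ (p - 1) * ((∫⁻ x in T, ‖u (x + h) - u x‖ₑ ^ p) +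
          ∫⁻ x in T, ‖u (x + h + k) - u (x + h)‖ₑ ^ p) := by
        rw [lintegral_const_mul' _ _ (by simp), lintegral_add_left']
        exact (((aemeasurable_shift hu h).sub hu).enorm.pow_const p).restrict
    _ ≤ _ := by
        refine mul_le_mul' le_rfl (add_le_add ?_ ?_)
        · refine lintegral_mono_set fun x hx => ⟨hx.1, hABC x hx.1 ?_⟩
          rw [add_assoc]; exact hx.2
        · calc ∫⁻ x in T, ‖u (x + h + k) - u (x + h)‖ₑ ^ p
              = ∫⁻ x, (T.indicator (fun x => ‖u (x + h + k) - u (x + h)‖ₑ ^ p)) x :=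
                (lintegral_indicator hTm _).symm
            _ ≤ ∫⁻ x, ({x | x ∈ B ∧ x + k ∈ C}.indicator (fun x => ‖u (x + k) - u x‖ₑ ^ p))
                  (x + h) := by
                refine lintegral_mono fun x => ?_
                by_cases hx : x ∈ T
                · have hx2 : x + h + k ∈ C := by rw [add_assoc]; exact hx.2
                  rw [indicator_of_mem hx, indicator_of_mem (by exact ⟨hABC x hx.1 hx2, hx2⟩)]
                · rw [indicator_of_notMem hx]; exact zero_le
            _ = ∫⁻ x, ({x | x ∈ B ∧ x + k ∈ C}.indicator (fun x => ‖u (x + k) - u x‖ₑ ^ p)) x :=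
                lintegral_add_right_eq_self _ h
            _ ≤ _ := lintegral_indicator_le _ _

/-- Iterated shifts between points of `A` and `C` such that all intermediate points belong to
`B`. -/
theorem shiftInt_nsmul_le [MeasurableSpace F] [BorelSpace F] [SecondCountableTopology F]
    {p : ℝ} (hp : 1 ≤ p) {A B C : Set (E d)} (hA : MeasurableSet A)
    (hC : MeasurableSet C) {u : E d → F} (hu : AEMeasurable u) (k : E d) (N : ℕ)
    (hAk : ∀ x ∈ A, x + N • k ∈ C → ∀ j ≤ N, x + j • k ∈ B) :
    shiftInt p A C u (N • k) ≤ (N : ℝ≥0∞) ^ p * shiftInt p B B u k := by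
  have hp0 : 0 < p := by linarith
  rcases Nat.eq_zero_or_pos N with rfl | hN
  · simp [shiftInt, hp0]
  set T := {x | x ∈ A ∧ x + N • k ∈ C} with hT
  have hTm : MeasurableSet T := measurableSet_slice hA hC _
  have hterm : ∀ j ∈ Finset.range N,
      ∫⁻ x in T, ‖u (x + (j + 1) • k) - u (x + j • k)‖ₑ ^ p ≤ shiftInt p B B u k := by
    intro j hj
    rw [Finset.mem_range] at hj
    calc ∫⁻ x in T, ‖u (x + (j + 1) • k) - u (x + j • k)‖ₑ ^ p
        = ∫⁻ x, (T.indicator (fun x => ‖u (x + (j + 1) • k) - u (x + j • k)‖ₑ ^ p)) x :=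
          (lintegral_indicator hTm _).symm
      _ ≤ ∫⁻ x, ({x | x ∈ B ∧ x + k ∈ B}.indicator (fun x => ‖u (x + k) - u x‖ₑ ^ p))
            (x + j • k) := by
          refine lintegral_mono fun x => ?_
          have e : x + (j + 1) • k = x + j • k + k := by rw [add_smul, one_smul, add_assoc]
          by_cases hx : x ∈ T
          · have h1 := hAk x hx.1 hx.2 j hj.le
            have h2 := hAk x hx.1 hx.2 (j + 1) hj
            rw [e] at h2
            rw [indicator_of_mem hx, indicator_of_mem (by exact ⟨h1, h2⟩), e]
          · rw [indicator_of_notMem hx]; exact zero_le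
      _ = ∫⁻ x, ({x | x ∈ B ∧ x + k ∈ B}.indicator (fun x => ‖u (x + k) - u x‖ₑ ^ p)) x :=
          lintegral_add_right_eq_self _ _
      _ ≤ _ := lintegral_indicator_le _ _
  calc shiftInt p A C u (N • k)
      ≤ ∫⁻ x in T, (N : ℝ≥0∞) ^ (p - 1) *
          ∑ j ∈ Finset.range N, ‖u (x + (j + 1) • k) - u (x + j • k)‖ₑ ^ p := by
        refine lintegral_mono fun x => ?_
        have e : u (x + N • k) - u x =
            ∑ j ∈ Finset.range N, (u (x + (j + 1) • k) - u (x + j • k)) := by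
          rw [Finset.sum_range_sub (fun j => u (x + j • k))]; simp
        rw [e]
        calc _ ≤ (∑ j ∈ Finset.range N, ‖u (x + (j + 1) • k) - u (x + j • k)‖ₑ) ^ p :=
              ENNReal.rpow_le_rpow (enorm_sum_le _ _) hp0.le
          _ ≤ _ := by
              simpa using ENNReal.rpow_sum_le_const_mul_sum_rpow (Finset.range N)
                (fun j => ‖u (x + (j + 1) • k) - u (x + j • k)‖ₑ) hp
    _ = (N : ℝ≥0∞) ^ (p - 1) * ∑ j ∈ Finset.range N,
          ∫⁻ x in T, ‖u (x + (j + 1) • k) - u (x + j • k)‖ₑ ^ p := by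
        rw [lintegral_const_mul' _ _ (by simp [hp]), lintegral_finsetSum']
        intro j _
        exact (((aemeasurable_shift hu _).sub (aemeasurable_shift hu _)).enorm.pow_const p).restrict
    _ ≤ (N : ℝ≥0∞) ^ (p - 1) * ∑ j ∈ Finset.range N, shiftInt p B B u k := by
        gcongr with j hj
        exact hterm j hj
    _ = (N : ℝ≥0∞) ^ p * shiftInt p B B u k := by
        rw [Finset.sum_const, Finset.card_range, nsmul_eq_mul, ← mul_assoc]
        congr 1
        conv_rhs => rw [show p = (p - 1) + 1 by ring]
        rw [ENNReal.rpow_add _ _ (by simpa using hN.ne') (by simp), ENNReal.rpow_one]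

theorem shiftInt_le_lintegral [MeasurableSpace F] [BorelSpace F] [SecondCountableTopology F]
    {p : ℝ} (hp : 1 ≤ p) (A B : Set (E d)) {u : E d → F}
    (hu : AEMeasurable u) (h : E d) :
    shiftInt p A B u h ≤ 2 ^ p * ∫⁻ x, ‖u x‖ₑ ^ p := by
  have hp0 : 0 ≤ p := by linarith
  calc shiftInt p A B u h ≤ ∫⁻ x, ‖u (x + h) - u x‖ₑ ^ p := setLIntegral_le_lintegral _ _
    _ ≤ ∫⁻ x, 2 ^ (p - 1) * (‖u (x + h)‖ₑ ^ p + ‖u x‖ₑ ^ p) := by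
        refine lintegral_mono fun x => ?_
        refine le_trans (ENNReal.rpow_le_rpow ?_ hp0) (ENNReal.rpow_add_le_mul_rpow_add_rpow _ _ hp)
        exact enorm_sub_le
    _ = 2 ^ (p - 1) * ((∫⁻ x, ‖u (x + h)‖ₑ ^ p) + ∫⁻ x, ‖u x‖ₑ ^ p) := by
        rw [lintegral_const_mul' _ _ (by simp), lintegral_add_right' _ (hu.enorm.pow_const p)]
    _ = 2 ^ (p - 1) * ((∫⁻ x, ‖u x‖ₑ ^ p) + ∫⁻ x, ‖u x‖ₑ ^ p) := by
        rw [lintegral_add_right_eq_self (fun x => ‖u x‖ₑ ^ p)]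
    _ = 2 ^ p * ∫⁻ x, ‖u x‖ₑ ^ p := by
        rw [← two_mul, ← mul_assoc]
        congr 1
        conv_rhs => rw [show p = (p - 1) + 1 by ring]
        rw [ENNReal.rpow_add _ _ (by simp) (by simp), ENNReal.rpow_one]

theorem measurable_shiftInt [MeasurableSpace F] [BorelSpace F] [SecondCountableTopology F]
    (p : ℝ) {A B : Set (E d)} (hA : MeasurableSet A)
    (hB : MeasurableSet B) {u : E d → F} (hu : AEMeasurable u) :
    Measurable (shiftInt p A B u) := by
  have e : shiftInt p A B u = shiftInt p A B (hu.mk u) := by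
    funext h
    exact shiftInt_congr p hA hB (hu.ae_eq_mk.mono fun x hx _ => hx)
      (hu.ae_eq_mk.mono fun x hx _ => hx) h
  rw [e]
  have hm := hu.measurable_mk
  have e2 : shiftInt p A B (hu.mk u) = fun h => ∫⁻ x,
      {z : E d × E d | z.2 ∈ A ∧ z.2 + z.1 ∈ B}.indicator
        (fun z => ‖hu.mk u (z.2 + z.1) - hu.mk u z.2‖ₑ ^ p) (h, x) := by
    funext h
    unfold shiftInt
    rw [← lintegral_indicator (measurableSet_slice hA hB _)]
    rfl
  rw [e2]
  refine Measurable.lintegral_prod_right' (f := {z : E d × E d | z.2 ∈ A ∧ z.2 + z.1 ∈ B}.indicator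
        (fun z => ‖hu.mk u (z.2 + z.1) - hu.mk u z.2‖ₑ ^ p)) ?_
  refine Measurable.indicator ?_ ?_
  · exact ((((hm.comp (measurable_snd.add measurable_fst)).sub
      (hm.comp measurable_snd))).enorm.pow_const p)
  · exact (hA.preimage measurable_snd).inter (hB.preimage (measurable_snd.add measurable_fst))

variable {p : ℝ}

/-- The kernel as a function with values in `[0, ∞]`. -/
def RadialLevyKernel.ker (ν : RadialLevyKernel d p) (h : E d) : ℝ≥0∞ := ENNReal.ofReal (ν h)

theorem RadialLevyKernel.measurable_ker (ν : RadialLevyKernel d p) : Measurable ν.ker :=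
  ν.measurable_toFun.ennreal_ofReal

theorem RadialLevyKernel.ker_congr (ν : RadialLevyKernel d p) {h k : E d} (hk : ‖h‖ = ‖k‖) :
    ν.ker h = ν.ker k := by
  unfold RadialLevyKernel.ker
  rw [ν.radial h k hk]

theorem energy_eq_enorm (hp : 0 ≤ p) (S : Set (E d × E d)) (ν : RadialLevyKernel d p)
    (u : E d → ℝ) :
    energy S ν u = ∫⁻ z in S, ‖u z.1 - u z.2‖ₑ ^ p * ν.ker (z.1 - z.2) := by
  unfold energy RadialLevyKernel.ker
  refine lintegral_congr fun z => ?_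
  rw [ENNReal.ofReal_mul (by positivity), ofReal_abs_rpow hp]

theorem aemeasurable_energy_integrand {u : E d → ℝ} (hu : AEMeasurable u)
    (ν : RadialLevyKernel d p) :
    AEMeasurable (fun z : E d × E d => ‖u z.1 - u z.2‖ₑ ^ p * ν.ker (z.1 - z.2)) := by
  have h1 : AEMeasurable (fun z : E d × E d => u z.1) volume :=
    hu.comp_quasiMeasurePreserving Measure.quasiMeasurePreserving_fst
  have h2 : AEMeasurable (fun z : E d × E d => u z.2) volume :=
    hu.comp_quasiMeasurePreserving Measure.quasiMeasurePreserving_snd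
  exact ((h1.sub h2).enorm.pow_const p).mul
    (ν.measurable_ker.comp (measurable_fst.sub measurable_snd)).aemeasurable

theorem energy_congr (hp : 0 ≤ p) (ν : RadialLevyKernel d p) {A B : Set (E d)}
    (hA : MeasurableSet A) (hB : MeasurableSet B) {u v : E d → ℝ}
    (h1 : ∀ᵐ x, x ∈ A → u x = v x) (h2 : ∀ᵐ x, x ∈ B → u x = v x) :
    energy (A ×ˢ B) ν u = energy (A ×ˢ B) ν v := by
  rw [energy_eq_enorm hp, energy_eq_enorm hp]
  refine setLIntegral_congr_fun_ae (hA.prod hB) ?_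
  filter_upwards [Measure.quasiMeasurePreserving_fst.tendsto_ae h1,
    Measure.quasiMeasurePreserving_snd.tendsto_ae h2] with z hz1 hz2 hz
  rw [hz1 hz.1, hz2 hz.2]

/-- Energies are integrals of slices against the kernel. -/
theorem energy_prod (hp : 0 ≤ p) (ν : RadialLevyKernel d p) {A B : Set (E d)}
    (hA : MeasurableSet A) (hB : MeasurableSet B) {u : E d → ℝ} (hu : AEMeasurable u) :
    energy (A ×ˢ B) ν u = ∫⁻ h, ν.ker h * shiftInt p A B u h := by
  have hum := hu.measurable_mk
  set w := hu.mk u with hw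
  have e0 : ∀ᵐ x, u x = w x := hu.ae_eq_mk
  rw [energy_congr hp ν hA hB (e0.mono fun x hx _ => hx) (e0.mono fun x hx _ => hx)]
  simp_rw [shiftInt_congr p hA hB (e0.mono fun x hx _ => hx) (e0.mono fun x hx _ => hx)]
  rw [energy_eq_enorm hp, ← lintegral_indicator (hA.prod hB), Measure.volume_eq_prod,
    lintegral_prod _ (((aemeasurable_energy_integrand hum.aemeasurable ν).indicator
      (hA.prod hB)))]
  have e1 : ∀ x : E d, ∫⁻ y, (A ×ˢ B).indicator
        (fun z : E d × E d => ‖w z.1 - w z.2‖ₑ ^ p * ν.ker (z.1 - z.2)) (x, y) =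
      ∫⁻ h, {z : E d × E d | z.2 ∈ A ∧ z.2 + z.1 ∈ B}.indicator
        (fun z => ν.ker z.1 * ‖w (z.2 + z.1) - w z.2‖ₑ ^ p) (h, x) := by
    intro x
    rw [← lintegral_add_left_eq_self _ x]
    refine lintegral_congr fun h => ?_
    by_cases hx : x ∈ A ∧ x + h ∈ B
    · rw [indicator_of_mem (by exact hx), indicator_of_mem (by exact hx), mul_comm]
      simp only [sub_add_cancel_left]
      rw [ν.ker_congr (norm_neg h), ← enorm_neg (w (x + h) - w x), neg_sub]
    · rw [indicator_of_notMem (by exact hx), indicator_of_notMem (by exact hx)]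
  simp_rw [e1]
  rw [lintegral_lintegral_swap]
  · refine lintegral_congr fun h => ?_
    unfold shiftInt
    rw [← lintegral_indicator (measurableSet_slice hA hB _),
      ← lintegral_const_mul' _ _ (by exact ENNReal.ofReal_ne_top)]
    refine lintegral_congr fun x => ?_
    by_cases hx : x ∈ A ∧ x + h ∈ B
    · rw [indicator_of_mem (by exact hx), indicator_of_mem (by exact hx)]
    · rw [indicator_of_notMem (by exact hx), indicator_of_notMem (by exact hx), mul_zero]
  · refine Measurable.aemeasurable ?_
    refine Measurable.indicator (f := fun z : E d × E d =>
      ν.ker z.2 * ‖w (z.1 + z.2) - w z.1‖ₑ ^ p) (s := {z | z.1 ∈ A ∧ z.1 + z.2 ∈ B}) ?_ ?_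
    · exact (ν.measurable_ker.comp measurable_snd).mul
        (((hum.comp (measurable_fst.add measurable_snd)).sub
          (hum.comp measurable_fst)).enorm.pow_const p)
    · exact (hA.preimage measurable_fst).inter (hB.preimage (measurable_fst.add measurable_snd))

theorem energy_mono (ν : RadialLevyKernel d p) {S T : Set (E d × E d)} (h : S ⊆ T)
    (u : E d → ℝ) : energy S ν u ≤ energy T ν u :=
  lintegral_mono_set h

theorem hullRegion_eq (Ω : Set (E d)) : hullRegion Ω = (Ω ×ˢ univ) ∪ (Ωᶜ ×ˢ Ω) := by
  ext z
  simp only [hullRegion, mem_compl_iff, mem_prod, mem_union, mem_univ, and_true, not_and, not_not]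
  tauto

theorem energy_hull (ν : RadialLevyKernel d p) {Ω : Set (E d)} (hΩ : MeasurableSet Ω)
    (u : E d → ℝ) :
    energy (hullRegion Ω) ν u = energy (Ω ×ˢ univ) ν u + energy (Ωᶜ ×ˢ Ω) ν u := by
  unfold energy
  rw [hullRegion_eq, lintegral_union (hΩ.compl.prod hΩ)]
  rw [Set.disjoint_left]
  rintro z hz hz'
  exact hz'.1 hz.1

theorem energy_prod_comm (hp : 0 ≤ p) (ν : RadialLevyKernel d p) {A B : Set (E d)}
    (hA : MeasurableSet A) (hB : MeasurableSet B) {u : E d → ℝ} (hu : AEMeasurable u) :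
    energy (A ×ˢ B) ν u = energy (B ×ˢ A) ν u := by
  rw [energy_prod hp ν hA hB hu, energy_prod hp ν hB hA hu, ← lintegral_neg_eq_self]
  refine lintegral_congr fun h => ?_
  rw [shiftInt_neg p hA hB, ν.ker_congr (norm_neg h)]

end Slices

/-! ### Jensen's inequality -/

theorem lintegral_rpow_le_measure {α : Type*} [MeasurableSpace α] {μ : Measure α} {p : ℝ}
    (hp : 1 ≤ p) {f : α → ℝ≥0∞} (hf : AEMeasurable f μ) :
    (∫⁻ x, f x ∂μ) ^ p ≤ μ univ ^ (p - 1) * ∫⁻ x, f x ^ p ∂μ := by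
  rcases hp.eq_or_lt with rfl | hp
  · simp
  have hpq := Real.HolderConjugate.conjExponent hp
  have h := ENNReal.lintegral_mul_le_Lp_mul_Lq μ hpq hf (g := fun _ => 1) aemeasurable_const
  simp only [Pi.mul_apply, mul_one, ENNReal.one_rpow, lintegral_const, one_mul] at h
  have hp0 : 0 < p := by linarith
  calc _ ≤ ((∫⁻ x, f x ^ p ∂μ) ^ (1 / p) * μ univ ^ (1 / p.conjExponent)) ^ p :=
        ENNReal.rpow_le_rpow h hp0.le
    _ = _ := by
        rw [ENNReal.mul_rpow_of_nonneg _ _ hp0.le, ← ENNReal.rpow_mul, ← ENNReal.rpow_mul,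
          one_div_mul_cancel hp0.ne', ENNReal.rpow_one, mul_comm]
        congr 2
        rw [Real.conjExponent]
        field_simp

/-! ### Weak gradients along segments -/

section Segments

variable {d : ℕ}

theorem integrable_mul_comp_sub_smul {w Φ : E d → ℝ} (hw : LocallyIntegrable w)
    (hΦ : Measurable Φ) {C : ℝ} (hC : ∀ x, |Φ x| ≤ C) {K : Set (E d)} (hK : IsCompact K)
    (hΦK : ∀ x, x ∉ K → Φ x = 0) (h : E d) :
    Integrable (fun z : E d × ℝ => w z.1 * Φ (z.1 - z.2 • h))
      (volume.prod (volume.restrict (Ioc (0 : ℝ) 1))) := by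
  set K' : Set (E d) := (fun z : E d × ℝ => z.1 + z.2 • h) '' (K ×ˢ Icc (0 : ℝ) 1) with hK'
  have hK'c : IsCompact K' := (hK.prod isCompact_Icc).image (by fun_prop)
  have h1 : Integrable (K'.indicator w) :=
    (integrable_indicator_iff hK'c.measurableSet).2 (hw.integrableOn_isCompact hK'c)
  have h2 : Integrable (fun z : E d × ℝ => K'.indicator w z.1)
      (volume.prod (volume.restrict (Ioc (0 : ℝ) 1))) := h1.comp_fst _
  have hm : Measurable (fun z : E d × ℝ => Φ (z.1 - z.2 • h)) :=
    hΦ.comp (measurable_fst.sub (measurable_snd.smul_const h))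
  have h3 := h2.mul_bdd (c := C) hm.aestronglyMeasurable
    (Eventually.of_forall fun z => by simpa using hC _)
  refine h3.congr ?_
  have hs : ∀ᵐ z : E d × ℝ ∂(volume.prod (volume.restrict (Ioc (0 : ℝ) 1))), z.2 ∈ Ioc (0 : ℝ) 1 :=
    Measure.quasiMeasurePreserving_snd.tendsto_ae (ae_restrict_mem measurableSet_Ioc)
  filter_upwards [hs] with z hz
  by_cases hzK : z.1 ∈ K'
  · rw [indicator_of_mem hzK]
  · have : Φ (z.1 - z.2 • h) = 0 := by
      refine hΦK _ fun hmem => hzK ⟨(z.1 - z.2 • h, z.2), ⟨hmem, hz.1.le, hz.2⟩, by simp⟩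
    simp [this]

theorem integrable_comp_add_smul_mul {w Φ : E d → ℝ} (hw : LocallyIntegrable w) (hwm : Measurable w)
    (hΦ : Measurable Φ) {C : ℝ} (hC : ∀ x, |Φ x| ≤ C) {K : Set (E d)} (hK : IsCompact K)
    (hΦK : ∀ x, x ∉ K → Φ x = 0) (h : E d) :
    Integrable (fun z : E d × ℝ => w (z.1 + z.2 • h) * Φ z.1)
      (volume.prod (volume.restrict (Ioc (0 : ℝ) 1))) := by
  have h0 := (integrable_mul_comp_sub_smul hw hΦ hC hK hΦK h)
  have hm : Measurable (fun z : E d × ℝ => w (z.1 + z.2 • h) * Φ z.1) :=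
    (hwm.comp (measurable_fst.add (measurable_snd.smul_const h))).mul (hΦ.comp measurable_fst)
  refine ⟨hm.aestronglyMeasurable, ?_⟩
  have h1 := h0.2
  unfold HasFiniteIntegral at h1 ⊢
  rw [lintegral_prod_symm _ h0.1.enorm] at h1
  rw [lintegral_prod_symm _ hm.enorm.aemeasurable]
  refine lt_of_le_of_lt (le_of_eq ?_) h1
  refine lintegral_congr fun s => ?_
  rw [← lintegral_add_right_eq_self (fun x => ‖w x * Φ (x - s • h)‖ₑ) (s • h)]
  simp

/-- The fundamental theorem along almost every segment in the direction `h`, obtained by testing the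
weak gradient. -/
theorem ae_shift_eq_integral {Ω V : Set (E d)} (hV : IsOpen V)
    {u : E d → ℝ} {G : E d → E d}
    (hu : IsWeakGrad Ω u G) (hui : LocallyIntegrable u) (hGm : Measurable G)
    (hGi : LocallyIntegrable G) (h : E d) (hVΩ : ∀ x ∈ V, ∀ s ∈ Icc (0 : ℝ) 1, x + s • h ∈ Ω) :
    ∀ᵐ x, x ∈ V → u (x + h) - u x = ∫ s in Ioc (0 : ℝ) 1, inner ℝ (G (x + s • h)) h := by
  set w : E d → ℝ := fun x => inner ℝ (G x) h with hw
  have hwm : Measurable w := hGm.inner_const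
  have hwi : LocallyIntegrable w := by
    intro x
    obtain ⟨s, hs, hsi⟩ := hGi x
    exact ⟨s, hs, hsi.inner_const h⟩
  have hush : LocallyIntegrable (fun x => u (x + h)) := by
    rw [locallyIntegrable_iff] at hui ⊢
    intro K hK
    have hK2 : IsCompact ((fun x => x + h) '' K) := hK.image (by fun_prop)
    exact ((measurePreserving_add_right volume h).integrableOn_image
      (measurableEmbedding_addRight h)).1 (hui _ hK2)
  have hgi : LocallyIntegrable (fun x => ∫ s in Ioc (0 : ℝ) 1, w (x + s • h)) := by
    rw [locallyIntegrable_iff]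
    intro K hK
    have h1 := (integrable_comp_add_smul_mul hwi hwm (Φ := K.indicator fun _ => 1)
      (measurable_const.indicator hK.measurableSet) (C := 1) (fun x => by
        by_cases hx : x ∈ K <;> simp [hx]) hK
      (fun x hx => by simp [hx]) h).integral_prod_left
    rw [← integrable_indicator_iff hK.measurableSet]
    refine h1.congr (Eventually.of_forall fun x => ?_)
    by_cases hx : x ∈ K <;> simp [hx]
  have hf : LocallyIntegrable
      (fun x => (u (x + h) - u x) - ∫ s in Ioc (0 : ℝ) 1, w (x + s • h)) := (hush.sub hui).sub hgi
  have key := hV.ae_eq_zero_of_integral_contDiff_smul_eq_zero (hf.locallyIntegrableOn V) ?_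
  · filter_upwards [key] with x hx hxV
    exact sub_eq_zero.1 (hx hxV)
  intro φ hφ hφc hφV
  have hφ1 : ContDiff ℝ 1 φ := hφ.of_le (by simp)
  have hφd : Differentiable ℝ φ := hφ1.differentiable (by simp)
  set ψ : E d → ℝ := fun x => fderiv ℝ φ x h with hψ
  have hψcont : Continuous ψ := (hφ.continuous_fderiv (by simp)).clm_apply continuous_const
  have hψc : HasCompactSupport ψ := hφc.fderiv_apply (𝕜 := ℝ) h
  obtain ⟨C1, hC1⟩ := hψcont.bounded_above_of_compact_support hψc
  obtain ⟨C0, hC0⟩ := hφ.continuous.bounded_above_of_compact_support hφc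
  have hout : ∀ x, x ∉ tsupport φ → φ x = 0 := fun x hx => image_eq_zero_of_notMem_tsupport hx
  have hout1 : ∀ x, x ∉ tsupport φ → ψ x = 0 := fun x hx =>
    image_eq_zero_of_notMem_tsupport (f := ψ) fun h' => hx (tsupport_fderiv_apply_subset ℝ h h')
  -- the identity for a fixed intermediate point of the segment
  have hstep : ∀ s ∈ Ioc (0 : ℝ) 1, ∫ x, u x * ψ (x - s • h) = -∫ x, w (x + s • h) * φ x := by
    intro s hs
    have hφs : ContDiff ℝ ∞ (fun x => φ (x - s • h)) := hφ.comp (contDiff_id.sub contDiff_const)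
    have hsub : (fun x => φ (x - s • h)) = φ ∘ (Homeomorph.addRight (-(s • h))) := by
      funext x; simp [sub_eq_add_neg]
    have hφsc : HasCompactSupport (fun x => φ (x - s • h)) := by
      rw [hsub]; exact hφc.comp_homeomorph _
    have hts : tsupport (fun x => φ (x - s • h)) ⊆ Ω := by
      intro x hx
      rw [hsub, tsupport_comp_eq_preimage] at hx
      have hx' : x - s • h ∈ tsupport φ := by simpa [sub_eq_add_neg] using hx
      have := hVΩ _ (hφV hx') s ⟨hs.1.le, hs.2⟩
      simpa using this
    have hder : ∀ x, fderiv ℝ (fun x => φ (x - s • h)) x h = ψ (x - s • h) := by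
      intro x
      simp only [sub_eq_add_neg]
      rw [fderiv_comp_add_right, hψ]
    have hid := hu.integral_eq _ hφs hφsc hts h
    simp_rw [hder] at hid
    have e1 : ∫ x in Ω, u x * ψ (x - s • h) = ∫ x, u x * ψ (x - s • h) := by
      refine setIntegral_eq_integral_of_forall_compl_eq_zero fun x hx => ?_
      rw [hout1 _ fun hm => hx ?_, mul_zero]
      have := hVΩ _ (hφV hm) s ⟨hs.1.le, hs.2⟩
      simpa using this
    have e2 : ∫ x in Ω, inner ℝ (G x) h * φ (x - s • h) = ∫ x, w x * φ (x - s • h) := by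
      refine setIntegral_eq_integral_of_forall_compl_eq_zero fun x hx => ?_
      rw [hout _ fun hm => hx ?_, mul_zero]
      have := hVΩ _ (hφV hm) s ⟨hs.1.le, hs.2⟩
      simpa using this
    rw [e1, e2] at hid
    rw [hid, ← integral_add_right_eq_self (fun x => w x * φ (x - s • h)) (s • h)]
    simp
  -- the increment of the test function along the segment
  have hφinc : ∀ x, φ (x - h) - φ x = -∫ s in Ioc (0 : ℝ) 1, ψ (x - s • h) := by
    intro x
    have hd : ∀ s ∈ uIcc (0 : ℝ) 1, HasDerivAt (fun s : ℝ => φ (x - s • h)) (-ψ (x - s • h)) s := by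
      intro s _
      have h1 : HasDerivAt (fun s : ℝ => x - s • h) (-h) s := by
        simpa using ((hasDerivAt_id s).smul_const h).const_sub x
      have h2 : HasDerivAt (fun s : ℝ => φ (x - s • h)) (fderiv ℝ φ (x - s • h) (-h)) s :=
        (hφd (x - s • h)).hasFDerivAt.comp_hasDerivAt s h1
      simpa only [map_neg] using h2
    have := intervalIntegral.integral_eq_sub_of_hasDerivAt hd
      (Continuous.intervalIntegrable (by fun_prop) _ _)
    rw [intervalIntegral.integral_of_le zero_le_one, integral_neg] at this
    simpa using this.symm
  have i1 := integrable_mul_comp_sub_smul hui hψcont.measurable hC1 hφc hout1 h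
  have i2 := integrable_comp_add_smul_mul hwi hwm hφ.continuous.measurable hC0 hφc hout h
  have hmain : ∫ x, u x * (φ (x - h) - φ x) = ∫ x, (∫ s in Ioc (0 : ℝ) 1, w (x + s • h)) * φ x := by
    calc ∫ x, u x * (φ (x - h) - φ x)
        = -∫ x, ∫ s in Ioc (0 : ℝ) 1, u x * ψ (x - s • h) := by
          rw [← integral_neg]
          refine integral_congr_ae (Eventually.of_forall fun x => ?_)
          simp only
          rw [hφinc, integral_const_mul, mul_neg]
      _ = -∫ s in Ioc (0 : ℝ) 1, ∫ x, u x * ψ (x - s • h) := by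
          rw [integral_integral_swap (f := fun x s => u x * ψ (x - s • h)) i1]
      _ = ∫ s in Ioc (0 : ℝ) 1, ∫ x, w (x + s • h) * φ x := by
          rw [← integral_neg]
          refine setIntegral_congr_fun measurableSet_Ioc fun s hs => ?_
          rw [hstep s hs, neg_neg]
      _ = ∫ x, ∫ s in Ioc (0 : ℝ) 1, w (x + s • h) * φ x :=
          (integral_integral_swap (f := fun x s => w (x + s • h) * φ x) i2).symm
      _ = _ := by
          refine integral_congr_ae (Eventually.of_forall fun x => ?_)
          exact integral_mul_const _ _
  have j1 : Integrable (fun x => u x * φ (x - h)) := by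
    have hsub : (fun x => φ (x - h)) = φ ∘ (Homeomorph.addRight (-h)) := by
      funext x; simp [sub_eq_add_neg]
    have hc : HasCompactSupport (fun x => φ (x - h)) := by
      rw [hsub]; exact hφc.comp_homeomorph _
    have := hui.integrable_smul_left_of_hasCompactSupport (g := fun x => φ (x - h))
      (hφ.continuous.comp (by fun_prop)) hc
    simpa [mul_comm] using this
  have j2 : Integrable (fun x => u x * φ x) := by
    have := hui.integrable_smul_left_of_hasCompactSupport hφ.continuous hφc
    simpa [mul_comm] using this
  have j3 : Integrable (fun x => φ x * u (x + h)) := by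
    simpa using hush.integrable_smul_left_of_hasCompactSupport hφ.continuous hφc
  have j4 : Integrable (fun x => φ x * ∫ s in Ioc (0 : ℝ) 1, w (x + s • h)) := by
    simpa using hgi.integrable_smul_left_of_hasCompactSupport hφ.continuous hφc
  simp only [smul_eq_mul, mul_sub]
  have j2' : Integrable (fun x => φ x * u x) := by simpa only [mul_comm] using j2
  have j5 : Integrable (fun x => φ x * u (x + h) - φ x * u x) := j3.sub j2'
  rw [integral_sub j5 j4, integral_sub j3 j2', sub_eq_zero]
  have e3 : ∫ x, φ x * u (x + h) = ∫ x, u x * φ (x - h) := by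
    rw [← integral_add_right_eq_self (fun x => u x * φ (x - h)) h]
    simp [mul_comm]
  rw [e3]
  calc _ = ∫ x, u x * (φ (x - h) - φ x) := by
        simp only [mul_sub]
        rw [integral_sub j1 j2]
        simp [mul_comm]
    _ = _ := by rw [hmain]; simp [mul_comm]

end Segments

/-! ### Difference quotients of Sobolev functions -/

section DifferenceQuotients

variable {d : ℕ} {p : ℝ}

theorem lintegral_segment_rpow_le (hp : 1 ≤ p) {V : Set (E d)} {g : E d → ℝ → ℝ≥0∞}
    (hg : Measurable (Function.uncurry g)) :
    ∫⁻ x in V, (∫⁻ s in Ioc (0 : ℝ) 1, g x s) ^ p ≤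
      ∫⁻ s in Ioc (0 : ℝ) 1, ∫⁻ x in V, g x s ^ p := by
  calc ∫⁻ x in V, (∫⁻ s in Ioc (0 : ℝ) 1, g x s) ^ p
      ≤ ∫⁻ x in V, ∫⁻ s in Ioc (0 : ℝ) 1, g x s ^ p := by
        refine lintegral_mono fun x => ?_
        have := lintegral_rpow_le_measure (μ := volume.restrict (Ioc (0 : ℝ) 1)) hp
          (f := g x) (hg.of_uncurry_left).aemeasurable
        simpa using this
    _ = _ := lintegral_lintegral_swap (hg.pow_const p).aemeasurable

theorem lintegral_shift_sub_le (hp : 1 ≤ p) {Ω V : Set (E d)} (hΩ : MeasurableSet Ω)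
    (hV : IsOpen V) {u : E d → ℝ} {G : E d → E d}
    (hu : IsWeakGrad Ω u G) (hui : LocallyIntegrable u) (hGm : Measurable G)
    (hGi : LocallyIntegrable G) (h : E d) (hVΩ : ∀ x ∈ V, ∀ s ∈ Icc (0 : ℝ) 1, x + s • h ∈ Ω) :
    ∫⁻ x in V, ‖u (x + h) - u x‖ₑ ^ p ≤ ‖h‖ₑ ^ p * ∫⁻ x in Ω, ‖G x‖ₑ ^ p := by
  have hp0 : 0 ≤ p := by linarith
  have hae := ae_shift_eq_integral hV hu hui hGm hGi h hVΩ
  have hm : Measurable (Function.uncurry fun (x : E d) (s : ℝ) => ‖G (x + s • h)‖ₑ * ‖h‖ₑ) :=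
    (hGm.comp (measurable_fst.add (measurable_snd.smul_const h))).enorm.mul_const _
  calc ∫⁻ x in V, ‖u (x + h) - u x‖ₑ ^ p
      ≤ ∫⁻ x in V, (∫⁻ s in Ioc (0 : ℝ) 1, ‖G (x + s • h)‖ₑ * ‖h‖ₑ) ^ p := by
        refine lintegral_mono_ae ?_
        rw [ae_restrict_iff' hV.measurableSet]
        filter_upwards [hae] with x hx hxV
        rw [hx hxV]
        refine ENNReal.rpow_le_rpow ((enorm_integral_le_lintegral_enorm _).trans ?_) hp0
        refine lintegral_mono fun s => ?_
        rw [← enorm_norm (G _), ← enorm_norm h, ← enorm_mul]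
        refine enorm_le_iff_norm_le.2 ?_
        rw [norm_mul, norm_norm, norm_norm]
        exact norm_inner_le_norm _ _
    _ ≤ ∫⁻ s in Ioc (0 : ℝ) 1, ∫⁻ x in V, (‖G (x + s • h)‖ₑ * ‖h‖ₑ) ^ p :=
        lintegral_segment_rpow_le hp hm
    _ ≤ ∫⁻ s in Ioc (0 : ℝ) 1, ‖h‖ₑ ^ p * ∫⁻ x in Ω, ‖G x‖ₑ ^ p := by
        refine setLIntegral_mono' measurableSet_Ioc fun s hs => ?_
        simp_rw [ENNReal.mul_rpow_of_nonneg _ _ hp0, mul_comm _ (‖h‖ₑ ^ p)]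
        rw [lintegral_const_mul' _ _ (by simp [hp0])]
        refine mul_le_mul' le_rfl ?_
        rw [← lintegral_indicator hV.measurableSet, ← lintegral_indicator hΩ,
          ← lintegral_add_right_eq_self (Ω.indicator fun x => ‖G x‖ₑ ^ p) (s • h)]
        refine lintegral_mono fun x => ?_
        by_cases hx : x ∈ V
        · rw [indicator_of_mem hx, indicator_of_mem (hVΩ x hx s ⟨hs.1.le, hs.2⟩)]
        · rw [indicator_of_notMem hx]; exact zero_le
    _ = _ := by simp

/-- First order Taylor expansion in the mean for Sobolev functions on `ℝᵈ`. -/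
theorem lintegral_taylor_le (hp : 1 ≤ p) {u : E d → ℝ} {G : E d → E d}
    (hu : IsWeakGrad univ u G) (hui : LocallyIntegrable u) (hGm : Measurable G)
    (hGi : LocallyIntegrable G) (h : E d) :
    ∫⁻ x, ‖u (x + h) - u x - inner ℝ (G x) h‖ₑ ^ p ≤
      ‖h‖ₑ ^ p * ∫⁻ s in Ioc (0 : ℝ) 1, shiftInt p univ univ G (s • h) := by
  have hp0 : 0 ≤ p := by linarith
  have hae := ae_shift_eq_integral isOpen_univ hu hui hGm hGi h fun _ _ _ _ => mem_univ _
  have hm : Measurable (Function.uncurry fun (x : E d) (s : ℝ) => ‖G (x + s • h) - G x‖ₑ * ‖h‖ₑ) :=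
    (((hGm.comp (measurable_fst.add (measurable_snd.smul_const h))).sub
      (hGm.comp measurable_fst)).enorm.mul_const _)
  have hint : ∀ᵐ x, IntegrableOn (fun s : ℝ => inner ℝ (G (x + s • h)) h) (Ioc 0 1) := by
    have hw : LocallyIntegrable (fun x => inner ℝ (G x) h) := by
      intro x
      obtain ⟨s, hs, hsi⟩ := hGi x
      exact ⟨s, hs, hsi.inner_const h⟩
    have hK : ∀ n : ℕ, ∀ᵐ x, x ∈ Metric.closedBall (0 : E d) n →
        IntegrableOn (fun s : ℝ => inner ℝ (G (x + s • h)) h) (Ioc 0 1) := by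
      intro n
      have hc := isCompact_closedBall (0 : E d) n
      have h1 := (integrable_comp_add_smul_mul hw hGm.inner_const
        (Φ := (Metric.closedBall (0 : E d) n).indicator fun _ => 1)
        (measurable_const.indicator hc.measurableSet) (C := 1) (fun x => by
          by_cases hx : x ∈ Metric.closedBall (0 : E d) n
          · simp [indicator_of_mem hx]
          · simp [indicator_of_notMem hx]) hc
        (fun x hx => indicator_of_notMem hx _) h).prod_right_ae
      filter_upwards [h1] with x hx hxn
      simpa [indicator_of_mem hxn, IntegrableOn] using hx
    rw [← ae_all_iff] at hK
    filter_upwards [hK] with x hx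
    obtain ⟨n, hn⟩ := exists_nat_ge ‖x‖
    exact hx n (by simpa using hn)
  calc ∫⁻ x, ‖u (x + h) - u x - inner ℝ (G x) h‖ₑ ^ p
      ≤ ∫⁻ x in univ, (∫⁻ s in Ioc (0 : ℝ) 1, ‖G (x + s • h) - G x‖ₑ * ‖h‖ₑ) ^ p := by
        rw [Measure.restrict_univ]
        refine lintegral_mono_ae ?_
        filter_upwards [hae, hint] with x hx hxi
        rw [hx (mem_univ _)]
        have e : (∫ s in Ioc (0 : ℝ) 1, inner ℝ (G (x + s • h)) h) - inner ℝ (G x) h =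
            ∫ s in Ioc (0 : ℝ) 1, inner ℝ (G (x + s • h) - G x) h := by
          simp_rw [inner_sub_left]
          rw [integral_sub hxi (integrable_const _)]
          simp
        rw [e]
        refine ENNReal.rpow_le_rpow ((enorm_integral_le_lintegral_enorm _).trans ?_) hp0
        refine lintegral_mono fun s => ?_
        rw [← enorm_norm (_ - _), ← enorm_norm h, ← enorm_mul]
        refine enorm_le_iff_norm_le.2 ?_
        rw [norm_mul, norm_norm, norm_norm]
        exact norm_inner_le_norm _ _
    _ ≤ ∫⁻ s in Ioc (0 : ℝ) 1, ∫⁻ x in univ, (‖G (x + s • h) - G x‖ₑ * ‖h‖ₑ) ^ p :=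
        lintegral_segment_rpow_le hp hm
    _ = ∫⁻ s in Ioc (0 : ℝ) 1, ‖h‖ₑ ^ p * shiftInt p univ univ G (s • h) := by
        refine lintegral_congr fun s => ?_
        simp_rw [ENNReal.mul_rpow_of_nonneg _ _ hp0, mul_comm _ (‖h‖ₑ ^ p)]
        rw [lintegral_const_mul' _ _ (by simp [hp0])]
        simp [shiftInt]
    _ = _ := lintegral_const_mul' _ _ (by simp [hp0])

/-- Translations are continuous in `Lᵖ`. -/
theorem tendsto_shiftInt_univ (hp : 1 ≤ p) {F : Type*} [NormedAddCommGroup F]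
    {G : E d → F} (hG : MemLp G (ENNReal.ofReal p) volume) :
    Tendsto (shiftInt p univ univ G) (𝓝 0) (𝓝 0) := by
  have hp0 : 0 < p := by linarith
  have : Fact (1 ≤ ENNReal.ofReal p) := ⟨by simpa using hp⟩
  set g : E d → C(E d, E d) := fun h => ⟨fun x => x + h, by fun_prop⟩ with hg
  have hgc : Continuous g := by
    refine ContinuousMap.continuous_of_continuous_uncurry _ ?_
    simp only [hg, Function.uncurry_def, ContinuousMap.coe_mk]
    fun_prop
  have hgm : ∀ h, MeasurePreserving (g h) (volume : Measure (E d)) volume :=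
    fun h => measurePreserving_add_right volume h
  have hcont := (continuous_const (y := hG.toLp G)).compMeasurePreservingLp hgc hgm
    ENNReal.ofReal_ne_top
  have h0 := hcont.tendsto 0
  have hz : Lp.compMeasurePreserving (g 0) (hgm 0) (hG.toLp G) = hG.toLp G := by
    rw [Lp.toLp_compMeasurePreserving]
    congr 1
    funext x
    simp [hg]
  rw [hz, tendsto_iff_edist_tendsto_0] at h0
  have h1 := h0.ennrpow_const p
  rw [ENNReal.zero_rpow_of_pos hp0] at h1
  refine h1.congr fun h => ?_
  rw [Lp.toLp_compMeasurePreserving, Lp.edist_toLp_toLp, eLpNorm_eq_lintegral_rpow_enorm_toReal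
    (by simp [hp0]) ENNReal.ofReal_ne_top, ENNReal.toReal_ofReal hp0.le, ← ENNReal.rpow_mul,
    one_div_mul_cancel hp0.ne', ENNReal.rpow_one]
  simp [shiftInt, hg]

theorem eLpNorm_rpow_eq {α F : Type*} [MeasurableSpace α] [NormedAddCommGroup F] {μ : Measure α}
    (hp : 0 < p) (f : α → F) :
    eLpNorm f (ENNReal.ofReal p) μ ^ p = ∫⁻ x, ‖f x‖ₑ ^ p ∂μ := by
  rw [eLpNorm_eq_lintegral_rpow_enorm_toReal (by simp [hp]) ENNReal.ofReal_ne_top,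
    ENNReal.toReal_ofReal hp.le, ← ENNReal.rpow_mul, one_div_mul_cancel hp.ne', ENNReal.rpow_one]

theorem eLpNorm_eq_rpow {α F : Type*} [MeasurableSpace α] [NormedAddCommGroup F] {μ : Measure α}
    (hp : 0 < p) (f : α → F) :
    eLpNorm f (ENNReal.ofReal p) μ = (∫⁻ x, ‖f x‖ₑ ^ p ∂μ) ^ (1 / p) := by
  rw [eLpNorm_eq_lintegral_rpow_enorm_toReal (by simp [hp]) ENNReal.ofReal_ne_top,
    ENNReal.toReal_ofReal hp.le]

theorem lintegral_rpow_lt_top {α F : Type*} [MeasurableSpace α] [NormedAddCommGroup F]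
    {μ : Measure α} (hp : 0 < p) {f : α → F} (hf : MemLp f (ENNReal.ofReal p) μ) :
    ∫⁻ x, ‖f x‖ₑ ^ p ∂μ < ⊤ := by
  rw [← eLpNorm_rpow_eq hp]
  exact ENNReal.rpow_lt_top_of_nonneg hp.le hf.2.ne

theorem memLp_of_lintegral_lt_top {α F : Type*} [MeasurableSpace α] [NormedAddCommGroup F]
    {μ : Measure α} (hp : 0 < p) {f : α → F} (hm : AEStronglyMeasurable f μ)
    (hf : ∫⁻ x, ‖f x‖ₑ ^ p ∂μ < ⊤) : MemLp f (ENNReal.ofReal p) μ := by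
  refine ⟨hm, ?_⟩
  rw [eLpNorm_eq_rpow hp]
  exact ENNReal.rpow_lt_top_of_nonneg (by positivity) hf.ne

end DifferenceQuotients

/-! ### Radial kernels and polar coordinates -/

section Radial

variable {d : ℕ} {p : ℝ}

theorem lintegral_comp_linearIsometryEquiv (R : E d ≃ₗᵢ[ℝ] E d) (f : E d → ℝ≥0∞) :
    ∫⁻ h, f (R h) = ∫⁻ h, f h :=
  R.measurePreserving.lintegral_comp_emb R.toHomeomorph.measurableEmbedding f

/-- The one-dimensional marginals of a radial measure do not depend on the direction. -/
theorem radial_marginal {n : E d → ℝ≥0∞} (hn : ∀ h k, ‖h‖ = ‖k‖ → n h = n k)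
    (Φ : ℝ → ℝ≥0∞) {v w : E d} (hvw : ‖v‖ = ‖w‖) :
    ∫⁻ h, n h * Φ (inner ℝ h v) = ∫⁻ h, n h * Φ (inner ℝ h w) := by
  set R := (ℝ ∙ (v - w))ᗮ.reflection with hR
  have hRv : R v = w := Submodule.reflection_sub hvw
  rw [← lintegral_comp_linearIsometryEquiv R (fun h => n h * Φ (inner ℝ h w))]
  refine lintegral_congr fun h => ?_
  rw [hn (R h) h (R.norm_map h), ← hRv, R.inner_map_map]

theorem lintegral_polar [NeZero d] {f : E d → ℝ≥0∞} (hf : Measurable f) :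
    ∫⁻ h, f h = ∫⁻ w : Metric.sphere (0 : E d) 1,
      (∫⁻ r in Ioi (0 : ℝ), ENNReal.ofReal (r ^ (d - 1)) * f (r • (w : E d)))
        ∂(volume : Measure (E d)).toSphere := by
  have hmp := (volume : Measure (E d)).measurePreserving_homeomorphUnitSphereProd
  have hfin : Module.finrank ℝ (E d) = d := by simp
  calc ∫⁻ h, f h = ∫⁻ h in ({0}ᶜ : Set (E d)), f h := by rw [restrict_compl_singleton]
    _ = ∫⁻ x : ({0}ᶜ : Set (E d)), f x ∂(Measure.comap Subtype.val volume) :=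
        (lintegral_subtype_comap (measurableSet_singleton _).compl _).symm
    _ = ∫⁻ x : ({0}ᶜ : Set (E d)), (fun z : Metric.sphere (0 : E d) 1 × Ioi (0 : ℝ) =>
          f ((z.2 : ℝ) • (z.1 : E d))) (homeomorphUnitSphereProd (E d) x)
          ∂(Measure.comap Subtype.val volume) := by
        refine lintegral_congr fun x => ?_
        have hx : ‖(x : E d)‖ ≠ 0 := norm_ne_zero_iff.2 x.2
        simp [smul_smul, hx]
    _ = ∫⁻ z : Metric.sphere (0 : E d) 1 × Ioi (0 : ℝ), f ((z.2 : ℝ) • (z.1 : E d))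
          ∂((volume : Measure (E d)).toSphere.prod (Measure.volumeIoiPow (d - 1))) := by
        rw [hfin] at hmp
        exact hmp.lintegral_comp_emb (Homeomorph.measurableEmbedding _)
          (fun z => f ((z.2 : ℝ) • (z.1 : E d)))
    _ = ∫⁻ w : Metric.sphere (0 : E d) 1,
          (∫⁻ r : Ioi (0 : ℝ), f ((r : ℝ) • (w : E d)) ∂(Measure.volumeIoiPow (d - 1)))
          ∂(volume : Measure (E d)).toSphere := by
        rw [lintegral_prod]
        refine Measurable.aemeasurable (hf.comp ?_)
        exact (measurable_subtype_coe.comp measurable_snd).smul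
          (measurable_subtype_coe.comp measurable_fst)
    _ = _ := by
        refine lintegral_congr fun w => ?_
        have hm : Measurable fun r : Ioi (0 : ℝ) => ENNReal.ofReal ((r : ℝ) ^ (d - 1)) :=
          (measurable_subtype_coe.pow_const _).ennreal_ofReal
        rw [Measure.volumeIoiPow, lintegral_withDensity_eq_lintegral_mul₀ hm.aemeasurable]
        · exact lintegral_subtype_comap measurableSet_Ioi
            (fun r : ℝ => ENNReal.ofReal (r ^ (d - 1)) * f (r • (w : E d)))
        · exact (hf.comp (measurable_subtype_coe.smul_const _)).aemeasurable

theorem enorm_rpow_eq_ofReal {F : Type*} [NormedAddCommGroup F] (hp : 0 ≤ p) (a : F) :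
    ‖a‖ₑ ^ p = ENNReal.ofReal (‖a‖ ^ p) := by
  rw [← ofReal_norm, ENNReal.ofReal_rpow_of_nonneg (norm_nonneg _) hp]

theorem K_nonneg [NeZero d] : 0 ≤ K d p := by
  unfold K
  rw [average_eq]
  exact smul_nonneg (by positivity) (integral_nonneg fun _ => by positivity)

theorem ofReal_K [NeZero d] (hp : 0 ≤ p) :
    ENNReal.ofReal (K d p) * (volume : Measure (E d)).toSphere univ =
      ∫⁻ w : Metric.sphere (0 : E d) 1, ‖(w : E d) 0‖ₑ ^ p ∂(volume : Measure (E d)).toSphere := by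
  set σ := (volume : Measure (E d)).toSphere with hσ
  have hcoord : ∀ w : Metric.sphere (0 : E d) 1, |(w : E d) 0| ≤ 1 := by
    intro w
    have h1 := PiLp.norm_apply_le (w : E d) 0
    have h2 : ‖(w : E d)‖ = 1 := by simp
    rw [h2] at h1
    simpa using h1
  have hcont : Continuous fun w : Metric.sphere (0 : E d) 1 => |(w : E d) 0| ^ p :=
    Continuous.rpow_const (by fun_prop) fun _ => Or.inr hp
  have hint : Integrable (fun w : Metric.sphere (0 : E d) 1 => |(w : E d) 0| ^ p) σ := by
    refine Integrable.mono' (integrable_const (1 : ℝ)) hcont.aestronglyMeasurable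
      (Eventually.of_forall fun w => ?_)
    rw [Real.norm_of_nonneg (by positivity)]
    exact Real.rpow_le_one (abs_nonneg _) (hcoord w) hp
  have hσ0 : σ ≠ 0 := Measure.toSphere_ne_zero _
  have hσr : σ.real univ ≠ 0 := by
    rw [Measure.real, ENNReal.toReal_ne_zero]
    exact ⟨by simpa using hσ0, measure_ne_top _ _⟩
  have e1 : K d p * σ.real univ = ∫ w : Metric.sphere (0 : E d) 1, |(w : E d) 0| ^ p ∂σ := by
    unfold K
    rw [average_eq, smul_eq_mul, mul_comm, ← mul_assoc, mul_inv_cancel₀ hσr, one_mul]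
  have e2 : σ univ = ENNReal.ofReal (σ.real univ) := (ENNReal.ofReal_toReal (measure_ne_top _ _)).symm
  rw [e2, ← ENNReal.ofReal_mul K_nonneg, e1, ofReal_integral_eq_lintegral_ofReal hint
    (Eventually.of_forall fun w => by positivity)]
  refine lintegral_congr fun w => ?_
  rw [enorm_rpow_eq_ofReal hp, Real.norm_eq_abs]

theorem norm_single_zero [NeZero d] : ‖(EuclideanSpace.single (0 : Fin d) (1 : ℝ) : E d)‖ = 1 := by
  simp

/-- The defining property of the constant `K_{d,p}`. -/
theorem lintegral_radial_inner [NeZero d] (hp : 0 < p) {n : E d → ℝ≥0∞} (hnm : Measurable n)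
    (hn : ∀ h k, ‖h‖ = ‖k‖ → n h = n k) (ξ : E d) :
    ∫⁻ h, n h * ‖(inner ℝ ξ h : ℝ)‖ₑ ^ p =
      ENNReal.ofReal (K d p) * ‖ξ‖ₑ ^ p * ∫⁻ h, n h * ‖h‖ₑ ^ p := by
  set σ := (volume : Measure (E d)).toSphere with hσ
  set e₀ : E d := EuclideanSpace.single (0 : Fin d) (1 : ℝ) with he₀
  have he₀n : ‖e₀‖ = 1 := norm_single_zero
  have hin : ∀ h : E d, (inner ℝ h e₀ : ℝ) = h 0 := by
    intro h
    rw [he₀, EuclideanSpace.inner_single_right]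
    simp
  -- the radial profile of the kernel
  have hray : ∀ w : Metric.sphere (0 : E d) 1, ∀ r : ℝ, n (r • (w : E d)) = n (r • e₀) := by
    intro w r
    have : ‖(w : E d)‖ = 1 := by simp
    exact hn _ _ (by rw [norm_smul, norm_smul, he₀n, this])
  have hwn : ∀ w : Metric.sphere (0 : E d) 1, ‖(w : E d)‖ₑ = 1 := by
    intro w
    have : ‖(w : E d)‖ = 1 := by simp
    rw [← ofReal_norm, this, ENNReal.ofReal_one]
  set I : ℝ≥0∞ := ∫⁻ r in Ioi (0 : ℝ), ENNReal.ofReal (r ^ (d - 1)) * (n (r • e₀) * ‖r‖ₑ ^ p)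
    with hI
  have hmr : Measurable fun r : ℝ => n (r • e₀) := hnm.comp (measurable_id.smul_const e₀)
  have hm0 : Measurable fun r : ℝ => ENNReal.ofReal (r ^ (d - 1)) * (n (r • e₀) * ‖r‖ₑ ^ p) :=
    (measurable_id.pow_const _).ennreal_ofReal.mul (hmr.mul (measurable_id.enorm.pow_const p))
  have hcoordm : Measurable fun h : E d => h 0 := by fun_prop
  have h2 : ∫⁻ h, n h * ‖h‖ₑ ^ p = I * σ univ := by
    rw [lintegral_polar (f := fun h => n h * ‖h‖ₑ ^ p)
      (hnm.mul (measurable_id.enorm.pow_const p)), ← lintegral_const]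
    refine lintegral_congr fun w => ?_
    rw [hI]
    refine lintegral_congr fun r => ?_
    rw [hray, enorm_smul, hwn, mul_one]
  have h1 : ∫⁻ h, n h * ‖h 0‖ₑ ^ p = I * (ENNReal.ofReal (K d p) * σ univ) := by
    rw [ofReal_K hp.le, lintegral_polar (f := fun h => n h * ‖h 0‖ₑ ^ p)
      (hnm.mul (hcoordm.enorm.pow_const p)),
      ← lintegral_const_mul _ ((by fun_prop : Measurable fun w : Metric.sphere (0 : E d) 1 =>
        ‖(w : E d) 0‖ₑ).pow_const p)]
    refine lintegral_congr fun w => ?_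
    rw [hI, ← lintegral_mul_const _ hm0]
    refine lintegral_congr fun r => ?_
    rw [hray, PiLp.smul_apply, enorm_smul, ENNReal.mul_rpow_of_nonneg _ _ hp.le]
    ring
  have h3 : ∫⁻ h, n h * ‖(inner ℝ ξ h : ℝ)‖ₑ ^ p = ‖ξ‖ₑ ^ p * ∫⁻ h, n h * ‖h 0‖ₑ ^ p := by
    have := radial_marginal hn (fun t => ‖t‖ₑ ^ p) (v := ξ) (w := ‖ξ‖ • e₀)
      (by rw [norm_smul, he₀n]; simp)
    simp_rw [real_inner_comm _ ξ] at this ⊢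
    rw [this, ← lintegral_const_mul' _ _ (by simp [hp.le])]
    refine lintegral_congr fun h => ?_
    rw [inner_smul_right, hin, enorm_mul, enorm_norm, ENNReal.mul_rpow_of_nonneg _ _ hp.le]
    ring
  rw [h3, h1, h2]
  ring

theorem K_pos [NeZero d] (hp : 0 < p) : 0 < K d p := by
  refine lt_of_le_of_ne K_nonneg fun h0 => ?_
  set e₀ : E d := EuclideanSpace.single (0 : Fin d) (1 : ℝ) with he₀
  have hin : ∀ h : E d, (inner ℝ e₀ h : ℝ) = h 0 := by
    intro h
    rw [he₀, EuclideanSpace.inner_single_left]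
    simp
  set n : E d → ℝ≥0∞ := (Metric.ball (0 : E d) 1).indicator fun _ => 1 with hn
  have hnm : Measurable n := measurable_const.indicator measurableSet_ball
  have h1 := lintegral_radial_inner hp hnm (fun h k hk => by
    simp only [hn, indicator, mem_ball_zero_iff, hk]) e₀
  rw [← h0] at h1
  simp only [ENNReal.ofReal_zero, zero_mul] at h1
  have hcoordm : Measurable fun h : E d => h 0 := by fun_prop
  simp_rw [hin] at h1
  rw [lintegral_eq_zero_iff (f := fun h : E d => n h * ‖h 0‖ₑ ^ p) (hnm.mul (hcoordm.enorm.pow_const p))] at h1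
  have hopen : IsOpen (Metric.ball (0 : E d) 1 ∩ {h | h 0 ≠ 0}) :=
    Metric.isOpen_ball.inter (isOpen_ne.preimage (by fun_prop : Continuous fun h : E d => h 0))
  have hne : (Metric.ball (0 : E d) 1 ∩ {h | h 0 ≠ 0}).Nonempty := by
    refine ⟨(1 / 2 : ℝ) • e₀, ?_, ?_⟩
    · rw [mem_ball_zero_iff, norm_smul, he₀, norm_single_zero]; norm_num
    · simp [he₀]
  refine (hopen.measure_pos volume hne).ne' ?_
  refine measure_mono_null (fun h hh => ?_) (ae_iff.1 h1)
  simp only [mem_ofPred_eq, Pi.zero_apply, mul_eq_zero, ENNReal.rpow_eq_zero_iff]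
  rw [hn, indicator_of_mem hh.1]
  have : h 0 ≠ 0 := hh.2
  simp [this]

end Radial

/-! ### Concentration of the kernels at the origin -/

section Concentration

variable {d : ℕ} {p : ℝ}

/-- The weight `1 ∧ |h|ᵖ`. -/
def levyWeight (p : ℝ) (h : E d) : ℝ≥0∞ := min 1 (‖h‖ₑ ^ p)

theorem measurable_levyWeight : Measurable (levyWeight p : E d → ℝ≥0∞) :=
  measurable_const.min (measurable_id.enorm.pow_const p)

theorem ofReal_levyWeight (hp : 0 ≤ p) (h : E d) :
    ENNReal.ofReal (min 1 (‖h‖ ^ p)) = levyWeight p h := by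
  rw [levyWeight, ENNReal.ofReal_min, ENNReal.ofReal_one, enorm_rpow_eq_ofReal hp]

theorem levyWeight_of_norm_le_one (hp : 0 ≤ p) {h : E d} (hh : ‖h‖ ≤ 1) :
    levyWeight p h = ‖h‖ₑ ^ p := by
  refine min_eq_right ?_
  rw [enorm_rpow_eq_ofReal hp]
  simpa using Real.rpow_le_one (norm_nonneg _) hh hp

theorem levyWeight_of_one_le_norm (hp : 0 ≤ p) {h : E d} (hh : 1 ≤ ‖h‖) :
    levyWeight p h = 1 := by
  refine min_eq_left ?_
  rw [enorm_rpow_eq_ofReal hp]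
  simpa using Real.one_le_rpow hh hp

theorem lintegral_ker_levyWeight (hp : 0 ≤ p) {ν : ℝ → RadialLevyKernel d p}
    (hν : IsLevyApproxUnity ν) {ε : ℝ} (hε : ε ∈ Ioo (0 : ℝ) 1) :
    ∫⁻ h, (ν ε).ker h * levyWeight p h = 1 := by
  have h1 := ofReal_integral_eq_lintegral_ofReal (ν ε).integrable
    (Eventually.of_forall fun h => mul_nonneg (by positivity) ((ν ε).nonneg h))
  rw [hν.1 ε hε, ENNReal.ofReal_one] at h1
  rw [h1]
  refine lintegral_congr fun h => ?_
  rw [ENNReal.ofReal_mul (by positivity), ofReal_levyWeight hp, mul_comm]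
  rfl

theorem eventually_Ioo : ∀ᶠ ε : ℝ in 𝓝[>] 0, ε ∈ Ioo (0 : ℝ) 1 :=
  Ioo_mem_nhdsGT one_pos

theorem tendsto_ker_tail (hp : 0 ≤ p) {ν : ℝ → RadialLevyKernel d p}
    (hν : IsLevyApproxUnity ν) {δ : ℝ} (hδ : 0 < δ) :
    Tendsto (fun ε => ∫⁻ h in {h : E d | δ < ‖h‖}, (ν ε).ker h) (𝓝[>] 0) (𝓝 0) := by
  have h0 := (ENNReal.tendsto_ofReal (hν.2 δ hδ))
  rw [ENNReal.ofReal_zero] at h0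
  refine h0.congr fun ε => ?_
  have hms : MeasurableSet {h : E d | δ < ‖h‖} := measurableSet_lt measurable_const measurable_norm
  rw [ofReal_integral_eq_lintegral_ofReal]
  · rfl
  · have h1 : IntegrableOn (fun h => (min 1 (δ ^ p))⁻¹ * (min 1 (‖h‖ ^ p) * ν ε h))
        {h : E d | δ < ‖h‖} := ((ν ε).integrable.const_mul _).integrableOn
    refine Integrable.mono' h1 (ν ε).measurable_toFun.aestronglyMeasurable ?_
    filter_upwards [ae_restrict_mem hms] with h hh
    have hδp : 0 < min 1 (δ ^ p) := lt_min one_pos (Real.rpow_pos_of_pos hδ p)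
    have hle : min 1 (δ ^ p) ≤ min 1 (‖h‖ ^ p) :=
      min_le_min le_rfl (Real.rpow_le_rpow hδ.le (le_of_lt hh) hp)
    rw [Real.norm_of_nonneg ((ν ε).nonneg h), ← mul_assoc]
    refine le_mul_of_one_le_left ((ν ε).nonneg h) ?_
    rw [inv_mul_eq_div]
    exact (one_le_div hδp).2 hle
  · exact Eventually.of_forall fun h => (ν ε).nonneg h

/-- Integrals of functions that are `o(|h|ᵖ)` at the origin against the kernels vanish in the
limit. -/
theorem tendsto_lintegral_ker_zero (hp : 0 ≤ p) {ν : ℝ → RadialLevyKernel d p}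
    (hν : IsLevyApproxUnity ν) {Φ : E d → ℝ≥0∞} {M : ℝ≥0∞} (hM : M ≠ ⊤)
    (hΦM : ∀ h, Φ h ≤ levyWeight p h * M)
    (hΦ0 : ∀ η : ℝ≥0∞, 0 < η → ∃ δ : ℝ, 0 < δ ∧ ∀ h, ‖h‖ < δ → Φ h ≤ η * ‖h‖ₑ ^ p) :
    Tendsto (fun ε => ∫⁻ h, (ν ε).ker h * Φ h) (𝓝[>] 0) (𝓝 0) := by
  rw [ENNReal.tendsto_nhds_zero]
  intro η hη
  obtain ⟨δ, hδ, hδΦ⟩ := hΦ0 (η / 2) (ENNReal.half_pos hη.ne')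
  set δ' := min (δ / 2) (1 / 2) with hδ'
  have hδ'0 : 0 < δ' := lt_min (by linarith) (by norm_num)
  have ht := ENNReal.Tendsto.const_mul (a := M) (tendsto_ker_tail hp hν hδ'0) (Or.inr hM)
  rw [mul_zero, ENNReal.tendsto_nhds_zero] at ht
  filter_upwards [ht (η / 2) (ENNReal.half_pos hη.ne'), eventually_Ioo] with ε hε hε1
  have hms : MeasurableSet {h : E d | δ' < ‖h‖} := measurableSet_lt measurable_const measurable_norm
  calc ∫⁻ h, (ν ε).ker h * Φ h
      ≤ ∫⁻ h, (η / 2 * ((ν ε).ker h * levyWeight p h) +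
          {h : E d | δ' < ‖h‖}.indicator (fun h => M * (ν ε).ker h) h) := by
        refine lintegral_mono fun h => ?_
        by_cases hh : δ' < ‖h‖
        · rw [indicator_of_mem (by exact hh)]
          refine le_add_left ?_
          rw [mul_comm M]
          refine mul_le_mul' le_rfl ((hΦM h).trans ?_)
          calc levyWeight p h * M ≤ 1 * M := mul_le_mul' (min_le_left _ _) le_rfl
            _ = M := one_mul M
        · refine le_add_right ?_
          push Not at hh
          have h1 : ‖h‖ < δ := by
            have := min_le_left (δ / 2) (1 / 2)
            linarith
          have h2 : ‖h‖ ≤ 1 := by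
            have := min_le_right (δ / 2) (1 / 2)
            linarith
          rw [levyWeight_of_norm_le_one hp h2, mul_left_comm]
          exact mul_le_mul' le_rfl (hδΦ h h1)
    _ = η / 2 * (∫⁻ h, (ν ε).ker h * levyWeight p h) +
          M * ∫⁻ h in {h : E d | δ' < ‖h‖}, (ν ε).ker h := by
        have hm1 : Measurable fun h => (ν ε).ker h * levyWeight p h :=
          (ν ε).measurable_ker.mul measurable_levyWeight
        rw [lintegral_add_left (hm1.const_mul _), lintegral_const_mul _ hm1,
          lintegral_indicator hms, lintegral_const_mul _ (ν ε).measurable_ker]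
    _ ≤ η / 2 + η / 2 := by
        rw [lintegral_ker_levyWeight hp hν hε1, mul_one]
        exact add_le_add le_rfl hε
    _ = η := ENNReal.add_halves η

/-- The normalized mass of the kernels concentrates at the origin. -/
theorem tendsto_lintegral_ker_ball (hp : 0 ≤ p) {ν : ℝ → RadialLevyKernel d p}
    (hν : IsLevyApproxUnity ν) {δ : ℝ} (hδ : 0 < δ) (hδ1 : δ ≤ 1) :
    Tendsto (fun ε => ∫⁻ h in {h : E d | ‖h‖ ≤ δ}, (ν ε).ker h * ‖h‖ₑ ^ p) (𝓝[>] 0) (𝓝 1) := by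
  have hms : MeasurableSet {h : E d | ‖h‖ ≤ δ} := measurableSet_le measurable_norm measurable_const
  have hc : {h : E d | ‖h‖ ≤ δ}ᶜ = {h : E d | δ < ‖h‖} := by ext h; simp
  have ht := tendsto_ker_tail hp hν hδ
  have hlow : Tendsto (fun ε => 1 - ∫⁻ h in {h : E d | δ < ‖h‖}, (ν ε).ker h) (𝓝[>] 0) (𝓝 1) := by
    have := ENNReal.Tendsto.sub (tendsto_const_nhds (x := (1 : ℝ≥0∞)) (f := 𝓝[>] (0 : ℝ))) ht
      (Or.inl ENNReal.one_ne_top)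
    simpa using this
  have hsplit : ∀ ε ∈ Ioo (0 : ℝ) 1,
      (∫⁻ h in {h : E d | ‖h‖ ≤ δ}, (ν ε).ker h * ‖h‖ₑ ^ p) +
        ∫⁻ h in {h : E d | δ < ‖h‖}, (ν ε).ker h * levyWeight p h = 1 := by
    intro ε hε
    rw [← lintegral_ker_levyWeight hp hν hε,
      ← lintegral_add_compl (μ := volume) (fun h => (ν ε).ker h * levyWeight p h) hms, hc]
    congr 1
    refine setLIntegral_congr_fun hms fun h hh => ?_
    rw [levyWeight_of_norm_le_one hp (le_trans hh hδ1)]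
  refine tendsto_of_tendsto_of_tendsto_of_le_of_le' hlow tendsto_const_nhds ?_ ?_
  · filter_upwards [eventually_Ioo] with ε hε
    rw [tsub_le_iff_right, ← hsplit ε hε]
    refine add_le_add le_rfl (lintegral_mono fun h => ?_)
    calc _ ≤ (ν ε).ker h * 1 := mul_le_mul' le_rfl (min_le_left _ _)
      _ = _ := mul_one _
  · filter_upwards [eventually_Ioo] with ε hε
    rw [← hsplit ε hε]
    exact le_self_add

/-- Minkowski's inequality for integrals of slices. -/
theorem lintegral_ker_minkowski (hp : 1 ≤ p) {n a b c : E d → ℝ≥0∞} (hn : Measurable n)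
    (hb : Measurable b) (hc : Measurable c)
    (h : ∀ x, a x ^ (1 / p) ≤ b x ^ (1 / p) + c x ^ (1 / p)) :
    (∫⁻ x, n x * a x) ^ (1 / p) ≤ (∫⁻ x, n x * b x) ^ (1 / p) + (∫⁻ x, n x * c x) ^ (1 / p) := by
  have hp0 : 0 < p := by linarith
  have hpp : ∀ t : ℝ≥0∞, (t ^ (1 / p)) ^ p = t := fun t => by
    rw [← ENNReal.rpow_mul, one_div_mul_cancel hp0.ne', ENNReal.rpow_one]
  have hpp' : ∀ t : ℝ≥0∞, (t ^ p) ^ (1 / p) = t := fun t => by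
    rw [← ENNReal.rpow_mul, mul_one_div_cancel hp0.ne', ENNReal.rpow_one]
  have key := ENNReal.lintegral_Lp_add_le (μ := volume)
    (f := fun x => (n x * b x) ^ (1 / p)) (g := fun x => (n x * c x) ^ (1 / p))
    ((hn.mul hb).pow_const _).aemeasurable ((hn.mul hc).pow_const _).aemeasurable hp
  simp only [hpp, Pi.add_apply] at key
  refine le_trans (ENNReal.rpow_le_rpow (lintegral_mono fun x => ?_) (by positivity)) key
  calc n x * a x = ((n x * a x) ^ (1 / p)) ^ p := (hpp _).symm
    _ ≤ _ := by
        refine ENNReal.rpow_le_rpow ?_ hp0.le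
        simp only [ENNReal.mul_rpow_of_nonneg _ _ (by positivity : 0 ≤ 1 / p), ← mul_add]
        exact mul_le_mul' le_rfl (h x)

end Concentration

/-! ### Nonlocal energies of Sobolev functions -/

section SobolevEnergies

variable {d : ℕ} {p : ℝ}

/-- The remainder of the first order Taylor expansion of `u` in `Lᵖ(ℝᵈ)`. -/
def taylorInt (p : ℝ) (u : E d → ℝ) (G : E d → E d) (h : E d) : ℝ≥0∞ :=
  ∫⁻ x, ‖u (x + h) - u x - inner ℝ (G x) h‖ₑ ^ p

theorem measurable_taylorInt {u : E d → ℝ} (hu : AEMeasurable u) {G : E d → E d}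
    (hG : Measurable G) : Measurable (taylorInt p u G) := by
  have e : taylorInt p u G = taylorInt p (hu.mk u) G := by
    funext h
    refine lintegral_congr_ae ?_
    filter_upwards [hu.ae_eq_mk, ae_add_const hu.ae_eq_mk h] with x hx hx'
    rw [hx, hx']
  rw [e]
  have hm := hu.measurable_mk
  refine Measurable.lintegral_prod_right' (f := fun z : E d × E d =>
    ‖hu.mk u (z.2 + z.1) - hu.mk u z.2 - inner ℝ (G z.2) z.1‖ₑ ^ p) ?_
  exact ((((hm.comp (measurable_snd.add measurable_fst)).sub
      (hm.comp measurable_snd))).sub ((hG.comp measurable_snd).inner measurable_fst)).enorm.pow_const p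

variable {u : E d → ℝ} {G : E d → E d}

/-- Sobolev functions are differentiable in `Lᵖ(ℝᵈ)`. -/
theorem taylorInt_small (hp : 1 ≤ p) (hu : IsWeakGrad univ u G)
    (hup : MemLp u (ENNReal.ofReal p) volume) (hGm : Measurable G)
    (hGp : MemLp G (ENNReal.ofReal p) volume) (η : ℝ≥0∞) (hη : 0 < η) :
    ∃ δ : ℝ, 0 < δ ∧ ∀ h, ‖h‖ < δ → taylorInt p u G h ≤ η * ‖h‖ₑ ^ p := by
  have hp1 : 1 ≤ ENNReal.ofReal p := by simpa using hp
  have h0 := tendsto_shiftInt_univ hp hGp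
  rw [ENNReal.tendsto_nhds_zero] at h0
  obtain ⟨δ, hδ, hball⟩ := Metric.eventually_nhds_iff.1 (h0 η hη)
  refine ⟨δ, hδ, fun h hh => ?_⟩
  refine (lintegral_taylor_le hp hu (hup.locallyIntegrable hp1) hGm
    (hGp.locallyIntegrable hp1) h).trans ?_
  rw [mul_comm]
  refine mul_le_mul' ?_ le_rfl
  calc ∫⁻ s in Ioc (0 : ℝ) 1, shiftInt p univ univ G (s • h)
      ≤ ∫⁻ s in Ioc (0 : ℝ) 1, η := by
        refine setLIntegral_mono' measurableSet_Ioc fun s hs => hball ?_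
        rw [dist_zero_right, norm_smul, Real.norm_of_nonneg hs.1.le]
        exact lt_of_le_of_lt (mul_le_of_le_one_left (norm_nonneg _) hs.2) hh
    _ = η := by simp

theorem shiftInt_le_levyWeight (hp : 1 ≤ p) (hu : IsWeakGrad univ u G)
    (hup : MemLp u (ENNReal.ofReal p) volume) (hGm : Measurable G)
    (hGp : MemLp G (ENNReal.ofReal p) volume) (h : E d) :
    shiftInt p univ univ u h ≤
      levyWeight p h * (2 ^ p * (∫⁻ x, ‖u x‖ₑ ^ p) + ∫⁻ x, ‖G x‖ₑ ^ p) := by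
  have hp0 : 0 ≤ p := by linarith
  have hp1 : 1 ≤ ENNReal.ofReal p := by simpa using hp
  rcases le_total ‖h‖ 1 with hh | hh
  · rw [levyWeight_of_norm_le_one hp0 hh]
    have := lintegral_shift_sub_le hp MeasurableSet.univ isOpen_univ hu
      (hup.locallyIntegrable hp1) hGm (hGp.locallyIntegrable hp1) h fun _ _ _ _ => mem_univ _
    calc shiftInt p univ univ u h ≤ ‖h‖ₑ ^ p * ∫⁻ x, ‖G x‖ₑ ^ p := by
          simpa [shiftInt] using this
      _ ≤ _ := mul_le_mul' le_rfl le_add_self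
  · rw [levyWeight_of_one_le_norm hp0 hh, one_mul]
    exact (shiftInt_le_lintegral hp _ _ hup.1.aemeasurable h).trans le_self_add

theorem sobolev_bound_ne_top (hp : 1 ≤ p) (hup : MemLp u (ENNReal.ofReal p) volume)
    (hGp : MemLp G (ENNReal.ofReal p) volume) :
    2 ^ p * (∫⁻ x, ‖u x‖ₑ ^ p) + ∫⁻ x, ‖G x‖ₑ ^ p ≠ ⊤ := by
  have hp0 : 0 < p := by linarith
  refine ENNReal.add_ne_top.2 ⟨ENNReal.mul_ne_top (by simp) ?_, ?_⟩
  · exact (lintegral_rpow_lt_top hp0 hup).ne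
  · exact (lintegral_rpow_lt_top hp0 hGp).ne

theorem energy_univ_le (hp : 1 ≤ p) {ν : ℝ → RadialLevyKernel d p} (hν : IsLevyApproxUnity ν)
    (hu : IsWeakGrad univ u G) (hup : MemLp u (ENNReal.ofReal p) volume) (hGm : Measurable G)
    (hGp : MemLp G (ENNReal.ofReal p) volume) {ε : ℝ} (hε : ε ∈ Ioo (0 : ℝ) 1) :
    energy univ (ν ε) u ≤ 2 ^ p * (∫⁻ x, ‖u x‖ₑ ^ p) + ∫⁻ x, ‖G x‖ₑ ^ p := by
  have hp0 : 0 ≤ p := by linarith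
  rw [← univ_prod_univ, energy_prod hp0 _ MeasurableSet.univ MeasurableSet.univ hup.1.aemeasurable]
  calc ∫⁻ h, (ν ε).ker h * shiftInt p univ univ u h
      ≤ ∫⁻ h, ((ν ε).ker h * levyWeight p h) *
          (2 ^ p * (∫⁻ x, ‖u x‖ₑ ^ p) + ∫⁻ x, ‖G x‖ₑ ^ p) := by
        refine lintegral_mono fun h => ?_
        rw [mul_assoc]
        exact mul_le_mul' le_rfl (shiftInt_le_levyWeight hp hu hup hGm hGp h)
    _ = _ := by
        rw [lintegral_mul_const' _ _ (sobolev_bound_ne_top hp hup hGp),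
          lintegral_ker_levyWeight hp0 hν hε, one_mul]

/-- The nonlocal energies of a Sobolev function converge to its local energy. -/
theorem tendsto_energy_univ_right [NeZero d] (hp : 1 ≤ p) {ν : ℝ → RadialLevyKernel d p}
    (hν : IsLevyApproxUnity ν)
    (hu : IsWeakGrad univ u G) (hup : MemLp u (ENNReal.ofReal p) volume) (hGm : Measurable G)
    (hGp : MemLp G (ENNReal.ofReal p) volume) {A : Set (E d)} (hA : MeasurableSet A) :
    Tendsto (fun ε => energy (A ×ˢ univ) (ν ε) u) (𝓝[>] 0)
      (𝓝 (ENNReal.ofReal (K d p) * ∫⁻ x in A, ‖G x‖ₑ ^ p)) := by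
  have hp0 : 0 < p := by linarith
  have hum := hup.1.aemeasurable
  set c := ENNReal.ofReal (K d p) * ∫⁻ x in A, ‖G x‖ₑ ^ p with hc
  set B : Set (E d) := {h : E d | ‖h‖ ≤ 1} with hB
  have hBm : MeasurableSet B := measurableSet_le measurable_norm measurable_const
  set X : E d → ℝ≥0∞ := B.indicator fun h => ∫⁻ x in A, ‖(inner ℝ (G x) h : ℝ)‖ₑ ^ p with hX
  set R : E d → ℝ≥0∞ := fun h => B.indicator (taylorInt p u G) h +
    Bᶜ.indicator (shiftInt p univ univ u) h with hR
  set Y : E d → ℝ≥0∞ := shiftInt p A univ u with hY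
  have hinm : Measurable fun z : E d × E d => ‖(inner ℝ (G z.2) z.1 : ℝ)‖ₑ ^ p :=
    ((hGm.comp measurable_snd).inner measurable_fst).enorm.pow_const p
  have hXm : Measurable X := Measurable.indicator (Measurable.lintegral_prod_right' hinm) hBm
  have hRm : Measurable R := ((measurable_taylorInt hum hGm).indicator hBm).add
    ((measurable_shiftInt p MeasurableSet.univ MeasurableSet.univ hum).indicator hBm.compl)
  have hYm : Measurable Y := measurable_shiftInt p hA MeasurableSet.univ hum
  have hYe : ∀ h, Y h = ∫⁻ x in A, ‖u (x + h) - u x‖ₑ ^ p := fun h => by simp [hY, shiftInt]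
  -- two forms of the triangle inequality in `Lᵖ(A)`
  have hdm : ∀ h, AEMeasurable (fun x => u (x + h) - u x) (volume.restrict A) := fun h =>
    ((aemeasurable_shift hum h).sub hum).restrict
  have him : ∀ h, AEMeasurable (fun x => (inner ℝ (G x) h : ℝ)) (volume.restrict A) := fun h =>
    (hGm.inner_const).aemeasurable
  have hmink : ∀ f g k : E d → ℝ, AEMeasurable g (volume.restrict A) →
      AEMeasurable k (volume.restrict A) → (∀ x, f x = g x + k x) →
      (∫⁻ x in A, ‖f x‖ₑ ^ p) ^ (1 / p) ≤
        (∫⁻ x in A, ‖g x‖ₑ ^ p) ^ (1 / p) + (∫⁻ x in A, ‖k x‖ₑ ^ p) ^ (1 / p) := by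
    intro f g k hg hk hfgk
    refine le_trans (ENNReal.rpow_le_rpow (lintegral_mono fun x => ?_) (by positivity))
      (ENNReal.lintegral_Lp_add_le hg.enorm hk.enorm hp)
    rw [hfgk x]
    exact ENNReal.rpow_le_rpow (enorm_add_le _ _) hp0.le
  have hTle : ∀ h, ∫⁻ x in A, ‖u (x + h) - u x - inner ℝ (G x) h‖ₑ ^ p ≤ taylorInt p u G h :=
    fun h => setLIntegral_le_lintegral _ _
  have hYX : ∀ h, Y h ^ (1 / p) ≤ X h ^ (1 / p) + R h ^ (1 / p) := by
    intro h
    by_cases hh : h ∈ B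
    · simp only [hX, hR, indicator_of_mem hh, indicator_of_notMem (fun h' : h ∈ Bᶜ => h' hh),
        add_zero]
      rw [hYe]
      refine (hmink _ (fun x => inner ℝ (G x) h) (fun x => u (x + h) - u x - inner ℝ (G x) h) (him h)
        ((hdm h).sub (him h)) fun x => by ring).trans ?_
      exact add_le_add le_rfl (ENNReal.rpow_le_rpow (hTle h) (by positivity))
    · have hh' : h ∈ Bᶜ := hh
      simp only [hX, hR, indicator_of_notMem hh, indicator_of_mem hh', zero_add]
      refine le_add_left (ENNReal.rpow_le_rpow ?_ (by positivity))
      exact shiftInt_mono p (subset_univ _) subset_rfl u h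
  have hXY : ∀ h, X h ^ (1 / p) ≤ Y h ^ (1 / p) + R h ^ (1 / p) := by
    intro h
    by_cases hh : h ∈ B
    · simp only [hX, hR, indicator_of_mem hh, indicator_of_notMem (fun h' : h ∈ Bᶜ => h' hh),
        add_zero]
      rw [hYe]
      refine (hmink _ (fun x => u (x + h) - u x) (fun x => inner ℝ (G x) h - (u (x + h) - u x))
        (hdm h) ((him h).sub (hdm h)) fun x => by ring).trans ?_
      refine add_le_add le_rfl (ENNReal.rpow_le_rpow (le_trans (le_of_eq ?_) (hTle h))
        (by positivity))
      refine lintegral_congr fun x => ?_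
      rw [← enorm_neg, neg_sub]
    · simp only [hX, indicator_of_notMem hh]
      rw [ENNReal.zero_rpow_of_pos (by positivity)]
      exact zero_le
  -- the remainder vanishes in the limit
  have hRlim : Tendsto (fun ε => (∫⁻ h, (ν ε).ker h * R h) ^ (1 / p)) (𝓝[>] 0) (𝓝 0) := by
    have hsm := taylorInt_small hp hu hup hGm hGp
    obtain ⟨N, hN⟩ : ∃ N : ℝ≥0∞, N = ∫⁻ x, ‖G x‖ₑ ^ p := ⟨_, rfl⟩
    have hNt : N ≠ ⊤ := by rw [hN]; exact (lintegral_rpow_lt_top hp0 hGp).ne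
    have hTb : ∀ h, taylorInt p u G h ≤ ‖h‖ₑ ^ p * (2 ^ p * N) := by
      intro h
      have hp1 : 1 ≤ ENNReal.ofReal p := by simpa using hp
      refine (lintegral_taylor_le hp hu (hup.locallyIntegrable hp1) hGm
        (hGp.locallyIntegrable hp1) h).trans (mul_le_mul' le_rfl ?_)
      calc ∫⁻ s in Ioc (0 : ℝ) 1, shiftInt p univ univ G (s • h)
          ≤ ∫⁻ s in Ioc (0 : ℝ) 1, 2 ^ p * N := by
            refine lintegral_mono fun s => ?_
            rw [hN]
            exact shiftInt_le_lintegral hp _ _ hGm.aemeasurable _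
        _ = _ := by simp
    have h0 := tendsto_lintegral_ker_zero hp0.le hν (Φ := R)
      (M := 2 ^ p * N + (2 ^ p * (∫⁻ x, ‖u x‖ₑ ^ p) + ∫⁻ x, ‖G x‖ₑ ^ p))
      (ENNReal.add_ne_top.2 ⟨ENNReal.mul_ne_top (by simp) hNt,
        sobolev_bound_ne_top hp hup hGp⟩) ?_ ?_
    · have := h0.ennrpow_const (1 / p)
      rwa [ENNReal.zero_rpow_of_pos (by positivity)] at this
    · intro h
      by_cases hh : h ∈ B
      · simp only [hR, indicator_of_mem hh, indicator_of_notMem (fun h' : h ∈ Bᶜ => h' hh),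
          add_zero]
        rw [levyWeight_of_norm_le_one hp0.le hh]
        exact (hTb h).trans (mul_le_mul' le_rfl le_self_add)
      · have hh' : h ∈ Bᶜ := hh
        simp only [hR, indicator_of_notMem hh, indicator_of_mem hh', zero_add]
        exact (shiftInt_le_levyWeight hp hu hup hGm hGp h).trans (mul_le_mul' le_rfl le_add_self)
    · intro η hη
      obtain ⟨δ, hδ, hδT⟩ := hsm η hη
      refine ⟨min δ 1, lt_min hδ one_pos, fun h hh => ?_⟩
      have hhB : h ∈ B := (hh.trans_le (min_le_right _ _)).le
      simp only [hR, indicator_of_mem hhB, indicator_of_notMem (fun h' : h ∈ Bᶜ => h' hhB),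
        add_zero]
      exact hδT h (hh.trans_le (min_le_left _ _))
  -- the main term
  have hXlim : Tendsto (fun ε => (∫⁻ h, (ν ε).ker h * X h) ^ (1 / p)) (𝓝[>] 0)
      (𝓝 (c ^ (1 / p))) := by
    have hcT : c ≠ ⊤ := by
      rw [hc]
      refine ENNReal.mul_ne_top ENNReal.ofReal_ne_top (ne_top_of_le_ne_top
        (lintegral_rpow_lt_top hp0 hGp).ne (setLIntegral_le_lintegral _ _))
    have hval : ∀ ε, ∫⁻ h, (ν ε).ker h * X h = c * ∫⁻ h in B, (ν ε).ker h * ‖h‖ₑ ^ p := by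
      intro ε
      have hkm := (ν ε).measurable_ker
      set n : E d → ℝ≥0∞ := B.indicator (ν ε).ker with hn
      have hnm : Measurable n := hkm.indicator hBm
      have hnr : ∀ h k, ‖h‖ = ‖k‖ → n h = n k := by
        intro h k hk
        by_cases hh : h ∈ B
        · have hk' : k ∈ B := by rw [hB, mem_ofPred_eq, ← hk]; exact hh
          rw [hn, indicator_of_mem hh, indicator_of_mem hk', (ν ε).ker_congr hk]
        · have hk' : k ∉ B := by rw [hB, mem_ofPred_eq, ← hk]; exact hh
          rw [hn, indicator_of_notMem hh, indicator_of_notMem hk']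
      have e1 : ∀ h, (ν ε).ker h * X h = ∫⁻ x in A, n h * ‖(inner ℝ (G x) h : ℝ)‖ₑ ^ p := by
        intro h
        by_cases hh : h ∈ B
        · rw [hX, hn, indicator_of_mem hh, indicator_of_mem hh,
            lintegral_const_mul' _ _ (by exact ENNReal.ofReal_ne_top)]
        · rw [hX, hn, indicator_of_notMem hh, indicator_of_notMem hh]; simp
      have e2 : ∫⁻ h in B, (ν ε).ker h * ‖h‖ₑ ^ p = ∫⁻ h, n h * ‖h‖ₑ ^ p := by
        rw [← lintegral_indicator hBm]
        refine lintegral_congr fun h => ?_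
        by_cases hh : h ∈ B
        · rw [hn, indicator_of_mem hh, indicator_of_mem hh]
        · rw [hn, indicator_of_notMem hh, indicator_of_notMem hh, zero_mul]
      simp_rw [e1]
      rw [lintegral_lintegral_swap, e2]
      · simp_rw [lintegral_radial_inner hp0 hnm hnr]
        rw [lintegral_mul_const, lintegral_const_mul _ (hGm.enorm.pow_const p)]
        exact (hGm.enorm.pow_const p).const_mul _
      · exact ((hnm.comp measurable_fst).mul hinm).aemeasurable
    simp_rw [hval]
    have := ENNReal.Tendsto.const_mul (a := c)
      (tendsto_lintegral_ker_ball hp0.le hν one_pos le_rfl) (Or.inr hcT)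
    rw [mul_one] at this
    exact this.ennrpow_const _
  have hYlim : Tendsto (fun ε => (∫⁻ h, (ν ε).ker h * Y h) ^ (1 / p)) (𝓝[>] 0)
      (𝓝 (c ^ (1 / p))) := by
    have hlow := ENNReal.Tendsto.sub hXlim hRlim (Or.inr ENNReal.zero_ne_top)
    have hupp := hXlim.add hRlim
    rw [tsub_zero] at hlow
    rw [add_zero] at hupp
    refine tendsto_of_tendsto_of_tendsto_of_le_of_le hlow hupp (fun ε => ?_) fun ε => ?_
    · simp only [tsub_le_iff_right]
      exact lintegral_ker_minkowski hp (ν ε).measurable_ker hYm hRm hXY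
    · exact lintegral_ker_minkowski hp (ν ε).measurable_ker hXm hRm hYX
  have hfin := hYlim.ennrpow_const p
  simp only [← ENNReal.rpow_mul, one_div_mul_cancel hp0.ne', ENNReal.rpow_one] at hfin
  refine hfin.congr fun ε => ?_
  rw [energy_prod hp0.le _ hA MeasurableSet.univ hum]

/-- The energy of a Sobolev function across the boundary of an open set vanishes in the limit. -/
theorem tendsto_energy_cross (hp : 1 ≤ p) {ν : ℝ → RadialLevyKernel d p}
    (hν : IsLevyApproxUnity ν)
    (hu : IsWeakGrad univ u G) (hup : MemLp u (ENNReal.ofReal p) volume) (hGm : Measurable G)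
    (hGp : MemLp G (ENNReal.ofReal p) volume) {A : Set (E d)} (hA : IsOpen A) :
    Tendsto (fun ε => energy (A ×ˢ Aᶜ) (ν ε) u) (𝓝[>] 0) (𝓝 0) := by
  have hp0 : 0 < p := by linarith
  have hum := hup.1.aemeasurable
  have hAm := hA.measurableSet
  have hY : Tendsto (fun h : E d => ∫⁻ x in {x | x ∈ A ∧ x + h ∈ Aᶜ}, ‖G x‖ₑ ^ p) (𝓝 0) (𝓝 0) := by
    have hT := tendsto_lintegral_filter_of_dominated_convergence (μ := (volume : Measure (E d)))
      (l := 𝓝 (0 : E d))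
      (F := fun h x => {x | x ∈ A ∧ x + h ∈ Aᶜ}.indicator (fun x => ‖G x‖ₑ ^ p) x)
      (f := fun _ => 0) (fun x => ‖G x‖ₑ ^ p)
      (Eventually.of_forall fun h =>
        (hGm.enorm.pow_const p).indicator (measurableSet_slice hAm hAm.compl h))
      (Eventually.of_forall fun h => Eventually.of_forall fun x => indicator_le_self _ _ x)
      (lintegral_rpow_lt_top hp0 hGp).ne (Eventually.of_forall fun x => ?_)
    · simp only [lintegral_zero] at hT
      refine hT.congr fun h => ?_
      rw [lintegral_indicator (measurableSet_slice hAm hAm.compl h)]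
    · refine tendsto_const_nhds.congr' ?_
      by_cases hx : x ∈ A
      · have : ∀ᶠ h : E d in 𝓝 0, x + h ∈ A := by
          have hc : Tendsto (fun h : E d => x + h) (𝓝 0) (𝓝 x) := by
            have : Continuous fun h : E d => x + h := by fun_prop
            simpa using this.tendsto 0
          exact hc (hA.mem_nhds hx)
        filter_upwards [this] with h hh
        exact (indicator_of_notMem (fun h' => h'.2 hh) _).symm
      · refine Eventually.of_forall fun h => ?_
        exact (indicator_of_notMem (fun h' => hx h'.1) _).symm
  have hle : ∀ h, shiftInt p A Aᶜ u h ≤ 2 ^ (p - 1) *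
      (taylorInt p u G h + ‖h‖ₑ ^ p * ∫⁻ x in {x | x ∈ A ∧ x + h ∈ Aᶜ}, ‖G x‖ₑ ^ p) := by
    intro h
    set S := {x | x ∈ A ∧ x + h ∈ Aᶜ} with hS
    calc shiftInt p A Aᶜ u h
        ≤ ∫⁻ x in S, 2 ^ (p - 1) *
            (‖u (x + h) - u x - inner ℝ (G x) h‖ₑ ^ p + ‖h‖ₑ ^ p * ‖G x‖ₑ ^ p) := by
          refine lintegral_mono fun x => ?_
          have h1 : ‖u (x + h) - u x‖ₑ ≤
              ‖u (x + h) - u x - inner ℝ (G x) h‖ₑ + ‖h‖ₑ * ‖G x‖ₑ := by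
            calc ‖u (x + h) - u x‖ₑ = ‖(u (x + h) - u x - inner ℝ (G x) h) + inner ℝ (G x) h‖ₑ := by
                  rw [sub_add_cancel]
              _ ≤ _ := by
                  refine (enorm_add_le _ _).trans (add_le_add le_rfl ?_)
                  rw [← enorm_norm (G x), ← enorm_norm h, ← enorm_mul]
                  refine enorm_le_iff_norm_le.2 ?_
                  rw [norm_mul, norm_norm, norm_norm, mul_comm]
                  exact norm_inner_le_norm _ _
          refine (ENNReal.rpow_le_rpow h1 hp0.le).trans ?_
          rw [← ENNReal.mul_rpow_of_nonneg _ _ hp0.le]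
          exact ENNReal.rpow_add_le_mul_rpow_add_rpow _ _ hp
      _ = 2 ^ (p - 1) * ((∫⁻ x in S, ‖u (x + h) - u x - inner ℝ (G x) h‖ₑ ^ p) +
            ‖h‖ₑ ^ p * ∫⁻ x in S, ‖G x‖ₑ ^ p) := by
          rw [lintegral_const_mul' _ _ (by simp), lintegral_add_right _
            ((hGm.enorm.pow_const p).const_mul _), lintegral_const_mul _ (hGm.enorm.pow_const p)]
      _ ≤ _ := mul_le_mul' le_rfl (add_le_add (setLIntegral_le_lintegral _ _) le_rfl)
  have h0 := tendsto_lintegral_ker_zero hp0.le hν (Φ := shiftInt p A Aᶜ u)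
    (sobolev_bound_ne_top hp hup hGp)
    (fun h => (shiftInt_mono p (subset_univ _) (subset_univ _) u h).trans
      (shiftInt_le_levyWeight hp hu hup hGm hGp h)) ?_
  · refine h0.congr fun ε => ?_
    rw [energy_prod hp0.le _ hAm hAm.compl hum]
  · intro η hη
    set κ : ℝ≥0∞ := η / (2 ^ (p - 1) * 2) with hκ
    have hden : (2 : ℝ≥0∞) ^ (p - 1) * 2 ≠ ⊤ := ENNReal.mul_ne_top (by simp) (by simp)
    have hden0 : (2 : ℝ≥0∞) ^ (p - 1) * 2 ≠ 0 := by simp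
    have hκ0 : 0 < κ := ENNReal.div_pos hη.ne' hden
    obtain ⟨δ₁, hδ₁, h1⟩ := taylorInt_small hp hu hup hGm hGp κ hκ0
    rw [ENNReal.tendsto_nhds_zero] at hY
    obtain ⟨δ₂, hδ₂, h2⟩ := Metric.eventually_nhds_iff.1 (hY κ hκ0)
    refine ⟨min δ₁ δ₂, lt_min hδ₁ hδ₂, fun h hh => (hle h).trans ?_⟩
    have a1 := h1 h (hh.trans_le (min_le_left _ _))
    have a2 := h2 (y := h) (by rw [dist_zero_right]; exact hh.trans_le (min_le_right _ _))
    calc _ ≤ 2 ^ (p - 1) * (κ * ‖h‖ₑ ^ p + ‖h‖ₑ ^ p * κ) :=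
          mul_le_mul' le_rfl (add_le_add a1 (mul_le_mul' le_rfl a2))
      _ = (2 ^ (p - 1) * 2 * κ) * ‖h‖ₑ ^ p := by ring
      _ = η * ‖h‖ₑ ^ p := by rw [hκ, ENNReal.mul_div_cancel hden0 hden]

theorem tendsto_energy_hull [NeZero d] (hp : 1 ≤ p) {ν : ℝ → RadialLevyKernel d p}
    (hν : IsLevyApproxUnity ν)
    (hu : IsWeakGrad univ u G) (hup : MemLp u (ENNReal.ofReal p) volume) (hGm : Measurable G)
    (hGp : MemLp G (ENNReal.ofReal p) volume) {A : Set (E d)} (hA : IsOpen A) :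
    Tendsto (fun ε => energy (hullRegion A) (ν ε) u) (𝓝[>] 0)
      (𝓝 (ENNReal.ofReal (K d p) * ∫⁻ x in A, ‖G x‖ₑ ^ p)) := by
  have h1 := (tendsto_energy_univ_right hp hν hu hup hGm hGp hA.measurableSet).add
    (tendsto_energy_cross hp hν hu hup hGm hGp hA)
  rw [add_zero] at h1
  refine h1.congr fun ε => ?_
  rw [energy_hull _ hA.measurableSet, energy_prod_comm (by linarith) _ hA.measurableSet.compl
    hA.measurableSet hup.1.aemeasurable]

end SobolevEnergies

/-! ### Ball energies -/

section BallEnergies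

variable {d : ℕ} {p : ℝ}

/-- The unnormalized `p`-energy of `u` over `A × A` at scale `r`:
`∬_{A × A, |x - y| < r} |u(x) - u(y)|ᵖ dx dy`. -/
def ballInt (p : ℝ) (A : Set (E d)) (u : E d → ℝ) (r : ℝ) : ℝ≥0∞ :=
  ∫⁻ h in Metric.ball 0 r, shiftInt p A A u h

theorem lintegral_comp_smul_eq (f : E d → ℝ≥0∞) {r : ℝ} (hr : 0 < r) :
    ∫⁻ x, f x = ENNReal.ofReal (r ^ d) * ∫⁻ x, f (r • x) := by
  have hm : MeasurableEmbedding (fun x : E d => r • x) :=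
    (Homeomorph.smulOfNeZero r hr.ne').measurableEmbedding
  have h1 := hm.lintegral_map (μ := volume) f
  rw [Measure.map_addHaar_smul volume hr.ne', lintegral_smul_measure, finrank_euclideanSpace,
    Fintype.card_fin, smul_eq_mul] at h1
  rw [← h1, ← mul_assoc, ← ENNReal.ofReal_mul (by positivity), abs_of_pos (by positivity),
    mul_inv_cancel₀ (by positivity), ENNReal.ofReal_one, one_mul]

theorem setLIntegral_ball_smul (f : E d → ℝ≥0∞) {s r : ℝ} (hs : 0 < s) :
    ∫⁻ x in Metric.ball 0 (s * r), f x =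
      ENNReal.ofReal (s ^ d) * ∫⁻ x in Metric.ball 0 r, f (s • x) := by
  rw [← lintegral_indicator measurableSet_ball, ← lintegral_indicator measurableSet_ball,
    lintegral_comp_smul_eq _ hs]
  congr 1
  refine lintegral_congr fun x => ?_
  have hiff : s • x ∈ Metric.ball (0 : E d) (s * r) ↔ x ∈ Metric.ball (0 : E d) r := by
    rw [mem_ball_zero_iff, mem_ball_zero_iff, norm_smul, Real.norm_of_nonneg hs.le,
      mul_lt_mul_iff_right₀ hs]
  by_cases hx : x ∈ Metric.ball (0 : E d) r
  · rw [indicator_of_mem hx, indicator_of_mem (hiff.2 hx)]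
  · rw [indicator_of_notMem hx, indicator_of_notMem (fun h => hx (hiff.1 h))]

theorem ballInt_mono_radius (A : Set (E d)) (u : E d → ℝ) {r s : ℝ} (h : r ≤ s) :
    ballInt p A u r ≤ ballInt p A u s :=
  lintegral_mono_set (Metric.ball_subset_ball h)

/-- On convex sets the energy at a large scale is controlled by the energy at a small scale. -/
theorem ballInt_nsmul_le (hp : 1 ≤ p) {A : Set (E d)} (hA : MeasurableSet A) (hc : Convex ℝ A)
    {u : E d → ℝ} (hu : AEMeasurable u) (r : ℝ) {N : ℕ} (hN : 0 < N) :
    ballInt p A u (N * r) ≤ ENNReal.ofReal ((N : ℝ) ^ (d + p)) * ballInt p A u r := by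
  have hN' : (0 : ℝ) < N := by exact_mod_cast hN
  have hp0 : 0 ≤ p := by linarith
  unfold ballInt
  rw [setLIntegral_ball_smul _ hN', Real.rpow_add hN', Real.rpow_natCast,
    ENNReal.ofReal_mul (by positivity), mul_assoc]
  refine mul_le_mul' le_rfl ?_
  rw [← lintegral_const_mul' _ _ ENNReal.ofReal_ne_top]
  refine lintegral_mono fun k => ?_
  have e : ENNReal.ofReal ((N : ℝ) ^ p) = (N : ℝ≥0∞) ^ p := by
    rw [← ENNReal.ofReal_rpow_of_nonneg hN'.le hp0, ENNReal.ofReal_natCast]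
  rw [e, Nat.cast_smul_eq_nsmul]
  refine shiftInt_nsmul_le hp hA hA hu k N fun x hx hxN j hj => ?_
  have := hc.add_smul_mem hx hxN (t := (j : ℝ) / N)
    ⟨by positivity, (div_le_one hN').2 (by exact_mod_cast hj)⟩
  rw [← Nat.cast_smul_eq_nsmul ℝ N k, smul_smul, div_mul_cancel₀ _ hN'.ne',
    Nat.cast_smul_eq_nsmul] at this
  exact this

/-- Averaging over two-step paths bounds a single slice by a ball energy. -/
theorem shiftInt_mul_volume_le (hp : 1 ≤ p) {u : E d → ℝ} (hu : AEMeasurable u) {r : ℝ}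
    {h : E d} (hh : ‖h‖ ≤ r / 2) :
    shiftInt p univ univ u h * volume (Metric.ball (0 : E d) (r / 2)) ≤
      2 ^ p * ballInt p univ u r := by
  have hFm := measurable_shiftInt p MeasurableSet.univ MeasurableSet.univ hu
  set B := Metric.ball (0 : E d) (r / 2) with hB
  have hBm : MeasurableSet B := measurableSet_ball
  have e2 : (2 : ℝ≥0∞) ^ p = 2 ^ (p - 1) * 2 := by
    conv_lhs => rw [show p = (p - 1) + 1 by ring]
    rw [ENNReal.rpow_add _ _ (by simp) (by simp), ENNReal.rpow_one]
  have h1 : ∫⁻ k in B, shiftInt p univ univ u k ≤ ballInt p univ u r := by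
    refine lintegral_mono_set fun k hk => ?_
    rw [hB, mem_ball_zero_iff] at hk
    rw [mem_ball_zero_iff]
    have := norm_nonneg k
    linarith
  have h2 : ∫⁻ k in B, shiftInt p univ univ u (h - k) ≤ ballInt p univ u r := by
    unfold ballInt
    rw [← lintegral_indicator hBm, ← lintegral_indicator measurableSet_ball,
      ← lintegral_sub_left_eq_self ((Metric.ball 0 r).indicator (shiftInt p univ univ u)) h]
    refine lintegral_mono fun k => ?_
    by_cases hk : k ∈ B
    · rw [indicator_of_mem hk, indicator_of_mem]
      rw [hB, mem_ball_zero_iff] at hk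
      rw [mem_ball_zero_iff]
      have := norm_sub_le h k
      linarith
    · rw [indicator_of_notMem hk]; exact zero_le
  calc shiftInt p univ univ u h * volume B = ∫⁻ _k in B, shiftInt p univ univ u h := by
        rw [setLIntegral_const]
    _ ≤ ∫⁻ k in B, 2 ^ (p - 1) * (shiftInt p univ univ u k + shiftInt p univ univ u (h - k)) := by
        refine lintegral_mono fun k => ?_
        have := shiftInt_add_le hp MeasurableSet.univ MeasurableSet.univ hu k (h - k)
          (B := univ) fun _ _ _ => mem_univ _
        rwa [add_sub_cancel] at this
    _ = 2 ^ (p - 1) * ((∫⁻ k in B, shiftInt p univ univ u k) +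
          ∫⁻ k in B, shiftInt p univ univ u (h - k)) := by
        rw [lintegral_const_mul' _ _ (by simp), lintegral_add_left hFm]
    _ ≤ 2 ^ (p - 1) * (ballInt p univ u r + ballInt p univ u r) :=
        mul_le_mul' le_rfl (add_le_add h1 h2)
    _ = _ := by rw [e2, ← two_mul, mul_assoc]

/-- A bound for the ball energy at one scale gives a Lipschitz bound in `Lᵖ(ℝᵈ)` at all larger
scales. -/
theorem exists_shiftInt_le_of_ballInt (d : ℕ) (hp : 1 ≤ p) :
    ∃ C : ℝ≥0∞, C ≠ ⊤ ∧ ∀ (u : E d → ℝ), AEMeasurable u → ∀ (r ρ : ℝ) (c : ℝ≥0∞), 0 < r → r ≤ ρ →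
      ballInt p univ u r ≤ c * ENNReal.ofReal (r ^ (d + p)) →
      ∀ h : E d, ‖h‖ ≤ ρ → shiftInt p univ univ u h ≤ C * c * ENNReal.ofReal (ρ ^ p) := by
  have hp0 : 0 ≤ p := by linarith
  set b := volume (Metric.ball (0 : E d) 1) with hb
  have hb0 : b ≠ 0 := (Metric.measure_ball_pos volume _ one_pos).ne'
  have hbt : b ≠ ⊤ := measure_ball_lt_top.ne
  refine ⟨2 ^ p * ENNReal.ofReal (2 ^ d * 3 ^ p) * b⁻¹,
    ENNReal.mul_ne_top (ENNReal.mul_ne_top (by simp) ENNReal.ofReal_ne_top)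
      (ENNReal.inv_ne_top.2 hb0), ?_⟩
  intro u hu r ρ c hr hrρ hQ h hh
  set N : ℕ := ⌈2 * ρ / r⌉₊ with hN
  have hρ : 0 < ρ := hr.trans_le hrρ
  have hN0 : 0 < N := Nat.ceil_pos.2 (by positivity)
  have hN1 : 2 * ρ ≤ N * r := by
    have := Nat.le_ceil (2 * ρ / r)
    rwa [div_le_iff₀ hr] at this
  have hN2 : N * r ≤ 3 * ρ := by
    have := (Nat.ceil_lt_add_one (by positivity : 0 ≤ 2 * ρ / r)).le
    have h2 : (N : ℝ) * r ≤ (2 * ρ / r + 1) * r := mul_le_mul_of_nonneg_right this hr.le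
    rw [add_mul, div_mul_cancel₀ _ hr.ne'] at h2
    linarith
  set R : ℝ := N * r with hR
  have hR0 : 0 < R := by positivity
  have hQR : ballInt p univ u R ≤ c * ENNReal.ofReal (R ^ (d + p)) := by
    refine (ballInt_nsmul_le hp MeasurableSet.univ convex_univ hu r hN0).trans ?_
    refine (mul_le_mul' le_rfl hQ).trans (le_of_eq ?_)
    rw [hR, Real.mul_rpow (by positivity) hr.le, ENNReal.ofReal_mul (by positivity)]
    ring
  have key := shiftInt_mul_volume_le hp hu (r := R) (h := h) (by linarith)
  have hvol : volume (Metric.ball (0 : E d) (R / 2)) = ENNReal.ofReal ((R / 2) ^ d) * b := by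
    rw [hb, Measure.addHaar_ball_of_pos _ _ (by positivity)]
    simp
  rw [hvol] at key
  have hRd : ENNReal.ofReal ((R / 2) ^ d) ≠ 0 := by
    rw [ne_eq, ENNReal.ofReal_eq_zero, not_le]; positivity
  have h3 : shiftInt p univ univ u h ≤
      (2 ^ p * ballInt p univ u R) / (ENNReal.ofReal ((R / 2) ^ d) * b) :=
    (ENNReal.le_div_iff_mul_le (Or.inl (mul_ne_zero hRd hb0))
      (Or.inl (ENNReal.mul_ne_top ENNReal.ofReal_ne_top hbt))).2 key
  refine h3.trans ?_
  rw [ENNReal.div_le_iff (mul_ne_zero hRd hb0) (ENNReal.mul_ne_top ENNReal.ofReal_ne_top hbt)]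
  calc 2 ^ p * ballInt p univ u R ≤ 2 ^ p * (c * ENNReal.ofReal (R ^ (d + p))) :=
        mul_le_mul' le_rfl hQR
    _ ≤ 2 ^ p * (c * ENNReal.ofReal ((2 ^ d * 3 ^ p) * ρ ^ p * (R / 2) ^ d)) := by
        refine mul_le_mul' le_rfl (mul_le_mul' le_rfl (ENNReal.ofReal_le_ofReal ?_))
        rw [Real.rpow_add hR0, Real.rpow_natCast, div_pow]
        have : R ^ p ≤ 3 ^ p * ρ ^ p := by
          rw [← Real.mul_rpow (by norm_num) hρ.le]
          exact Real.rpow_le_rpow hR0.le hN2 hp0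
        calc R ^ d * R ^ p ≤ R ^ d * (3 ^ p * ρ ^ p) := by gcongr
          _ = _ := by field_simp
    _ = 2 ^ p * (c * ENNReal.ofReal ((2 ^ d * 3 ^ p) * ρ ^ p * (R / 2) ^ d)) * (b⁻¹ * b) := by
        rw [ENNReal.inv_mul_cancel hb0 hbt, mul_one]
    _ = _ := by
        rw [ENNReal.ofReal_mul (by positivity), ENNReal.ofReal_mul (by positivity)]
        ring

end BallEnergies

/-! ### Folding maps at the boundary of a Lipschitz domain -/

section Folding

variable {d : ℕ}

theorem LipschitzWith.volume_image_le {S : E d → E d} {Λ : NNReal} (hS : LipschitzWith Λ S)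
    (A : Set (E d)) : volume (S '' A) ≤ (Λ : ℝ≥0∞) ^ (d : ℝ) * volume A := by
  have h := Measure.isAddLeftInvariant_eq_smul (volume : Measure (E d)) (Measure.hausdorffMeasure d)
  set c := Measure.addHaarScalarFactor (volume : Measure (E d)) (Measure.hausdorffMeasure d)
  have hv : ∀ B : Set (E d), volume B = (c : ℝ≥0∞) * (Measure.hausdorffMeasure d : Measure (E d)) B := by
    intro B
    have h2 := congrArg (fun m : Measure (E d) => m B) h
    exact h2
  rw [hv, hv, mul_left_comm]
  exact mul_le_mul' le_rfl (hS.hausdorffMeasure_image_le (by positivity) A)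

/-- `S` folds the open set `B` into `Ω`: it is a Lipschitz map of `ℝᵈ` that distorts volumes by a
bounded factor, fixes the points of `Ω ∩ B`, and maps almost all of `B` into `Ω`. -/
structure IsFold (Ω B : Set (E d)) (S : E d → E d) : Prop where
  lipschitz : ∃ Λ : NNReal, LipschitzWith Λ S
  map_le : ∃ C : ℝ≥0∞, C ≠ ⊤ ∧ Measure.map S volume ≤ C • volume
  eq_self : ∀ y ∈ Ω, y ∈ B → S y = y
  ae_mem : ∀ᵐ y, y ∈ B → S y ∈ Ω

theorem isFold_id {Ω B : Set (E d)} (h : B ⊆ Ω) : IsFold Ω B id := by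
  refine ⟨⟨1, LipschitzWith.id⟩, ⟨1, ENNReal.one_ne_top, by simp⟩, fun _ _ _ => rfl, ?_⟩
  exact Eventually.of_forall fun y hy => h hy

open scoped Pointwise in
/-- The graph of a continuous function is a null set. -/
theorem volume_graph_eq_zero {e : E d} (he : ‖e‖ = 1) {γ : E d → ℝ} (hγ : Continuous γ) :
    volume {y : E d | γ (y - inner ℝ y e • e) = inner ℝ y e} = 0 := by
  have hee : (inner ℝ e e : ℝ) = 1 := by rw [real_inner_self_eq_norm_sq, he]; norm_num
  have hcl : IsClosed {y : E d | γ (y - inner ℝ y e • e) = inner ℝ y e} :=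
    isClosed_eq (by fun_prop) (by fun_prop)
  refine Measure.addHaar_eq_zero_of_disjoint_translates volume
    (fun n : ℕ => ((1 : ℝ) / (n + 1)) • e) ?_ ?_ hcl.measurableSet
  · refine (Metric.isBounded_iff_subset_closedBall 0).2 ⟨1, ?_⟩
    rintro _ ⟨n, rfl⟩
    rw [mem_closedBall_zero_iff, norm_smul, he, mul_one, Real.norm_of_nonneg (by positivity)]
    rw [div_le_one (by positivity)]
    linarith [Nat.cast_nonneg (α := ℝ) n]
  · have key : ∀ (n : ℕ) (y : E d),
        y ∈ ({((1 : ℝ) / (n + 1)) • e} : Set (E d)) +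
          {y : E d | γ (y - inner ℝ y e • e) = inner ℝ y e} →
        inner ℝ y e - γ (y - inner ℝ y e • e) = 1 / ((n : ℝ) + 1) := by
      intro n y hy
      obtain ⟨a, ha, z, hz, rfl⟩ := Set.mem_add.1 hy
      rw [mem_singleton_iff] at ha
      subst ha
      rw [mem_ofPred_eq] at hz
      rw [inner_add_left, real_inner_smul_left, hee, mul_one]
      have e1 : (1 / ((n : ℝ) + 1)) • e + z - (1 / ((n : ℝ) + 1) + inner ℝ z e) • e =
          z - inner ℝ z e • e := by rw [add_smul]; abel
      rw [e1, hz]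
      ring
    intro m n hmn
    refine Set.disjoint_left.2 fun y hy hy' => hmn ?_
    have h1 := (key m y hy).symm.trans (key n y hy')
    have h2 : (m : ℝ) + 1 = n + 1 := by
      have hm : (m : ℝ) + 1 ≠ 0 := by positivity
      have hn : (n : ℝ) + 1 ≠ 0 := by positivity
      field_simp at h1
      linarith
    exact_mod_cast (add_right_cancel h2)

/-- Near a boundary point a Lipschitz domain is a sublevel set `{q < 0}` of a Lipschitz function that
decreases at unit speed in some direction `e`. -/
theorem exists_graph_function {Ω : Set (E d)} (hΩ : IsOpen Ω) (hlip : HasLipschitzBoundary Ω)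
    {x : E d} (hx : x ∈ frontier Ω) :
    ∃ r : ℝ, 0 < r ∧ ∃ e : E d, ‖e‖ = 1 ∧ ∃ (q : E d → ℝ) (Kq : NNReal), LipschitzWith Kq q ∧
      (∀ (y : E d) (t : ℝ), q (y + t • e) = q y - t) ∧ q x = 0 ∧
      (∀ y ∈ Metric.ball x r, (y ∈ Ω ↔ q y < 0)) ∧ volume {y | q y = 0} = 0 := by
  obtain ⟨r, hr, e, he, γ, L, hγ, hgraph⟩ := hlip x hx
  have hee : (inner ℝ e e : ℝ) = 1 := by rw [real_inner_self_eq_norm_sq, he]; norm_num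
  set P : E d → E d := fun y => y - inner ℝ y e • e with hP
  set q : E d → ℝ := fun y => γ (P y) - inner ℝ y e with hq
  have hPe : ∀ (y : E d) (t : ℝ), P (y + t • e) = P y := by
    intro y t
    simp only [hP, inner_add_left, real_inner_smul_left, hee, mul_one, add_smul]
    abel
  have hqe : ∀ (y : E d) (t : ℝ), q (y + t • e) = q y - t := by
    intro y t
    simp only [hq, hPe, inner_add_left, real_inner_smul_left, hee, mul_one]
    ring
  have hlin : LipschitzWith 1 (fun y : E d => (inner ℝ y e : ℝ)) := by
    refine LipschitzWith.of_dist_le_mul fun y z => ?_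
    rw [Real.dist_eq, ← inner_sub_left, dist_eq_norm, NNReal.coe_one, one_mul]
    refine (abs_real_inner_le_norm _ _).trans ?_
    rw [he, mul_one]
  have hse : LipschitzWith 1 (fun t : ℝ => t • e) := by
    refine LipschitzWith.of_dist_le_mul fun y z => ?_
    rw [dist_eq_norm, ← sub_smul, norm_smul, he, mul_one, NNReal.coe_one, one_mul, Real.dist_eq,
      Real.norm_eq_abs]
  have hPl : LipschitzWith (1 + 1 * 1) P := LipschitzWith.id.sub (hse.comp hlin)
  have hql : LipschitzWith (L * (1 + 1 * 1) + 1) q := (hγ.comp hPl).sub hlin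
  have hmem : ∀ y ∈ Metric.ball x r, (y ∈ Ω ↔ q y < 0) := by
    intro y hy
    rw [hgraph y hy]
    simp only [hq, hP, sub_neg]
  refine ⟨r, hr, e, he, q, _, hql, hqe, ?_, hmem, ?_⟩
  · have hxr : x ∈ Metric.ball x r := Metric.mem_ball_self hr
    refine le_antisymm ?_ ?_
    · by_contra hcon
      push Not at hcon
      have hopen : IsOpen (Metric.ball x r ∩ {y | 0 < q y}) :=
        Metric.isOpen_ball.inter (isOpen_lt continuous_const hql.continuous)
      have hxc : x ∈ closure Ω := hx.1
      obtain ⟨y, ⟨hy1, hy2⟩, hy3⟩ := mem_closure_iff.1 hxc _ hopen ⟨hxr, hcon⟩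
      have := (hmem y hy1).1 hy3
      have hy2' : 0 < q y := hy2
      linarith
    · have hxn : x ∉ Ω := by
        have := hx.2
        rwa [hΩ.interior_eq] at this
      by_contra hcon
      push Not at hcon
      exact hxn ((hmem x hxr).2 hcon)
  · have hnull := volume_graph_eq_zero he hγ.continuous
    refine measure_mono_null (fun y hy => ?_) hnull
    exact sub_eq_zero.1 hy

/-- At a boundary point, the points below the graph are reflected across it in the vertical
direction. -/
theorem exists_isFold_frontier {Ω : Set (E d)} (hΩ : IsOpen Ω) (hlip : HasLipschitzBoundary Ω)
    {x : E d} (hx : x ∈ frontier Ω) : ∃ ρ : ℝ, 0 < ρ ∧ ∃ S, IsFold Ω (Metric.ball x ρ) S := by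
  obtain ⟨r, hr, e, he, q, Kq, hql, hqe, hqx, hmem, hnull⟩ := exists_graph_function hΩ hlip hx
  have hse : LipschitzWith 1 (fun t : ℝ => t • e) := by
    refine LipschitzWith.of_dist_le_mul fun y z => ?_
    rw [dist_eq_norm, ← sub_smul, norm_smul, he, mul_one, NNReal.coe_one, one_mul, Real.dist_eq,
      Real.norm_eq_abs]
  set Λ₀ : NNReal := 1 + 1 * (2 * Kq) with hΛ₀
  have h2l : ∀ {f : E d → ℝ} {Kf : NNReal}, LipschitzWith Kf f →
      LipschitzWith (2 * Kf) (fun y => 2 * f y) := by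
    intro f Kf hf
    refine LipschitzWith.of_dist_le_mul fun y z => ?_
    rw [Real.dist_eq, ← mul_sub, abs_mul, abs_two, NNReal.coe_mul, NNReal.coe_ofNat, mul_assoc]
    exact mul_le_mul_of_nonneg_left (by simpa [Real.dist_eq] using hf.dist_le_mul y z) (by norm_num)
  set R : E d → E d := fun y => y + (2 * q y) • e with hR
  set S : E d → E d := fun y => y + (2 * max 0 (q y)) • e with hS
  have hRl : LipschitzWith Λ₀ R := LipschitzWith.id.add (hse.comp (h2l hql))
  have hSl : LipschitzWith Λ₀ S := LipschitzWith.id.add (hse.comp (h2l (hql.const_max 0)))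
  have hRR : Function.Involutive R := by
    intro y
    simp only [hR, hqe]
    rw [add_assoc, ← add_smul]
    have : 2 * q y + 2 * (q y - 2 * q y) = 0 := by ring
    rw [this, zero_smul, add_zero]
  have hSpos : ∀ y, 0 < q y → S y = R y := fun y hy => by simp only [hS, hR, max_eq_right hy.le]
  have hSneg : ∀ y, q y ≤ 0 → S y = y := fun y hy => by simp [hS, max_eq_left hy]
  have hΛ1 : (1 : ℝ) ≤ Λ₀ := by
    have : (1 : NNReal) ≤ Λ₀ := by rw [hΛ₀]; exact le_self_add
    exact_mod_cast this
  have hΛpos : (0 : ℝ) < Λ₀ := by linarith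
  refine ⟨r / Λ₀, by positivity, S, ⟨Λ₀, hSl⟩, ⟨1 + (Λ₀ : ℝ≥0∞) ^ (d : ℝ), ?_, ?_⟩, ?_, ?_⟩
  · exact ENNReal.add_ne_top.2 ⟨ENNReal.one_ne_top,
      ENNReal.rpow_ne_top_of_nonneg (by positivity) ENNReal.coe_ne_top⟩
  · refine Measure.le_iff.2 fun A hA => ?_
    rw [Measure.map_apply hSl.continuous.measurable hA, Measure.smul_apply, smul_eq_mul, add_mul,
      one_mul]
    have hsub : S ⁻¹' A ⊆ A ∪ R '' A := by
      intro y hy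
      rcases le_or_gt (q y) 0 with h | h
      · left
        have := hSneg y h
        rw [mem_preimage, this] at hy
        exact hy
      · right
        rw [mem_preimage, hSpos y h] at hy
        exact ⟨R y, hy, hRR y⟩
    exact (measure_mono hsub).trans ((measure_union_le _ _).trans
      (add_le_add le_rfl (LipschitzWith.volume_image_le hRl A)))
  · intro y hyΩ hyB
    have hyr : y ∈ Metric.ball x r :=
      Metric.ball_subset_ball (div_le_self hr.le hΛ1) hyB
    exact hSneg y ((hmem y hyr).1 hyΩ).le
  · filter_upwards [measure_eq_zero_iff_ae_notMem.1 hnull] with y hy hyB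
    have hyr : y ∈ Metric.ball x r :=
      Metric.ball_subset_ball (div_le_self hr.le hΛ1) hyB
    have hSx : S x = x := hSneg x hqx.le
    have hSyr : S y ∈ Metric.ball x r := by
      rw [Metric.mem_ball] at hyB ⊢
      calc dist (S y) x = dist (S y) (S x) := by rw [hSx]
        _ ≤ Λ₀ * dist y x := hSl.dist_le_mul y x
        _ < Λ₀ * (r / Λ₀) := mul_lt_mul_of_pos_left hyB hΛpos
        _ = r := by field_simp
    have hq0 : q y ≠ 0 := hy
    refine (hmem _ hSyr).2 ?_
    rcases lt_or_gt_of_ne hq0 with h | h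
    · rwa [hSneg y h.le]
    · rw [hSpos y h]
      simp only [hR, hqe]
      linarith

theorem exists_isFold {Ω : Set (E d)} (hΩ : IsOpen Ω) (hlip : HasLipschitzBoundary Ω)
    {x : E d} (hx : x ∈ closure Ω) : ∃ ρ : ℝ, 0 < ρ ∧ ∃ S, IsFold Ω (Metric.ball x ρ) S := by
  by_cases hxΩ : x ∈ Ω
  · obtain ⟨ρ, hρ, hsub⟩ := Metric.isOpen_iff.1 hΩ x hxΩ
    exact ⟨ρ, hρ, id, isFold_id hsub⟩
  · exact exists_isFold_frontier hΩ hlip ⟨hx, by rwa [hΩ.interior_eq]⟩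

end Folding

/-! ### Extension from a Lipschitz domain -/

section Extension

variable {d : ℕ} {p : ℝ}

theorem IsFold.measurable {Ω B : Set (E d)} {S : E d → E d} (hS : IsFold Ω B S) : Measurable S := by
  obtain ⟨Λ, hΛ⟩ := hS.lipschitz
  exact hΛ.continuous.measurable

theorem IsFold.exists_setLIntegral_comp_le {Ω B : Set (E d)} {S : E d → E d} (hS : IsFold Ω B S)
    (hΩ : MeasurableSet Ω) (hB : MeasurableSet B) :
    ∃ C : ℝ≥0∞, C ≠ ⊤ ∧ ∀ f : E d → ℝ≥0∞, Measurable f →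
      ∫⁻ x in B, f (S x) ≤ C * ∫⁻ x in Ω, f x := by
  obtain ⟨C, hC, hmap⟩ := hS.map_le
  refine ⟨C, hC, fun f hf => ?_⟩
  calc ∫⁻ x in B, f (S x) ≤ ∫⁻ x in B, Ω.indicator f (S x) := by
        refine lintegral_mono_ae ?_
        rw [ae_restrict_iff' hB]
        filter_upwards [hS.ae_mem] with x hx hxB
        rw [indicator_of_mem (hx hxB)]
    _ ≤ ∫⁻ x, Ω.indicator f (S x) := setLIntegral_le_lintegral _ _
    _ = ∫⁻ x, Ω.indicator f x ∂(Measure.map S volume) :=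
        (lintegral_map (hf.indicator hΩ) hS.measurable).symm
    _ ≤ ∫⁻ x, Ω.indicator f x ∂(C • volume) := lintegral_mono' hmap le_rfl
    _ = C * ∫⁻ x in Ω, f x := by
        rw [lintegral_smul_measure, lintegral_indicator hΩ, smul_eq_mul]

/-- The integrand of the ball energy as a function of two points. -/
def ballKernel (p : ℝ) (u : E d → ℝ) (r : ℝ) (x y : E d) : ℝ≥0∞ :=
  (Metric.ball (0 : E d) r).indicator (fun _ => ‖u y - u x‖ₑ ^ p) (y - x)

theorem measurable_ballKernel {u : E d → ℝ} (hu : Measurable u) (r : ℝ) :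
    Measurable (Function.uncurry (ballKernel p u r)) := by
  have e : Function.uncurry (ballKernel p u r) =
      {z : E d × E d | z.2 - z.1 ∈ Metric.ball (0 : E d) r}.indicator
        (fun z => ‖u z.2 - u z.1‖ₑ ^ p) := by
    funext z
    rfl
  rw [e]
  exact (((hu.comp measurable_snd).sub (hu.comp measurable_fst)).enorm.pow_const p).indicator
    (measurableSet_ball.preimage (measurable_snd.sub measurable_fst))

theorem ballInt_eq {A : Set (E d)} (hA : MeasurableSet A) {u : E d → ℝ} (hu : Measurable u)
    (r : ℝ) : ballInt p A u r = ∫⁻ x in A, ∫⁻ y in A, ballKernel p u r x y := by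
  have hm : Measurable (fun z : E d × E d =>
      {z : E d × E d | z.2 ∈ A ∧ z.2 + z.1 ∈ A ∧ z.1 ∈ Metric.ball (0 : E d) r}.indicator
        (fun z => ‖u (z.2 + z.1) - u z.2‖ₑ ^ p) z) := by
    refine ((((hu.comp (measurable_snd.add measurable_fst)).sub
      (hu.comp measurable_snd))).enorm.pow_const p).indicator ?_
    exact (hA.preimage measurable_snd).inter ((hA.preimage (measurable_snd.add measurable_fst)).inter
      (measurableSet_ball.preimage measurable_fst))
  have e1 : ballInt p A u r = ∫⁻ h, ∫⁻ x,
      {z : E d × E d | z.2 ∈ A ∧ z.2 + z.1 ∈ A ∧ z.1 ∈ Metric.ball (0 : E d) r}.indicator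
        (fun z => ‖u (z.2 + z.1) - u z.2‖ₑ ^ p) (h, x) := by
    unfold ballInt
    rw [← lintegral_indicator measurableSet_ball]
    refine lintegral_congr fun h => ?_
    by_cases hh : h ∈ Metric.ball (0 : E d) r
    · rw [indicator_of_mem hh, shiftInt, ← lintegral_indicator (measurableSet_slice hA hA h)]
      refine lintegral_congr fun x => ?_
      by_cases hx : x ∈ A ∧ x + h ∈ A
      · rw [indicator_of_mem (by exact hx), indicator_of_mem (by exact ⟨hx.1, hx.2, hh⟩)]
      · rw [indicator_of_notMem (by exact hx),
          indicator_of_notMem (by exact fun hc => hx ⟨hc.1, hc.2.1⟩)]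
    · rw [indicator_of_notMem hh]
      have : ∀ x : E d, {z : E d × E d | z.2 ∈ A ∧ z.2 + z.1 ∈ A ∧ z.1 ∈ Metric.ball (0 : E d) r}.indicator
        (fun z => ‖u (z.2 + z.1) - u z.2‖ₑ ^ p) (h, x) = 0 := fun x =>
          indicator_of_notMem (by exact fun hc => hh hc.2.2) _
      simp_rw [this]
      simp
  rw [e1, lintegral_lintegral_swap hm.aemeasurable, ← lintegral_indicator hA]
  refine lintegral_congr fun x => ?_
  by_cases hx : x ∈ A
  · rw [indicator_of_mem hx, ← lintegral_indicator hA,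
      ← lintegral_add_right_eq_self (A.indicator fun y => ballKernel p u r x y) x]
    refine lintegral_congr fun h => ?_
    by_cases hh : h + x ∈ A
    · rw [indicator_of_mem hh]
      unfold ballKernel
      rw [add_sub_cancel_right]
      by_cases hb : h ∈ Metric.ball (0 : E d) r
      · rw [indicator_of_mem hb, indicator_of_mem (by exact ⟨hx, by rwa [add_comm], hb⟩), add_comm h]
      · rw [indicator_of_notMem hb, indicator_of_notMem (by exact fun hc => hb hc.2.2)]
    · rw [indicator_of_notMem hh,
        indicator_of_notMem (by exact fun hc => hh (by rw [add_comm]; exact hc.2.1))]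
  · rw [indicator_of_notMem hx]
    have : ∀ h : E d, {z : E d × E d | z.2 ∈ A ∧ z.2 + z.1 ∈ A ∧ z.1 ∈ Metric.ball (0 : E d) r}.indicator
      (fun z => ‖u (z.2 + z.1) - u z.2‖ₑ ^ p) (h, x) = 0 := fun h =>
        indicator_of_notMem (by exact fun hc => hx hc.1) _
    simp_rw [this]
    simp

theorem ballInt_congr {A : Set (E d)} (hA : MeasurableSet A) {u v : E d → ℝ}
    (h : ∀ᵐ x, x ∈ A → u x = v x) (r : ℝ) : ballInt p A u r = ballInt p A v r := by
  unfold ballInt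
  simp_rw [shiftInt_congr p hA hA h h]

/-- A fold changes the ball energy at most by a constant factor and a bounded rescaling. -/
theorem IsFold.exists_lintegral_ballKernel_le {Ω B : Set (E d)} {S : E d → E d}
    (hS : IsFold Ω B S) (hΩ : MeasurableSet Ω) (hB : MeasurableSet B) :
    ∃ C : ℝ≥0∞, C ≠ ⊤ ∧ ∃ Λ : ℝ, 1 ≤ Λ ∧ ∀ u : E d → ℝ, Measurable u → ∀ r : ℝ, 0 < r →
      ∫⁻ x in B, ∫⁻ y in B, ballKernel p (u ∘ S) r x y ≤ C * ballInt p Ω u (Λ * r) := by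
  obtain ⟨C, hC, hle⟩ := hS.exists_setLIntegral_comp_le hΩ hB
  obtain ⟨Λ, hΛ⟩ := hS.lipschitz
  refine ⟨C * C, ENNReal.mul_ne_top hC hC, Λ + 1, by simp, fun u hu r hr => ?_⟩
  have hk : Measurable (Function.uncurry (ballKernel p u ((Λ + 1) * r))) := measurable_ballKernel hu _
  have hpt : ∀ x y, ballKernel p (u ∘ S) r x y ≤ ballKernel p u ((Λ + 1) * r) (S x) (S y) := by
    intro x y
    unfold ballKernel
    by_cases h : y - x ∈ Metric.ball (0 : E d) r
    · rw [indicator_of_mem h, indicator_of_mem]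
      · rfl
      · rw [mem_ball_zero_iff] at h ⊢
        have h1 := hΛ.dist_le_mul y x
        rw [dist_eq_norm, dist_eq_norm] at h1
        have h2 : (Λ : ℝ) * ‖y - x‖ ≤ Λ * r := mul_le_mul_of_nonneg_left h.le Λ.2
        linarith
    · rw [indicator_of_notMem h]; exact zero_le
  rw [ballInt_eq hΩ hu]
  calc ∫⁻ x in B, ∫⁻ y in B, ballKernel p (u ∘ S) r x y
      ≤ ∫⁻ x in B, ∫⁻ y in B, ballKernel p u ((Λ + 1) * r) (S x) (S y) :=
        lintegral_mono fun x => lintegral_mono fun y => hpt x y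
    _ ≤ ∫⁻ x in B, C * ∫⁻ y in Ω, ballKernel p u ((Λ + 1) * r) (S x) y :=
        lintegral_mono fun x => hle _ hk.of_uncurry_left
    _ = C * ∫⁻ x in B, ∫⁻ y in Ω, ballKernel p u ((Λ + 1) * r) (S x) y :=
        lintegral_const_mul' _ _ hC
    _ ≤ C * (C * ∫⁻ x in Ω, ∫⁻ y in Ω, ballKernel p u ((Λ + 1) * r) x y) :=
        mul_le_mul' le_rfl (hle (fun x => ∫⁻ y in Ω, ballKernel p u ((Λ + 1) * r) x y)
          (hk.lintegral_prod_right'))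
    _ = _ := (mul_assoc _ _ _).symm

/-- The bounds for one term `χ · (u ∘ S)` of the extension. -/
theorem IsFold.exists_cutoff_bound (hp : 1 ≤ p) {Ω B : Set (E d)} {S : E d → E d}
    (hS : IsFold Ω B S) (hΩ : MeasurableSet Ω) (hB : MeasurableSet B) {χ : E d → ℝ} {M : NNReal}
    (hχ : LipschitzWith M χ) (hχ0 : ∀ x, |χ x| ≤ 1) {η : ℝ}
    (hsupp : ∀ x, χ x ≠ 0 → Metric.ball x η ⊆ B) (hη : 0 < η) :
    ∃ C : ℝ≥0∞, C ≠ ⊤ ∧ ∃ Λ : ℝ, 1 ≤ Λ ∧ ∀ u : E d → ℝ, Measurable u →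
      (∫⁻ x, ‖χ x * u (S x)‖ₑ ^ p ≤ C * ∫⁻ x in Ω, ‖u x‖ₑ ^ p) ∧
      ∀ r : ℝ, 0 < r → r ≤ η → ballInt p univ (fun x => χ x * u (S x)) r ≤
        C * (ballInt p Ω u (Λ * r) + ENNReal.ofReal (r ^ (d + p)) * ∫⁻ x in Ω, ‖u x‖ₑ ^ p) := by
  have hp0 : 0 ≤ p := by linarith
  have hpp : 0 < p := by linarith
  obtain ⟨C₁, hC₁, h1⟩ := hS.exists_setLIntegral_comp_le hΩ hB
  obtain ⟨C₂, hC₂, Λ, hΛ, h2⟩ := hS.exists_lintegral_ballKernel_le (p := p) hΩ hB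
  set b := volume (Metric.ball (0 : E d) 1) with hb
  have hbt : b ≠ ⊤ := measure_ball_lt_top.ne
  set D : ℝ≥0∞ := 2 ^ (p - 1) * (C₂ + (M : ℝ≥0∞) ^ p * b * C₁) with hD
  have hχm : Measurable χ := hχ.continuous.measurable
  have hχ1 : ∀ x, ‖χ x‖ₑ ≤ 1 := fun x => by
    rw [Real.enorm_eq_ofReal_abs, ← ENNReal.ofReal_one]
    exact ENNReal.ofReal_le_ofReal (hχ0 x)
  refine ⟨C₁ + D, ?_, Λ, hΛ, fun u hu => ⟨?_, fun r hr hrη => ?_⟩⟩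
  · refine ENNReal.add_ne_top.2 ⟨hC₁, ENNReal.mul_ne_top (by simp) (ENNReal.add_ne_top.2 ⟨hC₂, ?_⟩)⟩
    exact ENNReal.mul_ne_top (ENNReal.mul_ne_top
      (ENNReal.rpow_ne_top_of_nonneg hp0 ENNReal.coe_ne_top) hbt) hC₁
  · calc ∫⁻ x, ‖χ x * u (S x)‖ₑ ^ p ≤ ∫⁻ x, B.indicator (fun x => ‖u (S x)‖ₑ ^ p) x := by
          refine lintegral_mono fun x => ?_
          by_cases hx : χ x = 0
          · simp [hx, hpp]
          · rw [indicator_of_mem (hsupp x hx (Metric.mem_ball_self hη)), enorm_mul]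
            exact ENNReal.rpow_le_rpow (mul_le_of_le_one_left' (hχ1 x)) hp0
      _ = ∫⁻ x in B, ‖u (S x)‖ₑ ^ p := lintegral_indicator hB _
      _ ≤ C₁ * ∫⁻ x in Ω, ‖u x‖ₑ ^ p := h1 _ (hu.enorm.pow_const p)
      _ ≤ _ := mul_le_mul' le_self_add le_rfl
  · set v : E d → ℝ := fun x => χ x * u (S x) with hv
    have huS : Measurable (u ∘ S) := hu.comp hS.measurable
    have hvm : Measurable v := hχm.mul huS
    set ball₀ := Metric.ball (0 : E d) r with hball₀
    set k₂ : E d → E d → ℝ≥0∞ := fun x y =>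
      ball₀.indicator (fun _ => ((M : ℝ≥0∞) ^ p * ENNReal.ofReal (r ^ p)) * ‖u (S x)‖ₑ ^ p) (y - x)
      with hk₂
    have hpt : ∀ x y, ballKernel p v r x y ≤ B.indicator (fun x => B.indicator (fun y =>
        2 ^ (p - 1) * (ballKernel p (u ∘ S) r x y + k₂ x y)) y) x := by
      intro x y
      by_cases hxy : y - x ∈ ball₀
      · have hd : dist y x < r := by rwa [hball₀, mem_ball_zero_iff, ← dist_eq_norm] at hxy
        by_cases h0 : χ x = 0 ∧ χ y = 0
        · have : ballKernel p v r x y = 0 := by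
            unfold ballKernel
            rw [indicator_of_mem hxy]
            simp [hv, h0.1, h0.2, hpp]
          rw [this]; exact zero_le
        · have hxB : x ∈ B ∧ y ∈ B := by
            by_cases hx : χ x = 0
            · have hy : χ y ≠ 0 := fun h => h0 ⟨hx, h⟩
              refine ⟨hsupp y hy ?_, hsupp y hy (Metric.mem_ball_self hη)⟩
              rw [Metric.mem_ball, dist_comm]; linarith
            · refine ⟨hsupp x hx (Metric.mem_ball_self hη), hsupp x hx ?_⟩
              rw [Metric.mem_ball]; linarith
          rw [indicator_of_mem hxB.1, indicator_of_mem hxB.2]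
          simp only [ballKernel, hk₂]
          rw [indicator_of_mem hxy, indicator_of_mem hxy, indicator_of_mem hxy]
          have e : v y - v x = χ y * ((u ∘ S) y - (u ∘ S) x) + (χ y - χ x) * u (S x) := by
            simp only [hv, Function.comp]; ring
          have hM : ‖χ y - χ x‖ₑ ^ p ≤ (M : ℝ≥0∞) ^ p * ENNReal.ofReal (r ^ p) := by
            rw [← ENNReal.ofReal_rpow_of_nonneg hr.le hp0, ← ENNReal.mul_rpow_of_nonneg _ _ hp0]
            refine ENNReal.rpow_le_rpow ?_ hp0
            rw [← edist_eq_enorm_sub]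
            refine (hχ.edist_le_mul y x).trans (mul_le_mul' le_rfl ?_)
            rw [edist_dist]
            exact ENNReal.ofReal_le_ofReal hd.le
          rw [e]
          refine (ENNReal.rpow_le_rpow (enorm_add_le _ _) hp0).trans
            ((ENNReal.rpow_add_le_mul_rpow_add_rpow _ _ hp).trans ?_)
          refine mul_le_mul' le_rfl (add_le_add ?_ ?_)
          · rw [enorm_mul]
            exact ENNReal.rpow_le_rpow (mul_le_of_le_one_left' (hχ1 y)) hp0
          · rw [enorm_mul, ENNReal.mul_rpow_of_nonneg _ _ hp0]
            exact mul_le_mul' hM le_rfl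
      · have : ballKernel p v r x y = 0 := indicator_of_notMem hxy _
        rw [this]; exact zero_le
    have hk₁m : Measurable (Function.uncurry (ballKernel p (u ∘ S) r)) := measurable_ballKernel huS r
    have hin : ∀ x, ∫⁻ y, k₂ x y =
        ((M : ℝ≥0∞) ^ p * ENNReal.ofReal (r ^ p) * (ENNReal.ofReal (r ^ d) * b)) *
          ‖u (S x)‖ₑ ^ p := by
      intro x
      rw [hk₂]
      dsimp only
      rw [lintegral_sub_right_eq_self (fun y => ball₀.indicator (fun _ =>
        ((M : ℝ≥0∞) ^ p * ENNReal.ofReal (r ^ p)) * ‖u (S x)‖ₑ ^ p) y) x,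
        lintegral_indicator measurableSet_ball, setLIntegral_const,
        Measure.addHaar_ball_of_pos _ _ hr, finrank_euclideanSpace, Fintype.card_fin]
      ring
    have hr2 : ENNReal.ofReal (r ^ (d + p)) = ENNReal.ofReal (r ^ p) * ENNReal.ofReal (r ^ d) := by
      rw [Real.rpow_add hr, Real.rpow_natCast, ← ENNReal.ofReal_mul (by positivity), mul_comm]
    rw [ballInt_eq MeasurableSet.univ hvm, setLIntegral_univ]
    simp only [setLIntegral_univ]
    calc ∫⁻ x, ∫⁻ y, ballKernel p v r x y
        ≤ ∫⁻ x, B.indicator (fun x => ∫⁻ y in B,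
            2 ^ (p - 1) * (ballKernel p (u ∘ S) r x y + k₂ x y)) x := by
          refine lintegral_mono fun x => (lintegral_mono fun y => hpt x y).trans ?_
          by_cases hx : x ∈ B
          · simp only [indicator_of_mem hx]
            rw [lintegral_indicator hB]
          · simp [indicator_of_notMem hx]
      _ = ∫⁻ x in B, ∫⁻ y in B, 2 ^ (p - 1) * (ballKernel p (u ∘ S) r x y + k₂ x y) :=
          lintegral_indicator hB _
      _ = 2 ^ (p - 1) * ∫⁻ x in B, ((∫⁻ y in B, ballKernel p (u ∘ S) r x y) +
            ∫⁻ y in B, k₂ x y) := by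
          rw [← lintegral_const_mul' _ _ (by simp)]
          refine lintegral_congr fun x => ?_
          rw [lintegral_const_mul' _ _ (by simp), lintegral_add_left hk₁m.of_uncurry_left]
      _ = 2 ^ (p - 1) * ((∫⁻ x in B, ∫⁻ y in B, ballKernel p (u ∘ S) r x y) +
            ∫⁻ x in B, ∫⁻ y in B, k₂ x y) := by
          rw [lintegral_add_left (f := fun x => ∫⁻ y in B, ballKernel p (u ∘ S) r x y)
            hk₁m.lintegral_prod_right']
      _ ≤ 2 ^ (p - 1) * (C₂ * ballInt p Ω u (Λ * r) +
            ((M : ℝ≥0∞) ^ p * ENNReal.ofReal (r ^ p) * (ENNReal.ofReal (r ^ d) * b)) *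
              (C₁ * ∫⁻ x in Ω, ‖u x‖ₑ ^ p)) := by
          refine mul_le_mul' le_rfl (add_le_add (h2 u hu r hr) ?_)
          calc ∫⁻ x in B, ∫⁻ y in B, k₂ x y ≤ ∫⁻ x in B,
                ((M : ℝ≥0∞) ^ p * ENNReal.ofReal (r ^ p) * (ENNReal.ofReal (r ^ d) * b)) *
                  ‖u (S x)‖ₑ ^ p :=
                lintegral_mono fun x => (setLIntegral_le_lintegral _ _).trans (hin x).le
            _ = ((M : ℝ≥0∞) ^ p * ENNReal.ofReal (r ^ p) * (ENNReal.ofReal (r ^ d) * b)) *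
                  ∫⁻ x in B, ‖u (S x)‖ₑ ^ p :=
                lintegral_const_mul _ ((huS.enorm).pow_const p)
            _ ≤ _ := mul_le_mul' le_rfl (h1 _ (hu.enorm.pow_const p))
      _ ≤ D * (ballInt p Ω u (Λ * r) + ENNReal.ofReal (r ^ (d + p)) * ∫⁻ x in Ω, ‖u x‖ₑ ^ p) := by
          rw [hD, hr2, mul_assoc (2 ^ (p - 1))]
          refine mul_le_mul' le_rfl ?_
          rw [mul_add]
          refine add_le_add (mul_le_mul' le_self_add le_rfl) ?_
          refine le_trans (le_of_eq ?_) (mul_le_mul' (le_add_self : (M : ℝ≥0∞) ^ p * b * C₁ ≤ _) le_rfl)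
          ring
      _ ≤ _ := mul_le_mul' le_add_self le_rfl

/-- A Lipschitz partition of unity on `Ω`, subordinate to given balls around finitely many points of
`closure Ω`. -/
theorem exists_lipschitz_partition {Ω : Set (E d)} (hbdd : Bornology.IsBounded Ω)
    {ρ : E d → ℝ} (hρ : ∀ x ∈ closure Ω, 0 < ρ x) :
    ∃ (t : Finset (E d)) (χ : E d → E d → ℝ) (η : ℝ), 0 < η ∧ (∀ i ∈ t, i ∈ closure Ω) ∧
      (∀ i ∈ t, (∃ M : NNReal, LipschitzWith M (χ i)) ∧ (∀ x, |χ i x| ≤ 1) ∧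
        ∀ x, χ i x ≠ 0 → Metric.ball x η ⊆ Metric.ball i (ρ i)) ∧
      ∀ x ∈ Ω, ∑ i ∈ t, χ i x = 1 := by
  have hcpt : IsCompact (closure Ω) := hbdd.isCompact_closure
  obtain ⟨t, ht, hcov⟩ := hcpt.elim_nhds_subcover (fun x => Metric.ball x (ρ x / 2)) fun x hx =>
    Metric.ball_mem_nhds x (half_pos (hρ x hx))
  obtain ⟨f, hf⟩ := SmoothPartitionOfUnity.exists_isSubordinate (modelWithCornersSelf ℝ (E d))
    (isClosed_closure (s := Ω)) (fun i : t => Metric.ball (i : E d) (ρ i / 2))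
    (fun i => Metric.isOpen_ball) (by
      intro x hx
      obtain ⟨i, hi, hxi⟩ := mem_iUnion₂.1 (hcov hx)
      exact mem_iUnion.2 ⟨⟨i, hi⟩, hxi⟩)
  have hη : ∃ η : ℝ, 0 < η ∧ ∀ i ∈ t, η ≤ ρ i / 2 := by
    by_cases hne : t.Nonempty
    · obtain ⟨i, hi, hmin⟩ := t.exists_min_image (fun i => ρ i / 2) hne
      exact ⟨ρ i / 2, half_pos (hρ i (ht i hi)), hmin⟩
    · rw [Finset.not_nonempty_iff_eq_empty] at hne
      exact ⟨1, one_pos, by simp [hne]⟩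
  obtain ⟨η, hη, hηt⟩ := hη
  classical
  refine ⟨t, fun i x => if h : i ∈ t then f ⟨i, h⟩ x else 0, η, hη, ht, fun i hi => ?_, ?_⟩
  · simp only [hi, dif_pos]
    refine ⟨?_, fun x => ?_, fun x hx => ?_⟩
    · have hc : HasCompactSupport (f ⟨i, hi⟩) :=
        (isCompact_closedBall i (ρ i / 2)).of_isClosed_subset (isClosed_tsupport _)
          ((hf ⟨i, hi⟩).trans Metric.ball_subset_closedBall)
      have hs : ContDiff ℝ ∞ (f ⟨i, hi⟩) := (f ⟨i, hi⟩).contMDiff.contDiff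
      exact hs.lipschitzWith_of_hasCompactSupport hc (by simp)
    · rw [abs_of_nonneg (f.nonneg _ _)]
      exact f.le_one _ _
    · have hx2 : x ∈ Metric.ball i (ρ i / 2) := hf ⟨i, hi⟩ (subset_tsupport _ hx)
      refine Metric.ball_subset_ball' ?_
      rw [Metric.mem_ball] at hx2
      have := hηt i hi
      linarith
  · intro x hx
    have h1 := f.sum_eq_one (subset_closure hx)
    rw [finsum_eq_sum_of_fintype] at h1
    rw [← h1, ← Finset.sum_coe_sort t]
    refine Finset.sum_congr rfl fun i _ => ?_
    simp

/-- Measurable functions on a bounded Lipschitz domain extend to the whole space with control of the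
`Lᵖ` norm and of all ball energies at small scales. -/
theorem exists_extension (hp : 1 ≤ p) {Ω : Set (E d)} (hΩ : IsOpen Ω)
    (hbdd : Bornology.IsBounded Ω) (hlip : HasLipschitzBoundary Ω) :
    ∃ C : ℝ≥0∞, C ≠ ⊤ ∧ ∃ Λ : ℝ, 1 ≤ Λ ∧ ∃ r₀ : ℝ, 0 < r₀ ∧ ∀ u : E d → ℝ, AEMeasurable u →
      ∃ U : E d → ℝ, Measurable U ∧ (∀ᵐ x, x ∈ Ω → U x = u x) ∧
        (∫⁻ x, ‖U x‖ₑ ^ p ≤ C * ∫⁻ x in Ω, ‖u x‖ₑ ^ p) ∧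
        ∀ r : ℝ, 0 < r → r ≤ r₀ → ballInt p univ U r ≤
          C * (ballInt p Ω u (Λ * r) + ENNReal.ofReal (r ^ (d + p)) * ∫⁻ x in Ω, ‖u x‖ₑ ^ p) := by
  have hp0 : 0 ≤ p := by linarith
  have hΩm := hΩ.measurableSet
  have hfold : ∀ x : E d, ∃ ρ : ℝ, x ∈ closure Ω → 0 < ρ ∧ ∃ S, IsFold Ω (Metric.ball x ρ) S := by
    intro x
    by_cases hx : x ∈ closure Ω
    · obtain ⟨ρ, h⟩ := exists_isFold hΩ hlip hx
      exact ⟨ρ, fun _ => h⟩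
    · exact ⟨0, fun h => absurd h hx⟩
  choose ρ hρ using hfold
  obtain ⟨t, χ, η, hη, ht, hχ, hsum⟩ := exists_lipschitz_partition hbdd fun x hx => (hρ x hx).1
  have hS : ∀ i : E d, ∃ S, i ∈ t → IsFold Ω (Metric.ball i (ρ i)) S := by
    intro i
    by_cases hi : i ∈ t
    · obtain ⟨S, h⟩ := (hρ i (ht i hi)).2
      exact ⟨S, fun _ => h⟩
    · exact ⟨id, fun h => absurd h hi⟩
  choose S hS using hS
  have hb : ∀ i : E d, ∃ C : ℝ≥0∞, ∃ Λ : ℝ, i ∈ t → C ≠ ⊤ ∧ 1 ≤ Λ ∧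
      ∀ u : E d → ℝ, Measurable u →
      (∫⁻ x, ‖χ i x * u (S i x)‖ₑ ^ p ≤ C * ∫⁻ x in Ω, ‖u x‖ₑ ^ p) ∧
      ∀ r : ℝ, 0 < r → r ≤ η → ballInt p univ (fun x => χ i x * u (S i x)) r ≤
        C * (ballInt p Ω u (Λ * r) + ENNReal.ofReal (r ^ (d + p)) * ∫⁻ x in Ω, ‖u x‖ₑ ^ p) := by
    intro i
    by_cases hi : i ∈ t
    · obtain ⟨⟨M, hM⟩, h1, h2⟩ := hχ i hi
      obtain ⟨C, hC, Λ, hΛ, h⟩ :=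
        (hS i hi).exists_cutoff_bound hp hΩm measurableSet_ball hM h1 h2 hη
      exact ⟨C, Λ, fun _ => ⟨hC, hΛ, h⟩⟩
    · exact ⟨0, 0, fun h => absurd h hi⟩
  choose C Λ hb using hb
  set N : ℝ≥0∞ := (t.card : ℝ≥0∞) ^ (p - 1) with hN
  have hNt : N ≠ ⊤ := ENNReal.rpow_ne_top_of_nonneg (by linarith) (ENNReal.natCast_ne_top _)
  set Λ₀ : ℝ := 1 + ∑ i ∈ t, Λ i with hΛ₀
  have hΛ0 : ∀ i ∈ t, 0 ≤ Λ i := fun i hi => zero_le_one.trans (hb i hi).2.1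
  have hΛle : ∀ i ∈ t, Λ i ≤ Λ₀ := fun i hi => by
    have := Finset.single_le_sum hΛ0 hi
    linarith
  refine ⟨N * ∑ i ∈ t, C i, ENNReal.mul_ne_top hNt (ENNReal.sum_ne_top.2 fun i hi => (hb i hi).1),
    Λ₀, by linarith [Finset.sum_nonneg hΛ0], η, hη, fun u₀ hu₀ => ?_⟩
  set u := hu₀.mk u₀ with hu
  have hum : Measurable u := hu₀.measurable_mk
  have hae : ∀ᵐ x, u₀ x = u x := hu₀.ae_eq_mk
  have hL : ∫⁻ x in Ω, ‖u₀ x‖ₑ ^ p = ∫⁻ x in Ω, ‖u x‖ₑ ^ p := by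
    refine lintegral_congr_ae (ae_restrict_of_ae ?_)
    filter_upwards [hae] with x hx
    rw [hx]
  have hQ : ∀ r, ballInt p Ω u₀ r = ballInt p Ω u r :=
    ballInt_congr hΩm (hae.mono fun x hx _ => hx)
  rw [hL]
  simp_rw [hQ]
  have hvm : ∀ i ∈ t, Measurable fun x => χ i x * u (S i x) := fun i hi => by
    obtain ⟨⟨M, hM⟩, -⟩ := hχ i hi
    exact hM.continuous.measurable.mul (hum.comp (hS i hi).measurable)
  refine ⟨fun x => ∑ i ∈ t, χ i x * u (S i x), Finset.measurable_sum _ hvm, ?_, ?_, ?_⟩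
  · filter_upwards [hae] with x hx hxΩ
    rw [hx, ← one_mul (u x), ← hsum x hxΩ, Finset.sum_mul]
    refine Finset.sum_congr rfl fun i hi => ?_
    by_cases h0 : χ i x = 0
    · simp [h0]
    · rw [(hS i hi).eq_self x hxΩ ((hχ i hi).2.2 x h0 (Metric.mem_ball_self hη))]
  · calc ∫⁻ x, ‖∑ i ∈ t, χ i x * u (S i x)‖ₑ ^ p
        ≤ ∫⁻ x, N * ∑ i ∈ t, ‖χ i x * u (S i x)‖ₑ ^ p := by
          refine lintegral_mono fun x => ?_
          exact (ENNReal.rpow_le_rpow (enorm_sum_le _ _) hp0).trans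
            (ENNReal.rpow_sum_le_const_mul_sum_rpow t _ hp)
      _ = N * ∑ i ∈ t, ∫⁻ x, ‖χ i x * u (S i x)‖ₑ ^ p := by
          rw [lintegral_const_mul' _ _ hNt, lintegral_finsetSum _ fun i hi =>
            ((hvm i hi).enorm.pow_const p)]
      _ ≤ N * ∑ i ∈ t, C i * ∫⁻ x in Ω, ‖u x‖ₑ ^ p :=
          mul_le_mul' le_rfl (Finset.sum_le_sum fun i hi => ((hb i hi).2.2 u hum).1)
      _ = _ := by rw [← Finset.sum_mul, mul_assoc]
  · intro r hr hrη
    have hs : ∀ h, shiftInt p univ univ (fun x => ∑ i ∈ t, χ i x * u (S i x)) h ≤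
        N * ∑ i ∈ t, shiftInt p univ univ (fun x => χ i x * u (S i x)) h := by
      intro h
      unfold shiftInt
      rw [← lintegral_finsetSum' (f := fun i x => ‖χ i (x + h) * u (S i (x + h)) -
        χ i x * u (S i x)‖ₑ ^ p) t fun i hi => (((aemeasurable_shift (hvm i hi).aemeasurable h).sub
        (hvm i hi).aemeasurable).enorm.pow_const p).restrict, ← lintegral_const_mul' _ _ hNt]
      refine lintegral_mono fun x => ?_
      dsimp only
      rw [← Finset.sum_sub_distrib]
      exact (ENNReal.rpow_le_rpow (enorm_sum_le _ _) hp0).trans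
        (ENNReal.rpow_sum_le_const_mul_sum_rpow t _ hp)
    calc ballInt p univ (fun x => ∑ i ∈ t, χ i x * u (S i x)) r
        ≤ ∫⁻ h in Metric.ball 0 r, N * ∑ i ∈ t, shiftInt p univ univ
            (fun x => χ i x * u (S i x)) h := lintegral_mono fun h => hs h
      _ = N * ∑ i ∈ t, ballInt p univ (fun x => χ i x * u (S i x)) r := by
          rw [lintegral_const_mul' _ _ hNt, lintegral_finsetSum _ fun i hi =>
            measurable_shiftInt p MeasurableSet.univ MeasurableSet.univ (hvm i hi).aemeasurable]
          rfl
      _ ≤ N * ∑ i ∈ t, C i * (ballInt p Ω u (Λ₀ * r) +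
            ENNReal.ofReal (r ^ (d + p)) * ∫⁻ x in Ω, ‖u x‖ₑ ^ p) := by
          refine mul_le_mul' le_rfl (Finset.sum_le_sum fun i hi => ?_)
          refine (((hb i hi).2.2 u hum).2 r hr hrη).trans (mul_le_mul' le_rfl (add_le_add ?_ le_rfl))
          exact ballInt_mono_radius _ _ (mul_le_mul_of_nonneg_right (hΛle i hi) hr.le)
      _ = _ := by rw [← Finset.sum_mul, mul_assoc]

end Extension

/-! ### Uniform convexity -/

section UniformConvexity

variable {p : ℝ}

theorem abs_rpow_midpoint_lt (hp : 1 < p) {a b : ℝ} (hab : a ≠ b) :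
    |(a + b) / 2| ^ p < |a| ^ p / 2 + |b| ^ p / 2 := by
  have hp0 : 0 < p := by linarith
  have h1 : |(a + b) / 2| ≤ (|a| + |b|) / 2 := by
    rw [abs_div, abs_two]
    have := abs_add_le a b
    linarith
  by_cases h : |a| = |b|
  · rcases abs_eq_abs.1 h with h2 | h2
    · exact absurd h2 hab
    · have hb : b ≠ 0 := by rintro rfl; simp at h2; exact hab h2
      have : |(a + b) / 2| ^ p = 0 := by rw [h2]; simp [hp0.ne']
      rw [this]
      have := Real.rpow_pos_of_pos (abs_pos.2 hb) p
      have h3 := Real.rpow_nonneg (abs_nonneg a) p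
      linarith
  · have h2 := (strictConvexOn_rpow hp).2 (show |a| ∈ Ici (0 : ℝ) from abs_nonneg a)
      (show |b| ∈ Ici (0 : ℝ) from abs_nonneg b) h (show (0 : ℝ) < 1 / 2 by norm_num)
      (show (0 : ℝ) < 1 / 2 by norm_num) (by norm_num)
    simp only [smul_eq_mul] at h2
    calc |(a + b) / 2| ^ p ≤ ((|a| + |b|) / 2) ^ p := Real.rpow_le_rpow (abs_nonneg _) h1 hp0.le
      _ = (1 / 2 * |a| + 1 / 2 * |b|) ^ p := by ring_nf
      _ < _ := h2
      _ = _ := by ring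

theorem abs_rpow_midpoint_le (hp : 1 < p) (a b : ℝ) :
    |(a + b) / 2| ^ p ≤ |a| ^ p / 2 + |b| ^ p / 2 := by
  by_cases hab : a = b
  · subst hab
    have : (a + a) / 2 = a := by ring
    rw [this]
    linarith
  · exact (abs_rpow_midpoint_lt hp hab).le

/-- Quantitative strict convexity of `|·|ᵖ`: up to an arbitrarily small multiple of
`|a|ᵖ + |b|ᵖ`, the quantity `|a - b|ᵖ` is controlled by the convexity defect at the midpoint. By
homogeneity it suffices to consider the compact set `|a|ᵖ + |b|ᵖ = 1`. -/
theorem exists_abs_sub_rpow_le (hp : 1 < p) {η : ℝ} (hη : 0 < η) :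
    ∃ C : ℝ, 0 ≤ C ∧ ∀ a b : ℝ, |a - b| ^ p ≤ η * (|a| ^ p + |b| ^ p) +
      C * (|a| ^ p / 2 + |b| ^ p / 2 - |(a + b) / 2| ^ p) := by
  have hp0 : 0 < p := by linarith
  set T : Set (ℝ × ℝ) := {z | |z.1| ^ p + |z.2| ^ p = 1 ∧ η ≤ |z.1 - z.2| ^ p} with hT
  have hcont : ∀ f : ℝ × ℝ → ℝ, Continuous f → Continuous fun z => |f z| ^ p := fun f hf =>
    (continuous_abs.comp hf).rpow_const fun _ => Or.inr hp0.le
  set ψ : ℝ × ℝ → ℝ := fun z => |z.1| ^ p / 2 + |z.2| ^ p / 2 - |(z.1 + z.2) / 2| ^ p with hψ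
  have hψc : Continuous ψ := by
    have h1 := hcont (fun z => z.1) continuous_fst
    have h2 := hcont (fun z => z.2) continuous_snd
    have h3 := hcont (fun z => (z.1 + z.2) / 2) (by fun_prop)
    exact ((h1.div_const 2).add (h2.div_const 2)).sub h3
  have hTc : IsClosed T := by
    have h1 := hcont (fun z => z.1) continuous_fst
    have h2 := hcont (fun z => z.2) continuous_snd
    have h3 := hcont (fun z => z.1 - z.2) (by fun_prop)
    exact (isClosed_eq (h1.add h2) continuous_const).inter (isClosed_le continuous_const h3)
  have hle1 : ∀ t : ℝ, |t| ^ p ≤ 1 → |t| ≤ 1 := fun t ht => by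
    by_contra hcon
    push Not at hcon
    have := Real.one_lt_rpow hcon hp0
    linarith
  have hbound : ∀ z : ℝ × ℝ, |z.1| ^ p + |z.2| ^ p = 1 → |z.1| ≤ 1 ∧ |z.2| ≤ 1 := fun z hz => by
    have h1 := Real.rpow_nonneg (abs_nonneg z.1) p
    have h2 := Real.rpow_nonneg (abs_nonneg z.2) p
    exact ⟨hle1 _ (by linarith), hle1 _ (by linarith)⟩
  have hTcomp : IsCompact T := by
    refine (isCompact_closedBall (0 : ℝ × ℝ) 1).of_isClosed_subset hTc fun z hz => ?_
    rw [mem_closedBall_zero_iff, Prod.norm_def]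
    exact max_le (hbound z hz.1).1 (hbound z hz.1).2
  -- the constant on the normalized set
  have hC : ∃ C : ℝ, 0 ≤ C ∧ ∀ z : ℝ × ℝ, |z.1| ^ p + |z.2| ^ p = 1 →
      |z.1 - z.2| ^ p ≤ η + C * ψ z := by
    have hψ0 : ∀ z, 0 ≤ ψ z := fun z => by
      have := abs_rpow_midpoint_le hp z.1 z.2
      simp only [hψ]
      linarith
    by_cases hne : T.Nonempty
    · obtain ⟨z₀, hz₀, hmin⟩ := hTcomp.exists_isMinOn hne hψc.continuousOn
      have hm : 0 < ψ z₀ := by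
        have hne' : z₀.1 ≠ z₀.2 := by
          intro h
          have h2 := hz₀.2
          rw [h, sub_self, abs_zero, Real.zero_rpow hp0.ne'] at h2
          linarith
        have := abs_rpow_midpoint_lt hp hne'
        simp only [hψ]
        linarith
      refine ⟨2 ^ p / ψ z₀, by positivity, fun z hz => ?_⟩
      by_cases hzT : z ∈ T
      · have h1 : |z.1 - z.2| ≤ 2 := by
          have := abs_sub z.1 z.2
          have h2 := hbound z hz
          linarith [h2.1, h2.2]
        have h2 : |z.1 - z.2| ^ p ≤ 2 ^ p := Real.rpow_le_rpow (abs_nonneg _) h1 hp0.le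
        have h3 : ψ z₀ ≤ ψ z := hmin hzT
        have h4 : (2 : ℝ) ^ p ≤ 2 ^ p / ψ z₀ * ψ z := by
          rw [div_mul_eq_mul_div, le_div_iff₀ hm]
          exact mul_le_mul_of_nonneg_left h3 (by positivity)
        linarith
      · have h1 : |z.1 - z.2| ^ p < η := by
          by_contra hcon
          exact hzT ⟨hz, not_lt.1 hcon⟩
        have : 0 ≤ 2 ^ p / ψ z₀ * ψ z := mul_nonneg (by positivity) (hψ0 z)
        linarith
    · refine ⟨0, le_rfl, fun z hz => ?_⟩
      have h1 : |z.1 - z.2| ^ p < η := by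
        by_contra hcon
        exact hne ⟨z, hz, not_lt.1 hcon⟩
      linarith
  obtain ⟨C, hC0, hC⟩ := hC
  refine ⟨C, hC0, fun a b => ?_⟩
  by_cases hab : a = 0 ∧ b = 0
  · rw [hab.1, hab.2]; simp [hp0.ne']
  set s : ℝ := |a| ^ p + |b| ^ p with hs
  have hs0 : 0 < s := by
    have h1 := Real.rpow_nonneg (abs_nonneg a) p
    have h2 := Real.rpow_nonneg (abs_nonneg b) p
    rcases not_and_or.1 hab with h | h
    · have := Real.rpow_pos_of_pos (abs_pos.2 h) p
      linarith
    · have := Real.rpow_pos_of_pos (abs_pos.2 h) p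
      linarith
  set t : ℝ := s ^ (1 / p) with ht
  have ht0 : 0 < t := Real.rpow_pos_of_pos hs0 _
  have htp : t ^ p = s := by
    rw [ht, ← Real.rpow_mul hs0.le, one_div_mul_cancel hp0.ne', Real.rpow_one]
  have hscale : ∀ c : ℝ, |c / t| ^ p = |c| ^ p / s := fun c => by
    rw [abs_div, abs_of_pos ht0, Real.div_rpow (abs_nonneg _) ht0.le, htp]
  have h1 := hC (a / t, b / t) (by
    simp only [hscale]
    rw [← add_div, ← hs, div_self hs0.ne'])
  simp only [hψ] at h1
  have e1 : a / t - b / t = (a - b) / t := by ring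
  have e2 : (a / t + b / t) / 2 = ((a + b) / 2) / t := by ring
  rw [e1, e2, hscale, hscale, hscale, hscale, div_le_iff₀ hs0] at h1
  refine h1.trans (le_of_eq ?_)
  field_simp

theorem ofReal_abs_rpow' (hp : 0 ≤ p) (a : ℝ) : ‖a‖ₑ ^ p = ENNReal.ofReal (|a| ^ p) :=
  (ofReal_abs_rpow hp a).symm

/-- The inequality of `exists_abs_sub_rpow_le`, in a form that can be integrated. -/
theorem exists_enorm_sub_rpow_le (hp : 1 < p) {η : ℝ} (hη : 0 < η) :
    ∃ C : ℝ, 0 ≤ C ∧ ∀ a b : ℝ, ‖a - b‖ₑ ^ p + ENNReal.ofReal C * ‖(a + b) / 2‖ₑ ^ p ≤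
      ENNReal.ofReal (η + C / 2) * (‖a‖ₑ ^ p + ‖b‖ₑ ^ p) := by
  have hp0 : 0 ≤ p := by linarith
  obtain ⟨C, hC, h⟩ := exists_abs_sub_rpow_le hp hη
  refine ⟨C, hC, fun a b => ?_⟩
  rw [ofReal_abs_rpow' hp0, ofReal_abs_rpow' hp0, ofReal_abs_rpow' hp0, ofReal_abs_rpow' hp0,
    ← ENNReal.ofReal_mul hC, ← ENNReal.ofReal_add (by positivity) (by positivity),
    ← ENNReal.ofReal_add (by positivity) (by positivity), ← ENNReal.ofReal_mul (by positivity)]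
  refine ENNReal.ofReal_le_ofReal ?_
  have := h a b
  linarith

/-- In a uniformly convex Banach space every bounded sequence has a point that represents all limits
of continuous functionals along the sequence: near-minimizers of the norm on the convex hulls of the
tails form a Cauchy sequence. -/
theorem exists_forall_functional_eq {X : Type*} [NormedAddCommGroup X] [NormedSpace ℝ X]
    [CompleteSpace X] (hp : 0 < p)
    (hX : ∀ η : ℝ, 0 < η → ∃ C : ℝ, 0 ≤ C ∧ ∀ x y : X, ‖x - y‖ ^ p + C * ‖(1 / 2 : ℝ) • (x + y)‖ ^ p ≤
      (η + C / 2) * (‖x‖ ^ p + ‖y‖ ^ p))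
    {D : ℕ → X} {B : ℝ} (hB : ∀ n, ‖D n‖ ≤ B) :
    ∃ g : X, ∀ (ℓ : X →L[ℝ] ℝ) (L : ℝ), Tendsto (fun n => ℓ (D n)) atTop (𝓝 L) → ℓ g = L := by
  have hB0 : 0 ≤ B := (norm_nonneg _).trans (hB 0)
  set T : ℕ → Set X := fun n => convexHull ℝ (D '' Ici n) with hT
  have hTmono : ∀ {m n}, m ≤ n → T n ⊆ T m := fun {m n} h =>
    convexHull_mono (image_mono (Ici_subset_Ici.2 h))
  have hTne : ∀ n, (T n).Nonempty := fun n => ⟨D n, subset_convexHull ℝ _ ⟨n, self_mem_Ici, rfl⟩⟩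
  have hTB : ∀ n, ∀ x ∈ T n, ‖x‖ ≤ B := fun n x hx => by
    have : T n ⊆ Metric.closedBall 0 B := convexHull_min (by
      rintro _ ⟨k, -, rfl⟩
      simpa using hB k) (convex_closedBall _ _)
    simpa using this hx
  set φ : X → ℝ := fun x => ‖x‖ ^ p with hφ
  have hφ0 : ∀ x, 0 ≤ φ x := fun x => Real.rpow_nonneg (norm_nonneg _) _
  have hbdd : ∀ n, BddBelow (φ '' T n) := fun n => ⟨0, by rintro _ ⟨x, -, rfl⟩; exact hφ0 x⟩
  set m : ℕ → ℝ := fun n => sInf (φ '' T n) with hm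
  have hmle : ∀ n, ∀ x ∈ T n, m n ≤ φ x := fun n x hx => csInf_le (hbdd n) ⟨x, hx, rfl⟩
  have hφB : ∀ n, ∀ x ∈ T n, φ x ≤ B ^ p := fun n x hx =>
    Real.rpow_le_rpow (norm_nonneg _) (hTB n x hx) hp.le
  have hmmono : Monotone m := fun a b h => csInf_le_csInf (hbdd a) ((hTne b).image φ)
    (image_mono (hTmono h))
  have hmB : BddAbove (range m) := ⟨B ^ p, by
    rintro _ ⟨n, rfl⟩
    obtain ⟨x, hx⟩ := hTne n
    exact (hmle n x hx).trans (hφB n x hx)⟩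
  have hmlim := tendsto_atTop_ciSup hmmono hmB
  set mi := ⨆ n, m n with hmi
  have hg : ∀ n : ℕ, ∃ x ∈ T n, φ x < m n + 1 / ((n : ℝ) + 1) := fun n => by
    obtain ⟨_, ⟨x, hx, rfl⟩, h⟩ := exists_lt_of_csInf_lt ((hTne n).image φ)
      (lt_add_of_pos_right (m n) (by positivity : 0 < 1 / ((n : ℝ) + 1)))
    exact ⟨x, hx, h⟩
  choose g hgT hgm using hg
  have hdef : Tendsto (fun N : ℕ => mi - m N + 1 / ((N : ℝ) + 1)) atTop (𝓝 0) := by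
    have h1 := (tendsto_const_nhds (x := mi)).sub hmlim
    simpa using h1.add tendsto_one_div_add_atTop_nhds_zero_nat
  have hcauchy : CauchySeq g := by
    rw [Metric.cauchySeq_iff]
    intro ε hε
    have hεp : 0 < ε ^ p := Real.rpow_pos_of_pos hε p
    set η : ℝ := ε ^ p / (4 * (B ^ p + 1)) with hη
    have hBp : 0 ≤ B ^ p := Real.rpow_nonneg hB0 p
    have hη0 : 0 < η := by positivity
    obtain ⟨C, hC0, hC⟩ := hX η hη0
    have h2 : Tendsto (fun N : ℕ => C * (mi - m N + 1 / ((N : ℝ) + 1))) atTop (𝓝 0) := by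
      simpa using hdef.const_mul C
    obtain ⟨N, hN⟩ := (h2.eventually_lt_const (by positivity : 0 < ε ^ p / 2)).exists
    refine ⟨N, fun a ha b hb => ?_⟩
    have ha' := hTmono ha (hgT a)
    have hb' := hTmono hb (hgT b)
    have hmid : (1 / 2 : ℝ) • (g a + g b) ∈ T N := by
      have := (convex_convexHull ℝ (D '' Ici N)) ha' hb' (a := 1 / 2) (b := 1 / 2) (by norm_num)
        (by norm_num) (by norm_num)
      rwa [← smul_add] at this
    have h3 : ∀ c, N ≤ c → φ (g c) ≤ mi + 1 / ((N : ℝ) + 1) := fun c hc => by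
      have h4 : m c ≤ mi := le_ciSup hmB c
      have h5 : 1 / ((c : ℝ) + 1) ≤ 1 / ((N : ℝ) + 1) := by
        have : (N : ℝ) ≤ c := by exact_mod_cast hc
        gcongr
      linarith [hgm c]
    have h4 := hC (g a) (g b)
    have h5 := mul_le_mul_of_nonneg_left (hmle N _ hmid) hC0
    have h6 := mul_le_mul_of_nonneg_left (h3 a ha) hC0
    have h7 := mul_le_mul_of_nonneg_left (h3 b hb) hC0
    have h8 := mul_le_mul_of_nonneg_left (hφB a _ (hgT a)) hη0.le
    have h9 := mul_le_mul_of_nonneg_left (hφB b _ (hgT b)) hη0.le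
    have h10 : 2 * (η * B ^ p) ≤ ε ^ p / 2 := by
      rw [hη, div_mul_eq_mul_div, ← mul_div_assoc, div_le_div_iff₀ (by positivity) (by norm_num)]
      nlinarith
    have h11 : ‖g a - g b‖ ^ p < ε ^ p := by
      simp only [hφ] at h5 h6 h7 h8 h9
      nlinarith
    rw [dist_eq_norm]
    exact lt_of_not_ge fun hle => absurd (Real.rpow_le_rpow hε.le hle hp.le) (not_le.2 h11)
  obtain ⟨x, hx⟩ := cauchySeq_tendsto_of_complete hcauchy
  refine ⟨x, fun ℓ L hL => ?_⟩
  refine tendsto_nhds_unique ((ℓ.continuous.tendsto x).comp hx) ?_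
  rw [Metric.tendsto_atTop] at hL ⊢
  intro δ hδ
  obtain ⟨N, hN⟩ := hL δ hδ
  refine ⟨N, fun n hn => ?_⟩
  have hsub : T N ⊆ ℓ ⁻¹' Metric.ball L δ := convexHull_min (by
    rintro _ ⟨k, hk, rfl⟩
    exact hN k hk) ((convex_ball L δ).linear_preimage ℓ.toLinearMap)
  exact hsub (hTmono hn (hgT n))

theorem Lp_norm_rpow {α : Type*} [MeasurableSpace α] {μ : Measure α} (hp : 0 < p)
    (f : Lp ℝ (ENNReal.ofReal p) μ) : ‖f‖ ^ p = (∫⁻ x, ‖f x‖ₑ ^ p ∂μ).toReal := by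
  rw [Lp.norm_def, ← eLpNorm_rpow_eq hp, ENNReal.toReal_rpow]

theorem Lp_exists_uniform_convexity {α : Type*} [MeasurableSpace α] {μ : Measure α} (hp : 1 < p)
    {η : ℝ} (hη : 0 < η) : ∃ C : ℝ, 0 ≤ C ∧ ∀ f g : Lp ℝ (ENNReal.ofReal p) μ,
      ‖f - g‖ ^ p + C * ‖(1 / 2 : ℝ) • (f + g)‖ ^ p ≤ (η + C / 2) * (‖f‖ ^ p + ‖g‖ ^ p) := by
  have hp0 : 0 < p := by linarith
  obtain ⟨C, hC, h⟩ := exists_enorm_sub_rpow_le hp hη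
  refine ⟨C, hC, fun f g => ?_⟩
  rw [Lp_norm_rpow hp0, Lp_norm_rpow hp0, Lp_norm_rpow hp0, Lp_norm_rpow hp0]
  have hfin : ∀ f : Lp ℝ (ENNReal.ofReal p) μ, ∫⁻ x, ‖f x‖ₑ ^ p ∂μ ≠ ⊤ := fun f =>
    (lintegral_rpow_lt_top hp0 (Lp.memLp f)).ne
  have hm : ∀ f : Lp ℝ (ENNReal.ofReal p) μ, AEMeasurable (fun x => ‖f x‖ₑ ^ p) μ := fun f =>
    (Lp.aestronglyMeasurable f).aemeasurable.enorm.pow_const p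
  have key : (∫⁻ x, ‖(f - g) x‖ₑ ^ p ∂μ) +
      ENNReal.ofReal C * ∫⁻ x, ‖((1 / 2 : ℝ) • (f + g)) x‖ₑ ^ p ∂μ ≤
      ENNReal.ofReal (η + C / 2) * ((∫⁻ x, ‖f x‖ₑ ^ p ∂μ) + ∫⁻ x, ‖g x‖ₑ ^ p ∂μ) := by
    rw [← lintegral_add_left' (hm f), ← lintegral_const_mul' _ _ ENNReal.ofReal_ne_top,
      ← lintegral_const_mul' _ _ ENNReal.ofReal_ne_top, ← lintegral_add_left' (hm (f - g))]
    refine lintegral_mono_ae ?_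
    filter_upwards [Lp.coeFn_sub f g, Lp.coeFn_smul (1 / 2 : ℝ) (f + g), Lp.coeFn_add f g]
      with x h1 h2 h3
    rw [h1, h2, Pi.sub_apply, Pi.smul_apply, h3, Pi.add_apply]
    have := h (f x) (g x)
    have e : (1 / 2 : ℝ) • (f x + g x) = (f x + g x) / 2 := by rw [smul_eq_mul]; ring
    rwa [e]
  have h2 := ENNReal.toReal_mono (ENNReal.mul_ne_top ENNReal.ofReal_ne_top
    (ENNReal.add_ne_top.2 ⟨hfin f, hfin g⟩)) key
  rwa [ENNReal.toReal_add (hfin _) (ENNReal.mul_ne_top ENNReal.ofReal_ne_top (hfin _)),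
    ENNReal.toReal_mul, ENNReal.toReal_mul, ENNReal.toReal_add (hfin _) (hfin _),
    ENNReal.toReal_ofReal hC, ENNReal.toReal_ofReal (by positivity)] at h2

/-- Weak sequential compactness of bounded sequences in `Lᵖ`, tested against a family of functions
for which the integrals converge. -/
theorem exists_weak_limit {α : Type*} [MeasurableSpace α] {μ : Measure α} (hp : 1 < p)
    {D : ℕ → α → ℝ} (hD : ∀ n, AEStronglyMeasurable (D n) μ) {c : ℝ≥0∞} (hc : c ≠ ⊤)
    (hDc : ∀ n, ∫⁻ x, ‖D n x‖ₑ ^ p ∂μ ≤ c) :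
    ∃ g : α → ℝ, MemLp g (ENNReal.ofReal p) μ ∧ ∀ (φ : α → ℝ) (L : ℝ),
      MemLp φ (ENNReal.ofReal (p / (p - 1))) μ →
      Tendsto (fun n => ∫ x, D n x * φ x ∂μ) atTop (𝓝 L) → ∫ x, g x * φ x ∂μ = L := by
  have hp0 : 0 < p := by linarith
  have : Fact (1 ≤ ENNReal.ofReal p) := ⟨by simpa using hp.le⟩
  have hq : 1 ≤ p / (p - 1) := by rw [le_div_iff₀ (by linarith)]; linarith
  have : Fact (1 ≤ ENNReal.ofReal (p / (p - 1))) := ⟨by simpa using hq⟩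
  have hconj : p.HolderConjugate (p / (p - 1)) := Real.HolderConjugate.conjExponent hp
  have : (ENNReal.ofReal p).HolderConjugate (ENNReal.ofReal (p / (p - 1))) := hconj.ennrealOfReal
  have hDm : ∀ n, MemLp (D n) (ENNReal.ofReal p) μ := fun n =>
    memLp_of_lintegral_lt_top hp0 (hD n) ((hDc n).trans_lt hc.lt_top)
  obtain ⟨g, hg⟩ := exists_forall_functional_eq (X := Lp ℝ (ENNReal.ofReal p) μ) hp0
    (fun η hη => Lp_exists_uniform_convexity hp hη) (D := fun n => (hDm n).toLp (D n))
    (B := c.toReal ^ (1 / p)) (fun n => by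
      rw [Lp.norm_toLp, eLpNorm_eq_rpow hp0, ← ENNReal.toReal_rpow]
      exact Real.rpow_le_rpow ENNReal.toReal_nonneg (ENNReal.toReal_mono hc (hDc n))
        (by positivity))
  refine ⟨g, Lp.memLp g, fun φ L hφ hL => ?_⟩
  set ℓ := ((ContinuousLinearMap.mul ℝ ℝ).lpPairing μ (ENNReal.ofReal p)
    (ENNReal.ofReal (p / (p - 1)))).flip (hφ.toLp φ) with hℓ
  have hℓe : ∀ f : Lp ℝ (ENNReal.ofReal p) μ, ℓ f = ∫ x, f x * φ x ∂μ := fun f => by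
    rw [hℓ, ContinuousLinearMap.flip_apply, ContinuousLinearMap.lpPairing_eq_integral]
    refine integral_congr_ae ?_
    filter_upwards [hφ.coeFn_toLp] with x hx
    simp [hx]
  rw [← hℓe]
  refine hg ℓ L (hL.congr fun n => ?_)
  rw [hℓe]
  refine integral_congr_ae ?_
  filter_upwards [(hDm n).coeFn_toLp] with x hx
  rw [hx]

end UniformConvexity

/-! ### Weak gradients from difference quotients -/

section GradientFromShifts

variable {d : ℕ} {p : ℝ}

theorem exists_abs_sub_le_of_contDiff {φ : E d → ℝ} (hφ : ContDiff ℝ ∞ φ)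
    (hc : HasCompactSupport φ) : ∃ M : ℝ, 0 ≤ M ∧ ∀ x y, |φ x - φ y| ≤ M * ‖x - y‖ := by
  obtain ⟨M, hM⟩ := hφ.lipschitzWith_of_hasCompactSupport hc (by simp)
  exact ⟨M, M.2, fun x y => by simpa [Real.dist_eq, dist_eq_norm] using hM.dist_le_mul x y⟩

/-- Integrals of difference quotients against test functions converge to the distributional
derivative. -/
theorem tendsto_integral_difference_quotient {u : E d → ℝ} (hu : LocallyIntegrable u)
    {φ : E d → ℝ} (hφ : ContDiff ℝ ∞ φ) (hc : HasCompactSupport φ) {e : E d} (he : ‖e‖ ≤ 1) :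
    Tendsto (fun n : ℕ => ∫ x, ((n + 1 : ℝ) * (u (x + ((n + 1 : ℝ)⁻¹) • e) - u x)) * φ x) atTop
      (𝓝 (- ∫ x, u x * fderiv ℝ φ x e)) := by
  obtain ⟨M, hM0, hM⟩ := exists_abs_sub_le_of_contDiff hφ hc
  set K := Metric.cthickening 1 (tsupport φ) with hK
  have hKc : IsCompact K := hc.isCompact.cthickening
  have hstep : ∀ n : ℕ, ‖((n + 1 : ℝ)⁻¹) • e‖ ≤ 1 := fun n => by
    rw [norm_smul, Real.norm_of_nonneg (by positivity)]
    have : (n + 1 : ℝ)⁻¹ ≤ 1 := inv_le_one_of_one_le₀ (by linarith [Nat.cast_nonneg (α := ℝ) n])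
    calc _ ≤ (1 : ℝ) * 1 := mul_le_mul this he (norm_nonneg _) zero_le_one
      _ = 1 := one_mul 1
  have hzero : ∀ (h : E d), ‖h‖ ≤ 1 → ∀ x, x ∉ K → φ (x - h) = 0 := fun h hh x hx => by
    refine image_eq_zero_of_notMem_tsupport fun hmem => hx ?_
    refine Metric.mem_cthickening_of_dist_le x (x - h) 1 _ hmem ?_
    rw [dist_eq_norm]
    simpa using hh
  have hui : ∀ ψ : E d → ℝ, Continuous ψ → (∀ x, x ∉ K → ψ x = 0) →
      Integrable (fun x => u x * ψ x) := fun ψ hψ h0 => by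
    have h1 : IntegrableOn (fun x => u x * ψ x) K :=
      (hu.integrableOn_isCompact hKc).mul_continuousOn hψ.continuousOn hKc
    refine (integrableOn_iff_integrable_of_support_subset fun x hx => ?_).1 h1
    by_contra hxK
    exact hx (by simp [h0 x hxK])
  have hzero0 : ∀ x, x ∉ K → φ x = 0 := fun x hx => by simpa using hzero 0 (by simp) x hx
  have e1 : ∀ n : ℕ, ∫ x, ((n + 1 : ℝ) * (u (x + ((n + 1 : ℝ)⁻¹) • e) - u x)) * φ x =
      ∫ x, u x * ((n + 1 : ℝ) * (φ (x - ((n + 1 : ℝ)⁻¹) • e) - φ x)) := by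
    intro n
    set h := ((n + 1 : ℝ)⁻¹) • e with hh
    have i1 := hui (fun x => φ (x - h)) (hφ.continuous.comp (by fun_prop)) (hzero h (hstep n))
    have i2 := hui φ hφ.continuous hzero0
    have i3 : Integrable (fun x => u (x + h) * φ x) := by
      have := i1.comp_add_right h
      simpa using this
    have e2 : ∫ x, u (x + h) * φ x = ∫ x, u x * φ (x - h) := by
      rw [← integral_add_right_eq_self (fun x => u x * φ (x - h)) h]
      simp
    calc ∫ x, ((n + 1 : ℝ) * (u (x + h) - u x)) * φ x
        = ∫ x, (n + 1 : ℝ) * (u (x + h) * φ x - u x * φ x) := by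
          congr 1; funext x; ring
      _ = (n + 1 : ℝ) * ((∫ x, u (x + h) * φ x) - ∫ x, u x * φ x) := by
          rw [integral_const_mul, integral_sub i3 i2]
      _ = (n + 1 : ℝ) * ((∫ x, u x * φ (x - h)) - ∫ x, u x * φ x) := by rw [e2]
      _ = ∫ x, (n + 1 : ℝ) * (u x * φ (x - h) - u x * φ x) := by
          rw [integral_const_mul, integral_sub i1 i2]
      _ = _ := by congr 1; funext x; ring
  simp_rw [e1]
  rw [← integral_neg]
  have hbi : Integrable (fun x => K.indicator (fun x => ‖u x‖ * M) x) := by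
    rw [integrable_indicator_iff hKc.measurableSet]
    exact ((hu.integrableOn_isCompact hKc).norm).mul_const M
  refine tendsto_integral_of_dominated_convergence _ (fun n => ?_) hbi (fun n => ?_) ?_
  · refine (hui _ ?_ ?_).1
    · exact continuous_const.mul ((hφ.continuous.comp (by fun_prop)).sub hφ.continuous)
    · intro x hx
      rw [hzero _ (hstep n) x hx, hzero0 x hx]; simp
  · refine Eventually.of_forall fun x => ?_
    by_cases hx : x ∈ K
    · rw [indicator_of_mem hx, norm_mul]
      refine mul_le_mul_of_nonneg_left ?_ (norm_nonneg _)
      rw [norm_mul, Real.norm_of_nonneg (by positivity : (0 : ℝ) ≤ n + 1), Real.norm_eq_abs]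
      have h1 := hM (x - ((n + 1 : ℝ)⁻¹) • e) x
      rw [sub_sub_cancel_left, norm_neg, norm_smul, Real.norm_of_nonneg (by positivity)] at h1
      calc (n + 1 : ℝ) * |φ (x - ((n + 1 : ℝ)⁻¹) • e) - φ x|
          ≤ (n + 1 : ℝ) * (M * ((n + 1 : ℝ)⁻¹ * ‖e‖)) :=
            mul_le_mul_of_nonneg_left h1 (by positivity)
        _ = M * ‖e‖ := by field_simp
        _ ≤ M := mul_le_of_le_one_right hM0 he
    · rw [indicator_of_notMem hx, hzero _ (hstep n) x hx, hzero0 x hx]; simp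
  · refine Eventually.of_forall fun x => ?_
    have hd : HasFDerivAt φ (fderiv ℝ φ x) x := (hφ.differentiable (by simp) x).hasFDerivAt
    have hl := hd.lim_real (-e)
    have hn : Tendsto (fun n : ℕ => (n + 1 : ℝ)) atTop atTop :=
      tendsto_atTop_add_const_right _ _ tendsto_natCast_atTop_atTop
    have h2 := (hl.comp hn).const_mul (u x)
    rw [map_neg, mul_neg] at h2
    refine h2.congr fun n => ?_
    simp [sub_eq_add_neg]

/-- A function whose translations are Lipschitz in `Lᵖ(ℝᵈ)` at small scales, `1 < p < ∞`, belongs to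
`W^{1,p}(ℝᵈ)`. -/
theorem exists_isWeakGrad_of_shiftInt_le (hp : 1 < p) {u : E d → ℝ}
    (hup : MemLp u (ENNReal.ofReal p) volume) {c : ℝ≥0∞} (hc : c ≠ ⊤) {r₀ : ℝ} (hr₀ : 0 < r₀)
    (h : ∀ k : E d, ‖k‖ ≤ r₀ → shiftInt p univ univ u k ≤ c * ‖k‖ₑ ^ p) :
    ∃ G : E d → E d, Measurable G ∧ MemLp G (ENNReal.ofReal p) volume ∧ IsWeakGrad univ u G := by
  have hp0 : 0 < p := by linarith
  have hp1 : 1 ≤ ENNReal.ofReal p := by simpa using hp.le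
  have hui : LocallyIntegrable u := hup.locallyIntegrable hp1
  obtain ⟨N, hN⟩ := exists_nat_gt (1 / r₀)
  have hdir : ∀ i : Fin d, ∃ g : E d → ℝ, MemLp g (ENNReal.ofReal p) volume ∧ Measurable g ∧
      ∀ φ : E d → ℝ, ContDiff ℝ ∞ φ → HasCompactSupport φ →
        ∫ x, g x * φ x = - ∫ x, u x * fderiv ℝ φ x (EuclideanSpace.single i 1) := by
    intro i
    set e : E d := EuclideanSpace.single i 1 with he
    have he1 : ‖e‖ = 1 := by simp [he]
    set D : ℕ → E d → ℝ := fun n x =>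
      ((n + N : ℕ) + 1 : ℝ) * (u (x + ((((n + N : ℕ) : ℝ) + 1)⁻¹) • e) - u x) with hD
    have hDm : ∀ n, AEStronglyMeasurable (D n) volume := fun n =>
      (((aemeasurable_shift hup.1.aemeasurable _).sub hup.1.aemeasurable).const_mul
        _).aestronglyMeasurable
    obtain ⟨g, hg, hgφ⟩ := exists_weak_limit hp hDm hc fun n => by
      set t : ℝ := ((n + N : ℕ) : ℝ) + 1 with ht
      have ht0 : 0 < t := by positivity
      have hk : ‖t⁻¹ • e‖ = t⁻¹ := by
        rw [norm_smul, he1, mul_one, Real.norm_of_nonneg (by positivity)]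
      have htr : t⁻¹ ≤ r₀ := by
        rw [inv_le_comm₀ ht0 hr₀, ← one_div]
        have : (N : ℝ) ≤ t := by rw [ht]; push_cast; linarith [Nat.cast_nonneg (α := ℝ) n]
        linarith
      have h1 := h (t⁻¹ • e) (hk.le.trans htr)
      have h2 : ∫⁻ x, ‖D n x‖ₑ ^ p = ‖t‖ₑ ^ p * shiftInt p univ univ u (t⁻¹ • e) := by
        unfold shiftInt
        simp only [mem_univ, and_self, ofPred_true, Measure.restrict_univ]
        rw [← lintegral_const_mul' _ _ (ENNReal.rpow_ne_top_of_nonneg hp0.le enorm_ne_top)]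
        refine lintegral_congr fun x => ?_
        rw [← ENNReal.mul_rpow_of_nonneg _ _ hp0.le, ← enorm_mul]
      rw [h2]
      refine (mul_le_mul' le_rfl h1).trans (le_of_eq ?_)
      rw [mul_left_comm, ← ENNReal.mul_rpow_of_nonneg _ _ hp0.le, ← enorm_norm (t⁻¹ • e), hk,
        ← enorm_mul, mul_inv_cancel₀ ht0.ne']
      simp
    refine ⟨hg.1.mk g, hg.ae_eq hg.1.ae_eq_mk, hg.1.stronglyMeasurable_mk.measurable,
      fun φ hφ hφc => ?_⟩
    have h3 : ∫ x, hg.1.mk g x * φ x = ∫ x, g x * φ x := by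
      refine integral_congr_ae ?_
      filter_upwards [hg.1.ae_eq_mk] with x hx
      rw [hx]
    rw [h3]
    refine hgφ φ _ (hφ.continuous.memLp_of_hasCompactSupport hφc) ?_
    exact (tendsto_add_atTop_iff_nat N).2
      (tendsto_integral_difference_quotient hui hφ hφc he1.le)
  choose g hg hgm hgφ using hdir
  have hGm : Measurable fun x => ∑ i, g i x • (EuclideanSpace.single i 1 : E d) :=
    Finset.measurable_sum _ fun i _ => (hgm i).smul_const _
  have hGp : MemLp (fun x => ∑ i, g i x • (EuclideanSpace.single i 1 : E d)) (ENNReal.ofReal p)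
      volume := memLp_finsetSum _ fun i _ => by
    refine MemLp.of_le (hg i) ((hgm i).smul_const _).aestronglyMeasurable
      (Eventually.of_forall fun x => ?_)
    rw [norm_smul]
    simp
  refine ⟨_, hGm, hGp, ⟨hui.locallyIntegrableOn _, (hGp.locallyIntegrable hp1).locallyIntegrableOn _,
    fun φ hφ hφc _ e => ?_⟩⟩
  rw [setIntegral_univ, setIntegral_univ]
  have hin : ∀ x, (inner ℝ (∑ i, g i x • (EuclideanSpace.single i 1 : E d)) e : ℝ) =
      ∑ i, g i x * e i := fun x => by
    rw [sum_inner]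
    refine Finset.sum_congr rfl fun i _ => ?_
    rw [real_inner_smul_left, EuclideanSpace.inner_single_left]
    simp
  have hesum : e = ∑ i, e i • (EuclideanSpace.single i 1 : E d) := by
    ext j
    simp [Finset.sum_apply, Pi.single_apply]
  have hint : ∀ i, Integrable (fun x => g i x * φ x) := fun i => by
    have := integrableOn_mul_test (Ω := univ) (((hg i).locallyIntegrable hp1).locallyIntegrableOn _)
      hφ.continuous hφc (subset_univ _)
    rwa [integrableOn_univ] at this
  have hint2 : ∀ i : Fin d, Integrable (fun x => u x * fderiv ℝ φ x (EuclideanSpace.single i 1)) :=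
      fun i => by
    have := integrableOn_mul_test (Ω := univ) (hui.locallyIntegrableOn _)
      ((hφ.continuous_fderiv (by simp)).clm_apply continuous_const)
      (hφc.fderiv_apply (𝕜 := ℝ) (EuclideanSpace.single i 1 : E d)) (subset_univ _)
    rwa [integrableOn_univ] at this
  calc ∫ x, u x * fderiv ℝ φ x e
      = ∫ x, ∑ i, e i * (u x * fderiv ℝ φ x (EuclideanSpace.single i 1)) := by
        congr 1
        funext x
        conv_lhs => rw [hesum, map_sum, Finset.mul_sum]
        refine Finset.sum_congr rfl fun i _ => ?_
        rw [map_smul, smul_eq_mul]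
        ring
    _ = ∑ i, e i * ∫ x, u x * fderiv ℝ φ x (EuclideanSpace.single i 1) := by
        rw [integral_finsetSum _ fun i _ => (hint2 i).const_mul _]
        simp_rw [integral_const_mul]
    _ = - ∑ i, e i * ∫ x, g i x * φ x := by
        rw [← Finset.sum_neg_distrib]
        refine Finset.sum_congr rfl fun i _ => ?_
        rw [hgφ i φ hφ hφc]
        ring
    _ = - ∫ x, ∑ i, e i * (g i x * φ x) := by
        rw [integral_finsetSum _ fun i _ => (hint i).const_mul _]
        simp_rw [integral_const_mul]
    _ = _ := by
        congr 2
        funext x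
        rw [hin, Finset.sum_mul]
        refine Finset.sum_congr rfl fun i _ => ?_
        ring

end GradientFromShifts

/-! ### Sobolev extension -/

section SobolevExtension

variable {d : ℕ} {p : ℝ}

theorem IsWeakGrad.congr_ae {Ω : Set (E d)} (hΩ : MeasurableSet Ω) {u v : E d → ℝ} {G H : E d → E d}
    (hu : IsWeakGrad Ω u G) (hv : LocallyIntegrableOn v Ω) (hH : LocallyIntegrableOn H Ω)
    (h1 : ∀ᵐ x, x ∈ Ω → u x = v x) (h2 : ∀ᵐ x, x ∈ Ω → G x = H x) : IsWeakGrad Ω v H := by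
  refine ⟨hv, hH, fun φ hφ hc hs e => ?_⟩
  have e1 : ∫ x in Ω, v x * fderiv ℝ φ x e = ∫ x in Ω, u x * fderiv ℝ φ x e := by
    refine setIntegral_congr_ae hΩ ?_
    filter_upwards [h1] with x hx hxΩ
    rw [hx hxΩ]
  have e2 : ∫ x in Ω, inner ℝ (H x) e * φ x = ∫ x in Ω, inner ℝ (G x) e * φ x := by
    refine setIntegral_congr_ae hΩ ?_
    filter_upwards [h2] with x hx hxΩ
    rw [hx hxΩ]
  rw [e1, e2]
  exact hu.integral_eq φ hφ hc hs e

/-- Near a boundary point, a Sobolev function has Lipschitz translations in `Lᵖ`: the points `x` and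
`x + h` are joined inside the domain by a path that first moves away from the boundary. -/
theorem exists_shiftInt_le_of_mem_frontier (hp : 1 ≤ p) {Ω : Set (E d)} (hΩ : IsOpen Ω)
    (hlip : HasLipschitzBoundary Ω) {x₀ : E d} (hx₀ : x₀ ∈ frontier Ω) :
    ∃ ρ : ℝ, 0 < ρ ∧ ∃ C : ℝ≥0∞, C ≠ ⊤ ∧ ∀ (u : E d → ℝ) (G : E d → E d), IsWeakGrad Ω u G →
      LocallyIntegrable u → AEMeasurable u → Measurable G → LocallyIntegrable G →
      ∀ h : E d, ‖h‖ < ρ →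
        shiftInt p (Ω ∩ Metric.ball x₀ ρ) Ω u h ≤ C * (‖h‖ₑ ^ p * ∫⁻ x in Ω, ‖G x‖ₑ ^ p) := by
  have hp0 : 0 ≤ p := by linarith
  obtain ⟨r, hr, e, he, q, Kq, hql, hqe, hqx, hmem, -⟩ := exists_graph_function hΩ hlip hx₀
  set M : ℝ := Kq + 1 with hM
  have hM0 : 1 ≤ M := by rw [hM]; linarith [Kq.2]
  set ρ : ℝ := r / (2 * (M + 2)) with hρ
  have hρ0 : 0 < ρ := by positivity
  have hρr : (M + 2) * ρ < r := by
    rw [hρ, mul_div_assoc', div_lt_iff₀ (by positivity)]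
    nlinarith
  refine ⟨ρ, hρ0, 2 ^ (p - 1) * (ENNReal.ofReal (M ^ p) + 2 ^ (p - 1) * (1 + ENNReal.ofReal (M ^ p))),
    ?_, fun u G hu hui hum hGm hGi h hh => ?_⟩
  · finiteness
  set I := ∫⁻ x in Ω, ‖G x‖ₑ ^ p with hI
  set t : ℝ := M * ‖h‖ with ht
  have ht0 : 0 ≤ t := by positivity
  have htρ : t ≤ M * ρ := mul_le_mul_of_nonneg_left hh.le (by linarith)
  have hnt : ‖t • e‖ₑ ^ p = ENNReal.ofReal (M ^ p) * ‖h‖ₑ ^ p := by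
    rw [← enorm_norm (t • e), norm_smul, he, mul_one, enorm_norm, ht, enorm_mul, enorm_norm,
      ENNReal.mul_rpow_of_nonneg _ _ hp0, Real.enorm_eq_ofReal (by linarith),
      ENNReal.ofReal_rpow_of_nonneg (by linarith) hp0]
  set A := Ω ∩ Metric.ball x₀ ρ with hA
  set C := Ω ∩ Metric.ball x₀ (2 * ρ) with hC
  set A₁ : Set (E d) := (fun x => x - t • e) ⁻¹' A with hA₁
  set C₁ : Set (E d) := (fun x => x - t • e) ⁻¹' C with hC₁
  have hAo : IsOpen A := hΩ.inter Metric.isOpen_ball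
  have hCo : IsOpen C := hΩ.inter Metric.isOpen_ball
  have hA₁o : IsOpen A₁ := hAo.preimage (by fun_prop)
  have hC₁o : IsOpen C₁ := hCo.preimage (by fun_prop)
  -- upward segments stay in the domain
  have hup : ∀ x ∈ C, ∀ s ∈ Icc (0 : ℝ) 1, x + s • (t • e) ∈ Ω := by
    intro x hx s hs
    have hxr : x ∈ Metric.ball x₀ r := Metric.ball_subset_ball (by nlinarith) hx.2
    have hx2 := hx.2
    rw [Metric.mem_ball, dist_eq_norm] at hx2
    have hin : x + s • (t • e) ∈ Metric.ball x₀ r := by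
      rw [Metric.mem_ball, dist_eq_norm]
      calc ‖x + s • (t • e) - x₀‖ = ‖(x - x₀) + s • (t • e)‖ := by congr 1; abel
        _ ≤ ‖x - x₀‖ + ‖s • (t • e)‖ := norm_add_le _ _
        _ ≤ 2 * ρ + M * ρ := by
            refine add_le_add hx2.le ?_
            rw [norm_smul, norm_smul, he, mul_one, Real.norm_of_nonneg hs.1, Real.norm_of_nonneg ht0]
            exact (mul_le_of_le_one_left ht0 hs.2).trans htρ
        _ < r := by linarith
    rw [hmem _ hin, smul_smul, hqe]
    have := (hmem x hxr).1 hx.1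
    have h2 : 0 ≤ s * t := mul_nonneg hs.1 ht0
    linarith
  have hside : ∀ x ∈ A₁, ∀ s ∈ Icc (0 : ℝ) 1, x + s • h ∈ Ω := by
    intro x hx s hs
    have hy : x - t • e ∈ A := hx
    set y := x - t • e with hy'
    have hyr : y ∈ Metric.ball x₀ r := Metric.ball_subset_ball (by nlinarith) hy.2
    have hy2 := hy.2
    rw [Metric.mem_ball, dist_eq_norm] at hy2
    have hxe : x + s • h = (y + s • h) + t • e := by rw [hy']; abel
    have hsh : ‖s • h‖ ≤ ‖h‖ := by
      rw [norm_smul, Real.norm_of_nonneg hs.1]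
      exact mul_le_of_le_one_left (norm_nonneg _) hs.2
    have hin : x + s • h ∈ Metric.ball x₀ r := by
      rw [Metric.mem_ball, dist_eq_norm, hxe]
      calc ‖y + s • h + t • e - x₀‖ = ‖(y - x₀) + (s • h + t • e)‖ := by congr 1; abel
        _ ≤ ‖y - x₀‖ + (‖s • h‖ + ‖t • e‖) := (norm_add_le _ _).trans
            (add_le_add le_rfl (norm_add_le _ _))
        _ ≤ ρ + (ρ + M * ρ) := by
            refine add_le_add hy2.le (add_le_add (hsh.trans hh.le) ?_)
            rw [norm_smul, he, mul_one, Real.norm_of_nonneg ht0]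
            exact htρ
        _ < r := by linarith
    rw [hmem _ hin, hxe, hqe]
    have h1 := (hmem y hyr).1 hy.1
    have h2 : q (y + s • h) - q y ≤ Kq * ‖h‖ := by
      have := hql.dist_le_mul (y + s • h) y
      rw [Real.dist_eq, dist_eq_norm, add_sub_cancel_left] at this
      exact (le_abs_self _).trans (this.trans (mul_le_mul_of_nonneg_left hsh Kq.2))
    have h3 : t = Kq * ‖h‖ + ‖h‖ := by rw [ht, hM]; ring
    have h4 := norm_nonneg h
    linarith
  have hb1 : shiftInt p A A₁ u (t • e) ≤ ENNReal.ofReal (M ^ p) * ‖h‖ₑ ^ p * I := by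
    rw [← hnt]
    refine (lintegral_mono_set fun x hx => hx.1).trans
      (lintegral_shift_sub_le hp hΩ.measurableSet hAo hu hui hGm hGi _ fun x hx =>
        hup x ⟨hx.1, Metric.ball_subset_ball (by linarith) hx.2⟩)
  have hb2 : shiftInt p A₁ C₁ u h ≤ ‖h‖ₑ ^ p * I :=
    (lintegral_mono_set fun x hx => hx.1).trans
      (lintegral_shift_sub_le hp hΩ.measurableSet hA₁o hu hui hGm hGi _ hside)
  have hb3 : shiftInt p C₁ C u (-(t • e)) ≤ ENNReal.ofReal (M ^ p) * ‖h‖ₑ ^ p * I := by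
    rw [shiftInt_neg p hC₁o.measurableSet hCo.measurableSet, ← hnt]
    exact (lintegral_mono_set fun x hx => hx.1).trans
      (lintegral_shift_sub_le hp hΩ.measurableSet hCo hu hui hGm hGi _ hup)
  have hAC : shiftInt p A Ω u h ≤ shiftInt p A C u h := by
    refine lintegral_mono_set fun x hx => ⟨hx.1, hx.2, ?_⟩
    have h1 := hx.1.2
    rw [Metric.mem_ball, dist_eq_norm] at h1 ⊢
    calc ‖x + h - x₀‖ = ‖(x - x₀) + h‖ := by congr 1; abel
      _ ≤ ‖x - x₀‖ + ‖h‖ := norm_add_le _ _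
      _ < 2 * ρ := by linarith
  have hs1 := shiftInt_add_le hp hAo.measurableSet hCo.measurableSet hum (t • e) (h + -(t • e))
    (B := A₁) fun x hx _ => by simpa [hA₁] using hx
  have hs2 := shiftInt_add_le hp hA₁o.measurableSet hCo.measurableSet hum h (-(t • e))
    (B := C₁) fun x _ hx => by
      rw [hC₁, mem_preimage, sub_eq_add_neg]
      exact hx
  have e0 : t • e + (h + -(t • e)) = h := by abel
  rw [e0] at hs1
  calc shiftInt p A Ω u h ≤ shiftInt p A C u h := hAC
    _ ≤ 2 ^ (p - 1) * (ENNReal.ofReal (M ^ p) * ‖h‖ₑ ^ p * I +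
          2 ^ (p - 1) * (‖h‖ₑ ^ p * I + ENNReal.ofReal (M ^ p) * ‖h‖ₑ ^ p * I)) :=
        hs1.trans (mul_le_mul' le_rfl (add_le_add hb1 (hs2.trans
          (mul_le_mul' le_rfl (add_le_add hb2 hb3)))))
    _ = _ := by ring

theorem exists_shiftInt_le_of_mem_closure (hp : 1 ≤ p) {Ω : Set (E d)} (hΩ : IsOpen Ω)
    (hlip : HasLipschitzBoundary Ω) {x₀ : E d} (hx₀ : x₀ ∈ closure Ω) :
    ∃ ρ : ℝ, 0 < ρ ∧ ∃ C : ℝ≥0∞, C ≠ ⊤ ∧ ∀ (u : E d → ℝ) (G : E d → E d), IsWeakGrad Ω u G →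
      LocallyIntegrable u → AEMeasurable u → Measurable G → LocallyIntegrable G →
      ∀ h : E d, ‖h‖ < ρ →
        shiftInt p (Ω ∩ Metric.ball x₀ ρ) Ω u h ≤ C * (‖h‖ₑ ^ p * ∫⁻ x in Ω, ‖G x‖ₑ ^ p) := by
  by_cases hxΩ : x₀ ∈ Ω
  · obtain ⟨r, hr, hsub⟩ := Metric.isOpen_iff.1 hΩ x₀ hxΩ
    refine ⟨r / 2, half_pos hr, 1, ENNReal.one_ne_top, fun u G hu hui _ hGm hGi h hh => ?_⟩
    rw [one_mul]
    refine (lintegral_mono_set fun x hx => hx.1).trans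
      (lintegral_shift_sub_le hp hΩ.measurableSet (hΩ.inter Metric.isOpen_ball) hu hui hGm hGi _
        fun x hx s hs => hsub ?_)
    have h1 := hx.2
    rw [Metric.mem_ball, dist_eq_norm] at h1 ⊢
    calc ‖x + s • h - x₀‖ = ‖(x - x₀) + s • h‖ := by congr 1; abel
      _ ≤ ‖x - x₀‖ + ‖s • h‖ := norm_add_le _ _
      _ < r / 2 + r / 2 := by
          refine add_lt_add h1 (lt_of_le_of_lt ?_ hh)
          rw [norm_smul, Real.norm_of_nonneg hs.1]
          exact mul_le_of_le_one_left (norm_nonneg _) hs.2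
      _ = r := add_halves r
  · exact exists_shiftInt_le_of_mem_frontier hp hΩ hlip ⟨hx₀, by rwa [hΩ.interior_eq]⟩

/-- Sobolev functions on a bounded Lipschitz domain have Lipschitz translations in `Lᵖ`. -/
theorem exists_shiftInt_le_of_isWeakGrad (hp : 1 ≤ p) {Ω : Set (E d)} (hΩ : IsOpen Ω)
    (hbdd : Bornology.IsBounded Ω) (hlip : HasLipschitzBoundary Ω) :
    ∃ ρ : ℝ, 0 < ρ ∧ ∃ C : ℝ≥0∞, C ≠ ⊤ ∧ ∀ (u : E d → ℝ) (G : E d → E d), IsWeakGrad Ω u G →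
      LocallyIntegrable u → AEMeasurable u → Measurable G → LocallyIntegrable G →
      ∀ h : E d, ‖h‖ < ρ →
        shiftInt p Ω Ω u h ≤ C * (‖h‖ₑ ^ p * ∫⁻ x in Ω, ‖G x‖ₑ ^ p) := by
  have hloc : ∀ x : E d, ∃ ρ : ℝ, ∃ C : ℝ≥0∞, x ∈ closure Ω → 0 < ρ ∧ C ≠ ⊤ ∧
      ∀ (u : E d → ℝ) (G : E d → E d), IsWeakGrad Ω u G →
      LocallyIntegrable u → AEMeasurable u → Measurable G → LocallyIntegrable G →
      ∀ h : E d, ‖h‖ < ρ →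
        shiftInt p (Ω ∩ Metric.ball x ρ) Ω u h ≤ C * (‖h‖ₑ ^ p * ∫⁻ x in Ω, ‖G x‖ₑ ^ p) := by
    intro x
    by_cases hx : x ∈ closure Ω
    · obtain ⟨ρ, h1, C, h2, h3⟩ := exists_shiftInt_le_of_mem_closure hp hΩ hlip hx
      exact ⟨ρ, C, fun _ => ⟨h1, h2, h3⟩⟩
    · exact ⟨0, 0, fun h => absurd h hx⟩
  choose ρ C hloc using hloc
  obtain ⟨t, ht, hcov⟩ := hbdd.isCompact_closure.elim_nhds_subcover
    (fun x => Metric.ball x (ρ x)) fun x hx => Metric.ball_mem_nhds x (hloc x hx).1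
  have hη : ∃ η : ℝ, 0 < η ∧ ∀ i ∈ t, η ≤ ρ i := by
    by_cases hne : t.Nonempty
    · obtain ⟨i, hi, hmin⟩ := t.exists_min_image ρ hne
      exact ⟨ρ i, (hloc i (ht i hi)).1, hmin⟩
    · rw [Finset.not_nonempty_iff_eq_empty] at hne
      exact ⟨1, one_pos, by simp [hne]⟩
  obtain ⟨η, hη, hηt⟩ := hη
  refine ⟨η, hη, ∑ i ∈ t, C i, ENNReal.sum_ne_top.2 fun i hi => (hloc i (ht i hi)).2.1,
    fun u G hu hui hum hGm hGi h hh => ?_⟩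
  calc shiftInt p Ω Ω u h
      ≤ ∫⁻ x in ⋃ i : t, {x | x ∈ Ω ∩ Metric.ball (i : E d) (ρ i) ∧ x + h ∈ Ω},
          ‖u (x + h) - u x‖ₑ ^ p := by
        refine lintegral_mono_set fun x hx => ?_
        obtain ⟨i, hi, hxi⟩ := mem_iUnion₂.1 (hcov (subset_closure hx.1))
        exact mem_iUnion.2 ⟨⟨i, hi⟩, ⟨⟨hx.1, hxi⟩, hx.2⟩⟩
    _ ≤ ∑' i : t, shiftInt p (Ω ∩ Metric.ball (i : E d) (ρ i)) Ω u h := lintegral_iUnion_le _ _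
    _ = ∑ i ∈ t, shiftInt p (Ω ∩ Metric.ball (i : E d) (ρ i)) Ω u h := by
        rw [tsum_fintype, Finset.sum_coe_sort t
          (fun i => shiftInt p (Ω ∩ Metric.ball (i : E d) (ρ i)) Ω u h)]
    _ ≤ ∑ i ∈ t, C i * (‖h‖ₑ ^ p * ∫⁻ x in Ω, ‖G x‖ₑ ^ p) :=
        Finset.sum_le_sum fun i hi => (hloc i (ht i hi)).2.2 u G hu hui hum hGm hGi h
          (hh.trans_le (hηt i hi))
    _ = _ := by rw [Finset.sum_mul]

/-- A function on a bounded Lipschitz domain whose ball energies at scale `r` are of order `r^{d+p}`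
extends to a function in `W^{1,p}(ℝᵈ)`. -/
theorem exists_sobolev_extension_of_ballInt_le (hp : 1 < p) {Ω : Set (E d)} (hΩ : IsOpen Ω)
    (hbdd : Bornology.IsBounded Ω) (hlip : HasLipschitzBoundary Ω) {u : E d → ℝ}
    (hu : AEMeasurable u) (hup : ∫⁻ x in Ω, ‖u x‖ₑ ^ p ≠ ⊤) {c : ℝ≥0∞} (hc : c ≠ ⊤) {R : ℝ}
    (hR : 0 < R) (h : ∀ r : ℝ, 0 < r → r ≤ R → ballInt p Ω u r ≤ c * ENNReal.ofReal (r ^ (d + p))) :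
    ∃ (U : E d → ℝ) (G : E d → E d), MemLp U (ENNReal.ofReal p) volume ∧ Measurable G ∧
      MemLp G (ENNReal.ofReal p) volume ∧ IsWeakGrad univ U G ∧ ∀ᵐ x, x ∈ Ω → U x = u x := by
  have hp0 : 0 < p := by linarith
  obtain ⟨C, hC, Λ, hΛ, r₀, hr₀, hext⟩ := exists_extension hp.le hΩ hbdd hlip
  obtain ⟨U, hUm, hUu, hUp, hUr⟩ := hext u hu
  obtain ⟨C', hC', hsh⟩ := exists_shiftInt_le_of_ballInt d hp.le
  have hUL : MemLp U (ENNReal.ofReal p) volume :=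
    memLp_of_lintegral_lt_top hp0 hUm.aestronglyMeasurable
      (hUp.trans_lt (ENNReal.mul_lt_top hC.lt_top hup.lt_top))
  have hΛ0 : 0 < Λ := by linarith
  set I := ∫⁻ x in Ω, ‖u x‖ₑ ^ p with hI
  set c' : ℝ≥0∞ := C * (c * ENNReal.ofReal (Λ ^ (d + p)) + I) with hc'
  have hc't : c' ≠ ⊤ := by finiteness
  have hball : ∀ r : ℝ, 0 < r → r ≤ min r₀ (R / Λ) →
      ballInt p univ U r ≤ c' * ENNReal.ofReal (r ^ (d + p)) := by
    intro r hr hrR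
    have h1 : Λ * r ≤ R := by
      have := hrR.trans (min_le_right _ _)
      rwa [le_div_iff₀ hΛ0, mul_comm] at this
    refine (hUr r hr (hrR.trans (min_le_left _ _))).trans ?_
    have h2 := h (Λ * r) (by positivity) h1
    rw [Real.mul_rpow hΛ0.le hr.le, ENNReal.ofReal_mul (by positivity)] at h2
    calc _ ≤ C * (c * (ENNReal.ofReal (Λ ^ (d + p)) * ENNReal.ofReal (r ^ (d + p))) +
          ENNReal.ofReal (r ^ (d + p)) * I) := mul_le_mul' le_rfl (add_le_add h2 le_rfl)
      _ = _ := by rw [hc']; ring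
  have hmin : 0 < min r₀ (R / Λ) := lt_min hr₀ (by positivity)
  obtain ⟨G, hGm, hGp, hG⟩ := exists_isWeakGrad_of_shiftInt_le hp hUL
    (c := C' * c') (ENNReal.mul_ne_top hC' hc't) hmin fun k hk => by
      by_cases hk0 : k = 0
      · subst hk0
        simp [shiftInt, hp0]
      have hkn : 0 < ‖k‖ := norm_pos_iff.2 hk0
      have := hsh U hUm.aemeasurable ‖k‖ ‖k‖ c' hkn le_rfl (hball _ hkn hk) k le_rfl
      rwa [← ENNReal.ofReal_rpow_of_nonneg hkn.le hp0.le, ofReal_norm] at this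
  exact ⟨U, G, hUL, hGm, hGp, hG, hUu⟩

/-- The extension theorem for Sobolev functions on bounded Lipschitz domains. -/
theorem exists_sobolev_extension (hp : 1 < p) {Ω : Set (E d)} (hΩ : IsOpen Ω)
    (hbdd : Bornology.IsBounded Ω) (hlip : HasLipschitzBoundary Ω) {u : E d → ℝ}
    (hu : u ∈ W1p p Ω) :
    ∃ (U : E d → ℝ) (G : E d → E d), MemLp U (ENNReal.ofReal p) volume ∧ Measurable G ∧
      MemLp G (ENNReal.ofReal p) volume ∧ IsWeakGrad univ U G ∧ ∀ᵐ x, x ∈ Ω → U x = u x := by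
  have hp0 : 0 < p := by linarith
  have hp1 : 1 ≤ ENNReal.ofReal p := by simpa using hp.le
  have hΩm := hΩ.measurableSet
  obtain ⟨hup, G, hG, hGp⟩ := hu
  set v : E d → ℝ := Ω.indicator u with hv
  have hvp : MemLp v (ENNReal.ofReal p) volume := (memLp_indicator_iff_restrict hΩm).2 hup
  set H₀ : E d → E d := Ω.indicator G with hH₀
  have hH₀p : MemLp H₀ (ENNReal.ofReal p) volume := (memLp_indicator_iff_restrict hΩm).2 hGp
  set H := hH₀p.1.mk H₀ with hH
  have hHm : Measurable H := hH₀p.1.stronglyMeasurable_mk.measurable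
  have hHp : MemLp H (ENNReal.ofReal p) volume := hH₀p.ae_eq hH₀p.1.ae_eq_mk
  have hvu : ∀ x, x ∈ Ω → u x = v x := fun x hx => by rw [hv, indicator_of_mem hx]
  have hw : IsWeakGrad Ω v H := hG.congr_ae hΩm ((hvp.locallyIntegrable hp1).locallyIntegrableOn _)
    ((hHp.locallyIntegrable hp1).locallyIntegrableOn _) (Eventually.of_forall hvu) (by
      filter_upwards [hH₀p.1.ae_eq_mk] with x hx hxΩ
      rw [hH, ← hx, hH₀, indicator_of_mem hxΩ])
  obtain ⟨ρ, hρ, C, hC, hsh⟩ := exists_shiftInt_le_of_isWeakGrad hp.le hΩ hbdd hlip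
  set I := ∫⁻ x in Ω, ‖H x‖ₑ ^ p with hI
  have hIt : I ≠ ⊤ := ((setLIntegral_le_lintegral _ _).trans_lt (lintegral_rpow_lt_top hp0 hHp)).ne
  set b := volume (Metric.ball (0 : E d) 1) with hb
  have hbt : b ≠ ⊤ := measure_ball_lt_top.ne
  obtain ⟨U, G', h1, h2, h3, h4, h5⟩ := exists_sobolev_extension_of_ballInt_le hp hΩ hbdd hlip
    hvp.1.aemeasurable ((setLIntegral_le_lintegral _ _).trans_lt (lintegral_rpow_lt_top hp0 hvp)).ne
    (c := C * I * b) (by finiteness) hρ fun r hr hrρ => by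
      calc ballInt p Ω v r ≤ ∫⁻ _h in Metric.ball (0 : E d) r, C * (ENNReal.ofReal (r ^ p) * I) := by
            refine setLIntegral_mono' measurableSet_ball fun h hh => ?_
            rw [mem_ball_zero_iff] at hh
            refine (hsh v H hw (hvp.locallyIntegrable hp1) hvp.1.aemeasurable hHm
              (hHp.locallyIntegrable hp1) h (hh.trans_le hrρ)).trans ?_
            refine mul_le_mul' le_rfl (mul_le_mul' ?_ le_rfl)
            rw [← ENNReal.ofReal_rpow_of_nonneg hr.le hp0.le, ← ofReal_norm]
            exact ENNReal.rpow_le_rpow (ENNReal.ofReal_le_ofReal hh.le) hp0.le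
        _ = C * I * b * ENNReal.ofReal (r ^ (d + p)) := by
            rw [setLIntegral_const, Measure.addHaar_ball_of_pos _ _ hr, finrank_euclideanSpace,
              Fintype.card_fin, Real.rpow_add hr, Real.rpow_natCast,
              ENNReal.ofReal_mul (by positivity)]
            ring
  refine ⟨U, G', h1, h2, h3, h4, ?_⟩
  filter_upwards [h5] with x hx hxΩ
  rw [hx hxΩ, hvu x hxΩ]

end SobolevExtension

/-! ### Ball energies and nonlocal energies: dimension at least two -/

section Reflections

variable {d : ℕ} {p : ℝ}

/-- Any two points of `Ω` are joined by two-step paths whose corner may lie outside `Ω`; this is why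
the energy over `(Ωᶜ × Ωᶜ)ᶜ` controls small scales. -/
theorem shiftInt_add_le_univ (hp : 1 ≤ p) {Ω : Set (E d)} (hΩ : MeasurableSet Ω) {u : E d → ℝ}
    (hu : AEMeasurable u) (h k : E d) :
    shiftInt p Ω Ω u (h + k) ≤ 2 ^ (p - 1) * (shiftInt p Ω univ u h + shiftInt p Ω univ u (-k)) := by
  rw [shiftInt_neg p hΩ MeasurableSet.univ u k]
  exact shiftInt_add_le hp hΩ hΩ hu h k fun _ _ _ => mem_univ _

theorem two_rpow_sub_one_mul (p : ℝ) (t : ℝ≥0∞) : (2 : ℝ≥0∞) ^ (p - 1) * (t + t) = 2 ^ p * t := by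
  rw [← two_mul, ← mul_assoc]
  congr 1
  conv_rhs => rw [show p = (p - 1) + 1 by ring]
  rw [ENNReal.rpow_add _ _ (by simp) (by simp), ENNReal.rpow_one]

theorem setLIntegral_le_mul_comp {g : ℝ → ℝ} {c : NNReal} (hg : LipschitzWith c g) {S I : Set ℝ}
    (hS : S ⊆ g '' I) {Φ : ℝ → ℝ≥0∞} (hΦ : Measurable Φ) :
    ∫⁻ t in S, Φ t ≤ c * ∫⁻ s in I, Φ (g s) := by
  have hle : volume.restrict S ≤ (c : ℝ≥0∞) • Measure.map g (volume.restrict I) := by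
    refine Measure.le_iff.2 fun B hB => ?_
    rw [Measure.restrict_apply hB, Measure.smul_apply, smul_eq_mul,
      Measure.map_apply hg.continuous.measurable hB,
      Measure.restrict_apply (hg.continuous.measurable hB)]
    have hsub : B ∩ S ⊆ g '' (g ⁻¹' B ∩ I) := by
      rintro t ⟨htB, htS⟩
      obtain ⟨s, hs, rfl⟩ := hS htS
      exact ⟨s, ⟨htB, hs⟩, rfl⟩
    refine (measure_mono hsub).trans ?_
    have := hg.hausdorffMeasure_image_le (d := 1) zero_le_one (g ⁻¹' B ∩ I)
    simpa [hausdorffMeasure_real] using this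
  calc ∫⁻ t in S, Φ t ≤ ∫⁻ t, Φ t ∂((c : ℝ≥0∞) • Measure.map g (volume.restrict I)) :=
        lintegral_mono' hle le_rfl
    _ = _ := by
        rw [lintegral_smul_measure, lintegral_map hΦ hg.continuous.measurable, smul_eq_mul]

theorem exists_norm_le_abs_coord [NeZero d] (h : E d) : ∃ i, ‖h‖ / √d ≤ |h i| := by
  have hd : (0 : ℝ) < d := by exact_mod_cast Nat.pos_of_ne_zero (NeZero.ne d)
  by_contra hcon
  push Not at hcon
  have h1 : ‖h‖ ^ 2 = ∑ i, ‖h i‖ ^ 2 := EuclideanSpace.norm_sq_eq h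
  have h2 : ∑ i, ‖h i‖ ^ 2 < ∑ _i : Fin d, (‖h‖ / √d) ^ 2 := by
    refine Finset.sum_lt_sum_of_nonempty Finset.univ_nonempty fun i _ => ?_
    exact pow_lt_pow_left₀ (hcon i) (abs_nonneg _) two_ne_zero
  rw [Finset.sum_const, Finset.card_univ, Fintype.card_fin, nsmul_eq_mul, div_pow,
    Real.sq_sqrt hd.le, mul_div_cancel₀ _ hd.ne'] at h2
  linarith

/-- The unit vector at angle `φ` in the plane of the coordinates `i` and `j`. -/
def circleVec (i j : Fin d) (φ : ℝ) : E d :=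
  Real.cos φ • EuclideanSpace.single i 1 + Real.sin φ • EuclideanSpace.single j 1

theorem inner_circleVec (i j : Fin d) (φ : ℝ) (h : E d) :
    (inner ℝ h (circleVec i j φ) : ℝ) = Real.cos φ * h i + Real.sin φ * h j := by
  unfold circleVec
  rw [inner_add_right, real_inner_smul_right, real_inner_smul_right,
    EuclideanSpace.inner_single_right, EuclideanSpace.inner_single_right]
  simp

theorem norm_circleVec {i j : Fin d} (hij : i ≠ j) (φ : ℝ) : ‖circleVec i j φ‖ = 1 := by
  have h1 : ‖circleVec i j φ‖ ^ 2 = 1 := by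
    rw [← real_inner_self_eq_norm_sq, inner_circleVec]
    unfold circleVec
    simp only [PiLp.add_apply, PiLp.smul_apply, smul_eq_mul, EuclideanSpace.single]
    simp [hij, hij.symm]
    nlinarith [Real.sin_sq_add_cos_sq φ]
  exact (pow_eq_one_iff_of_nonneg (norm_nonneg _) two_ne_zero).1 h1

theorem lipschitzWith_inner_circleVec {i j : Fin d} (hij : i ≠ j) (h : E d) :
    LipschitzWith ‖h‖₊ fun φ => (inner ℝ h (circleVec i j φ) : ℝ) := by
  have hd : ∀ φ, HasDerivAt (fun φ => (inner ℝ h (circleVec i j φ) : ℝ))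
      (inner ℝ h (circleVec i j (φ + Real.pi / 2))) φ := by
    intro φ
    simp only [inner_circleVec, Real.cos_add_pi_div_two, Real.sin_add_pi_div_two]
    exact ((Real.hasDerivAt_cos φ).mul_const _).add ((Real.hasDerivAt_sin φ).mul_const _)
  refine lipschitzWith_of_nnnorm_deriv_le (fun φ => (hd φ).differentiableAt) fun φ => ?_
  rw [(hd φ).deriv]
  have := abs_real_inner_le_norm h (circleVec i j (φ + Real.pi / 2))
  rw [norm_circleVec hij, mul_one] at this
  exact this

/-- In dimension at least two, the one-dimensional marginals of a radial measure have a part with a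
density that is bounded below near the origin: rotate the direction in a coordinate plane. -/
theorem lintegral_radial_marginal_ge [NeZero d] (hd : 2 ≤ d) {m : E d → ℝ≥0∞} (hm : Measurable m)
    (hmr : ∀ h k, ‖h‖ = ‖k‖ → m h = m k) {Φ : ℝ → ℝ≥0∞} (hΦ : Measurable Φ) {w : E d}
    (hw : ‖w‖ = 1) :
    ∫⁻ h, m h * ∫⁻ t in Ioc 0 (‖h‖ / √d), Φ t ≤
      (d * ENNReal.ofReal Real.pi) * ∫⁻ h, (m h * ‖h‖ₑ) * Φ (inner ℝ h w) := by
  have hother : ∀ i : Fin d, ∃ j : Fin d, i ≠ j := fun i => by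
    have : Nontrivial (Fin d) := Fin.nontrivial_iff_two_le.2 hd
    obtain ⟨j, hj⟩ := exists_ne i
    exact ⟨j, hj.symm⟩
  choose j hj using hother
  have hpt : ∀ h : E d, ∫⁻ t in Ioc 0 (‖h‖ / √d), Φ t ≤
      ∑ i, ‖h‖ₑ * ∫⁻ φ in Icc 0 Real.pi, Φ (inner ℝ h (circleVec i (j i) φ)) := by
    intro h
    obtain ⟨i, hi⟩ := exists_norm_le_abs_coord h
    refine le_trans ?_ (Finset.single_le_sum (f := fun i => ‖h‖ₑ * ∫⁻ φ in Icc 0 Real.pi,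
      Φ (inner ℝ h (circleVec i (j i) φ))) (fun _ _ => zero_le) (Finset.mem_univ i))
    refine setLIntegral_le_mul_comp (lipschitzWith_inner_circleVec (hj i) h) ?_ hΦ
    have hivt := intermediate_value_uIcc (a := 0) (b := Real.pi)
      (lipschitzWith_inner_circleVec (hj i) h).continuous.continuousOn
    rw [uIcc_of_le Real.pi_pos.le] at hivt
    refine Subset.trans (fun t ht => ?_) hivt
    simp only [inner_circleVec, Real.cos_zero, Real.sin_zero, Real.cos_pi, Real.sin_pi, one_mul,
      zero_mul, add_zero, neg_mul]
    have h2 : t ≤ |h i| := ht.2.trans hi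
    rcases abs_cases (h i) with ⟨ha, hs⟩ | ⟨ha, hs⟩
    · rw [uIcc_of_ge (by linarith)]
      exact ⟨by linarith [ht.1], by linarith⟩
    · rw [uIcc_of_le (by linarith)]
      exact ⟨by linarith [ht.1], by linarith⟩
  have hjm : ∀ i, Measurable (Function.uncurry fun (h : E d) (φ : ℝ) =>
      (m h * ‖h‖ₑ) * Φ (inner ℝ h (circleVec i (j i) φ))) := fun i => by
    refine ((hm.comp measurable_fst).mul measurable_fst.enorm).mul (hΦ.comp ?_)
    simp only [inner_circleVec]
    fun_prop
  calc ∫⁻ h, m h * ∫⁻ t in Ioc 0 (‖h‖ / √d), Φ t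
      ≤ ∫⁻ h, ∑ i, ∫⁻ φ in Icc 0 Real.pi, (m h * ‖h‖ₑ) * Φ (inner ℝ h (circleVec i (j i) φ)) := by
        refine lintegral_mono fun h => (mul_le_mul' le_rfl (hpt h)).trans (le_of_eq ?_)
        rw [Finset.mul_sum]
        refine Finset.sum_congr rfl fun i _ => ?_
        rw [← mul_assoc, lintegral_const_mul]
        refine hΦ.comp ?_
        exact (lipschitzWith_inner_circleVec (hj i) h).continuous.measurable
    _ = ∑ i, ∫⁻ φ in Icc 0 Real.pi, ∫⁻ h, (m h * ‖h‖ₑ) * Φ (inner ℝ h (circleVec i (j i) φ)) := by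
        rw [lintegral_finsetSum (f := fun i h => ∫⁻ φ in Icc 0 Real.pi,
          (m h * ‖h‖ₑ) * Φ (inner ℝ h (circleVec i (j i) φ))) _
          fun i _ => (hjm i).lintegral_prod_right']
        refine Finset.sum_congr rfl fun i _ => ?_
        exact lintegral_lintegral_swap (hjm i).aemeasurable
    _ = ∑ _i : Fin d, ∫⁻ _φ in Icc 0 Real.pi, ∫⁻ h, (m h * ‖h‖ₑ) * Φ (inner ℝ h w) := by
        refine Finset.sum_congr rfl fun i _ => lintegral_congr fun φ => ?_
        refine radial_marginal (n := fun h => m h * ‖h‖ₑ) (fun h k hhk => ?_) Φ ?_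
        · rw [hmr h k hhk, ← ofReal_norm h, ← ofReal_norm k, hhk]
        · rw [norm_circleVec (hj i), hw]
    _ = _ := by
        rw [setLIntegral_const, Real.volume_Icc, sub_zero, Finset.sum_const, Finset.card_univ,
          Fintype.card_fin, nsmul_eq_mul]
        ring

/-- Two-step paths with steps `h` and its reflection at the line spanned by `w`, which have equal
lengths and whose sum is `2 ⟪h, w⟫ w`. -/
theorem lintegral_radial_reflection_le (hp : 1 ≤ p) {Ω : Set (E d)} (hΩ : MeasurableSet Ω)
    {u : E d → ℝ} (hu : AEMeasurable u) {n : E d → ℝ≥0∞} (hn : Measurable n)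
    (hnr : ∀ h k, ‖h‖ = ‖k‖ → n h = n k) {w : E d} (hw : ‖w‖ = 1) :
    ∫⁻ h, n h * shiftInt p Ω Ω u ((2 * inner ℝ h w) • w) ≤
      2 ^ p * ∫⁻ h, n h * shiftInt p Ω univ u h := by
  set R := (ℝ ∙ w).reflection with hR
  have hJm := measurable_shiftInt p hΩ MeasurableSet.univ hu
  have hRh : ∀ h, h + R h = (2 * inner ℝ h w) • w := fun h => by
    rw [hR, Submodule.reflection_singleton_apply, hw, real_inner_comm]
    simp only [RCLike.ofReal_real_eq_id, id, one_pow, div_one]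
    rw [← smul_assoc]
    simp
  have hinv : ∫⁻ h, n h * shiftInt p Ω univ u (-(R h)) = ∫⁻ h, n h * shiftInt p Ω univ u h := by
    rw [← lintegral_comp_linearIsometryEquiv (R.trans (LinearIsometryEquiv.neg ℝ))
      (fun h => n h * shiftInt p Ω univ u h)]
    refine lintegral_congr fun h => ?_
    rw [hnr h ((R.trans (LinearIsometryEquiv.neg ℝ)) h) (by simp)]
    simp
  calc ∫⁻ h, n h * shiftInt p Ω Ω u ((2 * inner ℝ h w) • w)
      ≤ ∫⁻ h, 2 ^ (p - 1) * (n h * shiftInt p Ω univ u h + n h * shiftInt p Ω univ u (-(R h))) := by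
        refine lintegral_mono fun h => ?_
        rw [← hRh, ← mul_add, mul_left_comm]
        exact mul_le_mul' le_rfl (shiftInt_add_le_univ hp hΩ hu h (R h))
    _ = 2 ^ p * ∫⁻ h, n h * shiftInt p Ω univ u h := by
        rw [lintegral_const_mul' _ _ (by simp), lintegral_add_left
          (f := fun h => n h * shiftInt p Ω univ u h) (hn.mul hJm), hinv,
          two_rpow_sub_one_mul]

/-- The ball energy in polar coordinates. -/
theorem ballInt_le_sphere [NeZero d] {Ω : Set (E d)} (hΩ : MeasurableSet Ω) {u : E d → ℝ}
    (hu : AEMeasurable u) (ρ : ℝ) :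
    ballInt p Ω u (2 * ρ) ≤ ENNReal.ofReal (2 ^ d * ρ ^ (d - 1)) *
      ∫⁻ w : Metric.sphere (0 : E d) 1, (∫⁻ t in Ioc 0 ρ, shiftInt p Ω Ω u ((2 * t) • (w : E d)))
        ∂(volume : Measure (E d)).toSphere := by
  have hFm := measurable_shiftInt p hΩ hΩ hu
  unfold ballInt
  rw [setLIntegral_ball_smul _ two_pos, ENNReal.ofReal_mul (by positivity), mul_assoc]
  refine mul_le_mul' le_rfl ?_
  rw [← lintegral_indicator measurableSet_ball, lintegral_polar
    (f := (Metric.ball 0 ρ).indicator fun x => shiftInt p Ω Ω u ((2 : ℝ) • x))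
    ((hFm.comp (measurable_const_smul (2 : ℝ))).indicator measurableSet_ball),
    ← lintegral_const_mul' _ _ ENNReal.ofReal_ne_top]
  refine lintegral_mono fun w => ?_
  rw [← lintegral_const_mul' _ _ ENNReal.ofReal_ne_top, ← lintegral_indicator measurableSet_Ioi,
    ← lintegral_indicator measurableSet_Ioc]
  refine lintegral_mono fun t => ?_
  by_cases ht : t ∈ Ioi (0 : ℝ)
  · rw [indicator_of_mem ht]
    have hn : ‖t • (w : E d)‖ = t := by rw [norm_smul, Real.norm_of_nonneg (le_of_lt ht)]; simp
    by_cases htb : t • (w : E d) ∈ Metric.ball (0 : E d) ρ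
    · rw [indicator_of_mem htb]
      rw [mem_ball_zero_iff, hn] at htb
      rw [indicator_of_mem (by exact ⟨ht, htb.le⟩), smul_smul]
      refine mul_le_mul' (ENNReal.ofReal_le_ofReal ?_) le_rfl
      exact pow_le_pow_left₀ (le_of_lt ht) htb.le _
    · rw [indicator_of_notMem htb, mul_zero]; exact zero_le
  · rw [indicator_of_notMem ht]; exact zero_le

/-- In dimension at least two, the energy over `Ω × ℝᵈ` of any radial kernel controls an average of
the ball energies of all scales. -/
theorem exists_lintegral_ballInt_le_of_two_le [NeZero d] (hp : 1 ≤ p) (hd : 2 ≤ d) :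
    ∃ C : ℝ≥0∞, C ≠ ⊤ ∧ ∃ c : ℝ, 0 < c ∧ ∀ (Ω : Set (E d)), MeasurableSet Ω → ∀ u : E d → ℝ,
      AEMeasurable u → ∀ n : E d → ℝ≥0∞, Measurable n → (∀ h k, ‖h‖ = ‖k‖ → n h = n k) →
      ∫⁻ h, n h * (‖h‖ₑ⁻¹ ^ d * ballInt p Ω u (c * ‖h‖)) ≤
        C * ∫⁻ h, n h * shiftInt p Ω univ u h := by
  have hd0 : (0 : ℝ) < d := by exact_mod_cast Nat.pos_of_ne_zero (NeZero.ne d)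
  have hsq : 1 ≤ √(d : ℝ) := by
    rw [Real.one_le_sqrt]
    exact_mod_cast Nat.one_le_iff_ne_zero.2 (NeZero.ne d)
  set σ := (volume : Measure (E d)).toSphere with hσ
  set κ : ℝ≥0∞ := (d * ENNReal.ofReal Real.pi) * 2 ^ p with hκ
  refine ⟨ENNReal.ofReal (2 ^ d) * (κ * σ univ), ?_, 2 / √d, by positivity,
    fun Ω hΩ u hu n hn hnr => ?_⟩
  · have := measure_ne_top σ univ
    have h2 : (2 : ℝ≥0∞) ^ p ≠ ⊤ := by simp
    exact ENNReal.mul_ne_top ENNReal.ofReal_ne_top (ENNReal.mul_ne_top (ENNReal.mul_ne_top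
      (ENNReal.mul_ne_top (ENNReal.natCast_ne_top d) ENNReal.ofReal_ne_top) h2) this)
  have hFm := measurable_shiftInt p hΩ hΩ hu
  set m : E d → ℝ≥0∞ := fun h => n h * ‖h‖ₑ⁻¹ with hm
  have hmm : Measurable m := hn.mul measurable_enorm.inv
  have hmr : ∀ h k, ‖h‖ = ‖k‖ → m h = m k := fun h k hhk => by
    simp only [hm]
    rw [hnr h k hhk, ← ofReal_norm h, ← ofReal_norm k, hhk]
  set Q : E d → Metric.sphere (0 : E d) 1 → ℝ≥0∞ := fun h w =>
    m h * ∫⁻ t in Ioc 0 (‖h‖ / √d), shiftInt p Ω Ω u ((2 * t) • (w : E d)) with hQ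
  have hQm : Measurable (Function.uncurry Q) := by
    refine (hmm.comp measurable_fst).mul ?_
    have e : (fun z : E d × Metric.sphere (0 : E d) 1 =>
        ∫⁻ t in Ioc 0 (‖z.1‖ / √d), shiftInt p Ω Ω u ((2 * t) • (z.2 : E d))) = fun z =>
        ∫⁻ t, {y : (E d × Metric.sphere (0 : E d) 1) × ℝ | 0 < y.2 ∧ y.2 ≤ ‖y.1.1‖ / √d}.indicator
          (fun y => shiftInt p Ω Ω u ((2 * y.2) • (y.1.2 : E d))) (z, t) := by
      funext z
      rw [← lintegral_indicator measurableSet_Ioc]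
      rfl
    rw [e]
    refine Measurable.lintegral_prod_right' (f := {y : (E d × Metric.sphere (0 : E d) 1) × ℝ |
      0 < y.2 ∧ y.2 ≤ ‖y.1.1‖ / √d}.indicator
          (fun y => shiftInt p Ω Ω u ((2 * y.2) • (y.1.2 : E d)))) ?_
    refine (hFm.comp ?_).indicator ?_
    · exact (measurable_snd.const_mul _).smul
        (measurable_subtype_coe.comp (measurable_snd.comp measurable_fst))
    · exact (measurableSet_lt measurable_const measurable_snd).inter
        (measurableSet_le measurable_snd ((measurable_fst.comp measurable_fst).norm.div_const _))
  have hle : ∀ h, n h * (‖h‖ₑ⁻¹ ^ d * ballInt p Ω u (2 / √d * ‖h‖)) ≤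
      ENNReal.ofReal (2 ^ d) * ∫⁻ w, Q h w ∂σ := by
    intro h
    by_cases hh : h = 0
    · subst hh
      have : ballInt p Ω u (2 / √d * ‖(0 : E d)‖) = 0 := by simp [ballInt]
      rw [this]
      simp
    have hhn : 0 < ‖h‖ := norm_pos_iff.2 hh
    have hhe : ‖h‖ₑ ≠ 0 := enorm_ne_zero.2 hh
    set ρ := ‖h‖ / √d with hρ
    have hρ0 : 0 < ρ := by positivity
    have hρh : ρ ≤ ‖h‖ := div_le_self hhn.le hsq
    have h1 := ballInt_le_sphere (p := p) hΩ hu ρ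
    have e1 : 2 / √d * ‖h‖ = 2 * ρ := by rw [hρ]; ring
    rw [e1]
    have hQi : ∫⁻ w, Q h w ∂σ = m h * ∫⁻ w : Metric.sphere (0 : E d) 1,
        (∫⁻ t in Ioc 0 ρ, shiftInt p Ω Ω u ((2 * t) • (w : E d))) ∂σ := by
      have hmw : Measurable fun w : Metric.sphere (0 : E d) 1 =>
          ∫⁻ t in Ioc 0 ρ, shiftInt p Ω Ω u ((2 * t) • (w : E d)) := by
        refine Measurable.lintegral_prod_right' (f := fun y : Metric.sphere (0 : E d) 1 × ℝ =>
          shiftInt p Ω Ω u ((2 * y.2) • (y.1 : E d))) (hFm.comp ?_)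
        exact (measurable_snd.const_mul _).smul (measurable_subtype_coe.comp measurable_fst)
      exact lintegral_const_mul _ hmw
    rw [hQi]
    set Iw := ∫⁻ w : Metric.sphere (0 : E d) 1,
        (∫⁻ t in Ioc 0 ρ, shiftInt p Ω Ω u ((2 * t) • (w : E d))) ∂σ with hIw
    have h3 : ENNReal.ofReal (ρ ^ (d - 1)) ≤ ‖h‖ₑ ^ (d - 1) := by
      rw [← ofReal_norm, ← ENNReal.ofReal_pow hhn.le]
      exact ENNReal.ofReal_le_ofReal (pow_le_pow_left₀ hρ0.le hρh _)
    have h4 : ‖h‖ₑ⁻¹ ^ d * ‖h‖ₑ ^ (d - 1) = ‖h‖ₑ⁻¹ := by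
      obtain ⟨k, rfl⟩ : ∃ k, d = k + 1 := ⟨d - 1, by omega⟩
      rw [Nat.add_sub_cancel, pow_succ, mul_right_comm, ← mul_pow,
        ENNReal.inv_mul_cancel hhe enorm_ne_top, one_pow, one_mul]
    calc n h * (‖h‖ₑ⁻¹ ^ d * ballInt p Ω u (2 * ρ))
        ≤ n h * (‖h‖ₑ⁻¹ ^ d * (ENNReal.ofReal (2 ^ d) * ‖h‖ₑ ^ (d - 1) * Iw)) := by
          refine mul_le_mul' le_rfl (mul_le_mul' le_rfl (h1.trans (mul_le_mul' ?_ le_rfl)))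
          rw [ENNReal.ofReal_mul (by positivity)]
          exact mul_le_mul' le_rfl h3
      _ = ENNReal.ofReal (2 ^ d) * (n h * (‖h‖ₑ⁻¹ ^ d * ‖h‖ₑ ^ (d - 1)) * Iw) := by ring
      _ = _ := by rw [h4]
  calc ∫⁻ h, n h * (‖h‖ₑ⁻¹ ^ d * ballInt p Ω u (2 / √d * ‖h‖))
      ≤ ∫⁻ h, ENNReal.ofReal (2 ^ d) * ∫⁻ w, Q h w ∂σ := lintegral_mono hle
    _ = ENNReal.ofReal (2 ^ d) * ∫⁻ w, (∫⁻ h, Q h w) ∂σ := by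
        rw [lintegral_const_mul' _ _ ENNReal.ofReal_ne_top,
          lintegral_lintegral_swap hQm.aemeasurable]
    _ ≤ ENNReal.ofReal (2 ^ d) * ∫⁻ _w, κ * (∫⁻ h, n h * shiftInt p Ω univ u h) ∂σ := by
        refine mul_le_mul' le_rfl (lintegral_mono fun w => ?_)
        have hw : ‖(w : E d)‖ = 1 := by simp
        refine (lintegral_radial_marginal_ge hd hmm hmr
          (Φ := fun t => shiftInt p Ω Ω u ((2 * t) • (w : E d)))
          (hFm.comp ((measurable_id.const_mul _).smul_const _)) hw).trans ?_
        rw [hκ, mul_assoc (d * ENNReal.ofReal Real.pi)]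
        refine mul_le_mul' le_rfl (le_trans (lintegral_mono fun h => ?_)
          (lintegral_radial_reflection_le hp hΩ hu hn hnr hw))
        refine mul_le_mul' ?_ le_rfl
        simp only [hm]
        rw [mul_assoc]
        exact mul_le_of_le_one_right' (ENNReal.inv_mul_le_one _)
    _ = _ := by
        rw [lintegral_const]
        ring

end Reflections

/-! ### Ball energies and nonlocal energies: small scales -/

section SmallScales

variable {d : ℕ} {p : ℝ}

/-- Two-step paths with steps in an annulus of radii comparable to `s`. -/
theorem ballInt_le_annulus [NeZero d] (hp : 1 ≤ p) {Ω : Set (E d)} (hΩ : MeasurableSet Ω)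
    {u : E d → ℝ} (hu : AEMeasurable u) {θ s : ℝ} (hθ1 : θ < 1) (hs : 0 < s) (hθ0 : 0 < θ) :
    ballInt p Ω u ((1 - θ) / 4 * s) ≤
      2 ^ p * ∫⁻ a in {a : E d | θ * s ≤ ‖a‖ ∧ ‖a‖ ≤ s}, shiftInt p Ω univ u a := by
  have hJm := measurable_shiftInt p hΩ MeasurableSet.univ hu
  set r : ℝ := (1 - θ) / 4 * s with hr
  have hr0 : 0 < r := by have : 0 < 1 - θ := by linarith
                         positivity
  set Ann : Set (E d) := {a : E d | θ * s ≤ ‖a‖ ∧ ‖a‖ ≤ s} with hAnn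
  have hAnnm : MeasurableSet Ann :=
    (measurableSet_le measurable_const measurable_norm).inter
      (measurableSet_le measurable_norm measurable_const)
  set I := ∫⁻ a in Ann, shiftInt p Ω univ u a with hI
  set z₀ : E d := ((1 + θ) / 2 * s) • EuclideanSpace.single (0 : Fin d) (1 : ℝ) with hz₀
  have hz₀n : ‖z₀‖ = (1 + θ) / 2 * s := by
    rw [hz₀, norm_smul, norm_single_zero, mul_one, Real.norm_of_nonneg (by positivity)]
  set B := Metric.ball z₀ r with hB
  set B₀ := Metric.ball (0 : E d) r with hB₀
  set V := volume B₀ with hV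
  have hVB : volume B = V := Measure.addHaar_ball_center _ _ _
  have hV0 : V ≠ 0 := (Metric.measure_ball_pos volume _ hr0).ne'
  have hVt : V ≠ ⊤ := measure_ball_lt_top.ne
  have hnear : ∀ a ∈ B, ∀ z : E d, ‖z‖ < r → a - z ∈ Ann := by
    intro a ha z hz
    rw [hB, Metric.mem_ball, dist_eq_norm] at ha
    have h1 : ‖(a - z) - z₀‖ < 2 * r := by
      calc ‖(a - z) - z₀‖ = ‖(a - z₀) - z‖ := by congr 1; abel
        _ ≤ ‖a - z₀‖ + ‖z‖ := norm_sub_le _ _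
        _ < 2 * r := by linarith
    have h2 := abs_norm_sub_norm_le (a - z) z₀
    rw [hz₀n] at h2
    have h3 := abs_lt.1 (h2.trans_lt h1)
    have e1 : 2 * r = (1 - θ) / 2 * s := by rw [hr]; ring
    rw [e1] at h3
    constructor
    · nlinarith [h3.1]
    · nlinarith [h3.2]
  have hBAnn : B ⊆ Ann := fun a ha => by simpa using hnear a ha 0 (by simpa using hr0)
  have hterm1 : ∫⁻ _z in B₀, (∫⁻ a in B, shiftInt p Ω univ u a) ≤ V * I := by
    rw [setLIntegral_const, mul_comm]
    exact mul_le_mul' le_rfl (lintegral_mono_set hBAnn)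
  have hterm2 : ∫⁻ z in B₀, (∫⁻ a in B, shiftInt p Ω univ u (a - z)) ≤ V * I := by
    have hm : Measurable (Function.uncurry fun z a : E d => shiftInt p Ω univ u (a - z)) :=
      hJm.comp (measurable_snd.sub measurable_fst)
    rw [lintegral_lintegral_swap hm.aemeasurable]
    calc ∫⁻ a in B, ∫⁻ z in B₀, shiftInt p Ω univ u (a - z) ≤ ∫⁻ _a in B, I := by
          refine setLIntegral_mono' measurableSet_ball fun a ha => ?_
          rw [hI, ← lintegral_indicator hAnnm, ← lintegral_indicator measurableSet_ball,
            ← lintegral_sub_left_eq_self (Ann.indicator (shiftInt p Ω univ u)) a]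
          refine lintegral_mono fun z => ?_
          by_cases hz : z ∈ B₀
          · rw [indicator_of_mem hz, indicator_of_mem (hnear a ha z (by simpa [hB₀] using hz))]
          · rw [indicator_of_notMem hz]; exact zero_le
      _ = V * I := by rw [setLIntegral_const, hVB, mul_comm]
  have key : V * ballInt p Ω u r ≤ V * (2 ^ p * I) := by
    calc V * ballInt p Ω u r = ∫⁻ z in B₀, ∫⁻ _a in B, shiftInt p Ω Ω u z := by
          unfold ballInt
          rw [← lintegral_const_mul' _ _ hVt]
          refine lintegral_congr fun z => ?_
          rw [setLIntegral_const, hVB, mul_comm]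
      _ ≤ ∫⁻ z in B₀, ∫⁻ a in B,
            2 ^ (p - 1) * (shiftInt p Ω univ u a + shiftInt p Ω univ u (a - z)) := by
          refine lintegral_mono fun z => lintegral_mono fun a => ?_
          have := shiftInt_add_le_univ hp hΩ hu a (z - a)
          rwa [add_sub_cancel, neg_sub] at this
      _ = 2 ^ (p - 1) * ((∫⁻ _z in B₀, (∫⁻ a in B, shiftInt p Ω univ u a)) +
            ∫⁻ z in B₀, (∫⁻ a in B, shiftInt p Ω univ u (a - z))) := by
          rw [← lintegral_add_left measurable_const, ← lintegral_const_mul' _ _ (by simp)]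
          refine lintegral_congr fun z => ?_
          rw [lintegral_const_mul' _ _ (by simp), lintegral_add_left hJm]
      _ ≤ 2 ^ (p - 1) * (V * I + V * I) := mul_le_mul' le_rfl (add_le_add hterm1 hterm2)
      _ = V * (2 ^ p * I) := by rw [two_rpow_sub_one_mul]; ring
  exact (ENNReal.mul_le_mul_iff_right hV0 hVt).1 key

/-- A kernel that is bounded by `n` on whole annuli controls an average of the ball energies of all
scales, in any dimension. -/
theorem lintegral_ballInt_le_of_annulus [NeZero d] (hp : 1 ≤ p) {θ : ℝ} (hθ0 : 0 < θ)
    (hθ1 : θ < 1) {Ω : Set (E d)} (hΩ : MeasurableSet Ω) {u : E d → ℝ} (hu : AEMeasurable u)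
    {n k : E d → ℝ≥0∞} (hn : Measurable n)
    (hkn : ∀ h a, θ * ‖h‖ ≤ ‖a‖ → ‖a‖ ≤ ‖h‖ → k h ≤ n a) :
    ∫⁻ h, k h * (‖h‖ₑ⁻¹ ^ d * ballInt p Ω u ((1 - θ) / 4 * ‖h‖)) ≤
      (2 ^ p * (ENNReal.ofReal (θ⁻¹ ^ d) * volume (Metric.ball (0 : E d) 1))) *
        ∫⁻ a, n a * shiftInt p Ω univ u a := by
  have hJm := measurable_shiftInt p hΩ MeasurableSet.univ hu
  set b := volume (Metric.ball (0 : E d) 1) with hb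
  set T : Set (E d × E d) := {z | θ * ‖z.1‖ ≤ ‖z.2‖ ∧ ‖z.2‖ ≤ ‖z.1‖} with hT
  have hTm : MeasurableSet T :=
    (measurableSet_le (measurable_fst.norm.const_mul _) measurable_snd.norm).inter
      (measurableSet_le measurable_snd.norm measurable_fst.norm)
  set Q : E d → E d → ℝ≥0∞ := fun h a =>
    T.indicator (fun z => ‖z.1‖ₑ⁻¹ ^ d * (n z.2 * shiftInt p Ω univ u z.2)) (h, a) with hQ
  have hQm : Measurable (Function.uncurry Q) :=
    (((measurable_fst.enorm.inv).pow_const d).mul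
      ((hn.comp measurable_snd).mul (hJm.comp measurable_snd))).indicator hTm
  have h1 : ∀ h, k h * (‖h‖ₑ⁻¹ ^ d * ballInt p Ω u ((1 - θ) / 4 * ‖h‖)) ≤
      2 ^ p * ∫⁻ a, Q h a := by
    intro h
    by_cases hh : h = 0
    · subst hh
      simp [ballInt]
    have hhn : 0 < ‖h‖ := norm_pos_iff.2 hh
    have hAm : MeasurableSet {a : E d | θ * ‖h‖ ≤ ‖a‖ ∧ ‖a‖ ≤ ‖h‖} :=
      (measurableSet_le measurable_const measurable_norm).inter
        (measurableSet_le measurable_norm measurable_const)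
    have hinv : ‖h‖ₑ⁻¹ ^ d ≠ ⊤ := ENNReal.pow_ne_top (ENNReal.inv_ne_top.2 (enorm_ne_zero.2 hh))
    calc k h * (‖h‖ₑ⁻¹ ^ d * ballInt p Ω u ((1 - θ) / 4 * ‖h‖))
        ≤ k h * (‖h‖ₑ⁻¹ ^ d * (2 ^ p *
            ∫⁻ a in {a : E d | θ * ‖h‖ ≤ ‖a‖ ∧ ‖a‖ ≤ ‖h‖}, shiftInt p Ω univ u a)) :=
          mul_le_mul' le_rfl (mul_le_mul' le_rfl (ballInt_le_annulus hp hΩ hu hθ1 hhn hθ0))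
      _ = 2 ^ p * (‖h‖ₑ⁻¹ ^ d * (k h *
            ∫⁻ a in {a : E d | θ * ‖h‖ ≤ ‖a‖ ∧ ‖a‖ ≤ ‖h‖}, shiftInt p Ω univ u a)) := by ring
      _ ≤ 2 ^ p * ∫⁻ a, Q h a := by
          refine mul_le_mul' le_rfl ?_
          rw [← lintegral_const_mul _ hJm, ← lintegral_const_mul' _ _ hinv,
            ← lintegral_indicator hAm]
          refine lintegral_mono fun a => ?_
          by_cases ha : θ * ‖h‖ ≤ ‖a‖ ∧ ‖a‖ ≤ ‖h‖
          · rw [indicator_of_mem (by exact ha), hQ]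
            dsimp only
            rw [indicator_of_mem (by exact ha)]
            exact mul_le_mul' le_rfl (mul_le_mul' (hkn h a ha.1 ha.2) le_rfl)
          · rw [indicator_of_notMem (by exact ha)]; exact zero_le
  have h2 : ∀ a : E d, ∫⁻ h, Q h a ≤
      (ENNReal.ofReal (θ⁻¹ ^ d) * b) * (n a * shiftInt p Ω univ u a) := by
    intro a
    have hAm : MeasurableSet {h : E d | θ * ‖h‖ ≤ ‖a‖ ∧ ‖a‖ ≤ ‖h‖} :=
      (measurableSet_le (measurable_norm.const_mul _) measurable_const).inter
        (measurableSet_le measurable_const measurable_norm)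
    have e1 : ∫⁻ h, Q h a = (∫⁻ h in {h : E d | θ * ‖h‖ ≤ ‖a‖ ∧ ‖a‖ ≤ ‖h‖}, ‖h‖ₑ⁻¹ ^ d) *
        (n a * shiftInt p Ω univ u a) := by
      rw [← lintegral_mul_const (f := fun h : E d => ‖h‖ₑ⁻¹ ^ d) _
        (measurable_enorm.inv.pow_const d), ← lintegral_indicator hAm]
      rfl
    rw [e1]
    refine mul_le_mul' ?_ le_rfl
    by_cases ha : a = 0
    · have hsub : {h : E d | θ * ‖h‖ ≤ ‖a‖ ∧ ‖a‖ ≤ ‖h‖} ⊆ {0} := by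
        intro h hh
        have h3 := hh.1
        rw [ha, norm_zero] at h3
        have h4 : ‖h‖ ≤ 0 := by
          by_contra hcon
          push Not at hcon
          have := mul_pos hθ0 hcon
          linarith
        exact norm_le_zero_iff.1 h4
      have h0 : volume ({0} : Set (E d)) = 0 := measure_singleton _
      refine (lintegral_mono_set hsub).trans ?_
      rw [setLIntegral_measure_zero _ _ h0]
      exact zero_le
    · have han : 0 < ‖a‖ := norm_pos_iff.2 ha
      calc ∫⁻ h in {h : E d | θ * ‖h‖ ≤ ‖a‖ ∧ ‖a‖ ≤ ‖h‖}, ‖h‖ₑ⁻¹ ^ d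
          ≤ ∫⁻ _h in {h : E d | θ * ‖h‖ ≤ ‖a‖ ∧ ‖a‖ ≤ ‖h‖}, ‖a‖ₑ⁻¹ ^ d := by
            refine setLIntegral_mono' hAm fun h hh => ?_
            refine pow_le_pow_left' (ENNReal.inv_le_inv.2 ?_) d
            rw [← ofReal_norm, ← ofReal_norm]
            exact ENNReal.ofReal_le_ofReal hh.2
        _ ≤ ‖a‖ₑ⁻¹ ^ d * volume (Metric.closedBall (0 : E d) (θ⁻¹ * ‖a‖)) := by
            rw [setLIntegral_const]
            refine mul_le_mul' le_rfl (measure_mono fun h hh => ?_)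
            rw [mem_closedBall_zero_iff, ← div_eq_inv_mul, le_div_iff₀ hθ0, mul_comm]
            exact hh.1
        _ = (‖a‖ₑ⁻¹ ^ d * ‖a‖ₑ ^ d) * (ENNReal.ofReal (θ⁻¹ ^ d) * b) := by
            rw [Measure.addHaar_closedBall _ _ (by positivity), finrank_euclideanSpace,
              Fintype.card_fin, mul_pow, ENNReal.ofReal_mul (by positivity),
              ENNReal.ofReal_pow han.le, ofReal_norm]
            ring
        _ = _ := by
            rw [← mul_pow, ENNReal.inv_mul_cancel (enorm_ne_zero.2 ha) enorm_ne_top, one_pow,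
              one_mul]
  calc ∫⁻ h, k h * (‖h‖ₑ⁻¹ ^ d * ballInt p Ω u ((1 - θ) / 4 * ‖h‖))
      ≤ ∫⁻ h, 2 ^ p * ∫⁻ a, Q h a := lintegral_mono h1
    _ = 2 ^ p * ∫⁻ a, ∫⁻ h, Q h a := by
        rw [lintegral_const_mul' _ _ (by simp), lintegral_lintegral_swap hQm.aemeasurable]
    _ ≤ 2 ^ p * ∫⁻ a, (ENNReal.ofReal (θ⁻¹ ^ d) * b) * (n a * shiftInt p Ω univ u a) :=
        mul_le_mul' le_rfl (lintegral_mono h2)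
    _ = _ := by
        rw [lintegral_const_mul (f := fun a => n a * shiftInt p Ω univ u a) _ (hn.mul hJm)]
        ring

theorem lintegral_closedBall_add_tail (f : E d → ℝ≥0∞) (δ : ℝ) :
    (∫⁻ h in Metric.closedBall (0 : E d) δ, f h) + ∫⁻ h in {h : E d | δ < ‖h‖}, f h =
      ∫⁻ h, f h := by
  have e : {h : E d | δ < ‖h‖} = (Metric.closedBall (0 : E d) δ)ᶜ := by
    ext h; simp
  rw [e]
  exact lintegral_add_compl _ Metric.isClosed_closedBall.measurableSet

/-- At small scales the kernels dominate, in an averaged sense, the ball energies. In dimension one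
this rests on the additional condition on the kernels. -/
theorem exists_scale_comparison [NeZero d] (hp : 1 < p) {ν : ℝ → RadialLevyKernel d p}
    (hν : IsLevyApproxUnity ν) (hν_one : d = 1 → OneDimCondition ν) :
    ∃ C : ℝ≥0∞, C ≠ ⊤ ∧ ∃ c : ℝ, 0 < c ∧ ∃ c₁ : ℝ≥0∞, c₁ ≠ 0 ∧ c₁ ≠ ⊤ ∧
      ∀ δ : ℝ, 0 < δ → δ ≤ 1 → ∀ᶠ ε in 𝓝[>] 0, ∃ k : E d → ℝ≥0∞, Measurable k ∧
        c₁ ≤ ∫⁻ h in Metric.closedBall 0 δ, k h * ‖h‖ₑ ^ p ∧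
        ∀ Ω : Set (E d), MeasurableSet Ω → ∀ u : E d → ℝ, AEMeasurable u →
          ∫⁻ h in Metric.closedBall 0 δ, k h * (‖h‖ₑ⁻¹ ^ d * ballInt p Ω u (c * ‖h‖)) ≤
            C * ∫⁻ h, (ν ε).ker h * shiftInt p Ω univ u h := by
  have hp0 : 0 < p := by linarith
  have hcl : ∀ δ : ℝ, MeasurableSet (Metric.closedBall (0 : E d) δ) := fun δ =>
    Metric.isClosed_closedBall.measurableSet
  by_cases hd : 2 ≤ d
  · obtain ⟨C, hC, c, hc, hmain⟩ := exists_lintegral_ballInt_le_of_two_le (d := d) hp.le hd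
    refine ⟨C, hC, c, hc, 2⁻¹, by simp, by simp, fun δ hδ hδ1 => ?_⟩
    have htail := tendsto_ker_tail hp0.le hν hδ
    filter_upwards [eventually_Ioo, htail.eventually_le_const (u := 2⁻¹) (by simp)] with ε hε ht
    refine ⟨(ν ε).ker, (ν ε).measurable_ker, ?_, fun Ω hΩ u hu => ?_⟩
    · have h1 := lintegral_ker_levyWeight hp0.le hν hε
      rw [← lintegral_closedBall_add_tail _ δ] at h1
      have h2 : ∫⁻ h in {h : E d | δ < ‖h‖}, (ν ε).ker h * levyWeight p h ≤ 2⁻¹ := by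
        refine le_trans (lintegral_mono fun h => ?_) ht
        exact mul_le_of_le_one_right' (min_le_left _ _)
      have h3 : ∫⁻ h in Metric.closedBall (0 : E d) δ, (ν ε).ker h * levyWeight p h =
          ∫⁻ h in Metric.closedBall (0 : E d) δ, (ν ε).ker h * ‖h‖ₑ ^ p := by
        refine setLIntegral_congr_fun (hcl δ) fun h hh => ?_
        rw [mem_closedBall_zero_iff] at hh
        rw [levyWeight_of_norm_le_one hp0.le (hh.trans hδ1)]
      rw [← h3]
      by_contra hcon
      push Not at hcon
      have h4 := ENNReal.add_lt_add_of_lt_of_le (ne_top_of_le_ne_top (by simp) h2) hcon h2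
      rw [h1, ENNReal.inv_two_add_inv_two] at h4
      exact lt_irrefl _ h4
    · set n : E d → ℝ≥0∞ := (Metric.closedBall (0 : E d) δ).indicator (ν ε).ker with hn
      have hnm : Measurable n := (ν ε).measurable_ker.indicator (hcl δ)
      have h1 := hmain Ω hΩ u hu n hnm fun h k hhk => by
        simp only [hn, indicator, mem_closedBall_zero_iff, hhk, (ν ε).ker_congr hhk]
      calc ∫⁻ h in Metric.closedBall 0 δ, (ν ε).ker h * (‖h‖ₑ⁻¹ ^ d * ballInt p Ω u (c * ‖h‖))
          = ∫⁻ h, n h * (‖h‖ₑ⁻¹ ^ d * ballInt p Ω u (c * ‖h‖)) := by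
            rw [← lintegral_indicator (hcl δ)]
            refine lintegral_congr fun h => ?_
            by_cases hh : h ∈ Metric.closedBall (0 : E d) δ
            · rw [indicator_of_mem hh, hn, indicator_of_mem hh]
            · rw [indicator_of_notMem hh, hn, indicator_of_notMem hh, zero_mul]
        _ ≤ C * ∫⁻ h, n h * shiftInt p Ω univ u h := h1
        _ ≤ _ := mul_le_mul' le_rfl (lintegral_mono fun h =>
            mul_le_mul' (indicator_le_self _ _ h) le_rfl)
  · have hd1 : d = 1 := by
      have := NeZero.ne d
      omega
    obtain ⟨c₀, hc₀, θ, hθ, hinf⟩ := hν_one hd1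
    set b := volume (Metric.ball (0 : E d) 1) with hb
    have hbt : b ≠ ⊤ := measure_ball_lt_top.ne
    refine ⟨2 ^ p * (ENNReal.ofReal (θ⁻¹ ^ d) * b), ?_, (1 - θ) / 4, by linarith [hθ.2],
      ENNReal.ofReal (c₀ / 2), ?_, ENNReal.ofReal_ne_top, fun δ hδ hδ1 => ?_⟩
    · exact ENNReal.mul_ne_top (by simp) (ENNReal.mul_ne_top ENNReal.ofReal_ne_top hbt)
    · rw [ne_eq, ENNReal.ofReal_eq_zero, not_le]; linarith [hc₀.1]
    have htail := tendsto_ker_tail hp0.le hν hδ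
    have hc2 : (0 : ℝ≥0∞) < ENNReal.ofReal (c₀ / 2) := ENNReal.ofReal_pos.2 (by linarith [hc₀.1])
    filter_upwards [eventually_Ioo, htail.eventually_le_const hc2] with ε hε ht
    -- a measurable minorant of the integrand, which need not be measurable itself
    obtain ⟨Ψ, hΨm, hΨle, hΨint⟩ := exists_measurable_le_lintegral_eq (volume : Measure (E d))
      (fun h => ENNReal.ofReal (min 1 (‖h‖ ^ p)) * ⨅ θ' ∈ Icc θ 1, ENNReal.ofReal (ν ε (θ' • h)))
    have hΨc : ENNReal.ofReal c₀ ≤ ∫⁻ h, Ψ h := by rw [← hΨint]; exact hinf ε hε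
    set k : E d → ℝ≥0∞ := fun h => Ψ h * (‖h‖ₑ ^ p)⁻¹ with hk
    have hkm : Measurable k := hΨm.mul (measurable_enorm.pow_const p).inv
    have hkinf : ∀ h, k h ≤ ⨅ θ' ∈ Icc θ 1, ENNReal.ofReal (ν ε (θ' • h)) := by
      intro h
      rw [hk]
      dsimp only
      rw [← div_eq_mul_inv]
      refine ENNReal.div_le_of_le_mul' ((hΨle h).trans (mul_le_mul' ?_ le_rfl))
      rw [enorm_rpow_eq_ofReal hp0.le]
      exact ENNReal.ofReal_le_ofReal (min_le_right _ _)
    refine ⟨k, hkm, ?_, fun Ω hΩ u hu => ?_⟩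
    · have hΨker : ∀ h, Ψ h ≤ (ν ε).ker h := by
        intro h
        refine (hΨle h).trans ?_
        calc _ ≤ 1 * ENNReal.ofReal (ν ε ((1 : ℝ) • h)) := by
              refine mul_le_mul' ?_ (iInf₂_le (1 : ℝ) ⟨hθ.2.le, le_rfl⟩)
              rw [← ENNReal.ofReal_one]
              exact ENNReal.ofReal_le_ofReal (min_le_left _ _)
          _ = (ν ε).ker h := by rw [one_mul, one_smul]; rfl
      have h2 : ∫⁻ h in {h : E d | δ < ‖h‖}, Ψ h ≤ ENNReal.ofReal (c₀ / 2) :=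
        le_trans (lintegral_mono fun h => hΨker h) ht
      have h3 : ∫⁻ h in Metric.closedBall (0 : E d) δ, k h * ‖h‖ₑ ^ p =
          ∫⁻ h in Metric.closedBall (0 : E d) δ, Ψ h := by
        refine lintegral_congr_ae (ae_restrict_of_ae ?_)
        have h0 : ∀ᵐ h : E d, h ≠ 0 := by
          have : volume ({0} : Set (E d)) = 0 := measure_singleton _
          exact measure_eq_zero_iff_ae_notMem.1 this
        filter_upwards [h0] with h hh
        have h5 : ‖h‖ₑ ≠ 0 := enorm_ne_zero.2 hh
        rw [hk]
        dsimp only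
        rw [mul_assoc, ENNReal.inv_mul_cancel, mul_one]
        · rw [ne_eq, ENNReal.rpow_eq_zero_iff]
          push Not
          exact ⟨fun h => absurd h h5, fun h => absurd h enorm_ne_top⟩
        · exact ENNReal.rpow_ne_top_of_nonneg hp0.le enorm_ne_top
      rw [h3]
      rw [← lintegral_closedBall_add_tail _ δ] at hΨc
      by_contra hcon
      push Not at hcon
      have h4 := ENNReal.add_lt_add_of_lt_of_le (ne_top_of_le_ne_top ENNReal.ofReal_ne_top h2) hcon h2
      rw [← ENNReal.ofReal_add (by linarith [hc₀.1]) (by linarith [hc₀.1]), add_halves] at h4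
      exact lt_irrefl _ (hΨc.trans_lt h4)
    · refine (setLIntegral_le_lintegral _ _).trans
        (lintegral_ballInt_le_of_annulus hp.le hθ.1 hθ.2 hΩ hu (ν ε).measurable_ker
          fun h a h1 h2 => ?_)
      by_cases hh : h = 0
      · subst hh
        rw [norm_zero] at h2
        have ha : a = 0 := norm_le_zero_iff.1 h2
        subst ha
        refine (hkinf 0).trans ((iInf₂_le (1 : ℝ) ⟨hθ.2.le, le_rfl⟩).trans (le_of_eq ?_))
        rw [one_smul]
        rfl
      · have hhn : 0 < ‖h‖ := norm_pos_iff.2 hh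
        refine (hkinf h).trans ((iInf₂_le (‖a‖ / ‖h‖)
          ⟨(le_div_iff₀ hhn).2 h1, (div_le_one hhn).2 h2⟩).trans (le_of_eq ?_))
        · refine (ν ε).ker_congr ?_
          rw [norm_smul, Real.norm_of_nonneg (by positivity), div_mul_cancel₀ _ hhn.ne']

/-- For small `ε` every function has a small scale at which its ball energy is controlled by its
nonlocal energy. -/
theorem exists_small_scale [NeZero d] (hp : 1 < p) {ν : ℝ → RadialLevyKernel d p}
    (hν : IsLevyApproxUnity ν) (hν_one : d = 1 → OneDimCondition ν) :
    ∃ C : ℝ≥0∞, C ≠ ⊤ ∧ ∀ δ : ℝ, 0 < δ → ∀ᶠ ε in 𝓝[>] 0, ∀ Ω : Set (E d), MeasurableSet Ω →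
      ∀ u : E d → ℝ, AEMeasurable u → ∀ κ : ℝ≥0∞, κ ≠ 0 → ∃ r : ℝ, 0 < r ∧ r < δ ∧
        ballInt p Ω u r ≤ (C * energy (Ω ×ˢ univ) (ν ε) u + κ) * ENNReal.ofReal (r ^ (d + p)) := by
  have hp0 : 0 < p := by linarith
  obtain ⟨C, hC, c, hc, c₁, hc₁0, hc₁t, hmain⟩ := exists_scale_comparison hp hν hν_one
  set A : ℝ≥0∞ := ENNReal.ofReal (c ^ (d + p)) * c₁ with hA
  have hcp : ENNReal.ofReal (c ^ (d + p)) ≠ 0 := by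
    rw [ne_eq, ENNReal.ofReal_eq_zero, not_le]; positivity
  have hA0 : A ≠ 0 := mul_ne_zero hcp hc₁0
  have hAt : A ≠ ⊤ := ENNReal.mul_ne_top ENNReal.ofReal_ne_top hc₁t
  refine ⟨C / A + 1, ENNReal.add_ne_top.2 ⟨ENNReal.div_ne_top hC hA0, ENNReal.one_ne_top⟩,
    fun δ hδ => ?_⟩
  set δ₁ : ℝ := min 1 (δ / (2 * c)) with hδ₁
  have hδ₁0 : 0 < δ₁ := lt_min one_pos (by positivity)
  have hcδ : c * δ₁ < δ := by
    have h1 : δ₁ ≤ δ / (2 * c) := min_le_right _ _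
    rw [le_div_iff₀ (by positivity)] at h1
    nlinarith
  filter_upwards [hmain δ₁ hδ₁0 (min_le_left _ _)] with ε hk Ω hΩ u hu κ hκ
  obtain ⟨k, hkm, hkc, hkE⟩ := hk
  have hE := energy_prod hp0.le (ν ε) hΩ MeasurableSet.univ hu
  rw [hE]
  have hkE' := hkE Ω hΩ u hu
  set I := ∫⁻ h, (ν ε).ker h * shiftInt p Ω univ u h with hI
  by_cases hIt : I = ⊤
  · refine ⟨δ / 2, half_pos hδ, half_lt_self hδ, ?_⟩
    have h1 : (C / A + 1) * I = ⊤ := by rw [hIt]; exact ENNReal.mul_top (by simp)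
    have h2 : ENNReal.ofReal ((δ / 2) ^ (d + p)) ≠ 0 := by
      rw [ne_eq, ENNReal.ofReal_eq_zero, not_le]; positivity
    rw [h1, top_add, ENNReal.top_mul h2]
    exact le_top
  by_contra hcon
  push Not at hcon
  have hlow : A * ((C / A + 1) * I + κ) ≤ C * I := by
    calc A * ((C / A + 1) * I + κ)
        ≤ (ENNReal.ofReal (c ^ (d + p)) * ∫⁻ h in Metric.closedBall 0 δ₁, k h * ‖h‖ₑ ^ p) *
            ((C / A + 1) * I + κ) := mul_le_mul' (mul_le_mul' le_rfl hkc) le_rfl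
      _ = ∫⁻ h in Metric.closedBall 0 δ₁, ENNReal.ofReal (c ^ (d + p)) * (k h * ‖h‖ₑ ^ p) *
            ((C / A + 1) * I + κ) := by
          rw [← lintegral_const_mul' _ _ ENNReal.ofReal_ne_top, ← lintegral_mul_const]
          exact (hkm.mul (measurable_enorm.pow_const p)).const_mul _
      _ ≤ ∫⁻ h in Metric.closedBall 0 δ₁, k h * (‖h‖ₑ⁻¹ ^ d * ballInt p Ω u (c * ‖h‖)) := by
          refine setLIntegral_mono' Metric.isClosed_closedBall.measurableSet fun h hh => ?_
          by_cases h0 : h = 0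
          · subst h0
            simp [hp0]
          have hhn : 0 < ‖h‖ := norm_pos_iff.2 h0
          rw [mem_closedBall_zero_iff] at hh
          have h1 := (hcon (c * ‖h‖) (by positivity)
            (lt_of_le_of_lt (mul_le_mul_of_nonneg_left hh hc.le) hcδ)).le
          have h2 : ‖h‖ₑ⁻¹ ^ d * ‖h‖ₑ ^ d = 1 := by
            rw [← mul_pow, ENNReal.inv_mul_cancel (enorm_ne_zero.2 h0) enorm_ne_top, one_pow]
          calc ENNReal.ofReal (c ^ (d + p)) * (k h * ‖h‖ₑ ^ p) * ((C / A + 1) * I + κ)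
              = k h * ((‖h‖ₑ⁻¹ ^ d * ‖h‖ₑ ^ d) * (((C / A + 1) * I + κ) *
                  (ENNReal.ofReal (c ^ (d + p)) * ‖h‖ₑ ^ p))) := by rw [h2]; ring
            _ = k h * (‖h‖ₑ⁻¹ ^ d * (((C / A + 1) * I + κ) *
                  ENNReal.ofReal ((c * ‖h‖) ^ (d + p)))) := by
                rw [Real.mul_rpow hc.le hhn.le, Real.rpow_add hhn, Real.rpow_natCast,
                  ENNReal.ofReal_mul (by positivity), ENNReal.ofReal_mul (by positivity),
                  ENNReal.ofReal_pow hhn.le, enorm_rpow_eq_ofReal hp0.le, ofReal_norm]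
                ring
            _ ≤ _ := mul_le_mul' le_rfl (mul_le_mul' le_rfl h1)
      _ ≤ C * I := hkE'
  have h5 : C * I + A * κ ≤ C * I := by
    refine le_trans ?_ hlow
    rw [mul_add, ← mul_assoc, mul_add, ENNReal.mul_div_cancel hA0 hAt]
    refine add_le_add ?_ le_rfl
    exact mul_le_mul' le_self_add le_rfl
  have h6 : A * κ = 0 := by
    have := ENNReal.le_of_add_le_add_left (ENNReal.mul_ne_top hC hIt)
      (h5.trans (le_of_eq (add_zero _).symm))
    exact le_antisymm this zero_le
  exact (mul_ne_zero hA0 hκ) h6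

end SmallScales

/-! ### Compactness -/

section Compactness

variable {d : ℕ} {p : ℝ}

/-- The half-open cube of side length `s` with index `k ∈ ℤᵈ`. -/
def cube (s : ℝ) (k : Fin d → ℤ) : Set (E d) := {x | ∀ i, ⌊x i / s⌋ = k i}

theorem measurableSet_cube (s : ℝ) (k : Fin d → ℤ) : MeasurableSet (cube s k) := by
  have : cube s k = ⋂ i, {x : E d | ⌊x i / s⌋ = k i} := by ext; simp [cube]
  rw [this]
  refine MeasurableSet.iInter fun i => ?_
  have hm : Measurable fun x : E d => ⌊x i / s⌋ :=
    Int.measurable_floor.comp (Measurable.div_const (by fun_prop) s)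
  exact hm (measurableSet_singleton (k i))

theorem disjoint_cube (s : ℝ) {k l : Fin d → ℤ} (hkl : k ≠ l) : Disjoint (cube s k) (cube s l) :=
  Set.disjoint_left.2 fun _ hk hl => hkl (funext fun i => (hk i).symm.trans (hl i))

theorem norm_le_of_forall_abs_le {x : E d} {s : ℝ} (hs : 0 ≤ s) (h : ∀ i, |x i| ≤ s) :
    ‖x‖ ≤ d * s := by
  rw [EuclideanSpace.norm_eq]
  refine Real.sqrt_le_iff.2 ⟨by positivity, ?_⟩
  calc ∑ i, ‖x i‖ ^ 2 ≤ ∑ _i : Fin d, s ^ 2 :=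
        Finset.sum_le_sum fun i _ => pow_le_pow_left₀ (norm_nonneg _) (h i) 2
    _ = d * s ^ 2 := by simp
    _ ≤ (d * s) ^ 2 := by
        rw [mul_pow]
        refine mul_le_mul_of_nonneg_right ?_ (by positivity)
        have : d ≤ d ^ 2 := Nat.le_self_pow two_ne_zero d
        exact_mod_cast this

theorem sub_mem_ball_of_mem_cube {s : ℝ} (hs : 0 < s) {k : Fin d → ℤ} {x y : E d}
    (hx : x ∈ cube s k) (hy : y ∈ cube s k) : y - x ∈ Metric.ball (0 : E d) ((d + 1) * s) := by
  rw [mem_ball_zero_iff]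
  have h1 : ‖y - x‖ ≤ d * s := by
    refine norm_le_of_forall_abs_le hs.le fun i => ?_
    have hxi := hx i
    have hyi := hy i
    rw [Int.floor_eq_iff, le_div_iff₀ hs, div_lt_iff₀ hs] at hxi hyi
    rw [PiLp.sub_apply, abs_le]
    constructor <;> nlinarith [hxi.1, hxi.2, hyi.1, hyi.2]
  nlinarith

theorem volume_cube_ge {s : ℝ} (hs : 0 < s) (k : Fin d → ℤ) :
    volume (Metric.ball (0 : E d) (s / 2)) ≤ volume (cube s k) := by
  set z : E d := WithLp.toLp 2 fun i => s * (k i + 1 / 2) with hz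
  rw [← Measure.addHaar_ball_center volume z]
  refine measure_mono fun x hx i => ?_
  rw [Metric.mem_ball, dist_eq_norm] at hx
  have h1 := (PiLp.norm_apply_le (x - z) i).trans_lt hx
  rw [Real.norm_eq_abs, PiLp.sub_apply, abs_lt] at h1
  have hzi : z i = s * (k i + 1 / 2) := rfl
  rw [hzi] at h1
  rw [Int.floor_eq_iff, le_div_iff₀ hs, div_lt_iff₀ hs]
  constructor <;> nlinarith [h1.1, h1.2]

theorem volume_cube_lt_top {s : ℝ} (hs : 0 < s) (k : Fin d → ℤ) : volume (cube s k) < ⊤ := by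
  rcases (cube s k).eq_empty_or_nonempty with h | ⟨x, hx⟩
  · simp [h]
  · refine lt_of_le_of_lt (measure_mono (t := Metric.ball x ((d + 1) * s)) fun y hy => ?_)
      measure_ball_lt_top
    have := sub_mem_ball_of_mem_cube hs hx hy
    rwa [mem_ball_zero_iff, ← dist_eq_norm] at this

theorem exists_finset_cube_cover {Ω : Set (E d)} (hbdd : Bornology.IsBounded Ω) (s : ℝ) :
    ∃ T : Finset (Fin d → ℤ), Ω ⊆ ⋃ k ∈ T, cube s k := by
  obtain ⟨R, hR⟩ := hbdd.subset_closedBall 0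
  refine ⟨Fintype.piFinset fun _ => Finset.Icc ⌊-(|R| / |s|)⌋ ⌊|R| / |s|⌋, fun x hx => ?_⟩
  refine mem_iUnion₂.2 ⟨fun i => ⌊x i / s⌋, Fintype.mem_piFinset.2 fun i => ?_, fun i => rfl⟩
  have h1 : ‖x‖ ≤ R := by simpa using hR hx
  have h2 : |x i / s| ≤ |R| / |s| := by
    rw [abs_div]
    have := PiLp.norm_apply_le x i
    rw [Real.norm_eq_abs] at this
    exact div_le_div_of_nonneg_right (this.trans (h1.trans (le_abs_self R))) (abs_nonneg s)
  rw [abs_le] at h2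
  exact Finset.mem_Icc.2 ⟨Int.floor_le_floor h2.1, Int.floor_le_floor h2.2⟩

/-- An elementary Poincaré inequality with mean value on a set `Q`. -/
theorem setLIntegral_rpow_le_mean (hp : 1 ≤ p) {Q : Set (E d)}
    (h0 : volume Q ≠ 0) (ht : volume Q ≠ ⊤) {W : E d → ℝ} (hW : Measurable W)
    (hWi : IntegrableOn W Q) :
    ∫⁻ x in Q, ‖W x‖ₑ ^ p ≤ 2 ^ (p - 1) * ((volume Q)⁻¹ *
      (∫⁻ x in Q, ∫⁻ y in Q, ‖W y - W x‖ₑ ^ p) +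
        volume Q * ((volume Q)⁻¹ * ‖∫ y in Q, W y‖ₑ) ^ p) := by
  have hp0 : 0 ≤ p := by linarith
  set v := volume Q with hv
  have hvi : v⁻¹ ≠ ⊤ := ENNReal.inv_ne_top.2 h0
  have hm2 : Measurable fun z : E d × E d => ‖W z.2 - W z.1‖ₑ ^ p :=
    ((hW.comp measurable_snd).sub (hW.comp measurable_fst)).enorm.pow_const p
  have hmx : ∀ x, Measurable fun y => ‖W y - W x‖ₑ := fun x => (hW.sub_const _).enorm
  have hpt : ∀ x, ‖W x‖ₑ ^ p ≤ 2 ^ (p - 1) * (v⁻¹ * (∫⁻ y in Q, ‖W y - W x‖ₑ ^ p) +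
      (v⁻¹ * ‖∫ y in Q, W y‖ₑ) ^ p) := by
    intro x
    have h1 : ‖W x‖ₑ ≤ v⁻¹ * (∫⁻ y in Q, ‖W y - W x‖ₑ) + v⁻¹ * ‖∫ y in Q, W y‖ₑ := by
      have e1 : v * ‖W x‖ₑ ≤ (∫⁻ y in Q, ‖W y - W x‖ₑ) + ‖∫ y in Q, W y‖ₑ := by
        have hc : IntegrableOn (fun _ : E d => W x) Q := integrableOn_const ht
        have e2 : ∫ y in Q, W x = (∫ y in Q, W y) - ∫ y in Q, (W y - W x) := by
          rw [integral_sub hWi hc]; ring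
        have e3 : v * ‖W x‖ₑ = ‖∫ _y in Q, W x‖ₑ := by
          rw [setIntegral_const, smul_eq_mul, enorm_mul, Real.enorm_eq_ofReal measureReal_nonneg,
            Measure.real, ENNReal.ofReal_toReal ht]
        rw [e3, e2, add_comm]
        exact enorm_sub_le.trans (add_le_add le_rfl (enorm_integral_le_lintegral_enorm _))
      calc ‖W x‖ₑ = v⁻¹ * (v * ‖W x‖ₑ) := by
            rw [← mul_assoc, ENNReal.inv_mul_cancel h0 ht, one_mul]
        _ ≤ v⁻¹ * ((∫⁻ y in Q, ‖W y - W x‖ₑ) + ‖∫ y in Q, W y‖ₑ) := mul_le_mul' le_rfl e1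
        _ = _ := mul_add _ _ _
    have hj : (v⁻¹ * ∫⁻ y in Q, ‖W y - W x‖ₑ) ^ p ≤ v⁻¹ * ∫⁻ y in Q, ‖W y - W x‖ₑ ^ p := by
      have h3 := lintegral_rpow_le_measure (μ := volume.restrict Q) hp (hmx x).aemeasurable
      rw [Measure.restrict_apply_univ] at h3
      rw [ENNReal.mul_rpow_of_nonneg _ _ hp0]
      refine (mul_le_mul' le_rfl h3).trans (le_of_eq ?_)
      rw [← mul_assoc]
      congr 1
      have e4 : (v⁻¹) ^ p = (v⁻¹) ^ (p - 1) * v⁻¹ := by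
        conv_lhs => rw [show p = (p - 1) + 1 by ring]
        rw [ENNReal.rpow_add _ _ (ENNReal.inv_ne_zero.2 ht) hvi, ENNReal.rpow_one]
      rw [e4, mul_right_comm, ← ENNReal.mul_rpow_of_nonneg _ _ (by linarith),
        ENNReal.inv_mul_cancel h0 ht, ENNReal.one_rpow, one_mul]
    exact (ENNReal.rpow_le_rpow h1 hp0).trans ((ENNReal.rpow_add_le_mul_rpow_add_rpow _ _ hp).trans
      (mul_le_mul' le_rfl (add_le_add hj le_rfl)))
  calc ∫⁻ x in Q, ‖W x‖ₑ ^ p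
      ≤ ∫⁻ x in Q, 2 ^ (p - 1) * (v⁻¹ * (∫⁻ y in Q, ‖W y - W x‖ₑ ^ p) +
          (v⁻¹ * ‖∫ y in Q, W y‖ₑ) ^ p) := lintegral_mono hpt
    _ = _ := by
        rw [lintegral_const_mul' _ _ (by simp), lintegral_add_right _ measurable_const,
          lintegral_const_mul' _ _ hvi, setLIntegral_const]
        congr 2
        exact mul_comm _ _

/-- On a bounded set the `Lᵖ` norm is controlled by the ball energy at a small scale and finitely
many mean values. -/
theorem exists_setLIntegral_rpow_le_cubes (hp : 1 ≤ p) {Ω : Set (E d)}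
    (hbdd : Bornology.IsBounded Ω) {s : ℝ} (hs : 0 < s) :
    ∃ T : Finset (Fin d → ℤ), ∀ W : E d → ℝ, Measurable W → LocallyIntegrable W →
      ∫⁻ x in Ω, ‖W x‖ₑ ^ p ≤ 2 ^ (p - 1) *
        ((volume (Metric.ball (0 : E d) (s / 2)))⁻¹ * ballInt p univ W ((d + 1) * s) +
        ∑ k ∈ T, volume (cube s k) * ((volume (cube s k))⁻¹ * ‖∫ y in cube s k, W y‖ₑ) ^ p) := by
  obtain ⟨T, hT⟩ := exists_finset_cube_cover hbdd s
  refine ⟨T, fun W hW hWi => ?_⟩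
  set v₀ := volume (Metric.ball (0 : E d) (s / 2)) with hv₀
  have hv₀0 : v₀ ≠ 0 := (Metric.measure_ball_pos volume _ (half_pos hs)).ne'
  set f : E d → ℝ≥0∞ := fun x => ∫⁻ y, ballKernel p W ((d + 1) * s) x y with hf
  have hcube : ∀ k, ∫⁻ x in cube s k, ‖W x‖ₑ ^ p ≤ 2 ^ (p - 1) *
      (v₀⁻¹ * (∫⁻ x in cube s k, f x) +
        volume (cube s k) * ((volume (cube s k))⁻¹ * ‖∫ y in cube s k, W y‖ₑ) ^ p) := by
    intro k
    have h0 : volume (cube s k) ≠ 0 :=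
      (lt_of_lt_of_le (pos_iff_ne_zero.2 hv₀0) (volume_cube_ge hs k)).ne'
    have hint : IntegrableOn W (cube s k) := by
      rcases (cube s k).eq_empty_or_nonempty with h | ⟨x, hx⟩
      · simp [h]
      · refine (hWi.integrableOn_isCompact
          (isCompact_closedBall x ((d + 1) * s))).mono_set fun y hy => ?_
        have := sub_mem_ball_of_mem_cube hs hx hy
        rw [mem_ball_zero_iff, ← dist_eq_norm] at this
        exact this.le
    refine (setLIntegral_rpow_le_mean hp h0
      (volume_cube_lt_top hs k).ne hW hint).trans ?_
    refine mul_le_mul' le_rfl (add_le_add (mul_le_mul'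
      (ENNReal.inv_le_inv.2 (volume_cube_ge hs k)) ?_) le_rfl)
    refine setLIntegral_mono' (measurableSet_cube s k) fun x hx => ?_
    refine le_trans ?_ (setLIntegral_le_lintegral (cube s k) _)
    refine setLIntegral_mono' (measurableSet_cube s k) fun y hy => ?_
    unfold ballKernel
    rw [indicator_of_mem (sub_mem_ball_of_mem_cube hs hx hy)]
  have hsumf : ∑ k ∈ T, ∫⁻ x in cube s k, f x ≤ ballInt p univ W ((d + 1) * s) := by
    rw [← lintegral_biUnion_finset (fun k _ l _ hkl => disjoint_cube s hkl)
      (fun k _ => measurableSet_cube s k), ballInt_eq MeasurableSet.univ hW]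
    simp only [setLIntegral_univ]
    exact setLIntegral_le_lintegral _ _
  calc ∫⁻ x in Ω, ‖W x‖ₑ ^ p ≤ ∫⁻ x in ⋃ k ∈ T, cube s k, ‖W x‖ₑ ^ p := lintegral_mono_set hT
    _ = ∑ k ∈ T, ∫⁻ x in cube s k, ‖W x‖ₑ ^ p :=
        lintegral_biUnion_finset (fun k _ l _ hkl => disjoint_cube s hkl)
          (fun k _ => measurableSet_cube s k) _
    _ ≤ ∑ k ∈ T, 2 ^ (p - 1) * (v₀⁻¹ * (∫⁻ x in cube s k, f x) +
        volume (cube s k) * ((volume (cube s k))⁻¹ * ‖∫ y in cube s k, W y‖ₑ) ^ p) :=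
        Finset.sum_le_sum fun k _ => hcube k
    _ = 2 ^ (p - 1) * (v₀⁻¹ * (∑ k ∈ T, ∫⁻ x in cube s k, f x) +
        ∑ k ∈ T, volume (cube s k) * ((volume (cube s k))⁻¹ * ‖∫ y in cube s k, W y‖ₑ) ^ p) := by
        rw [← Finset.mul_sum, Finset.sum_add_distrib, Finset.mul_sum T _ v₀⁻¹]
    _ ≤ _ := mul_le_mul' le_rfl (add_le_add (mul_le_mul' le_rfl hsumf) le_rfl)

theorem shiftInt_sub_le (hp : 1 ≤ p) {V W : E d → ℝ} (hV : AEMeasurable V) (A B : Set (E d))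
    (h : E d) : shiftInt p A B (fun x => V x - W x) h ≤
      2 ^ (p - 1) * (shiftInt p A B V h + shiftInt p A B W h) := by
  have hp0 : 0 ≤ p := by linarith
  unfold shiftInt
  rw [← lintegral_add_left' (f := fun x => ‖V (x + h) - V x‖ₑ ^ p)
    (((aemeasurable_shift hV h).sub hV).enorm.pow_const p).restrict,
    ← lintegral_const_mul' _ _ (by simp)]
  refine lintegral_mono fun x => ?_
  have e : V (x + h) - W (x + h) - (V x - W x) = (V (x + h) - V x) - (W (x + h) - W x) := by ring
  dsimp only [Pi.sub_apply]
  rw [e]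
  exact (ENNReal.rpow_le_rpow enorm_sub_le hp0).trans (ENNReal.rpow_add_le_mul_rpow_add_rpow _ _ hp)

theorem ballInt_sub_le_of_shiftInt_le (hp : 1 ≤ p) {V W : E d → ℝ} (hV : AEMeasurable V) {r : ℝ}
    {η : ℝ≥0∞} (h1 : ∀ h : E d, ‖h‖ ≤ r → shiftInt p univ univ V h ≤ η)
    (h2 : ∀ h : E d, ‖h‖ ≤ r → shiftInt p univ univ W h ≤ η) :
    ballInt p univ (fun x => V x - W x) r ≤ 2 ^ p * η * volume (Metric.ball (0 : E d) r) := by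
  unfold ballInt
  rw [← setLIntegral_const]
  refine setLIntegral_mono' measurableSet_ball fun h hh => ?_
  rw [mem_ball_zero_iff] at hh
  rw [← two_rpow_sub_one_mul]
  exact (shiftInt_sub_le hp hV univ univ h).trans
    (mul_le_mul' le_rfl (add_le_add (h1 h hh.le) (h2 h hh.le)))

theorem abs_setIntegral_le (hp : 1 ≤ p) {Q : Set (E d)} (ht : volume Q ≠ ⊤)
    {V : E d → ℝ} (hV : Measurable V) {M : ℝ≥0∞} (hM : M ≠ ⊤) (hVM : ∫⁻ x, ‖V x‖ₑ ^ p ≤ M) :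
    |∫ x in Q, V x| ≤ ((volume Q ^ (p - 1) * M) ^ (1 / p)).toReal := by
  have hp0 : 0 < p := by linarith
  have h1 : ‖∫ x in Q, V x‖ₑ ≤ (volume Q ^ (p - 1) * M) ^ (1 / p) := by
    refine (enorm_integral_le_lintegral_enorm _).trans ?_
    have h3 := lintegral_rpow_le_measure (μ := volume.restrict Q) hp
      (f := fun x => ‖V x‖ₑ) hV.enorm.aemeasurable
    rw [Measure.restrict_apply_univ] at h3
    rw [← ENNReal.rpow_le_rpow_iff hp0, ← ENNReal.rpow_mul, one_div_mul_cancel hp0.ne',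
      ENNReal.rpow_one]
    exact h3.trans (mul_le_mul' le_rfl ((setLIntegral_le_lintegral _ _).trans hVM))
  rw [Real.enorm_eq_ofReal_abs] at h1
  have hfin : (volume Q ^ (p - 1) * M) ^ (1 / p) ≠ ⊤ :=
    ENNReal.rpow_ne_top_of_nonneg (by positivity) (ENNReal.mul_ne_top
      (ENNReal.rpow_ne_top_of_nonneg (by linarith) ht) hM)
  exact (ENNReal.ofReal_le_iff_le_toReal hfin).1 h1

/-- A form of the Kolmogorov–Riesz theorem: a bounded sequence in `Lᵖ(ℝᵈ)` whose translations are
asymptotically equicontinuous has a subsequence that converges in `Lᵖ(Ω)`, for bounded `Ω`. -/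
theorem exists_subseq_tendsto_of_shiftInt (hp : 1 ≤ p) {Ω : Set (E d)}
    (hbdd : Bornology.IsBounded Ω) {V : ℕ → E d → ℝ}
    (hV : ∀ n, Measurable (V n)) {M : ℝ≥0∞} (hM : M ≠ ⊤) (hVM : ∀ n, ∫⁻ x, ‖V n x‖ₑ ^ p ≤ M)
    (heq : ∀ η : ℝ≥0∞, 0 < η → ∃ ρ : ℝ, 0 < ρ ∧ ∀ᶠ n in atTop, ∀ h : E d, ‖h‖ ≤ ρ →
      shiftInt p univ univ (V n) h ≤ η) :
    ∃ φ : ℕ → ℕ, StrictMono φ ∧ ∃ U : E d → ℝ, MemLp U (ENNReal.ofReal p) (volume.restrict Ω) ∧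
      Tendsto (fun n => ∫⁻ x in Ω, ‖V (φ n) x - U x‖ₑ ^ p) atTop (𝓝 0) := by
  have hp0 : 0 < p := by linarith
  have hp1 : 1 ≤ ENNReal.ofReal p := by simpa using hp
  have : Fact (1 ≤ ENNReal.ofReal p) := ⟨hp1⟩
  have hVL : ∀ n, MemLp (V n) (ENNReal.ofReal p) volume := fun n =>
    memLp_of_lintegral_lt_top hp0 (hV n).aestronglyMeasurable ((hVM n).trans_lt hM.lt_top)
  have hVΩ : ∀ n, MemLp (V n) (ENNReal.ofReal p) (volume.restrict Ω) := fun n =>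
    (hVL n).mono_measure Measure.restrict_le_self
  set side : ℕ → ℝ := fun j => 1 / ((j : ℝ) + 1) with hside
  have hside0 : ∀ j, 0 < side j := fun j => by positivity
  -- a diagonal subsequence along which all mean values over cubes converge
  set a : ℕ → (ℕ × (Fin d → ℤ)) → ℝ := fun n z => ∫ x in cube (side z.1) z.2, V n x with ha
  set bd : (ℕ × (Fin d → ℤ)) → ℝ := fun z =>
    ((volume (cube (side z.1) z.2 : Set (E d)) ^ (p - 1) * M) ^ (1 / p)).toReal with hbd
  have hab : ∀ n, a n ∈ Set.pi univ fun z => Icc (-bd z) (bd z) := fun n z _ =>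
    abs_le.1 (abs_setIntegral_le hp (volume_cube_lt_top (hside0 z.1) z.2).ne (hV n) hM (hVM n))
  obtain ⟨a₀, -, φ, hφ, hlim⟩ := (isCompact_univ_pi fun z => isCompact_Icc).tendsto_subseq hab
  refine ⟨φ, hφ, ?_⟩
  have hcauchy : ∀ η : ℝ≥0∞, 0 < η → ∃ N, ∀ n ≥ N, ∀ m ≥ N,
      ∫⁻ x in Ω, ‖V (φ n) x - V (φ m) x‖ₑ ^ p ≤ η := by
    intro η hη
    -- `D` is independent of the scale
    set D : ℝ≥0∞ := 2 ^ (p - 1) * (2 ^ p * ENNReal.ofReal ((2 * (d + 1)) ^ d)) with hD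
    have hDt : D ≠ ⊤ := by
      refine ENNReal.mul_ne_top (by simp) (ENNReal.mul_ne_top (by simp) ENNReal.ofReal_ne_top)
    obtain ⟨η', hη'0, hη'⟩ : ∃ η' : ℝ≥0∞, 0 < η' ∧ D * η' ≤ η / 2 := by
      have h1 : Tendsto (fun t : ℝ≥0∞ => D * t) (𝓝 0) (𝓝 (D * 0)) :=
        ENNReal.Tendsto.const_mul tendsto_id (Or.inr hDt)
      rw [mul_zero] at h1
      have h2 := h1.eventually_le_const (ENNReal.half_pos hη.ne')
      have h3 : ∀ᶠ t : ℝ≥0∞ in 𝓝[>] 0, D * t ≤ η / 2 ∧ 0 < t :=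
        (h2.filter_mono nhdsWithin_le_nhds).and self_mem_nhdsWithin
      obtain ⟨t, h4, h5⟩ := h3.exists
      exact ⟨t, h5, h4⟩
    obtain ⟨ρ, hρ, hev⟩ := heq η' hη'0
    obtain ⟨j, hj⟩ := exists_nat_gt ((d + 1) / ρ)
    set s := side j with hs
    have hs0 : 0 < s := hside0 j
    have hsρ : (d + 1) * s ≤ ρ := by
      rw [hs, hside]
      dsimp only
      rw [mul_one_div, div_le_iff₀ (by positivity)]
      rw [div_lt_iff₀ hρ] at hj
      nlinarith
    obtain ⟨T, hT⟩ := exists_setLIntegral_rpow_le_cubes (p := p) hp hbdd hs0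
    have hconv : ∀ k ∈ T, ∃ N, ∀ n ≥ N, ∀ m ≥ N, volume (cube s k) *
        ((volume (cube s k))⁻¹ * ‖a (φ n) (j, k) - a (φ m) (j, k)‖ₑ) ^ p ≤
          η / 2 * (2 ^ (p - 1))⁻¹ * ((T.card : ℝ≥0∞) + 1)⁻¹ := by
      intro k _
      set ζ : ℝ≥0∞ := η / 2 * (2 ^ (p - 1))⁻¹ * ((T.card : ℝ≥0∞) + 1)⁻¹ with hζ
      have hζ0 : 0 < ζ := by
        refine ENNReal.mul_pos (ENNReal.mul_pos (ENNReal.half_pos hη.ne').ne' ?_).ne' ?_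
        · exact ENNReal.inv_ne_zero.2 (by simp)
        · exact ENNReal.inv_ne_zero.2 (by simp)
      have hv := (volume_cube_lt_top hs0 k).ne
      have hv0 : (volume (cube s k))⁻¹ ≠ ⊤ := ENNReal.inv_ne_top.2
        (lt_of_lt_of_le (Metric.measure_ball_pos volume _ (half_pos hs0)) (volume_cube_ge hs0 k)).ne'
      have h1 : Tendsto (fun t : ℝ => volume (cube s k) *
          ((volume (cube s k))⁻¹ * ‖t‖ₑ) ^ p) (𝓝 0) (𝓝 0) := by
        have h2 : Tendsto (fun t : ℝ => ‖t‖ₑ) (𝓝 0) (𝓝 0) := by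
          have := (continuous_enorm (E := ℝ)).tendsto 0
          rwa [enorm_zero] at this
        have h3 := ENNReal.Tendsto.const_mul h2 (Or.inr hv0)
        rw [mul_zero] at h3
        have h4 := h3.ennrpow_const p
        rw [ENNReal.zero_rpow_of_pos hp0] at h4
        have h5 := ENNReal.Tendsto.const_mul h4 (Or.inr hv)
        rwa [mul_zero] at h5
      obtain ⟨δ, hδ, hδ'⟩ := Metric.eventually_nhds_iff.1 (h1.eventually_le_const hζ0)
      have hc : CauchySeq fun n => a (φ n) (j, k) := by
        have := (tendsto_pi_nhds.1 hlim) (j, k)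
        exact this.cauchySeq
      obtain ⟨N, hN⟩ := Metric.cauchySeq_iff.1 hc δ hδ
      refine ⟨N, fun n hn m hm => hδ' ?_⟩
      have := hN n hn m hm
      rw [Real.dist_eq] at this ⊢
      rwa [sub_zero]
    have hN' : ∀ k, ∃ N, k ∈ T → ∀ n ≥ N, ∀ m ≥ N, volume (cube s k) *
        ((volume (cube s k))⁻¹ * ‖a (φ n) (j, k) - a (φ m) (j, k)‖ₑ) ^ p ≤
          η / 2 * (2 ^ (p - 1))⁻¹ * ((T.card : ℝ≥0∞) + 1)⁻¹ := fun k => by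
      by_cases hk : k ∈ T
      · obtain ⟨N, hN⟩ := hconv k hk
        exact ⟨N, fun _ => hN⟩
      · exact ⟨0, fun h => absurd h hk⟩
    choose N₁ hN₁ using hN'
    obtain ⟨N₂, hN₂⟩ := eventually_atTop.1 hev
    refine ⟨max N₂ (T.sup N₁), fun n hn m hm => ?_⟩
    have hn2 : N₂ ≤ φ n := (le_max_left _ _).trans (hn.trans (hφ.id_le n))
    have hm2 : N₂ ≤ φ m := (le_max_left _ _).trans (hm.trans (hφ.id_le m))
    have hWm : Measurable fun x => V (φ n) x - V (φ m) x := (hV _).sub (hV _)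
    have hWi : LocallyIntegrable fun x => V (φ n) x - V (φ m) x :=
      ((hVL _).locallyIntegrable hp1).sub ((hVL _).locallyIntegrable hp1)
    refine (hT _ hWm hWi).trans ?_
    have hball := ballInt_sub_le_of_shiftInt_le hp (r := (d + 1) * s) (η := η')
      (hV (φ n)).aemeasurable (fun h hh => hN₂ _ hn2 h (hh.trans hsρ))
      (fun h hh => hN₂ _ hm2 h (hh.trans hsρ))
    have hvol : (volume (Metric.ball (0 : E d) (s / 2)))⁻¹ *
        volume (Metric.ball (0 : E d) ((d + 1) * s)) = ENNReal.ofReal ((2 * (d + 1)) ^ d) := by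
      have e1 : ((d : ℝ) + 1) * s = (2 * (d + 1)) * (s / 2) := by ring
      rw [e1, Measure.addHaar_ball_mul_of_pos volume (0 : E d) (by positivity : (0 : ℝ) < 2 * (d + 1)),
        finrank_euclideanSpace, Fintype.card_fin, mul_left_comm, ENNReal.inv_mul_cancel, mul_one]
      · exact (Metric.measure_ball_pos volume _ (half_pos hs0)).ne'
      · exact measure_ball_lt_top.ne
    have hint : ∀ k, ∫ y in cube s k, (V (φ n) y - V (φ m) y) = a (φ n) (j, k) - a (φ m) (j, k) := by
      intro k
      have hi : ∀ n, IntegrableOn (V n) (cube s k) := fun n => by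
        have : IsFiniteMeasure (volume.restrict (cube s k)) :=
          ⟨by rw [Measure.restrict_apply_univ]; exact volume_cube_lt_top hs0 k⟩
        exact ((hVL n).mono_measure Measure.restrict_le_self).integrable hp1
      exact integral_sub (hi _) (hi _)
    rw [mul_add]
    have hfirst : 2 ^ (p - 1) * ((volume (Metric.ball (0 : E d) (s / 2)))⁻¹ *
        ballInt p univ (fun x => V (φ n) x - V (φ m) x) ((d + 1) * s)) ≤ η / 2 := by
      refine le_trans ?_ hη'
      calc _ ≤ 2 ^ (p - 1) * ((volume (Metric.ball (0 : E d) (s / 2)))⁻¹ *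
            (2 ^ p * η' * volume (Metric.ball (0 : E d) ((d + 1) * s)))) :=
            mul_le_mul' le_rfl (mul_le_mul' le_rfl hball)
        _ = 2 ^ (p - 1) * (2 ^ p * ((volume (Metric.ball (0 : E d) (s / 2)))⁻¹ *
            volume (Metric.ball (0 : E d) ((d + 1) * s)))) * η' := by ring
        _ = D * η' := by rw [hvol]
    have hsecond : 2 ^ (p - 1) * ∑ k ∈ T, volume (cube s k) *
        ((volume (cube s k))⁻¹ * ‖∫ y in cube s k, (V (φ n) y - V (φ m) y)‖ₑ) ^ p ≤ η / 2 := by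
      calc _ ≤ 2 ^ (p - 1) * ∑ _k ∈ T, η / 2 * (2 ^ (p - 1))⁻¹ * ((T.card : ℝ≥0∞) + 1)⁻¹ := by
            refine mul_le_mul' le_rfl (Finset.sum_le_sum fun k hk => ?_)
            rw [hint]
            exact hN₁ k hk n ((Finset.le_sup hk).trans ((le_max_right _ _).trans hn)) m
              ((Finset.le_sup hk).trans ((le_max_right _ _).trans hm))
        _ = η / 2 * ((2 : ℝ≥0∞) ^ (p - 1) * (2 ^ (p - 1))⁻¹) *
              ((T.card : ℝ≥0∞) * ((T.card : ℝ≥0∞) + 1)⁻¹) := by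
            rw [Finset.sum_const, nsmul_eq_mul]; ring
        _ ≤ η / 2 * 1 * 1 := by
            refine mul_le_mul' (mul_le_mul' le_rfl (ENNReal.mul_inv_le_one _)) ?_
            refine le_trans (mul_le_mul' le_self_add le_rfl) (ENNReal.mul_inv_le_one _)
        _ = η / 2 := by rw [mul_one, mul_one]
    calc _ ≤ η / 2 + η / 2 := add_le_add hfirst hsecond
      _ = η := ENNReal.add_halves η
  set D : ℕ → Lp ℝ (ENNReal.ofReal p) (volume.restrict Ω) := fun n => (hVΩ (φ n)).toLp _ with hD
  have hDe : ∀ n m, edist (D n) (D m) ^ p = ∫⁻ x in Ω, ‖V (φ n) x - V (φ m) x‖ₑ ^ p := fun n m => by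
    rw [hD, Lp.edist_toLp_toLp, eLpNorm_rpow_eq hp0]
    rfl
  have hDc : CauchySeq D := by
    rw [EMetric.cauchySeq_iff]
    intro ε hε
    have h1 : 0 < (ε / 2) ^ p ∨ ε = ⊤ := by
      by_cases h : ε = ⊤
      · exact Or.inr h
      · left
        exact ENNReal.rpow_pos (ENNReal.half_pos hε.ne') (ENNReal.div_ne_top h (by simp))
    rcases h1 with h1 | h1
    · obtain ⟨N, hN⟩ := hcauchy _ h1
      refine ⟨N, fun n hn m hm => ?_⟩
      have h2 := hN n hn m hm
      rw [← hDe, ENNReal.rpow_le_rpow_iff hp0] at h2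
      by_cases h : ε = ⊤
      · rw [h]; exact edist_lt_top _ _
      · exact h2.trans_lt (ENNReal.half_lt_self hε.ne' h)
    · exact ⟨0, fun n _ m _ => by rw [h1]; exact edist_lt_top _ _⟩
  obtain ⟨U, hU⟩ := cauchySeq_tendsto_of_complete hDc
  refine ⟨U, Lp.memLp U, ?_⟩
  have h1 : Tendsto (fun n => edist (D n) U ^ p) atTop (𝓝 0) := by
    have h2 := (tendsto_iff_edist_tendsto_0.1 hU).ennrpow_const p
    rwa [ENNReal.zero_rpow_of_pos hp0] at h2
  refine h1.congr fun n => ?_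
  rw [Lp.edist_def, eLpNorm_rpow_eq hp0]
  refine lintegral_congr_ae ?_
  filter_upwards [(hVΩ (φ n)).coeFn_toLp] with x hx
  rw [Pi.sub_apply, hx]

end Compactness

/-! ### Asymptotic compactness -/

section AsymptoticCompactness

variable {d : ℕ} {p : ℝ}

theorem ballInt_le_of_shiftInt_le {A : Set (E d)} {u : E d → ℝ} {c : ℝ≥0∞}
    (h : ∀ (r : ℝ), 0 < r → ∀ h : E d, ‖h‖ ≤ r → shiftInt p A A u h ≤ c * ENNReal.ofReal (r ^ p))
    {r : ℝ} (hr : 0 < r) :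
    ballInt p A u r ≤ c * volume (Metric.ball (0 : E d) 1) * ENNReal.ofReal (r ^ (d + p)) := by
  calc ballInt p A u r ≤ ∫⁻ _ in Metric.ball (0 : E d) r, c * ENNReal.ofReal (r ^ p) :=
        setLIntegral_mono' measurableSet_ball fun k hk =>
          h r hr k (mem_ball_zero_iff.1 hk).le
    _ = _ := by
        rw [setLIntegral_const, Measure.addHaar_ball_of_pos _ _ hr, finrank_euclideanSpace_fin,
          Real.rpow_add hr, ENNReal.ofReal_mul (by positivity), Real.rpow_natCast]
        ring

/-- Sequences that are bounded in the nonlocal spaces, with `ε → 0`, have a subsequence that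
converges in `Lᵖ(Ω)` to the restriction of a function from `W^{1,p}(ℝᵈ)`. -/
theorem exists_subseq_sobolev_limit [NeZero d] (hp : 1 < p) {Ω : Set (E d)} (hΩ : IsOpen Ω)
    (hbdd : Bornology.IsBounded Ω) (hlip : HasLipschitzBoundary Ω)
    {ν : ℝ → RadialLevyKernel d p} (hν : IsLevyApproxUnity ν)
    (hν_one : d = 1 → OneDimCondition ν) {ε : ℕ → ℝ} (hε : Tendsto ε atTop (𝓝[>] 0))
    {u : ℕ → E d → ℝ} (hu : ∀ n, AEMeasurable (u n)) {M : ℝ≥0∞} (hM : M ≠ ⊤)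
    (hb : ∀ n, (∫⁻ x in Ω, ‖u n x‖ₑ ^ p) + energy (Ω ×ˢ univ) (ν (ε n)) (u n) ≤ M) :
    ∃ φ : ℕ → ℕ, StrictMono φ ∧ ∃ (U : E d → ℝ) (G : E d → E d),
      MemLp U (ENNReal.ofReal p) volume ∧ Measurable G ∧ MemLp G (ENNReal.ofReal p) volume ∧
      IsWeakGrad univ U G ∧
      Tendsto (fun n => ∫⁻ x in Ω, ‖u (φ n) x - U x‖ₑ ^ p) atTop (𝓝 0) := by
  have hp0 : 0 < p := by linarith
  obtain ⟨C₁, hC₁, Λ, hΛ, r₀, hr₀, hext⟩ := exists_extension hp.le hΩ hbdd hlip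
  obtain ⟨C₂, hC₂, hscale⟩ := exists_small_scale hp hν hν_one
  obtain ⟨C₃, hC₃, hlarge⟩ := exists_shiftInt_le_of_ballInt d hp.le
  have hΛ0 : 0 < Λ := by linarith
  choose V hVm hVu hVp hVr using fun n => hext (u n) (hu n)
  set c : ℝ≥0∞ := C₁ * ((C₂ * M + 1) * ENNReal.ofReal (Λ ^ (d + p)) + M) with hc
  have hct : c ≠ ⊤ := by rw [hc]; finiteness
  have hB : C₃ * c ≠ ⊤ := by finiteness
  have hS : ∀ ρ : ℝ, 0 < ρ → ∀ᶠ n in atTop, ∀ h : E d, ‖h‖ ≤ ρ →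
      shiftInt p univ univ (V n) h ≤ C₃ * c * ENNReal.ofReal (ρ ^ p) := by
    intro ρ hρ
    have hδ : 0 < Λ * min ρ r₀ := by positivity
    filter_upwards [hε.eventually (hscale _ hδ)] with n hn
    obtain ⟨r, hr, hrδ, hle⟩ := hn Ω hΩ.measurableSet (u n) (hu n) 1 one_ne_zero
    have h1 : r / Λ < min ρ r₀ := by rwa [div_lt_iff₀' hΛ0]
    have hr' : 0 < r / Λ := by positivity
    refine hlarge (V n) (hVm n).aemeasurable (r / Λ) ρ c hr' (h1.le.trans (min_le_left _ _)) ?_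
    refine (hVr n (r / Λ) hr' (h1.le.trans (min_le_right _ _))).trans ?_
    rw [mul_div_cancel₀ r hΛ0.ne', hc, mul_assoc]
    refine mul_le_mul' le_rfl ?_
    rw [add_mul, mul_comm (ENNReal.ofReal ((r / Λ) ^ (d + p)))]
    refine add_le_add ?_ (mul_le_mul' (le_self_add.trans (hb n)) le_rfl)
    rw [mul_assoc, ← ENNReal.ofReal_mul (by positivity), ← Real.mul_rpow hΛ0.le hr'.le,
      mul_div_cancel₀ r hΛ0.ne']
    refine hle.trans (mul_le_mul' (add_le_add (mul_le_mul' le_rfl ?_) le_rfl) le_rfl)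
    exact le_add_self.trans (hb n)
  have hVM : ∀ n, ∫⁻ x, ‖V n x‖ₑ ^ p ≤ C₁ * M := fun n =>
    (hVp n).trans (mul_le_mul' le_rfl (le_self_add.trans (hb n)))
  obtain ⟨φ, hφ, U₀, hU₀, hlim⟩ := exists_subseq_tendsto_of_shiftInt hp.le hbdd hVm
    (M := C₁ * M) (by finiteness) hVM (fun η hη => by
      obtain ⟨ρ, hρ, hρη⟩ : ∃ ρ : ℝ, 0 < ρ ∧ C₃ * c * ENNReal.ofReal (ρ ^ p) ≤ η := by
        have ht : Tendsto (fun ρ : ℝ => C₃ * c * ENNReal.ofReal (ρ ^ p)) (𝓝[>] 0) (𝓝 0) := by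
          have h1 : Tendsto (fun ρ : ℝ => ENNReal.ofReal (ρ ^ p)) (𝓝[>] 0) (𝓝 0) := by
            have h2 : ContinuousAt (fun ρ : ℝ => ENNReal.ofReal (ρ ^ p)) 0 :=
              (ENNReal.continuous_ofReal.continuousAt).comp
                (Real.continuousAt_rpow_const 0 p (Or.inr hp0.le))
            have h3 := h2.tendsto
            rw [Real.zero_rpow hp0.ne', ENNReal.ofReal_zero] at h3
            exact h3.mono_left nhdsWithin_le_nhds
          simpa using ENNReal.Tendsto.const_mul h1 (Or.inr hB)
        obtain ⟨ρ, h1, h2⟩ := ((ht.eventually (ge_mem_nhds hη)).and self_mem_nhdsWithin).exists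
        exact ⟨ρ, h2, h1⟩
      refine ⟨ρ, hρ, (hS ρ hρ).mono fun n hn h hh => (hn h hh).trans hρη⟩)
  set U₁ := hU₀.1.mk U₀ with hU₁
  have hU₁m : Measurable U₁ := hU₀.1.stronglyMeasurable_mk.measurable
  have hU₁e : U₀ =ᵐ[volume.restrict Ω] U₁ := hU₀.1.ae_eq_mk
  have hlim₁ : Tendsto (fun n => ∫⁻ x in Ω, ‖V (φ n) x - U₁ x‖ₑ ^ p) atTop (𝓝 0) := by
    refine hlim.congr fun n => lintegral_congr_ae ?_
    filter_upwards [hU₁e] with x hx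
    rw [hx]
  have hUp : ∫⁻ x in Ω, ‖U₁ x‖ₑ ^ p ≠ ⊤ := by
    have := lintegral_rpow_lt_top hp0 (hU₀.ae_eq hU₁e)
    exact this.ne
  have hsh : ∀ r : ℝ, 0 < r → ∀ h : E d, ‖h‖ ≤ r →
      shiftInt p Ω Ω U₁ h ≤ 2 ^ (p - 1) * (C₃ * c) * ENNReal.ofReal (r ^ p) := by
    intro r hr h hh
    have hev : ∀ᶠ n in atTop, shiftInt p Ω Ω U₁ h ≤ 2 ^ (p - 1) * (C₃ * c * ENNReal.ofReal (r ^ p) +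
        2 ^ p * ∫⁻ x in Ω, ‖V (φ n) x - U₁ x‖ₑ ^ p) := by
      filter_upwards [hφ.tendsto_atTop.eventually (hS r hr)] with n hn
      set W : E d → ℝ := Ω.indicator fun x => V (φ n) x - U₁ x with hW
      have hWm : Measurable W := ((hVm _).sub hU₁m).indicator hΩ.measurableSet
      have e1 : shiftInt p Ω Ω U₁ h = shiftInt p Ω Ω (fun x => V (φ n) x - W x) h := by
        refine shiftInt_congr p hΩ.measurableSet hΩ.measurableSet ?_ ?_ h <;>
        · refine Eventually.of_forall fun x hx => ?_
          simp [hW, indicator_of_mem hx]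
      rw [e1]
      refine (shiftInt_sub_le hp.le (hVm _).aemeasurable Ω Ω h).trans ?_
      refine mul_le_mul' le_rfl (add_le_add ?_ ?_)
      · exact (shiftInt_mono p (subset_univ _) (subset_univ _) _ h).trans (hn h hh)
      · refine (shiftInt_le_lintegral hp.le Ω Ω hWm.aemeasurable h).trans (le_of_eq ?_)
        rw [← lintegral_indicator hΩ.measurableSet]
        congr 1
        refine lintegral_congr fun x => ?_
        by_cases hx : x ∈ Ω
        · simp [hW, hx]
        · simp [hW, hx, hp0]
    have ht : Tendsto (fun n => 2 ^ (p - 1) * (C₃ * c * ENNReal.ofReal (r ^ p) +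
        2 ^ p * ∫⁻ x in Ω, ‖V (φ n) x - U₁ x‖ₑ ^ p)) atTop
        (𝓝 (2 ^ (p - 1) * (C₃ * c * ENNReal.ofReal (r ^ p) + 2 ^ p * 0))) :=
      ENNReal.Tendsto.const_mul (tendsto_const_nhds.add
        (ENNReal.Tendsto.const_mul hlim₁ (Or.inr (by finiteness)))) (Or.inr (by simp))
    have := ge_of_tendsto ht hev
    rwa [mul_zero, add_zero, ← mul_assoc] at this
  obtain ⟨U, G, hU, hGm, hG, hUG, hUU⟩ := exists_sobolev_extension_of_ballInt_le hp hΩ hbdd hlip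
    (u := U₁) hU₁m.aemeasurable hUp
    (c := 2 ^ (p - 1) * (C₃ * c) * volume (Metric.ball (0 : E d) 1))
    (ENNReal.mul_ne_top (ENNReal.mul_ne_top (by simp) hB) measure_ball_lt_top.ne) one_pos
    (fun r hr _ => ballInt_le_of_shiftInt_le hsh hr)
  refine ⟨φ, hφ, U, G, hU, hGm, hG, hUG, hlim₁.congr fun n => lintegral_congr_ae ?_⟩
  rw [EventuallyEq, ae_restrict_iff' hΩ.measurableSet]
  filter_upwards [hUU, hVu (φ n)] with x h1 h2 hx
  rw [h1 hx, h2 hx]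

end AsymptoticCompactness

/-! ### Lower semicontinuity -/

section LowerSemicontinuity

variable {d : ℕ} {p : ℝ}

theorem lintegral_rpow_minkowski {α F F₁ F₂ : Type*} [MeasurableSpace α] {μ : Measure α}
    [NormedAddCommGroup F] [NormedAddCommGroup F₁] [NormedAddCommGroup F₂] (hp : 1 ≤ p) {f : α → F}
    {g : α → F₁} {k : α → F₂} (hg : AEMeasurable (fun x => ‖g x‖ₑ) μ)
    (hk : AEMeasurable (fun x => ‖k x‖ₑ) μ) (h : ∀ᵐ x ∂μ, ‖f x‖ₑ ≤ ‖g x‖ₑ + ‖k x‖ₑ) :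
    (∫⁻ x, ‖f x‖ₑ ^ p ∂μ) ^ (1 / p) ≤
      (∫⁻ x, ‖g x‖ₑ ^ p ∂μ) ^ (1 / p) + (∫⁻ x, ‖k x‖ₑ ^ p ∂μ) ^ (1 / p) := by
  refine le_trans (ENNReal.rpow_le_rpow (lintegral_mono_ae ?_) (by positivity))
    (ENNReal.lintegral_Lp_add_le hg hk hp)
  filter_upwards [h] with x hx
  exact ENNReal.rpow_le_rpow hx (by linarith)

theorem shiftInt_univ_right (p : ℝ) (A : Set (E d)) (u : E d → ℝ) (h : E d) :
    shiftInt p A univ u h = ∫⁻ x in A, ‖u (x + h) - u x‖ₑ ^ p := by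
  simp [shiftInt]

/-- A Sobolev function `U` is compared with a function `u` that is close to `U` in `Lᵖ(Ω)`: by the
triangle inequality along the `N` steps from `x` to `x + N h`, where `N |h| ≈ r`, the slices of `U`
at `h` are bounded by those of `u` up to a small multiple of `|h|`. -/
theorem shiftInt_rpow_le_of_near (hp : 1 ≤ p) {A Ω : Set (E d)} (hA : MeasurableSet A)
    (hΩ : MeasurableSet Ω) {r : ℝ} (hr : 0 < r) (hAΩ : ∀ x ∈ A, ∀ h : E d, ‖h‖ ≤ r → x + h ∈ Ω)
    {u U : E d → ℝ} {G : E d → E d} (hu : AEMeasurable u) (hU : AEMeasurable U) (hG : Measurable G)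
    {κ : ℝ≥0∞} (hκ : ∀ h : E d, ‖h‖ ≤ r → taylorInt p U G h ≤ κ ^ p * ‖h‖ₑ ^ p)
    {h : E d} (hh : ‖h‖ ≤ r) :
    shiftInt p A univ U h ^ (1 / p) ≤ shiftInt p Ω Ω u h ^ (1 / p) +
      (2 * κ + ENNReal.ofReal (2 / r) * (2 ^ p * ∫⁻ x in Ω, ‖u x - U x‖ₑ ^ p) ^ (1 / p)) *
        ‖h‖ₑ := by
  have hp0 : 0 < p := by linarith
  have hpp' : ∀ t : ℝ≥0∞, (t ^ p) ^ (1 / p) = t := fun t => by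
    rw [← ENNReal.rpow_mul, mul_one_div_cancel hp0.ne', ENNReal.rpow_one]
  rcases eq_or_ne h 0 with rfl | hh0
  · simp [shiftInt, hp0]
  have hh0' : 0 < ‖h‖ := norm_pos_iff.2 hh0
  have hT : ∀ k : E d, ‖k‖ ≤ r → taylorInt p U G k ^ (1 / p) ≤ κ * ‖k‖ₑ := fun k hk => by
    refine (ENNReal.rpow_le_rpow (hκ k hk) (by positivity)).trans (le_of_eq ?_)
    rw [← ENNReal.mul_rpow_of_nonneg _ _ hp0.le, hpp']
  set N := ⌊r / ‖h‖⌋₊ with hN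
  have hN1 : 1 ≤ N := by rwa [hN, Nat.one_le_floor_iff, one_le_div hh0']
  have hN0 : (N : ℝ≥0∞) ≠ 0 := by simpa using (by omega : N ≠ 0)
  have hNle : N * ‖h‖ ≤ r := by
    rw [← le_div_iff₀ hh0']; exact Nat.floor_le (by positivity)
  have hNge : r ≤ 2 * (N * ‖h‖) := by
    have h1 : r / ‖h‖ < N + 1 := Nat.lt_floor_add_one _
    rw [div_lt_iff₀ hh0'] at h1
    have h2 : (1 : ℝ) ≤ N := by exact_mod_cast hN1
    nlinarith
  have hNn : ‖N • h‖ = N * ‖h‖ := by simp [← Nat.cast_smul_eq_nsmul ℝ, norm_smul]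
  have hNe : ‖N • h‖ₑ = N * ‖h‖ₑ := by
    rw [← ofReal_norm, hNn, ENNReal.ofReal_mul (by positivity), ofReal_norm, ENNReal.ofReal_natCast]
  set P : E d → ℝ≥0∞ := fun k => (∫⁻ x in A, ‖(inner ℝ (G x) k : ℝ)‖ₑ ^ p) ^ (1 / p) with hP
  have hGk : ∀ k : E d, Measurable fun x => (inner ℝ (G x) k : ℝ) := fun k =>
    hG.inner measurable_const
  have hPN : P (N • h) = N * P h := by
    simp only [hP]
    rw [← hpp' (N : ℝ≥0∞), ← ENNReal.mul_rpow_of_nonneg _ _ (by positivity),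
      ← lintegral_const_mul _ ((hGk h).enorm.pow_const p)]
    congr 1
    refine lintegral_congr fun x => ?_
    rw [← ENNReal.mul_rpow_of_nonneg _ _ hp0.le, ← Nat.cast_smul_eq_nsmul ℝ,
      real_inner_smul_right, enorm_mul]
    congr 2
    rw [Real.enorm_eq_ofReal_abs, Nat.abs_cast, ENNReal.ofReal_natCast]
  have hTm : ∀ k : E d, AEMeasurable (fun x => U (x + k) - U x - inner ℝ (G x) k) := fun k =>
    ((aemeasurable_shift hU k).sub hU).sub (hGk k).aemeasurable
  have hTA : ∀ k : E d, (∫⁻ x in A, ‖U (x + k) - U x - inner ℝ (G x) k‖ₑ ^ p) ^ (1 / p) ≤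
      taylorInt p U G k ^ (1 / p) := fun k =>
    ENNReal.rpow_le_rpow (setLIntegral_le_lintegral _ _) (by positivity)
  have h1 : shiftInt p A univ U h ^ (1 / p) ≤ P h + κ * ‖h‖ₑ := by
    rw [shiftInt_univ_right]
    refine (lintegral_rpow_minkowski hp (hGk h).enorm.aemeasurable (hTm h).enorm.restrict
      (Eventually.of_forall fun x => ?_)).trans (add_le_add le_rfl ((hTA h).trans (hT h hh)))
    refine le_of_eq_of_le ?_ (enorm_add_le _ _)
    congr 1; ring
  have h2 : P (N • h) ≤ shiftInt p A univ U (N • h) ^ (1 / p) + κ * (N * ‖h‖ₑ) := by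
    rw [shiftInt_univ_right]
    refine (lintegral_rpow_minkowski hp
      ((aemeasurable_shift hU _).sub hU).enorm.restrict (hTm (N • h)).enorm.restrict
      (Eventually.of_forall fun x => ?_)).trans (add_le_add le_rfl ((hTA _).trans ?_))
    · refine le_of_eq_of_le ?_ enorm_sub_le
      congr 1; simp only [Pi.sub_apply]; ring
    · rw [← hNe]; exact hT _ (hNn.trans_le hNle)
  set W : E d → ℝ := Ω.indicator fun x => u x - U x with hW
  have hWm : AEMeasurable W := (hu.sub hU).indicator hΩ
  have h3 : shiftInt p A univ U (N • h) ^ (1 / p) ≤ shiftInt p A univ u (N • h) ^ (1 / p) +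
      (2 ^ p * ∫⁻ x in Ω, ‖u x - U x‖ₑ ^ p) ^ (1 / p) := by
    have e1 : shiftInt p A univ W (N • h) ≤ 2 ^ p * ∫⁻ x in Ω, ‖u x - U x‖ₑ ^ p := by
      refine (shiftInt_le_lintegral hp _ _ hWm _).trans (le_of_eq ?_)
      rw [← lintegral_indicator hΩ]
      congr 1
      refine lintegral_congr fun x => ?_
      by_cases hx : x ∈ Ω <;> simp [hW, hx, hp0]
    refine le_trans ?_ (add_le_add le_rfl (ENNReal.rpow_le_rpow e1 (by positivity)))
    simp only [shiftInt_univ_right]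
    refine lintegral_rpow_minkowski hp ((aemeasurable_shift hu _).sub hu).enorm.restrict
      ((aemeasurable_shift hWm _).sub hWm).enorm.restrict ?_
    filter_upwards [ae_restrict_mem hA] with x hx
    have m1 : x ∈ Ω := by simpa using hAΩ x hx 0 (by simpa using hr.le)
    have m2 : x + N • h ∈ Ω := hAΩ x hx _ (hNn.trans_le hNle)
    refine le_of_eq_of_le ?_ enorm_sub_le
    congr 1
    simp only [hW, indicator_of_mem m1, indicator_of_mem m2]
    ring
  have h4 : shiftInt p A univ u (N • h) ^ (1 / p) ≤ N * shiftInt p Ω Ω u h ^ (1 / p) := by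
    refine (ENNReal.rpow_le_rpow (shiftInt_nsmul_le hp hA MeasurableSet.univ (B := Ω) hu h N
      fun x hx _ j hj => hAΩ x hx _ ?_) (by positivity)).trans (le_of_eq ?_)
    · rw [← Nat.cast_smul_eq_nsmul ℝ, norm_smul, Real.norm_natCast]
      refine le_trans (mul_le_mul_of_nonneg_right ?_ (norm_nonneg _)) hNle
      exact_mod_cast hj
    · rw [ENNReal.mul_rpow_of_nonneg _ _ (by positivity), hpp']
  set τ := (2 ^ p * ∫⁻ x in Ω, ‖u x - U x‖ₑ ^ p) ^ (1 / p) with hτ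
  have h5 : τ ≤ N * (ENNReal.ofReal (2 / r) * τ * ‖h‖ₑ) := by
    have e1 : (1 : ℝ≥0∞) ≤ N * (ENNReal.ofReal (2 / r) * ‖h‖ₑ) := by
      rw [← ofReal_norm, ← ENNReal.ofReal_natCast, ← ENNReal.ofReal_mul (by positivity),
        ← ENNReal.ofReal_mul (by positivity), ENNReal.one_le_ofReal]
      have : (N : ℝ) * (2 / r * ‖h‖) = 2 * (N * ‖h‖) / r := by ring
      rwa [this, one_le_div hr]
    calc τ = 1 * τ := (one_mul _).symm
      _ ≤ N * (ENNReal.ofReal (2 / r) * ‖h‖ₑ) * τ := mul_le_mul' e1 le_rfl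
      _ = _ := by ring
  refine (ENNReal.mul_le_mul_iff_right hN0 (ENNReal.natCast_ne_top N)).1 ?_
  calc N * shiftInt p A univ U h ^ (1 / p) ≤ N * (P h + κ * ‖h‖ₑ) := mul_le_mul' le_rfl h1
    _ = P (N • h) + N * (κ * ‖h‖ₑ) := by rw [mul_add, hPN]
    _ ≤ (N * shiftInt p Ω Ω u h ^ (1 / p) + N * (ENNReal.ofReal (2 / r) * τ * ‖h‖ₑ)) +
          κ * (N * ‖h‖ₑ) + N * (κ * ‖h‖ₑ) := by
        refine add_le_add (h2.trans (add_le_add (h3.trans ?_) le_rfl)) le_rfl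
        exact add_le_add h4 h5
    _ = _ := by ring

/-- The integrated form of `shiftInt_rpow_le_of_near`; beyond the distance `r` only the tail of the
kernel matters. -/
theorem energy_rpow_le_of_near (hp : 1 ≤ p) {ν : ℝ → RadialLevyKernel d p}
    (hν : IsLevyApproxUnity ν) {ε : ℝ} (hε : ε ∈ Ioo (0 : ℝ) 1)
    {A Ω : Set (E d)} (hA : MeasurableSet A)
    (hΩ : MeasurableSet Ω) {r : ℝ} (hr : 0 < r) (hr1 : r ≤ 1)
    (hAΩ : ∀ x ∈ A, ∀ h : E d, ‖h‖ ≤ r → x + h ∈ Ω)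
    {u U : E d → ℝ} {G : E d → E d} (hu : AEMeasurable u) (hU : AEMeasurable U) (hG : Measurable G)
    {κ : ℝ≥0∞} (hκ : ∀ h : E d, ‖h‖ ≤ r → taylorInt p U G h ≤ κ ^ p * ‖h‖ₑ ^ p) :
    energy (A ×ˢ univ) (ν ε) U ^ (1 / p) ≤ energy (Ω ×ˢ Ω) (ν ε) u ^ (1 / p) +
      ((2 * κ + ENNReal.ofReal (2 / r) * (2 ^ p * ∫⁻ x in Ω, ‖u x - U x‖ₑ ^ p) ^ (1 / p)) ^ p +
        2 ^ p * (∫⁻ x, ‖U x‖ₑ ^ p) * ∫⁻ h in {h : E d | r < ‖h‖}, (ν ε).ker h) ^ (1 / p) := by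
  have hp0 : 0 < p := by linarith
  have hpp' : ∀ t : ℝ≥0∞, (t ^ p) ^ (1 / p) = t := fun t => by
    rw [← ENNReal.rpow_mul, mul_one_div_cancel hp0.ne', ENNReal.rpow_one]
  set c := 2 * κ + ENNReal.ofReal (2 / r) * (2 ^ p * ∫⁻ x in Ω, ‖u x - U x‖ₑ ^ p) ^ (1 / p)
  set I := ∫⁻ x, ‖U x‖ₑ ^ p
  have hms : MeasurableSet {h : E d | r < ‖h‖} := measurableSet_lt measurable_const measurable_norm
  set b : E d → ℝ≥0∞ := fun h => c ^ p * levyWeight p h +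
    {h : E d | r < ‖h‖}.indicator (fun _ => 2 ^ p * I) h with hb
  have hb1 : Measurable fun h : E d => c ^ p * levyWeight p h := measurable_levyWeight.const_mul _
  have hbm : Measurable b := hb1.add (measurable_const.indicator hms)
  rw [energy_prod hp0.le _ hA MeasurableSet.univ hU, energy_prod hp0.le _ hΩ hΩ hu]
  refine (lintegral_ker_minkowski hp (ν ε).measurable_ker (measurable_shiftInt p hΩ hΩ hu) hbm
    (a := shiftInt p A univ U) fun h => ?_).trans (add_le_add le_rfl (ENNReal.rpow_le_rpow
      (le_of_eq ?_) (by positivity)))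
  · by_cases hh : r < ‖h‖
    · refine le_add_left (ENNReal.rpow_le_rpow ?_ (by positivity))
      simp only [hb]
      rw [indicator_of_mem (by exact hh)]
      exact (shiftInt_le_lintegral hp _ _ hU h).trans le_add_self
    · refine (shiftInt_rpow_le_of_near hp hA hΩ hr hAΩ hu hU hG hκ (not_lt.1 hh)).trans
        (add_le_add le_rfl ?_)
      simp only [hb]
      rw [indicator_of_notMem (by exact hh), add_zero,
        levyWeight_of_norm_le_one hp0.le ((not_lt.1 hh).trans hr1),
        ← ENNReal.mul_rpow_of_nonneg _ _ hp0.le, hpp']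
  · have e : ∀ h, (ν ε).ker h * b h = c ^ p * ((ν ε).ker h * levyWeight p h) +
        {h : E d | r < ‖h‖}.indicator (fun h => 2 ^ p * I * (ν ε).ker h) h := fun h => by
      simp only [hb]
      by_cases hh : r < ‖h‖
      · rw [indicator_of_mem (by exact hh), indicator_of_mem (by exact hh)]; ring
      · rw [indicator_of_notMem (by exact hh), indicator_of_notMem (by exact hh)]; ring
    have hm1 : Measurable fun h => (ν ε).ker h * levyWeight p h :=
      (ν ε).measurable_ker.mul measurable_levyWeight
    simp_rw [e]
    rw [lintegral_add_left (hm1.const_mul _), lintegral_const_mul _ hm1,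
      lintegral_ker_levyWeight hp0.le hν hε, mul_one, lintegral_indicator hms,
      lintegral_const_mul _ (ν ε).measurable_ker]

/-- The local energy of the limit is bounded by the limit inferior of the nonlocal energies. -/
theorem lintegral_grad_le_of_frequently [NeZero d] (hp : 1 ≤ p) {ν : ℝ → RadialLevyKernel d p}
    (hν : IsLevyApproxUnity ν) {Ω : Set (E d)} (hΩ : IsOpen Ω) {ε : ℕ → ℝ}
    (hε : Tendsto ε atTop (𝓝[>] 0)) {u : ℕ → E d → ℝ} (hu : ∀ n, AEMeasurable (u n))
    {U : E d → ℝ} {G : E d → E d} (hUG : IsWeakGrad univ U G)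
    (hU : MemLp U (ENNReal.ofReal p) volume) (hGm : Measurable G)
    (hG : MemLp G (ENNReal.ofReal p) volume)
    (hlim : Tendsto (fun n => ∫⁻ x in Ω, ‖u n x - U x‖ₑ ^ p) atTop (𝓝 0)) {L : ℝ≥0∞}
    (hL : ∃ᶠ n in atTop, energy (Ω ×ˢ Ω) (ν (ε n)) (u n) ≤ L) :
    ENNReal.ofReal (K d p) * ∫⁻ x in Ω, ‖G x‖ₑ ^ p ≤ L := by
  have hp0 : 0 < p := by linarith
  have hI : ∫⁻ x, ‖U x‖ₑ ^ p ≠ ⊤ := (lintegral_rpow_lt_top hp0 hU).ne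
  -- the estimate on an open subset at distance at least `s` from the complement
  have hA : ∀ s : ℝ, 0 < s → ENNReal.ofReal (K d p) *
      ∫⁻ x in {x | ENNReal.ofReal s < Metric.infEDist x Ωᶜ}, ‖G x‖ₑ ^ p ≤ L := by
    intro s hs
    set A : Set (E d) := {x | ENNReal.ofReal s < Metric.infEDist x Ωᶜ} with hAdef
    have hAo : IsOpen A := isOpen_lt continuous_const Metric.continuous_infEDist
    have hAΩ : ∀ x ∈ A, ∀ h : E d, ‖h‖ ≤ s → x + h ∈ Ω := by
      intro x hx h hh
      by_contra hc
      have h1 : Metric.infEDist x Ωᶜ ≤ edist x (x + h) := Metric.infEDist_le_edist_of_mem hc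
      rw [edist_dist, dist_eq_norm, sub_add_cancel_left, norm_neg] at h1
      exact absurd (h1.trans (ENNReal.ofReal_le_ofReal hh)) (not_le.2 hx)
    have key : ∀ κ : NNReal, 0 < κ → (ENNReal.ofReal (K d p) * ∫⁻ x in A, ‖G x‖ₑ ^ p) ^ (1 / p) ≤
        L ^ (1 / p) + 2 * κ := by
      intro κ hκ
      obtain ⟨δ, hδ, hT⟩ := taylorInt_small hp hUG hU hGm hG ((κ : ℝ≥0∞) ^ p)
        (ENNReal.rpow_pos (by simpa using hκ) (by simp))
      set r := min (min s (δ / 2)) 1 with hr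
      have hr0 : 0 < r := by positivity
      have hrs : r ≤ s := (min_le_left _ _).trans (min_le_left _ _)
      have hrδ : r < δ := ((min_le_left _ _).trans (min_le_right _ _)).trans_lt (by linarith)
      have hl1 : Tendsto (fun n => energy (A ×ˢ univ) (ν (ε n)) U ^ (1 / p)) atTop
          (𝓝 ((ENNReal.ofReal (K d p) * ∫⁻ x in A, ‖G x‖ₑ ^ p) ^ (1 / p))) :=
        ((tendsto_energy_univ_right hp hν hUG hU hGm hG hAo.measurableSet).comp hε).ennrpow_const _
      have hl2 : Tendsto (fun n => L ^ (1 / p) + ((2 * κ + ENNReal.ofReal (2 / r) *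
          (2 ^ p * ∫⁻ x in Ω, ‖u n x - U x‖ₑ ^ p) ^ (1 / p)) ^ p +
            2 ^ p * (∫⁻ x, ‖U x‖ₑ ^ p) *
              ∫⁻ h in {h : E d | r < ‖h‖}, (ν (ε n)).ker h) ^ (1 / p)) atTop
          (𝓝 (L ^ (1 / p) + ((2 * κ + ENNReal.ofReal (2 / r) * (2 ^ p * 0) ^ (1 / p)) ^ p +
            2 ^ p * (∫⁻ x, ‖U x‖ₑ ^ p) * 0) ^ (1 / p))) := by
        refine tendsto_const_nhds.add (Tendsto.ennrpow_const _ (Tendsto.add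
          (Tendsto.ennrpow_const _ (tendsto_const_nhds.add (ENNReal.Tendsto.const_mul
            (Tendsto.ennrpow_const _ (ENNReal.Tendsto.const_mul hlim (Or.inr (by finiteness))))
            (Or.inr ENNReal.ofReal_ne_top)))) (ENNReal.Tendsto.const_mul
              ((tendsto_ker_tail hp0.le hν hr0).comp hε) (Or.inr (by finiteness)))))
      have h3 := le_of_tendsto_of_tendsto_of_frequently hl1 hl2
        ((hL.and_eventually (hε.eventually eventually_Ioo)).mono fun n hn => by
          refine (energy_rpow_le_of_near hp hν hn.2 hAo.measurableSet hΩ.measurableSet hr0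
            (min_le_right _ _) (fun x hx h hh => hAΩ x hx h (hh.trans hrs)) (hu n)
            hU.1.aemeasurable hGm (κ := κ) fun h hh => hT h (hh.trans_lt hrδ)).trans ?_
          exact add_le_add (ENNReal.rpow_le_rpow hn.1 (by positivity)) le_rfl)
      refine h3.trans (le_of_eq ?_)
      rw [mul_zero, mul_zero, ENNReal.zero_rpow_of_pos (by positivity), mul_zero, add_zero,
        add_zero, ← ENNReal.rpow_mul, mul_one_div_cancel hp0.ne', ENNReal.rpow_one]
    rw [← ENNReal.rpow_le_rpow_iff (z := 1 / p) (by positivity)]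
    refine ENNReal.le_of_forall_pos_le_add fun κ hκ _ => ?_
    refine (key (κ / 2) (by positivity)).trans (le_of_eq ?_)
    congr 1
    rw [← ENNReal.coe_ofNat, ← ENNReal.coe_mul]
    congr 1
    field_simp
  set B : ℕ → Set (E d) := fun n => {x | ENNReal.ofReal (1 / (n + 1)) < Metric.infEDist x Ωᶜ}
    with hB
  have hBmono : Monotone B := fun m n hmn x hx => lt_of_le_of_lt (ENNReal.ofReal_le_ofReal
    (one_div_le_one_div_of_le (by positivity) (by gcongr))) hx
  have hBU : Ω ⊆ ⋃ n, B n := by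
    intro x hx
    have h1 : 0 < Metric.infEDist x Ωᶜ := by
      rw [pos_iff_ne_zero, ne_eq, ← Metric.mem_closure_iff_infEDist_zero,
        hΩ.isClosed_compl.closure_eq]
      exact fun h => h hx
    have h2 : Tendsto (fun n : ℕ => ENNReal.ofReal (1 / ((n : ℝ) + 1))) atTop (𝓝 0) := by
      simpa using ENNReal.tendsto_ofReal tendsto_one_div_add_atTop_nhds_zero_nat
    obtain ⟨n, hn⟩ := (h2.eventually (gt_mem_nhds h1)).exists
    exact mem_iUnion.2 ⟨n, hn⟩
  refine (mul_le_mul' le_rfl (lintegral_mono_set hBU)).trans ?_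
  rw [setLIntegral_iUnion_of_directed _ hBmono.directed_le, ENNReal.mul_iSup]
  exact iSup_le fun n => hA _ (by positivity)

end LowerSemicontinuity

/-! ### Poincaré inequality -/

section Poincare

variable {d : ℕ} {p : ℝ}

theorem exists_ae_eq_const_on_ball (hp : 1 ≤ p) {U : E d → ℝ} {G : E d → E d}
    (hUG : IsWeakGrad univ U G) (hU : MemLp U (ENNReal.ofReal p) volume) (hGm : Measurable G)
    (hG : MemLp G (ENNReal.ofReal p) volume) {x₀ : E d} {r : ℝ} (hr : 0 < r)
    (h0 : ∫⁻ x in Metric.ball x₀ r, ‖G x‖ₑ ^ p = 0) :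
    ∃ c : ℝ, ∀ᵐ x, x ∈ Metric.ball x₀ r → U x = c := by
  have hp0 : 0 < p := by linarith
  have hp1 : 1 ≤ ENNReal.ofReal p := by simpa using hp
  set B := Metric.ball x₀ r with hB
  set U' := hU.1.mk U with hU'
  have hU'm : Measurable U' := hU.1.stronglyMeasurable_mk.measurable
  have hUU' : ∀ᵐ x, U x = U' x := hU.1.ae_eq_mk
  have hball : ballInt p B U (2 * r) = 0 := by
    refine le_antisymm ((setLIntegral_le_lintegral _ _).trans (le_of_eq ?_)) zero_le
    refine lintegral_eq_zero_of_ae_eq_zero (Eventually.of_forall fun h => ?_)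
    have hV : IsOpen {x | x ∈ B ∧ x + h ∈ B} := by
      have h1 : IsOpen ((fun x => x + h) ⁻¹' B) := Metric.isOpen_ball.preimage (by fun_prop)
      exact Metric.isOpen_ball.inter h1
    have := lintegral_shift_sub_le hp measurableSet_ball hV (hUG.of_univ B)
      (hU.locallyIntegrable hp1) hGm (hG.locallyIntegrable hp1) h fun x hx s hs => by
        have e : x + s • h = (1 - s) • x + s • (x + h) := by module
        rw [e]
        exact convex_ball x₀ r hx.1 hx.2 (sub_nonneg.2 hs.2) hs.1 (sub_add_cancel 1 s)
    rw [h0, mul_zero] at this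
    exact le_antisymm this zero_le
  rw [ballInt_congr measurableSet_ball (hUU'.mono fun x hx _ => hx),
    ballInt_eq measurableSet_ball hU'm, lintegral_eq_zero_iff
      (Measurable.lintegral_prod_right (measurable_ballKernel hU'm _))] at hball
  have hB0 : volume B ≠ 0 := (Metric.measure_ball_pos volume _ hr).ne'
  have : NeBot (ae (volume.restrict B)) := by
    rw [ae_neBot, ne_eq, Measure.restrict_eq_zero]; exact hB0
  obtain ⟨x, hx, hxB⟩ := (hball.and (ae_restrict_mem measurableSet_ball)).exists
  refine ⟨U' x, ?_⟩
  rw [Pi.zero_apply, lintegral_eq_zero_iff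
    ((measurable_ballKernel hU'm _).of_uncurry_left), EventuallyEq,
    ae_restrict_iff' measurableSet_ball] at hx
  filter_upwards [hx, hUU'] with y hy hyU hyB
  have h1 := hy hyB
  have hyx : y - x ∈ Metric.ball (0 : E d) (2 * r) := by
    rw [mem_ball_zero_iff, ← dist_eq_norm]
    rw [Metric.mem_ball] at hyB hxB
    linarith [dist_triangle_right y x x₀]
  rw [ballKernel, indicator_of_mem hyx, Pi.zero_apply, ENNReal.rpow_eq_zero_iff_of_pos hp0,
    enorm_eq_zero, sub_eq_zero] at h1
  rw [hyU, h1]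

/-- A Sobolev function with vanishing gradient on a connected open set is constant there. -/
theorem exists_ae_eq_const (hp : 1 ≤ p) {Ω : Set (E d)} (hΩ : IsOpen Ω) (hconn : IsConnected Ω)
    {U : E d → ℝ} {G : E d → E d}
    (hUG : IsWeakGrad univ U G) (hU : MemLp U (ENNReal.ofReal p) volume) (hGm : Measurable G)
    (hG : MemLp G (ENNReal.ofReal p) volume) (h0 : ∫⁻ x in Ω, ‖G x‖ₑ ^ p = 0) :
    ∃ c : ℝ, ∀ᵐ x, x ∈ Ω → U x = c := by
  have hloc : ∀ x : E d, ∃ c : ℝ, x ∈ Ω → ∃ r > 0, ∀ᵐ y, y ∈ Metric.ball x r → U y = c := by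
    intro x
    by_cases hx : x ∈ Ω
    · obtain ⟨r, hr, hrΩ⟩ := Metric.isOpen_iff.1 hΩ x hx
      obtain ⟨c, hc⟩ := exists_ae_eq_const_on_ball hp hUG hU hGm hG hr
        (le_antisymm ((lintegral_mono_set hrΩ).trans h0.le) zero_le)
      exact ⟨c, fun _ => ⟨r, hr, hc⟩⟩
    · exact ⟨0, fun h => absurd h hx⟩
  choose c hc using hloc
  have hconst : ∀ x ∈ Ω, ∀ y ∈ Ω, c x = c y := fun x hx y hy =>
    hconn.isPreconnected.induction₂ (fun x y => c x = c y) (fun x hx => by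
      obtain ⟨r, hr, hcr⟩ := hc x hx
      filter_upwards [mem_nhdsWithin_of_mem_nhds (Metric.ball_mem_nhds x hr),
        self_mem_nhdsWithin] with y hy hyΩ
      obtain ⟨s, hs, hcs⟩ := hc y hyΩ
      have hopen : IsOpen (Metric.ball x r ∩ Metric.ball y s) :=
        Metric.isOpen_ball.inter Metric.isOpen_ball
      have hpos := hopen.measure_pos volume ⟨y, hy, Metric.mem_ball_self hs⟩
      have : ∃ᵐ z, z ∈ Metric.ball x r ∩ Metric.ball y s := by
        rw [frequently_ae_mem_iff]; exact hpos.ne'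
      obtain ⟨z, ⟨hz1, hz2⟩, hz3, hz4⟩ := (this.and_eventually (hcr.and hcs)).exists
      rw [← hz3 hz1, ← hz4 hz2]) (fun _ _ _ _ _ _ => Eq.trans) (fun _ _ _ _ => Eq.symm) hx hy
  obtain ⟨x₀, hx₀⟩ := hconn.nonempty
  refine ⟨c x₀, ?_⟩
  have : volume {x | x ∈ Ω ∧ U x ≠ c x₀} = 0 := by
    refine measure_null_of_locally_null _ fun x hx => ?_
    obtain ⟨r, hr, hcr⟩ := hc x hx.1
    refine ⟨{y | y ∈ Metric.ball x r ∧ U y ≠ c x₀}, ?_, ?_⟩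
    · filter_upwards [mem_nhdsWithin_of_mem_nhds (Metric.ball_mem_nhds x hr),
        self_mem_nhdsWithin] with y hy hy2
      exact ⟨hy, hy2.2⟩
    · rw [hconst x₀ hx₀ x hx.1]
      refine measure_mono_null (fun y hy => ?_) (ae_iff.1 hcr)
      exact fun h => hy.2 (h hy.1)
  refine (ae_iff.2 (measure_mono_null (fun y hy => ?_) this) : ∀ᵐ x, x ∈ Ω → U x = c x₀)
  rw [mem_ofPred_eq] at hy
  push Not at hy
  exact hy

theorem integral_eq_zero_of_tendsto (hp : 1 ≤ p) {Ω : Set (E d)} (hΩ : volume Ω ≠ ⊤)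
    {v : ℕ → E d → ℝ} {U : E d → ℝ} (hv : ∀ n, MemLp (v n) (ENNReal.ofReal p) (volume.restrict Ω))
    (hU : MemLp U (ENNReal.ofReal p) (volume.restrict Ω)) (hv0 : ∀ n, ∫ x in Ω, v n x = 0)
    (hlim : Tendsto (fun n => ∫⁻ x in Ω, ‖v n x - U x‖ₑ ^ p) atTop (𝓝 0)) :
    ∫ x in Ω, U x = 0 := by
  have hp0 : 0 < p := by linarith
  have hp1 : 1 ≤ ENNReal.ofReal p := by simpa using hp
  have : IsFiniteMeasure (volume.restrict Ω) := ⟨by simpa using hΩ.lt_top⟩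
  have h1 : ∀ n, ‖∫ x in Ω, U x‖ₑ ^ p ≤ volume Ω ^ (p - 1) * ∫⁻ x in Ω, ‖v n x - U x‖ₑ ^ p :=
    fun n => by
      have e1 : ∫ x in Ω, (v n x - U x) = -∫ x in Ω, U x := by
        rw [integral_sub ((hv n).integrable hp1) (hU.integrable hp1), hv0, zero_sub]
      have h2 := lintegral_rpow_le_measure (μ := volume.restrict Ω) hp
        (f := fun x => ‖v n x - U x‖ₑ) ((hv n).1.aemeasurable.sub hU.1.aemeasurable).enorm
      rw [Measure.restrict_apply_univ] at h2
      rw [← enorm_neg, ← e1]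
      exact (ENNReal.rpow_le_rpow (enorm_integral_le_lintegral_enorm _) hp0.le).trans h2
  have h2 : Tendsto (fun n => volume Ω ^ (p - 1) * ∫⁻ x in Ω, ‖v n x - U x‖ₑ ^ p) atTop (𝓝 0) := by
    simpa using ENNReal.Tendsto.const_mul hlim (Or.inr (by finiteness))
  have h3 := le_antisymm (ge_of_tendsto' h2 h1) zero_le
  rwa [ENNReal.rpow_eq_zero_iff_of_pos hp0, enorm_eq_zero] at h3

/-- The Poincaré inequality with a constant independent of `ε`. -/
theorem exists_poincare [NeZero d] (hp : 1 < p) {Ω : Set (E d)} (hΩ : IsOpen Ω)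
    (hbdd : Bornology.IsBounded Ω) (hlip : HasLipschitzBoundary Ω) (hconn : IsConnected Ω)
    {ν : ℝ → RadialLevyKernel d p} (hν : IsLevyApproxUnity ν)
    (hν_one : d = 1 → OneDimCondition ν) :
    ∃ C : ℝ≥0∞, C ≠ ⊤ ∧ ∀ᶠ ε in 𝓝[>] 0, ∀ u : E d → ℝ, AEMeasurable u →
      ∫⁻ x in Ω, ‖u x‖ₑ ^ p ≠ ⊤ → ∫ x in Ω, u x = 0 →
        ∫⁻ x in Ω, ‖u x‖ₑ ^ p ≤ C * energy (Ω ×ˢ univ) (ν ε) u := by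
  have hp0 : 0 < p := by linarith
  by_contra! hcon
  have hsel : ∀ n : ℕ, ∃ ε : ℝ, ε ∈ Ioo (0 : ℝ) (1 / (n + 1)) ∧ ∃ u : E d → ℝ, AEMeasurable u ∧
      ∫⁻ x in Ω, ‖u x‖ₑ ^ p ≠ ⊤ ∧ ∫ x in Ω, u x = 0 ∧
        ((n + 1 : ℕ) : ℝ≥0∞) * energy (Ω ×ˢ univ) (ν ε) u < ∫⁻ x in Ω, ‖u x‖ₑ ^ p := fun n => by
    obtain ⟨ε, h1, h2⟩ := ((hcon _ (ENNReal.natCast_ne_top (n + 1))).and_eventually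
      (Ioo_mem_nhdsGT (by positivity : (0 : ℝ) < 1 / (n + 1)))).exists
    exact ⟨ε, h2, h1⟩
  choose ε hε u hum hut hu0 hulow using hsel
  have hεt : Tendsto ε atTop (𝓝[>] 0) :=
    tendsto_nhdsWithin_iff.2 ⟨tendsto_of_tendsto_of_tendsto_of_le_of_le tendsto_const_nhds
      tendsto_one_div_add_atTop_nhds_zero_nat (fun n => (hε n).1.le) (fun n => (hε n).2.le),
      Eventually.of_forall fun n => (hε n).1⟩
  set m : ℕ → ℝ≥0∞ := fun n => ∫⁻ x in Ω, ‖u n x‖ₑ ^ p with hm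
  have hm0 : ∀ n, m n ≠ 0 := fun n => (zero_le.trans_lt (hulow n)).ne'
  -- normalization in `Lᵖ(Ω)`
  set k : ℕ → ℝ := fun n => (m n).toReal ^ (-(1 / p)) with hk
  have hkp : ∀ n, ENNReal.ofReal (|k n| ^ p) = (m n)⁻¹ := fun n => by
    have hpos : 0 < (m n).toReal := ENNReal.toReal_pos (hm0 n) (hut n)
    rw [hk]
    dsimp only
    rw [abs_of_pos (Real.rpow_pos_of_pos hpos _), ← Real.rpow_mul hpos.le, neg_mul,
      one_div_mul_cancel hp0.ne', Real.rpow_neg_one, ENNReal.ofReal_inv_of_pos hpos,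
      ENNReal.ofReal_toReal (hut n)]
  set v : ℕ → E d → ℝ := fun n => k n • u n with hv
  have hvm : ∀ n, AEMeasurable (v n) := fun n => AEMeasurable.const_smul (μ := volume) (hum n) (k n)
  have hvp : ∀ n, ∫⁻ x in Ω, ‖v n x‖ₑ ^ p = 1 := fun n => by
    have e : ∀ x, ‖v n x‖ₑ ^ p = (m n)⁻¹ * ‖u n x‖ₑ ^ p := fun x => by
      rw [← hkp, ofReal_abs_rpow hp0.le, ← ENNReal.mul_rpow_of_nonneg _ _ hp0.le, ← enorm_mul]
      rfl
    simp_rw [e]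
    rw [lintegral_const_mul' _ _ (ENNReal.inv_ne_top.2 (hm0 n))]
    exact ENNReal.inv_mul_cancel (hm0 n) (hut n)
  have hve : ∀ n, energy (Ω ×ˢ univ) (ν (ε n)) (v n) ≤ ((n + 1 : ℕ) : ℝ≥0∞)⁻¹ := fun n => by
    have hn0 : ((n + 1 : ℕ) : ℝ≥0∞) ≠ 0 := by exact_mod_cast Nat.succ_ne_zero n
    rw [hv, energy_smul, hkp, ENNReal.le_inv_iff_mul_le, mul_assoc, mul_comm,
      ← ENNReal.le_inv_iff_mul_le, inv_inv, mul_comm]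
    exact (hulow n).le
  have hv0 : ∀ n, ∫ x in Ω, v n x = 0 := fun n => by
    simp only [hv, Pi.smul_apply, integral_smul, hu0, smul_zero]
  obtain ⟨φ, hφ, U, G, hU, hGm, hG, hUG, hlim⟩ := exists_subseq_sobolev_limit hp hΩ hbdd hlip hν
    hν_one hεt hvm (M := 2) (by simp) fun n => by
      rw [hvp, ← one_add_one_eq_two]
      refine add_le_add le_rfl ((hve n).trans ?_)
      rw [ENNReal.inv_le_one]
      exact_mod_cast Nat.succ_pos n
  have hG0 : ∫⁻ x in Ω, ‖G x‖ₑ ^ p = 0 := by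
    have h1 : ENNReal.ofReal (K d p) * ∫⁻ x in Ω, ‖G x‖ₑ ^ p ≤ 0 := by
      refine le_of_forall_gt_imp_ge_of_dense fun L hL => ?_
      refine lintegral_grad_le_of_frequently hp.le hν hΩ (hεt.comp hφ.tendsto_atTop)
        (fun n => hvm (φ n)) hUG hU hGm hG hlim (Eventually.frequently ?_)
      have h2 : Tendsto (fun n : ℕ => ((n + 1 : ℕ) : ℝ≥0∞)⁻¹) atTop (𝓝 0) :=
        ENNReal.tendsto_inv_nat_nhds_zero.comp (tendsto_add_atTop_nat 1)
      filter_upwards [(h2.comp hφ.tendsto_atTop).eventually (ge_mem_nhds hL)] with n hn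
      exact (energy_mono _ (prod_mono_right (subset_univ _)) _).trans ((hve (φ n)).trans hn)
    have h3 : ENNReal.ofReal (K d p) ≠ 0 := by
      rw [ne_eq, ENNReal.ofReal_eq_zero, not_le]; exact K_pos hp0
    exact (mul_eq_zero.1 (le_antisymm h1 zero_le)).resolve_left h3
  obtain ⟨c, hc⟩ := exists_ae_eq_const hp.le hΩ hconn hUG hU hGm hG hG0
  have hlim' : Tendsto (fun n => ∫⁻ x in Ω, ‖v (φ n) x - c‖ₑ ^ p) atTop (𝓝 0) := by
    refine hlim.congr fun n => lintegral_congr_ae ?_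
    rw [EventuallyEq, ae_restrict_iff' hΩ.measurableSet]
    filter_upwards [hc] with x hx hxΩ
    rw [hx hxΩ]
  have hΩt : volume Ω ≠ ⊤ := hbdd.measure_lt_top.ne
  have hc0 : c = 0 := by
    have h1 := integral_eq_zero_of_tendsto hp.le hΩt (fun n => memLp_of_lintegral_lt_top hp0
      (hvm (φ n)).restrict.aestronglyMeasurable (by rw [hvp]; simp)) (hU.restrict Ω)
      (fun n => hv0 (φ n)) hlim
    rw [setIntegral_congr_ae hΩ.measurableSet hc, setIntegral_const, smul_eq_mul,
      mul_eq_zero] at h1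
    exact h1.resolve_left
      (ENNReal.toReal_pos (hΩ.measure_pos volume hconn.nonempty).ne' hΩt).ne'
  rw [hc0] at hlim'
  simp only [sub_zero, hvp] at hlim'
  exact one_ne_zero (tendsto_nhds_unique tendsto_const_nhds hlim')

end Poincare

/-! ### Convexity of the energies -/

section Convexity

variable {p : ℝ}

theorem rpow_add_mul_le (hp : 1 < p) {s t : ℝ} (hs : 0 ≤ s) (ht : 0 ≤ t) :
    s ^ p + p * (s ^ (p - 1) * (t - s)) ≤ t ^ p := by
  rcases hs.eq_or_lt with rfl | hs0
  · rw [Real.zero_rpow (by linarith), Real.zero_rpow (by linarith)]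
    simpa using Real.rpow_nonneg ht p
  have h1 := one_add_mul_self_le_rpow_one_add (s := t / s - 1)
    (by have : 0 ≤ t / s := by positivity
        linarith) hp.le
  rw [add_sub_cancel, Real.div_rpow ht hs, le_div_iff₀ (Real.rpow_pos_of_pos hs0 p)] at h1
  have e : s ^ p = s ^ (p - 1) * s := by
    rw [← Real.rpow_add_one hs0.ne', sub_add_cancel]
  refine le_of_eq_of_le ?_ h1
  rw [e]
  field_simp

variable {α : Type*} [MeasurableSpace α] {μ : Measure α}

theorem integrable_norm_rpow {F : Type*} [NormedAddCommGroup F] (hp : 0 < p) {f : α → F}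
    (hf : MemLp f (ENNReal.ofReal p) μ) :
    Integrable (fun x => ‖f x‖ ^ p) μ := by
  have := hf.integrable_norm_rpow (by simpa using hp) ENNReal.ofReal_ne_top
  rwa [ENNReal.toReal_ofReal hp.le] at this

theorem lintegral_enorm_rpow_eq {F : Type*} [NormedAddCommGroup F] (hp : 0 < p) {f : α → F}
    (hf : MemLp f (ENNReal.ofReal p) μ) :
    ∫⁻ x, ‖f x‖ₑ ^ p ∂μ = ENNReal.ofReal (∫ x, ‖f x‖ ^ p ∂μ) := by
  rw [ofReal_integral_eq_lintegral_ofReal (integrable_norm_rpow hp hf)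
    (Eventually.of_forall fun x => by positivity)]
  refine lintegral_congr fun x => ?_
  rw [← ofReal_norm, ENNReal.ofReal_rpow_of_nonneg (norm_nonneg _) hp.le]

variable {H : Type*} [NormedAddCommGroup H] [InnerProductSpace ℝ H]

theorem norm_rpow_add_inner_le (hp : 1 < p) (a b : H) :
    ‖a‖ ^ p + p * (‖a‖ ^ (p - 2) * inner ℝ a (b - a)) ≤ ‖b‖ ^ p := by
  rcases eq_or_ne a 0 with rfl | ha
  · simpa [Real.zero_rpow (by linarith : p ≠ 0)] using Real.rpow_nonneg (norm_nonneg b) p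
  have ha0 : 0 < ‖a‖ := norm_pos_iff.2 ha
  refine le_trans ?_ (rpow_add_mul_le hp (norm_nonneg a) (norm_nonneg b))
  have e : ‖a‖ ^ (p - 1) = ‖a‖ ^ (p - 2) * ‖a‖ := by
    rw [← Real.rpow_add_one ha0.ne']; congr 1; ring
  rw [e, mul_assoc]
  gcongr
  rw [inner_sub_right, real_inner_self_eq_norm_sq]
  nlinarith [real_inner_le_norm a b]

theorem integrable_norm_rpow_mul_inner (hp : 1 < p) {f g : α → H}
    (hf : MemLp f (ENNReal.ofReal p) μ) (hg : MemLp g (ENNReal.ofReal p) μ) :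
    Integrable (fun x => ‖f x‖ ^ (p - 2) * inner ℝ (f x) (g x)) μ := by
  have hp0 : 0 < p := by linarith
  refine ((integrable_norm_rpow hp0 hf).add (integrable_norm_rpow hp0 hg)).mono'
    ((hf.1.norm.aemeasurable.pow_const _).aestronglyMeasurable.mul (hf.1.inner hg.1))
    (Eventually.of_forall fun x => ?_)
  rw [Pi.add_apply, norm_mul, Real.norm_of_nonneg (by positivity)]
  rcases eq_or_ne (f x) 0 with h0 | h0
  · simp only [h0, inner_zero_left, norm_zero, mul_zero]; positivity
  have h1 : 0 < ‖f x‖ := norm_pos_iff.2 h0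
  have e : ‖f x‖ ^ (p - 2) * (‖f x‖ * ‖g x‖) = ‖f x‖ ^ (p - 1) * ‖g x‖ := by
    rw [← mul_assoc, ← Real.rpow_add_one h1.ne']; congr 2; ring
  have e' : ∀ t : ℝ, 0 ≤ t → t ^ p = t ^ (p - 1) * t := fun t ht => by
    rcases ht.eq_or_lt with rfl | ht
    · rw [Real.zero_rpow hp0.ne', mul_zero]
    · rw [← Real.rpow_add_one ht.ne', sub_add_cancel]
  calc ‖f x‖ ^ (p - 2) * ‖(inner ℝ (f x) (g x) : ℝ)‖ ≤ ‖f x‖ ^ (p - 2) * (‖f x‖ * ‖g x‖) :=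
        mul_le_mul_of_nonneg_left (norm_inner_le_norm _ _) (by positivity)
    _ = ‖f x‖ ^ (p - 1) * ‖g x‖ := e
    _ ≤ ‖f x‖ ^ p + ‖g x‖ ^ p := by
        have hp1 : 0 ≤ p - 1 := by linarith
        rcases le_total ‖f x‖ ‖g x‖ with h | h
        · calc _ ≤ ‖g x‖ ^ (p - 1) * ‖g x‖ := by gcongr
            _ = ‖g x‖ ^ p := (e' _ (norm_nonneg _)).symm
            _ ≤ _ := le_add_of_nonneg_left (by positivity)
        · calc _ ≤ ‖f x‖ ^ (p - 1) * ‖f x‖ := by gcongr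
            _ = ‖f x‖ ^ p := (e' _ (norm_nonneg _)).symm
            _ ≤ _ := le_add_of_nonneg_right (by positivity)

theorem integral_norm_rpow_add_le (hp : 1 < p) {f g : α → H}
    (hf : MemLp f (ENNReal.ofReal p) μ) (hg : MemLp g (ENNReal.ofReal p) μ) :
    ∫ x, ‖f x‖ ^ p ∂μ + p * ∫ x, ‖f x‖ ^ (p - 2) * inner ℝ (f x) (g x - f x) ∂μ ≤
      ∫ x, ‖g x‖ ^ p ∂μ := by
  have hp0 : 0 < p := by linarith
  have h1 : Integrable (fun x => ‖f x‖ ^ (p - 2) * inner ℝ (f x) (g x - f x)) μ :=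
    integrable_norm_rpow_mul_inner hp hf (hg.sub hf)
  rw [← integral_const_mul, ← integral_add (integrable_norm_rpow hp0 hf) (h1.const_mul p)]
  exact integral_mono ((integrable_norm_rpow hp0 hf).add (h1.const_mul p))
    (integrable_norm_rpow hp0 hg) fun x => norm_rpow_add_inner_le hp (f x) (g x)

/-- A quantitative form of strict convexity: the distance of `a` and `b` is controlled by the excess
of `|b|ᵖ` over the tangent of `|·|ᵖ` at `a`. -/
theorem exists_abs_sub_rpow_le_excess (hp : 1 < p) {η : ℝ} (hη : 0 < η) :
    ∃ C : ℝ, 0 ≤ C ∧ ∀ a b : ℝ, ‖a - b‖ ^ p ≤ η * (‖a‖ ^ p + ‖b‖ ^ p) +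
      C * (‖b‖ ^ p - ‖a‖ ^ p - p * (‖a‖ ^ (p - 2) * inner ℝ a (b - a))) := by
  obtain ⟨C, hC, h⟩ := exists_abs_sub_rpow_le hp hη
  refine ⟨C / 2, by positivity, fun a b => ?_⟩
  have h1 := norm_rpow_add_inner_le hp a ((a + b) / 2)
  have e : (a + b) / 2 - a = (1 / 2 : ℝ) • (b - a) := by rw [smul_eq_mul]; ring
  rw [e, real_inner_smul_right] at h1
  have h2 := h a b
  simp only [← Real.norm_eq_abs] at h2
  nlinarith

theorem exists_integral_sub_rpow_le_excess (hp : 1 < p) {η : ℝ} (hη : 0 < η) :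
    ∃ C : ℝ, 0 ≤ C ∧ ∀ {α : Type*} [MeasurableSpace α] {μ : Measure α} {f g : α → ℝ},
      MemLp f (ENNReal.ofReal p) μ → MemLp g (ENNReal.ofReal p) μ →
      ∫ x, ‖f x - g x‖ ^ p ∂μ ≤ η * (∫ x, ‖f x‖ ^ p ∂μ + ∫ x, ‖g x‖ ^ p ∂μ) +
        C * (∫ x, ‖g x‖ ^ p ∂μ - ∫ x, ‖f x‖ ^ p ∂μ -
          p * ∫ x, ‖f x‖ ^ (p - 2) * inner ℝ (f x) (g x - f x) ∂μ) := by
  have hp0 : 0 < p := by linarith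
  obtain ⟨C, hC, h⟩ := exists_abs_sub_rpow_le_excess hp hη
  refine ⟨C, hC, fun {α} _ {μ f g} hf hg => ?_⟩
  have h1 : Integrable (fun x => p * (‖f x‖ ^ (p - 2) * inner ℝ (f x) (g x - f x))) μ :=
    (integrable_norm_rpow_mul_inner hp hf (hg.sub hf)).const_mul p
  have h2 := integrable_norm_rpow hp0 hf
  have h3 := integrable_norm_rpow hp0 hg
  have h4 : Integrable (fun x => ‖f x - g x‖ ^ p) μ := integrable_norm_rpow hp0 (hf.sub hg)
  have h5 : Integrable (fun x => ‖g x‖ ^ p - ‖f x‖ ^ p) μ := h3.sub h2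
  have h6 : Integrable (fun x => ‖g x‖ ^ p - ‖f x‖ ^ p -
      p * (‖f x‖ ^ (p - 2) * inner ℝ (f x) (g x - f x))) μ := h5.sub h1
  have h7 : Integrable (fun x => ‖f x‖ ^ p + ‖g x‖ ^ p) μ := h2.add h3
  rw [← integral_const_mul, ← integral_add h2 h3, ← integral_sub h3 h2,
    ← integral_sub h5 h1, ← integral_const_mul, ← integral_const_mul,
    ← integral_add (h7.const_mul η) (h6.const_mul C)]
  exact integral_mono h4 ((h7.const_mul η).add (h6.const_mul C)) fun x => h (f x) (g x)

end Convexity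

section PairMeasure

variable {d : ℕ} {p : ℝ}

/-- The measure `ν(x - y) dy dx` on `S`; the nonlocal energies over `S` are `Lᵖ` norms of
`u(x) - u(y)` with respect to it. -/
def pairMeasure (S : Set (E d × E d)) (ν : RadialLevyKernel d p) : Measure (E d × E d) :=
  (volume.restrict S).withDensity fun z => ν.ker (z.1 - z.2)

/-- The difference `u(x) - u(y)`. -/
def pairDiff (u : E d → ℝ) (z : E d × E d) : ℝ := u z.1 - u z.2

theorem aemeasurable_pairDiff {u : E d → ℝ} (hu : AEMeasurable u) :
    AEMeasurable (pairDiff u) volume :=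
  (hu.comp_quasiMeasurePreserving Measure.quasiMeasurePreserving_fst).sub
    (hu.comp_quasiMeasurePreserving Measure.quasiMeasurePreserving_snd)

theorem measurable_pairKernel (ν : RadialLevyKernel d p) :
    Measurable fun z : E d × E d => ν.ker (z.1 - z.2) :=
  ν.measurable_ker.comp (measurable_fst.sub measurable_snd)

theorem energy_eq_lintegral_pair (hp : 0 ≤ p) (S : Set (E d × E d)) (ν : RadialLevyKernel d p)
    {u : E d → ℝ} (hu : AEMeasurable u) :
    energy S ν u = ∫⁻ z, ‖pairDiff u z‖ₑ ^ p ∂pairMeasure S ν := by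
  rw [energy_eq_enorm hp, pairMeasure, lintegral_withDensity_eq_lintegral_mul₀
    (measurable_pairKernel ν).aemeasurable ((aemeasurable_pairDiff hu).enorm.pow_const p).restrict]
  exact lintegral_congr fun z => mul_comm _ _

theorem form_eq_integral_pair (S : Set (E d × E d)) (ν : RadialLevyKernel d p) (u v : E d → ℝ) :
    form S ν u v =
      ∫ z, ‖pairDiff u z‖ ^ (p - 2) * inner ℝ (pairDiff u z) (pairDiff v z) ∂pairMeasure S ν := by
  have hm : Measurable fun z : E d × E d => (ν (z.1 - z.2)).toNNReal :=
    (ν.measurable_toFun.comp (measurable_fst.sub measurable_snd)).real_toNNReal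
  have h := integral_withDensity_eq_integral_smul (μ := volume.restrict S) hm
    (fun z => ‖pairDiff u z‖ ^ (p - 2) * (inner ℝ (pairDiff u z) (pairDiff v z) : ℝ))
  refine Eq.trans ?_ h.symm
  refine integral_congr_ae (Eventually.of_forall fun z => ?_)
  dsimp only [pairDiff]
  rw [NNReal.smul_def, Real.coe_toNNReal _ (ν.nonneg _), Real.norm_eq_abs, smul_eq_mul]
  simp only [RCLike.inner_apply, conj_trivial]
  ring

theorem memLp_pairDiff (hp : 0 < p) {S : Set (E d × E d)} {ν : RadialLevyKernel d p}
    {u : E d → ℝ} (hu : AEMeasurable u) (he : energy S ν u < ⊤) :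
    MemLp (pairDiff u) (ENNReal.ofReal p) (pairMeasure S ν) := by
  refine memLp_of_lintegral_lt_top hp ?_ (by rwa [← energy_eq_lintegral_pair hp.le S ν hu])
  exact ((aemeasurable_pairDiff hu).restrict.aestronglyMeasurable).mono_ac
    (withDensity_absolutelyContinuous _ _)

theorem toReal_energy (hp : 0 < p) {S : Set (E d × E d)} {ν : RadialLevyKernel d p}
    {u : E d → ℝ} (hu : AEMeasurable u) (he : energy S ν u < ⊤) :
    (energy S ν u).toReal = ∫ z, ‖pairDiff u z‖ ^ p ∂pairMeasure S ν := by
  rw [energy_eq_lintegral_pair hp.le S ν hu,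
    lintegral_enorm_rpow_eq hp (memLp_pairDiff hp hu he), ENNReal.toReal_ofReal]
  exact integral_nonneg fun z => by positivity

theorem form_self (hp : 0 < p) {S : Set (E d × E d)} {ν : RadialLevyKernel d p}
    {u : E d → ℝ} (hu : AEMeasurable u) (he : energy S ν u < ⊤) :
    form S ν u u = (energy S ν u).toReal := by
  rw [toReal_energy hp hu he, form_eq_integral_pair]
  refine integral_congr_ae (Eventually.of_forall fun z => ?_)
  dsimp only
  rcases eq_or_ne (pairDiff u z) 0 with h0 | h0
  · rw [h0, inner_zero_left, mul_zero, norm_zero, Real.zero_rpow hp.ne']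
  · rw [real_inner_self_eq_norm_sq, ← Real.rpow_natCast, ← Real.rpow_add (norm_pos_iff.2 h0)]
    norm_num

/-- Up to a small multiple of the energies of `u` and `v`, the energy of `u - v` is controlled by the
excess of the energy of `v` over the tangent of the energy at `u`. -/
theorem exists_energy_sub_le_excess (d : ℕ) (hp : 1 < p) {η : ℝ} (hη : 0 < η) :
    ∃ C : ℝ, 0 ≤ C ∧ ∀ (S : Set (E d × E d)) (ν : RadialLevyKernel d p) (u v : E d → ℝ),
      AEMeasurable u → AEMeasurable v → energy S ν u < ⊤ → energy S ν v < ⊤ →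
      energy S ν (u - v) < ⊤ →
      (energy S ν (u - v)).toReal ≤ η * ((energy S ν u).toReal + (energy S ν v).toReal) +
        C * ((energy S ν v).toReal - (energy S ν u).toReal - p * form S ν u (v - u)) := by
  have hp0 : 0 < p := by linarith
  obtain ⟨C, hC, h⟩ := exists_integral_sub_rpow_le_excess hp hη
  refine ⟨C, hC, fun S ν u v hu hv heu hev heuv => ?_⟩
  rw [toReal_energy hp0 hu heu, toReal_energy hp0 hv hev, toReal_energy hp0 (hu.sub hv) heuv,
    form_eq_integral_pair]
  have e1 : ∀ z : E d × E d, pairDiff (u - v) z = pairDiff u z - pairDiff v z := fun z => by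
    simp only [pairDiff, Pi.sub_apply]; ring
  have e2 : ∀ z : E d × E d, pairDiff (v - u) z = pairDiff v z - pairDiff u z := fun z => by
    simp only [pairDiff, Pi.sub_apply]; ring
  simp_rw [e1, e2]
  exact h (memLp_pairDiff hp0 hu heu) (memLp_pairDiff hp0 hv hev)

end PairMeasure

/-! ### Uniqueness of weak gradients -/

section WeakGradients

variable {d : ℕ}

theorem IsWeakGrad.ae_eq {Ω : Set (E d)} (hΩ : IsOpen Ω) {u : E d → ℝ} {G H : E d → E d}
    (hG : IsWeakGrad Ω u G) (hH : IsWeakGrad Ω u H) : ∀ᵐ x, x ∈ Ω → G x = H x := by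
  have hloc : ∀ (F : E d → E d) (e : E d), LocallyIntegrableOn F Ω →
      LocallyIntegrableOn (fun x => (inner ℝ (F x) e : ℝ)) Ω := fun F e hF x hx => by
    obtain ⟨s, hs, h⟩ := hF x hx
    exact ⟨s, hs, h.inner_const e⟩
  have h1 : ∀ i : Fin d, ∀ᵐ x, x ∈ Ω → (inner ℝ (G x - H x) (EuclideanSpace.single i 1) : ℝ) = 0 := by
    intro i
    set e : E d := EuclideanSpace.single i 1
    refine hΩ.ae_eq_zero_of_integral_contDiff_smul_eq_zero (hloc (G - H) e (hG.2.sub hH.2))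
      fun φ hφ hc hs => ?_
    have e1 := hG.3 φ hφ hc hs e
    rw [hH.3 φ hφ hc hs e, neg_inj] at e1
    have i1 := integrableOn_mul_test (hloc G e hG.2) hφ.continuous hc hs
    have i2 := integrableOn_mul_test (hloc H e hH.2) hφ.continuous hc hs
    have e2 : ∫ x in Ω, φ x • (inner ℝ (G x - H x) e : ℝ) = 0 := by
      simp only [inner_sub_left, smul_eq_mul, mul_comm (φ _), sub_mul]
      rw [integral_sub i1 i2, e1, sub_self]
    rw [← e2, setIntegral_eq_integral_of_forall_compl_eq_zero]
    intro x hx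
    rw [image_eq_zero_of_notMem_tsupport (fun h => hx (hs h)), zero_smul]
  filter_upwards [ae_all_iff.2 h1] with x hx hxΩ
  rw [← sub_eq_zero]
  ext i
  simpa [EuclideanSpace.inner_single_right] using hx i hxΩ

theorem IsWeakGrad.weakGrad_ae_eq {Ω : Set (E d)} (hΩ : IsOpen Ω) {u : E d → ℝ} {G : E d → E d}
    (hG : IsWeakGrad Ω u G) : ∀ᵐ x, x ∈ Ω → weakGrad Ω u x = G x := by
  have h : ∃ G, IsWeakGrad Ω u G := ⟨G, hG⟩
  have h1 : IsWeakGrad Ω u (weakGrad Ω u) := by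
    rw [weakGrad, dif_pos h]; exact h.choose_spec
  exact h1.ae_eq hΩ hG

theorem IsWeakGrad.const (Ω : Set (E d)) (c : ℝ) : IsWeakGrad Ω (fun _ => c) 0 := by
  refine IsWeakGrad.of_univ Ω ⟨(continuous_const.locallyIntegrable).locallyIntegrableOn _,
    locallyIntegrableOn_zero, fun φ hφ hc _ e => ?_⟩
  have hd : Continuous (fun x => fderiv ℝ φ x e) :=
    (hφ.continuous_fderiv (by simp)).clm_apply continuous_const
  have hdi : Integrable (fun x => fderiv ℝ φ x e) :=
    hd.integrable_of_hasCompactSupport (hc.fderiv_apply (𝕜 := ℝ) e)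
  have h := integral_mul_fderiv_eq_neg_fderiv_mul_of_integrable (μ := volume) (𝕜 := ℝ)
    (f := fun _ : E d => c) (g := φ) (v := e) (by simp) (hdi.const_mul c)
    ((hφ.continuous.integrable_of_hasCompactSupport hc).const_mul c)
    (fun x _ => differentiableAt_const c) (fun x _ => hφ.differentiable (by simp) x)
  rw [setIntegral_univ, setIntegral_univ, h]
  simp

end WeakGradients

/-! ### Norms, means and data -/

section Data

variable {d : ℕ} {p : ℝ}

theorem IsWeakGrad.sub {Ω : Set (E d)} {u v : E d → ℝ} {G H : E d → E d}
    (hu : IsWeakGrad Ω u G) (hv : IsWeakGrad Ω v H) : IsWeakGrad Ω (u - v) (G - H) := by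
  have := hu.add (hv.smul (-1))
  rwa [neg_one_smul, neg_one_smul, ← sub_eq_add_neg, ← sub_eq_add_neg] at this

theorem hullNorm_eq (hp : 0 ≤ p) (Ω : Set (E d)) (ν : RadialLevyKernel d p) (u : E d → ℝ) :
    hullNorm Ω ν u = ((∫⁻ x in Ω, ‖u x‖ₑ ^ p) + energy (hullRegion Ω) ν u) ^ (1 / p) := by
  simp only [hullNorm, nlNorm, ofReal_abs_rpow hp]

theorem energy_sub_le (hp : 1 ≤ p) (S : Set (E d × E d)) (ν : RadialLevyKernel d p)
    {u : E d → ℝ} (hu : AEMeasurable u) (v : E d → ℝ) :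
    energy S ν (u - v) ≤ 2 ^ (p - 1) * (energy S ν u + energy S ν v) := by
  have hp0 : 0 ≤ p := by linarith
  simp only [energy_eq_enorm hp0]
  rw [← lintegral_add_left' (aemeasurable_energy_integrand hu ν).restrict,
    ← lintegral_const_mul' _ _ (by simp)]
  refine lintegral_mono fun z => ?_
  have e : (u - v) z.1 - (u - v) z.2 = (u z.1 - u z.2) - (v z.1 - v z.2) := by
    simp only [Pi.sub_apply]; ring
  rw [e, ← add_mul, ← mul_assoc]
  exact mul_le_mul' ((ENNReal.rpow_le_rpow enorm_sub_le hp0).trans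
    (ENNReal.rpow_add_le_mul_rpow_add_rpow _ _ hp)) le_rfl

theorem energy_univ_lt_top (hp : 1 ≤ p) (ν : RadialLevyKernel d p) {u : E d → ℝ} {G : E d → E d}
    (hu : IsWeakGrad univ u G) (hup : MemLp u (ENNReal.ofReal p) volume) (hGm : Measurable G)
    (hGp : MemLp G (ENNReal.ofReal p) volume) : energy univ ν u < ⊤ := by
  have hp0 : 0 ≤ p := by linarith
  have hB := sobolev_bound_ne_top hp hup hGp
  have hν : ∫⁻ h, ν.ker h * levyWeight p h < ⊤ := by
    refine lt_of_eq_of_lt (lintegral_congr fun h => ?_) ν.integrable.lintegral_lt_top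
    rw [ENNReal.ofReal_mul (by positivity), ofReal_levyWeight hp0, mul_comm]
    rfl
  rw [← univ_prod_univ, energy_prod hp0 _ MeasurableSet.univ MeasurableSet.univ hup.1.aemeasurable]
  refine lt_of_le_of_lt (lintegral_mono fun h => mul_le_mul' le_rfl
    (shiftInt_le_levyWeight hp hu hup hGm hGp h)) ?_
  simp_rw [← mul_assoc]
  rw [lintegral_mul_const' _ _ hB]
  exact ENNReal.mul_lt_top hν hB.lt_top

theorem mem_WHull_of_isWeakGrad (hp : 1 < p) (Ω : Set (E d)) (ν : RadialLevyKernel d p)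
    {u : E d → ℝ} {G : E d → E d}
    (hu : IsWeakGrad univ u G) (hup : MemLp u (ENNReal.ofReal p) volume) (hGm : Measurable G)
    (hGp : MemLp G (ENNReal.ofReal p) volume) : u ∈ WHull hp Ω ν :=
  ⟨hup.1.aemeasurable, hup.restrict Ω, (energy_mono ν (subset_univ _) u).trans_lt
    (energy_univ_lt_top hp.le ν hu hup hGm hGp)⟩

theorem hullNorm_lt_top (hp : 1 < p) {Ω : Set (E d)} {ν : RadialLevyKernel d p} {u : E d → ℝ}
    (hu : u ∈ WHull hp Ω ν) : hullNorm Ω ν u < ⊤ := by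
  have hp0 : 0 < p := by linarith
  rw [hullNorm_eq hp0.le]
  exact ENNReal.rpow_lt_top_of_nonneg (by positivity)
    (ENNReal.add_lt_top.2 ⟨lintegral_rpow_lt_top hp0 hu.2.1, hu.2.2⟩).ne

theorem tNorm_Tr_le (hp : 1 < p) {Ω : Set (E d)} {ν : RadialLevyKernel d p} (v : WHull hp Ω ν) :
    tNorm hp Ω ν (Tr hp Ω ν v) ≤ hullNorm Ω ν v :=
  iInf₂_le (f := fun u (_ : Tr hp Ω ν u = Tr hp Ω ν v) => hullNorm Ω ν u) v rfl

theorem energy_subMean (S : Set (E d × E d)) (ν : RadialLevyKernel d p) (Ω : Set (E d))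
    (u : E d → ℝ) : energy S ν (subMean Ω u) = energy S ν u := by
  simp only [energy, subMean, sub_sub_sub_cancel_right]

theorem form_subMean_left (S : Set (E d × E d)) (ν : RadialLevyKernel d p) (Ω : Set (E d))
    (u v : E d → ℝ) : form S ν (subMean Ω u) v = form S ν u v := by
  simp only [form, subMean, sub_sub_sub_cancel_right]

theorem subMean_mem_WHull (hp : 1 < p) {Ω : Set (E d)} (hΩ : volume Ω ≠ ⊤)
    {ν : RadialLevyKernel d p} {u : E d → ℝ} (hu : u ∈ WHull hp Ω ν) :
    subMean Ω u ∈ WHull hp Ω ν := by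
  have : IsFiniteMeasure (volume.restrict Ω) := ⟨by simpa using hΩ.lt_top⟩
  exact ⟨hu.1.sub_const _, hu.2.1.sub (memLp_const _), (energy_subMean _ ν Ω u).trans_lt hu.2.2⟩

theorem integral_subMean {Ω : Set (E d)} (hΩ : volume Ω ≠ ⊤) (u : E d → ℝ) :
    ∫ x in Ω, subMean Ω u x = 0 := by
  have : IsFiniteMeasure (volume.restrict Ω) := ⟨by simpa using hΩ.lt_top⟩
  exact integral_sub_average (volume.restrict Ω) u

variable [NeZero d] {hp : 1 < p} {Ω : Set (E d)} {ν : ℝ → RadialLevyKernel d p}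
  {f : ∀ ε : ℝ, WHull hp Ω (ν ε) →ₗ[ℝ] ℝ} {f₀ : W1p p Ω →ₗ[ℝ] ℝ}
  {g : ∀ ε : ℝ, TSpace hp Ω (ν ε) →ₗ[ℝ] ℝ} {g₀ : TraceSpace hp Ω →ₗ[ℝ] ℝ}

theorem exists_abs_data_le (hf : AsympWeakConv hp Ω ν f f₀) (hg : AsympWeakConvTrace hp Ω ν g g₀) :
    ∃ C : ℝ, 0 ≤ C ∧ ∀ ε ∈ Ioo (0 : ℝ) 1, ∀ v : WHull hp Ω (ν ε),
      |f ε v + g ε (Tr hp Ω (ν ε) v)| ≤ C * (hullNorm Ω (ν ε) v).toReal := by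
  obtain ⟨C₁, h₁⟩ := hf.bdd
  obtain ⟨C₂, h₂⟩ := hg.bdd
  refine ⟨|C₁| + |C₂|, by positivity, fun ε hε v => (abs_add_le _ _).trans ?_⟩
  rw [add_mul]
  refine add_le_add ((h₁ ε hε v).trans ?_) ((h₂ ε hε _).trans ?_)
  · exact mul_le_mul_of_nonneg_right (le_abs_self _) ENNReal.toReal_nonneg
  · exact mul_le_mul (le_abs_self _) (ENNReal.toReal_mono (hullNorm_lt_top hp v.2).ne
      (tNorm_Tr_le hp v)) ENNReal.toReal_nonneg (abs_nonneg _)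

/-- Asymptotic weak convergence along a sequence `ε n → 0`: a family that is only controlled along
the sequence is replaced by its limit for all other `ε`. -/
theorem tendsto_data_seq (hν : IsLevyApproxUnity ν) (hf : AsympWeakConv hp Ω ν f f₀)
    (hg : AsympWeakConvTrace hp Ω ν g g₀) {ε : ℕ → ℝ} (hε : Tendsto ε atTop (𝓝[>] 0))
    (hεI : ∀ n, ε n ∈ Ioo (0 : ℝ) 1) (v : ∀ ε : ℝ, WHull hp Ω (ν ε)) {M : ℝ}
    (hM : ∀ n, (hullNorm Ω (ν (ε n)) (v (ε n))).toReal ≤ M)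
    (v₀ : W1p p (univ : Set (E d))) {G : E d → E d} (hv₀ : IsWeakGrad univ v₀ G)
    (hv₀p : MemLp (v₀ : E d → ℝ) (ENNReal.ofReal p) volume)
    (hGm : Measurable G) (hG : MemLp G (ENNReal.ofReal p) volume)
    (hlim : Tendsto (fun n => ∫⁻ x in Ω, ‖(v (ε n) : E d → ℝ) x - (v₀ : E d → ℝ) x‖ₑ ^ p)
      atTop (𝓝 0)) :
    Tendsto (fun n => f (ε n) (v (ε n)) + g (ε n) (Tr hp Ω (ν (ε n)) (v (ε n)))) atTop
      (𝓝 (f₀ (resW1p Ω v₀) + g₀ (trace hp Ω (resW1p Ω v₀)))) := by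
  classical
  have hp0 : 0 < p := by linarith
  set v' : ∀ ε : ℝ, WHull hp Ω (ν ε) := fun t => if t ∈ range ε then v t else
    ⟨v₀, mem_WHull_of_isWeakGrad hp Ω (ν t) hv₀ hv₀p hGm hG⟩ with hv'
  have hv'n : ∀ n, v' (ε n) = v (ε n) := fun n => if_pos (mem_range_self n)
  have hbdd : ∃ M : ℝ, ∀ t ∈ Ioo (0 : ℝ) 1, (hullNorm Ω (ν t) (v' t)).toReal ≤ M := by
    set B : ℝ≥0∞ := (∫⁻ x in Ω, ‖(v₀ : E d → ℝ) x‖ₑ ^ p) +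
      (2 ^ p * (∫⁻ x, ‖(v₀ : E d → ℝ) x‖ₑ ^ p) + ∫⁻ x, ‖G x‖ₑ ^ p) with hB
    have hBt : B ≠ ⊤ := ENNReal.add_ne_top.2 ⟨(lintegral_rpow_lt_top hp0 (hv₀p.restrict Ω)).ne,
      sobolev_bound_ne_top hp.le hv₀p hG⟩
    refine ⟨max M (B ^ (1 / p)).toReal, fun t ht => ?_⟩
    by_cases htr : t ∈ range ε
    · obtain ⟨n, rfl⟩ := htr
      rw [hv'n]
      exact (hM n).trans (le_max_left _ _)
    · refine le_trans (ENNReal.toReal_mono (ENNReal.rpow_ne_top_of_nonneg (by positivity) hBt) ?_)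
        (le_max_right _ _)
      simp only [hv', if_neg htr]
      rw [hullNorm_eq hp0.le]
      refine ENNReal.rpow_le_rpow (add_le_add le_rfl ?_) (by positivity)
      exact (energy_mono _ (subset_univ _) _).trans (energy_univ_le hp.le hν hv₀ hv₀p hGm hG ht)
  have hconv : Tendsto (fun t => eLpNorm (fun x => (v' t : E d → ℝ) x - (v₀ : E d → ℝ) x)
      (ENNReal.ofReal p) (volume.restrict Ω)) (𝓝[>] 0) (𝓝 0) := by
    have h1 : Tendsto (fun n => eLpNorm (fun x => (v (ε n) : E d → ℝ) x - (v₀ : E d → ℝ) x)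
        (ENNReal.ofReal p) (volume.restrict Ω)) atTop (𝓝 0) := by
      have := hlim.ennrpow_const (1 / p)
      rw [ENNReal.zero_rpow_of_pos (by positivity)] at this
      refine this.congr fun n => ?_
      rw [eLpNorm_eq_rpow hp0]
    rw [ENNReal.tendsto_nhds_zero] at h1 ⊢
    intro η hη
    obtain ⟨N, hN⟩ := eventually_atTop.1 (h1 η hη)
    have h2 : ∀ᶠ t in 𝓝[>] (0 : ℝ), ∀ n ∈ Finset.range N, t < ε n := by
      rw [Filter.eventually_all_finset]
      exact fun n _ => mem_nhdsWithin_of_mem_nhds (Iio_mem_nhds (hεI n).1)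
    filter_upwards [h2] with t ht
    by_cases htr : t ∈ range ε
    · obtain ⟨n, rfl⟩ := htr
      rw [hv'n]
      refine hN n (not_lt.1 fun hn => ?_)
      exact lt_irrefl _ (ht n (Finset.mem_range.2 hn))
    · simp only [hv', if_neg htr, sub_self]
      simp
  have h := ((hf.tendsto v₀ v' hbdd hconv).add (hg.tendsto v₀ v' hbdd hconv)).comp hε
  refine h.congr fun n => ?_
  simp only [Function.comp_apply, hv'n]

/-- The equation for `w - ⨍ w`, tested with functions of mean zero. -/
theorem IsWeakSolNonlocal.form_subMean {ν : RadialLevyKernel d p} {f : WHull hp Ω ν →ₗ[ℝ] ℝ}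
    {g : TSpace hp Ω ν →ₗ[ℝ] ℝ} {w : WHull hp Ω ν} (hw : IsWeakSolNonlocal hp Ω ν f g w)
    (v : WHull hp Ω ν) (hv : ∫ x in Ω, (v : E d → ℝ) x = 0) :
    form (hullRegion Ω) ν (subMean Ω w) v = K d p * (f v + g (Tr hp Ω ν v)) := by
  rw [form_subMean_left, ← hw v hv, mul_inv_cancel_left₀ (K_pos (by linarith)).ne']

/-- The energies of the solutions are bounded, by the Poincaré inequality and the bound for the
data. -/
theorem exists_solution_bound (hΩ : IsOpen Ω)
    (hbdd : Bornology.IsBounded Ω) (hlip : HasLipschitzBoundary Ω) (hconn : IsConnected Ω)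
    (hν : IsLevyApproxUnity ν)
    (hν_one : d = 1 → OneDimCondition ν) (hf : AsympWeakConv hp Ω ν f f₀)
    (hg : AsympWeakConvTrace hp Ω ν g g₀) {w : ∀ ε : ℝ, WHull hp Ω (ν ε)}
    (hw : ∀ ε ∈ Ioo (0 : ℝ) 1, IsWeakSolNonlocal hp Ω (ν ε) (f ε) (g ε) (w ε)) :
    ∃ B : ℝ≥0∞, B ≠ ⊤ ∧ ∀ᶠ ε in 𝓝[>] 0,
      energy (hullRegion Ω) (ν ε) (subMean Ω (w ε)) ≤ B ∧
        ∫⁻ x in Ω, ‖subMean Ω (w ε) x‖ₑ ^ p ≤ B := by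
  have hp0 : 0 < p := by linarith
  have hΩt : volume Ω ≠ ⊤ := hbdd.measure_lt_top.ne
  obtain ⟨C₁, hC₁, hP⟩ := exists_poincare hp hΩ hbdd hlip hconn hν hν_one
  obtain ⟨C₂, hC₂, hF⟩ := exists_abs_data_le hf hg
  set a : ℝ := K d p * (C₂ * ((C₁ + 1) ^ (1 / p)).toReal) with ha
  have ha0 : 0 ≤ a := mul_nonneg K_nonneg (mul_nonneg hC₂ ENNReal.toReal_nonneg)
  set b : ℝ := a ^ (p / (p - 1)) with hb
  refine ⟨(C₁ + 1) * ENNReal.ofReal b, by finiteness, ?_⟩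
  filter_upwards [hP, eventually_Ioo] with ε hPε hε
  set u := subMean Ω (w ε) with hu
  have humem : u ∈ WHull hp Ω (ν ε) := subMean_mem_WHull hp hΩt (w ε).2
  set e := energy (hullRegion Ω) (ν ε) u with he
  have het : e < ⊤ := humem.2.2
  have hu0 : ∫ x in Ω, u x = 0 := integral_subMean hΩt _
  have hPu : ∫⁻ x in Ω, ‖u x‖ₑ ^ p ≤ C₁ * e := by
    refine (hPε u humem.1 (lintegral_rpow_lt_top hp0 humem.2.1).ne hu0).trans
      (mul_le_mul' le_rfl (energy_mono _ ?_ _))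
    rw [hullRegion_eq]; exact subset_union_left
  have hN : (hullNorm Ω (ν ε) u).toReal ≤ ((C₁ + 1) ^ (1 / p)).toReal * e.toReal ^ (1 / p) := by
    rw [ENNReal.toReal_rpow, ← ENNReal.toReal_mul, ← ENNReal.mul_rpow_of_nonneg _ _ (by positivity)]
    refine ENNReal.toReal_mono ?_ ?_
    · exact ENNReal.rpow_ne_top_of_nonneg (by positivity) (by finiteness)
    · rw [hullNorm_eq hp0.le, add_mul, one_mul]
      exact ENNReal.rpow_le_rpow (add_le_add hPu le_rfl) (by positivity)
  have hkey : e.toReal ≤ a * e.toReal ^ (1 / p) := by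
    have h1 := (hw ε hε).form_subMean ⟨u, humem⟩ hu0
    rw [form_self hp0 humem.1 het] at h1
    refine h1.le.trans ?_
    rw [ha, mul_assoc, mul_assoc]
    refine mul_le_mul_of_nonneg_left ((le_abs_self _).trans ((hF ε hε _).trans ?_)) K_nonneg
    exact mul_le_mul_of_nonneg_left hN hC₂
  have hle : e ≤ ENNReal.ofReal b := by
    rw [ENNReal.le_ofReal_iff_toReal_le het.ne (Real.rpow_nonneg ha0 _)]
    rcases (ENNReal.toReal_nonneg (a := e)).eq_or_lt with h0 | h0
    · rw [← h0]; exact Real.rpow_nonneg ha0 _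
    have hp1 : 0 < p - 1 := by linarith
    have h1 : e.toReal ^ ((p - 1) / p) ≤ a := by
      have h2 : e.toReal ^ ((p - 1) / p) * e.toReal ^ (1 / p) = e.toReal := by
        rw [← Real.rpow_add h0, ← add_div, sub_add_cancel, div_self hp0.ne', Real.rpow_one]
      exact le_of_mul_le_mul_right (h2.le.trans hkey) (Real.rpow_pos_of_pos h0 _)
    calc e.toReal = (e.toReal ^ ((p - 1) / p)) ^ (p / (p - 1)) := by
          rw [← Real.rpow_mul h0.le, div_mul_div_comm, mul_comm p, div_self (by positivity),
            Real.rpow_one]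
      _ ≤ b := Real.rpow_le_rpow (by positivity) h1 (by positivity)
  constructor
  · calc e ≤ 1 * ENNReal.ofReal b := by rwa [one_mul]
      _ ≤ _ := mul_le_mul' le_add_self le_rfl
  · exact hPu.trans (mul_le_mul' le_self_add hle)

end Data

/-! ### Convergence of the solutions -/

section Convergence

variable {d : ℕ} {p : ℝ}

theorem weakGrad_ae_eq_of_subMean (hp : 1 < p) {Ω : Set (E d)} (hΩ : IsOpen Ω)
    (hΩt : volume Ω ≠ ⊤) {w : E d → ℝ} (hw : w ∈ W1p p Ω) {U : E d → ℝ} {G : E d → E d}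
    (hUG : IsWeakGrad univ U G) (hUw : ∀ᵐ x, x ∈ Ω → U x = subMean Ω w x) :
    ∀ᵐ x, x ∈ Ω → weakGrad Ω w x = G x := by
  have : IsFiniteMeasure (volume.restrict Ω) := ⟨by simpa using hΩt.lt_top⟩
  have hwi : IntegrableOn w Ω := hw.1.integrable (by simpa using hp.le)
  have h1 := (hUG.of_univ Ω).add (IsWeakGrad.const Ω (⨍ y in Ω, w y))
  rw [add_zero] at h1
  refine IsWeakGrad.weakGrad_ae_eq hΩ (h1.congr_ae hΩ.measurableSet hwi.locallyIntegrableOn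
    h1.2 ?_ (Eventually.of_forall fun _ _ => rfl))
  filter_upwards [hUw] with x hx hxΩ
  rw [Pi.add_apply, hx hxΩ, subMean, sub_add_cancel]

/-- The local solution minimizes its functional: the equation is tested with `V - U`, and convexity
turns it into an inequality of energies. -/
theorem local_energy_le [NeZero d] (hp : 1 < p) {Ω : Set (E d)} (hΩ : IsOpen Ω)
    (hΩt : volume Ω ≠ ⊤)
    {f₀ : W1p p Ω →ₗ[ℝ] ℝ} {g₀ : TraceSpace hp Ω →ₗ[ℝ] ℝ} {w₀ : W1p p Ω}
    (hw₀ : IsWeakSolLocal hp Ω f₀ g₀ w₀) {U V : E d → ℝ} {G H : E d → E d}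
    (hUG : IsWeakGrad univ U G) (hG : MemLp G (ENNReal.ofReal p) volume)
    (hVH : IsWeakGrad univ V H) (hH : MemLp H (ENNReal.ofReal p) volume)
    (hUw : ∀ᵐ x, x ∈ Ω → U x = subMean Ω w₀ x) (hVU : V - U ∈ W1p p (univ : Set (E d)))
    (h0 : ∫ x in Ω, (V - U) x = 0) :
    (∫ x in Ω, ‖G x‖ ^ p) + p * (f₀ (resW1p Ω ⟨V - U, hVU⟩) +
      g₀ (trace hp Ω (resW1p Ω ⟨V - U, hVU⟩))) ≤ ∫ x in Ω, ‖H x‖ ^ p := by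
  rw [← hw₀ (resW1p Ω ⟨V - U, hVU⟩) h0]
  refine le_of_eq_of_le ?_ (integral_norm_rpow_add_le hp (hG.restrict Ω) (hH.restrict Ω))
  congr 2
  refine setIntegral_congr_ae hΩ.measurableSet ?_
  filter_upwards [weakGrad_ae_eq_of_subMean hp hΩ hΩt w₀.2 hUG hUw,
    ((hVH.sub hUG).of_univ Ω).weakGrad_ae_eq hΩ] with x h1 h2 hx
  have h3 : weakGrad Ω (resW1p Ω ⟨V - U, hVU⟩ : W1p p Ω) x = (H - G) x := h2 hx
  rw [h1 hx, h3, Pi.sub_apply]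

/-- The energies of `u_ε - U` vanish in the limit, for a Sobolev extension `U` of the local solution.
Otherwise they stay away from zero along a sequence, and a subsequence has a limit `V` to which the
local solution is compared. -/
theorem tendsto_energy_hull_sub [NeZero d] {hp : 1 < p}
    {Ω : Set (E d)} (hΩ : IsOpen Ω) (hbdd : Bornology.IsBounded Ω)
    (hlip : HasLipschitzBoundary Ω) (hconn : IsConnected Ω)
    {ν : ℝ → RadialLevyKernel d p} (hν : IsLevyApproxUnity ν)
    (hν_one : d = 1 → OneDimCondition ν)
    {f : ∀ ε : ℝ, WHull hp Ω (ν ε) →ₗ[ℝ] ℝ} {f₀ : W1p p Ω →ₗ[ℝ] ℝ}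
    (hf : AsympWeakConv hp Ω ν f f₀)
    {g : ∀ ε : ℝ, TSpace hp Ω (ν ε) →ₗ[ℝ] ℝ} {g₀ : TraceSpace hp Ω →ₗ[ℝ] ℝ}
    (hg : AsympWeakConvTrace hp Ω ν g g₀)
    {w : ∀ ε : ℝ, WHull hp Ω (ν ε)}
    (hw : ∀ ε ∈ Ioo (0 : ℝ) 1, IsWeakSolNonlocal hp Ω (ν ε) (f ε) (g ε) (w ε))
    {w₀ : W1p p Ω} (hw₀ : IsWeakSolLocal hp Ω f₀ g₀ w₀)
    {U : E d → ℝ} {G : E d → E d} (hU : MemLp U (ENNReal.ofReal p) volume) (hGm : Measurable G)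
    (hG : MemLp G (ENNReal.ofReal p) volume) (hUG : IsWeakGrad univ U G)
    (hUw : ∀ᵐ x, x ∈ Ω → U x = subMean Ω w₀ x) :
    Tendsto (fun ε => energy (hullRegion Ω) (ν ε) (subMean Ω (w ε) - U)) (𝓝[>] 0) (𝓝 0) := by
  have hp0 : 0 < p := by linarith
  have hp1 : 1 ≤ ENNReal.ofReal p := by simpa using hp.le
  have hΩt : volume Ω ≠ ⊤ := hbdd.measure_lt_top.ne
  have : IsFiniteMeasure (volume.restrict Ω) := ⟨by simpa using hΩt.lt_top⟩
  have hΩS : Ω ×ˢ univ ⊆ hullRegion Ω := by rw [hullRegion_eq]; exact subset_union_left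
  obtain ⟨B, hB, hBev⟩ := exists_solution_bound hΩ hbdd hlip hconn hν hν_one hf hg hw
  set u : ℝ → E d → ℝ := fun ε => subMean Ω (w ε) with hu
  have humem : ∀ ε, u ε ∈ WHull hp Ω (ν ε) := fun ε => subMean_mem_WHull hp hΩt (w ε).2
  have hUmem : ∀ ε, U ∈ WHull hp Ω (ν ε) := fun ε =>
    mem_WHull_of_isWeakGrad hp Ω (ν ε) hUG hU hGm hG
  set v : ∀ ε, WHull hp Ω (ν ε) := fun ε => ⟨u ε - U, sub_mem (humem ε) (hUmem ε)⟩ with hv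
  have hui : ∀ ε, IntegrableOn (u ε) Ω := fun ε => (humem ε).2.1.integrable hp1
  have hUi : IntegrableOn U Ω := (hU.restrict Ω).integrable hp1
  have hU0 : ∫ x in Ω, U x = 0 := by
    rw [setIntegral_congr_ae hΩ.measurableSet hUw]; exact integral_subMean hΩt _
  have hv0 : ∀ ε, ∫ x in Ω, (v ε : E d → ℝ) x = 0 := fun ε => by
    have := integral_sub (hui ε) hUi
    rw [hU0, integral_subMean hΩt, sub_zero] at this
    exact this
  rw [ENNReal.tendsto_nhds_zero]
  by_contra! hcon
  obtain ⟨κ₀, hκ₀, hfreq⟩ := hcon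
  -- a sequence along which the energy stays away from zero
  obtain ⟨ε₀, hε₀, hseq₀⟩ := exists_seq_forall_of_frequently
    (hfreq.and_eventually (hBev.and eventually_Ioo))
  obtain ⟨φ, hφ, V, H, hV, hHm, hH, hVH, hlim⟩ := exists_subseq_sobolev_limit hp hΩ hbdd hlip hν
    hν_one hε₀ (u := fun n => u (ε₀ n)) (fun n => (humem _).1) (M := B + B) (by finiteness)
    fun n => add_le_add (hseq₀ n).2.1.2 ((energy_mono _ hΩS _).trans (hseq₀ n).2.1.1)
  set ε : ℕ → ℝ := fun n => ε₀ (φ n) with hεdef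
  have hε : Tendsto ε atTop (𝓝[>] 0) := hε₀.comp hφ.tendsto_atTop
  have hεI : ∀ n, ε n ∈ Ioo (0 : ℝ) 1 := fun n => (hseq₀ (φ n)).2.2
  have hBn : ∀ n, energy (hullRegion Ω) (ν (ε n)) (u (ε n)) ≤ B ∧ ∫⁻ x in Ω, ‖u (ε n) x‖ₑ ^ p ≤ B :=
    fun n => (hseq₀ (φ n)).2.1
  have hV0 : ∫ x in Ω, V x = 0 := integral_eq_zero_of_tendsto hp.le hΩt
    (fun n => (humem (ε n)).2.1) (hV.restrict Ω) (fun n => integral_subMean hΩt _) hlim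
  have hVU : V - U ∈ W1p p (univ : Set (E d)) := ⟨(hV.sub hU).restrict _, H - G, hVH.sub hUG,
    (hH.sub hG).restrict _⟩
  have hVU0 : ∫ x in Ω, (V - U) x = 0 := by
    have := integral_sub ((hV.restrict Ω).integrable hp1) hUi
    rw [hU0, hV0, sub_zero] at this
    exact this
  have hEfin : ∀ n, energy (hullRegion Ω) (ν (ε n)) (u (ε n)) < ⊤ := fun n => (humem _).2.2
  have hUfin : ∀ n, energy (hullRegion Ω) (ν (ε n)) U < ⊤ := fun n => (hUmem _).2.2
  have hvfin : ∀ n, energy (hullRegion Ω) (ν (ε n)) (u (ε n) - U) < ⊤ := fun n => (v (ε n)).2.2.2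
  -- convergence of the data
  set ℓ : ℝ := f₀ (resW1p Ω ⟨V - U, hVU⟩) + g₀ (trace hp Ω (resW1p Ω ⟨V - U, hVU⟩)) with hℓ
  have hdata : Tendsto (fun n => f (ε n) (v (ε n)) + g (ε n) (Tr hp Ω (ν (ε n)) (v (ε n)))) atTop
      (𝓝 ℓ) := by
    set B' : ℝ≥0∞ := 2 ^ (p - 1) * (B + ∫⁻ x in Ω, ‖U x‖ₑ ^ p) +
      2 ^ (p - 1) * (B + (2 ^ p * (∫⁻ x, ‖U x‖ₑ ^ p) + ∫⁻ x, ‖G x‖ₑ ^ p)) with hB'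
    have hB't : B' ≠ ⊤ := by
      have h1 := (lintegral_rpow_lt_top hp0 (hU.restrict Ω)).ne
      have h2 := sobolev_bound_ne_top hp.le hU hG
      rw [hB']
      finiteness
    refine tendsto_data_seq hν hf hg hε hεI v (M := (B' ^ (1 / p)).toReal) (fun n => ?_)
      ⟨V - U, hVU⟩ (hVH.sub hUG) (hV.sub hU) (hHm.sub hGm) (hH.sub hG) (hlim.congr fun n => ?_)
    · refine ENNReal.toReal_mono (ENNReal.rpow_ne_top_of_nonneg (by positivity) hB't) ?_
      rw [hullNorm_eq hp0.le]
      refine ENNReal.rpow_le_rpow (add_le_add ?_ ?_) (by positivity)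
      · calc ∫⁻ x in Ω, ‖u (ε n) x - U x‖ₑ ^ p
            ≤ ∫⁻ x in Ω, 2 ^ (p - 1) * (‖u (ε n) x‖ₑ ^ p + ‖U x‖ₑ ^ p) :=
              lintegral_mono fun x => (ENNReal.rpow_le_rpow enorm_sub_le hp0.le).trans
                (ENNReal.rpow_add_le_mul_rpow_add_rpow _ _ hp.le)
          _ = 2 ^ (p - 1) * ((∫⁻ x in Ω, ‖u (ε n) x‖ₑ ^ p) + ∫⁻ x in Ω, ‖U x‖ₑ ^ p) := by
              rw [lintegral_const_mul' _ _ (by simp),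
                lintegral_add_left' ((humem (ε n)).1.enorm.pow_const p).restrict]
          _ ≤ _ := mul_le_mul' le_rfl (add_le_add (hBn n).2 le_rfl)
      · refine (energy_sub_le hp.le _ _ (humem (ε n)).1 U).trans
          (mul_le_mul' le_rfl (add_le_add (hBn n).1 ?_))
        exact (energy_mono _ (subset_univ _) _).trans (energy_univ_le hp.le hν hUG hU hGm hG (hεI n))
    · refine lintegral_congr fun x => ?_
      congr 2
      simp only [hv, Pi.sub_apply]
      abel
  -- convergence of the energies of the local solution
  have hK : 0 < K d p := K_pos hp0
  set a : ℝ := K d p * ∫ x in Ω, ‖H x‖ ^ p with ha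
  set b : ℝ := K d p * ∫ x in Ω, ‖G x‖ ^ p with hb
  have hb0 : 0 ≤ b := mul_nonneg hK.le (integral_nonneg fun x => by positivity)
  have hab : b + p * (K d p * ℓ) ≤ a := by
    have := local_energy_le hp hΩ hΩt hw₀ hUG hG hVH hH hUw hVU hVU0
    have := mul_le_mul_of_nonneg_left this hK.le
    rw [ha, hb]
    linarith
  have hbE : Tendsto (fun n => (energy (hullRegion Ω) (ν (ε n)) U).toReal) atTop (𝓝 b) := by
    have h1 := (tendsto_energy_hull hp.le hν hUG hU hGm hG hΩ).comp hε
    rw [lintegral_enorm_rpow_eq hp0 (hG.restrict Ω), ← ENNReal.ofReal_mul hK.le] at h1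
    have h2 := (ENNReal.tendsto_toReal ENNReal.ofReal_ne_top).comp h1
    rwa [ENNReal.toReal_ofReal hb0] at h2
  have haE : ∀ τ : ℝ, 0 < τ → ∀ᶠ n in atTop,
      a - τ < (energy (hullRegion Ω) (ν (ε n)) (u (ε n))).toReal := by
    intro τ hτ
    by_contra hc
    rw [not_eventually] at hc
    have h1 : 0 ≤ a - τ := by
      obtain ⟨n, hn⟩ := hc.exists
      exact ENNReal.toReal_nonneg.trans (not_lt.1 hn)
    have h2 := lintegral_grad_le_of_frequently hp.le hν hΩ hε (fun n => (humem (ε n)).1) hVH hV hHm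
      hH hlim (L := ENNReal.ofReal (a - τ)) (hc.mono fun n hn => by
        refine (energy_mono _ ((prod_mono_right (subset_univ _)).trans hΩS) _).trans ?_
        rw [ENNReal.le_ofReal_iff_toReal_le (hEfin n).ne h1]
        exact not_lt.1 hn)
    rw [lintegral_enorm_rpow_eq hp0 (hH.restrict Ω), ← ENNReal.ofReal_mul hK.le,
      ENNReal.ofReal_le_ofReal_iff h1] at h2
    linarith
  -- the choice of the parameters in the uniform convexity estimate
  set κ : ℝ := (min κ₀ 1).toReal with hκ
  have hκ0 : 0 < κ := ENNReal.toReal_pos (lt_min hκ₀ one_pos).ne' (by simp)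
  set η : ℝ := κ / (4 * (B.toReal + b + 1)) with hη
  have hBb : 0 < B.toReal + b + 1 := by positivity
  obtain ⟨C, hC, hexc⟩ := exists_energy_sub_le_excess d hp (η := η) (by positivity)
  set τ : ℝ := min 1 (κ / (4 * (C * (2 + p * K d p) + 1))) with hτ
  have hτ0 : 0 < τ := by positivity
  have hev : ∀ᶠ n in atTop, (energy (hullRegion Ω) (ν (ε n)) (u (ε n) - U)).toReal ≤ κ / 2 := by
    filter_upwards [haE τ hτ0, hbE.eventually (gt_mem_nhds (lt_add_of_pos_right b hτ0)),
      hdata.eventually (gt_mem_nhds (lt_add_of_pos_right ℓ hτ0))] with n h1 h2 h3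
    have h4 := hexc (hullRegion Ω) (ν (ε n)) (u (ε n)) U (humem _).1 hU.1.aemeasurable (hEfin n)
      (hUfin n) (hvfin n)
    have h5 : form (hullRegion Ω) (ν (ε n)) (u (ε n)) (U - u (ε n)) =
        -(K d p * (f (ε n) (v (ε n)) + g (ε n) (Tr hp Ω (ν (ε n)) (v (ε n))))) := by
      have h6 := (hw (ε n) (hεI n)).form_subMean (-v (ε n)) (by
        have := hv0 (ε n)
        rw [← neg_eq_zero, ← integral_neg] at this
        exact this)
      have h7 : ((-v (ε n) : WHull hp Ω (ν (ε n))) : E d → ℝ) = U - u (ε n) := neg_sub _ _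
      rw [h7, map_neg, map_neg, map_neg] at h6
      refine h6.trans ?_
      ring
    have hBr : (energy (hullRegion Ω) (ν (ε n)) (u (ε n))).toReal ≤ B.toReal :=
      ENNReal.toReal_mono hB (hBn n).1
    have hτ1 : τ ≤ 1 := min_le_left _ _
    have e1 : η * ((energy (hullRegion Ω) (ν (ε n)) (u (ε n))).toReal +
        (energy (hullRegion Ω) (ν (ε n)) U).toReal) ≤ κ / 4 := by
      calc _ ≤ η * (B.toReal + b + 1) := by
            refine mul_le_mul_of_nonneg_left ?_ (by positivity)
            linarith
        _ = κ / 4 := by rw [hη]; field_simp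
    have e2 : C * ((energy (hullRegion Ω) (ν (ε n)) U).toReal -
        (energy (hullRegion Ω) (ν (ε n)) (u (ε n))).toReal -
          p * form (hullRegion Ω) (ν (ε n)) (u (ε n)) (U - u (ε n))) ≤ κ / 4 := by
      have hpK : 0 < p * K d p := by positivity
      calc _ ≤ C * ((2 + p * K d p) * τ) := by
            refine mul_le_mul_of_nonneg_left ?_ hC
            rw [h5]
            have := mul_le_mul_of_nonneg_left h3.le hpK.le
            linarith
        _ = C * (2 + p * K d p) * τ := by ring
        _ ≤ (C * (2 + p * K d p) + 1) * (κ / (4 * (C * (2 + p * K d p) + 1))) := by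
            refine mul_le_mul (by linarith) (min_le_right _ _) hτ0.le (by positivity)
        _ = κ / 4 := by
            have : C * (2 + p * K d p) + 1 ≠ 0 := by positivity
            field_simp
    linarith
  obtain ⟨n, hn⟩ := hev.exists
  have h1 : κ ≤ (energy (hullRegion Ω) (ν (ε n)) (u (ε n) - U)).toReal :=
    ENNReal.toReal_mono (hvfin n).ne ((min_le_left _ _).trans (hseq₀ (φ n)).1.le)
  linarith

theorem subMean_mem_W1p {Ω : Set (E d)} (hΩt : volume Ω ≠ ⊤) {w : E d → ℝ}
    (hw : w ∈ W1p p Ω) : subMean Ω w ∈ W1p p Ω := by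
  have : IsFiniteMeasure (volume.restrict Ω) := ⟨by simpa using hΩt.lt_top⟩
  obtain ⟨hwp, G, hG, hGp⟩ := hw
  refine ⟨hwp.sub (memLp_const _), G, ?_, hGp⟩
  have := hG.sub (IsWeakGrad.const Ω (⨍ y in Ω, w y))
  rwa [sub_zero] at this

/-- By the Poincaré inequality, the energies control the norms of functions of mean zero. -/
theorem tendsto_hullNorm_of_energy [NeZero d] (hp : 1 < p) {Ω : Set (E d)} (hΩ : IsOpen Ω)
    (hbdd : Bornology.IsBounded Ω) (hlip : HasLipschitzBoundary Ω) (hconn : IsConnected Ω)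
    {ν : ℝ → RadialLevyKernel d p} (hν : IsLevyApproxUnity ν)
    (hν_one : d = 1 → OneDimCondition ν) {v : ℝ → E d → ℝ} (hv : ∀ ε, v ε ∈ WHull hp Ω (ν ε))
    (hv0 : ∀ ε, ∫ x in Ω, v ε x = 0)
    (h : Tendsto (fun ε => energy (hullRegion Ω) (ν ε) (v ε)) (𝓝[>] 0) (𝓝 0)) :
    Tendsto (fun ε => hullNorm Ω (ν ε) (v ε)) (𝓝[>] 0) (𝓝 0) := by
  have hp0 : 0 < p := by linarith
  obtain ⟨C, hC, hP⟩ := exists_poincare hp hΩ hbdd hlip hconn hν hν_one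
  have h1 : Tendsto (fun ε => ((C + 1) * energy (hullRegion Ω) (ν ε) (v ε)) ^ (1 / p)) (𝓝[>] 0)
      (𝓝 0) := by
    have := (ENNReal.Tendsto.const_mul (a := C + 1) h (Or.inr (by finiteness))).ennrpow_const
      (1 / p)
    rwa [mul_zero, ENNReal.zero_rpow_of_pos (by positivity)] at this
  refine tendsto_of_tendsto_of_tendsto_of_le_of_le' tendsto_const_nhds h1
    (Eventually.of_forall fun _ => zero_le) ?_
  filter_upwards [hP] with ε hε
  rw [hullNorm_eq hp0.le, add_mul, one_mul]
  refine ENNReal.rpow_le_rpow (add_le_add ?_ le_rfl) (by positivity)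
  refine (hε _ (hv ε).1 (lintegral_rpow_lt_top hp0 (hv ε).2.1).ne (hv0 ε)).trans
    (mul_le_mul' le_rfl (energy_mono _ ?_ _))
  rw [hullRegion_eq]
  exact subset_union_left

theorem regionalNorm_le_hullNorm (hp : 0 ≤ p) {Ω : Set (E d)} (hΩ : MeasurableSet Ω)
    (ν : RadialLevyKernel d p) {u v : E d → ℝ} (h : ∀ᵐ x, x ∈ Ω → u x = v x) :
    regionalNorm Ω ν u ≤ hullNorm Ω ν v := by
  rw [regionalNorm, nlNorm, energy_congr hp ν hΩ hΩ h h, hullNorm, nlNorm]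
  refine ENNReal.rpow_le_rpow (add_le_add (le_of_eq ?_) (energy_mono _ ?_ _)) (by positivity)
  · refine setLIntegral_congr_fun_ae hΩ ?_
    filter_upwards [h] with x hx hxΩ
    rw [hx hxΩ]
  · rw [hullRegion_eq]
    exact (prod_mono_right (subset_univ _)).trans subset_union_left

theorem tendsto_crossEnergy [NeZero d] (hp : 1 ≤ p) {Ω : Set (E d)} (hΩ : IsOpen Ω)
    {ν : ℝ → RadialLevyKernel d p} (hν : IsLevyApproxUnity ν) {u : ℝ → E d → ℝ}
    (hu : ∀ ε, AEMeasurable (u ε)) {U : E d → ℝ} {G : E d → E d}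
    (hU : MemLp U (ENNReal.ofReal p) volume) (hGm : Measurable G)
    (hG : MemLp G (ENNReal.ofReal p) volume) (hUG : IsWeakGrad univ U G)
    (h : Tendsto (fun ε => energy (hullRegion Ω) (ν ε) (u ε - U)) (𝓝[>] 0) (𝓝 0)) :
    Tendsto (fun ε => crossEnergy Ω (ν ε) (u ε)) (𝓝[>] 0) (𝓝 0) := by
  have h1 : Tendsto (fun ε => 2 ^ (p - 1) * (energy (hullRegion Ω) (ν ε) (u ε - U) +
      energy (Ω ×ˢ Ωᶜ) (ν ε) U)) (𝓝[>] 0) (𝓝 0) := by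
    have := ENNReal.Tendsto.const_mul (a := 2 ^ (p - 1))
      (h.add (tendsto_energy_cross hp hν hUG hU hGm hG hΩ)) (Or.inr (by simp))
    rwa [add_zero, mul_zero] at this
  refine tendsto_of_tendsto_of_tendsto_of_le_of_le tendsto_const_nhds h1 (fun _ => zero_le)
    fun ε => ?_
  have e1 : (u ε - U) - (-U) = u ε := by abel
  have e2 : energy (Ω ×ˢ Ωᶜ) (ν ε) (-U) = energy (Ω ×ˢ Ωᶜ) (ν ε) U := by
    have := energy_smul (Ω ×ˢ Ωᶜ) (ν ε) (-1) U
    simpa using this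
  have e3 := energy_sub_le hp (Ω ×ˢ Ωᶜ) (ν ε) ((hu ε).sub hU.1.aemeasurable) (-U)
  rw [e1, e2] at e3
  refine e3.trans (mul_le_mul' le_rfl (add_le_add (energy_mono _ ?_ _) le_rfl))
  rw [hullRegion_eq]
  exact (prod_mono_right (subset_univ _)).trans subset_union_left

end Convergence

end NonlocalNeumann

end

theorem theorem5p1 {d : ℕ} [NeZero d] {p : ℝ} (hp : 1 < p)
    (Ω : Set (E d)) (hΩ_open : IsOpen Ω) (hΩ_bdd : Bornology.IsBounded Ω)
    (hΩ_lip : HasLipschitzBoundary Ω) (hΩ_conn : IsConnected Ω)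
    (ν : ℝ → RadialLevyKernel d p) (hν : IsLevyApproxUnity ν)
    (hν_one : d = 1 → OneDimCondition ν)
    (f : ∀ ε : ℝ, WHull hp Ω (ν ε) →ₗ[ℝ] ℝ) (f₀ : W1p p Ω →ₗ[ℝ] ℝ)
    (hf : AsympWeakConv hp Ω ν f f₀)
    (g : ∀ ε : ℝ, TSpace hp Ω (ν ε) →ₗ[ℝ] ℝ) (g₀ : TraceSpace hp Ω →ₗ[ℝ] ℝ)
    (hg : AsympWeakConvTrace hp Ω ν g g₀)
    (w : ∀ ε : ℝ, WHull hp Ω (ν ε))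
    (hw : ∀ ε ∈ Set.Ioo (0 : ℝ) 1, IsWeakSolNonlocal hp Ω (ν ε) (f ε) (g ε) (w ε))
    (w₀ : W1p p Ω) (hw₀ : IsWeakSolLocal hp Ω f₀ g₀ w₀) :
    Tendsto (fun ε => regionalNorm Ω (ν ε) (subMean Ω (w ε) - subMean Ω w₀)) (𝓝[>] 0) (𝓝 0) ∧
    (∀ u' : W1p p (Set.univ : Set (E d)),
      (u' : E d → ℝ) =ᵐ[volume.restrict Ω] subMean Ω w₀ →
      Tendsto (fun ε => hullNorm Ω (ν ε) (subMean Ω (w ε) - (u' : E d → ℝ))) (𝓝[>] 0) (𝓝 0)) ∧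
    Tendsto (fun ε => crossEnergy Ω (ν ε) (subMean Ω (w ε))) (𝓝[>] 0) (𝓝 0) := by
  have hp0 : 0 < p := by linarith
  have hp1 : 1 ≤ ENNReal.ofReal p := by simpa using hp.le
  have hΩt : volume Ω ≠ ⊤ := hΩ_bdd.measure_lt_top.ne
  have : IsFiniteMeasure (volume.restrict Ω) := ⟨by simpa using hΩt.lt_top⟩
  have humem : ∀ ε, subMean Ω (w ε) ∈ WHull hp Ω (ν ε) := fun ε =>
    subMean_mem_WHull hp hΩt (w ε).2
  have key : ∀ (U : E d → ℝ) (G : E d → E d), MemLp U (ENNReal.ofReal p) volume → Measurable G →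
      MemLp G (ENNReal.ofReal p) volume → IsWeakGrad univ U G →
      (∀ᵐ x, x ∈ Ω → U x = subMean Ω w₀ x) →
      Tendsto (fun ε => energy (hullRegion Ω) (ν ε) (subMean Ω (w ε) - U)) (𝓝[>] 0) (𝓝 0) ∧
        Tendsto (fun ε => hullNorm Ω (ν ε) (subMean Ω (w ε) - U)) (𝓝[>] 0) (𝓝 0) := by
    intro U G hU hGm hG hUG hUw
    have h1 := tendsto_energy_hull_sub hΩ_open hΩ_bdd hΩ_lip hΩ_conn hν hν_one hf hg hw hw₀ hU hGm
      hG hUG hUw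
    refine ⟨h1, tendsto_hullNorm_of_energy hp hΩ_open hΩ_bdd hΩ_lip hΩ_conn hν hν_one
      (fun ε => sub_mem (humem ε) (mem_WHull_of_isWeakGrad hp Ω (ν ε) hUG hU hGm hG))
      (fun ε => ?_) h1⟩
    have h2 := integral_sub ((humem ε).2.1.integrable hp1 : Integrable _ (volume.restrict Ω))
      ((hU.restrict Ω).integrable hp1)
    rw [setIntegral_congr_ae hΩ_open.measurableSet hUw, integral_subMean hΩt,
      integral_subMean hΩt, sub_zero] at h2
    exact h2
  obtain ⟨U, G, hU, hGm, hG, hUG, hUw⟩ := exists_sobolev_extension hp hΩ_open hΩ_bdd hΩ_lip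
    (subMean_mem_W1p hΩt w₀.2)
  obtain ⟨hE, hN⟩ := key U G hU hGm hG hUG hUw
  refine ⟨?_, fun u' hu' => ?_, ?_⟩
  · refine tendsto_of_tendsto_of_tendsto_of_le_of_le tendsto_const_nhds hN (fun _ => zero_le)
      fun ε => regionalNorm_le_hullNorm hp0.le hΩ_open.measurableSet (ν ε) ?_
    filter_upwards [hUw] with x hx hxΩ
    rw [Pi.sub_apply, Pi.sub_apply, hx hxΩ]
  · obtain ⟨hu'p, G', hG', hG'p⟩ := u'.2
    rw [Measure.restrict_univ] at hu'p hG'p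
    have hmk : ∀ᵐ x, G' x = hG'p.1.mk G' x := hG'p.1.ae_eq_mk
    have hG'' : MemLp (hG'p.1.mk G') (ENNReal.ofReal p) volume := hG'p.ae_eq hmk
    refine (key u' (hG'p.1.mk G') hu'p hG'p.1.stronglyMeasurable_mk.measurable hG''
      (hG'.congr_ae MeasurableSet.univ hG'.1
        ((hG''.locallyIntegrable hp1).locallyIntegrableOn _) (Eventually.of_forall fun _ _ => rfl)
        (hmk.mono fun x hx _ => hx)) ?_).2
    exact (ae_restrict_iff' hΩ_open.measurableSet).1 hu'
  · exact tendsto_crossEnergy hp.le hΩ_open hν (fun ε => (humem ε).1) hU hGm hG hUG hE
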